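/- Let $n\ge 3$ and $N\ge 0$ be integers, let $\eta=\mathrm{diag}(-1,1,\dots,1)$ on $\mathbb R^n$, and consider $N$ free massless spin-2 fields $h^a_{\alpha\beta}=h^a_{\beta\alpha}$ ($1\le a\le N$) with Pauli–Fierz action $S_0$. A *polynomial* (ghost-free local form) is an element of the free graded-commutative real algebra generated by the $dx^\mu$ (odd), by $h^a_{\alpha\beta}$ and $C_a^{*\alpha}$ (even) and $h_a^{*\alpha\beta}=h_a^{*\beta\alpha}$ (odd), and by all formal partial derivatives of these fields and antifields; the coefficients are constants. The antighost number is $1$ for $h^*$, $2$ for $C^*$ and $0$ for $h$ and $dx$; derivatives do not change it. Let $$K^a_{\alpha\beta\mu\nu}=-\tfrac12\left(\partial_\alpha\partial_\mu h^a_{\beta\nu}+\partial_\beta\partial_\nu h^a_{\alpha\mu}-\partial_\alpha\partial_\nu h^a_{\beta\mu}-\partial_\beta\partial_\mu h^a_{\alpha\nu}\right)$$ be the linearized Riemann tensor, $K^a_{\beta\nu}=\eta^{\alpha\mu}K^a_{\alpha\beta\mu\nu}$, $K^a=\eta^{\beta\nu}K^a_{\beta\nu}$, and $H^a_{\alpha\beta}=K^a_{\alpha\beta}-\tfrac12\eta_{\alpha\beta}K^a$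 the linearized Einstein tensor. Let $d=dx^\mu\partial_\mu$, and let $\delta$ be the odd derivation that anticommutes with $d$, kills $dx^\mu$ and $h$, and satisfies $$\delta h_a^{*\alpha\beta}=\frac{\delta S_0}{\delta h^a_{\alpha\beta}}=-2H_a^{\alpha\beta},\qquad \delta C_a^{*\alpha}=-2\,\partial_\beta h_a^{*\beta\alpha}.$$ An *invariant polynomial* is a polynomial in the $dx^\mu$, the $K^a_{\alpha\beta\mu\nu}$, the antifields $h^*$, $C^*$, and all their derivatives. **Theorem.** 1. Let $a$ be an invariant polynomial all of whose terms have strictly positive antighost number, and suppose $a=\delta b+dc$ for some polynomials $b,c$. Then $a=\delta b'+dc'$ for some invariant polynomials $b',c'$. 2. Consequently the results on the characteristic cohomology hold in the space of invariant polynomials. Let $a$ be an invariant polynomial of form degree $n$ and antighost number $k$. * If $k>2$ and $\delta a+dc=0$ for some invariant polynomial $c$ of form degree $n-1$ and antighost number $k-1$, then $a=\delta b+de$ with invariant polynomials $b$ (form degree $n$, antighost number $k+1$) and $e$ (form degree $n-1$, antighost number $k$). * If $k=2$, then $\delta a+dc=0$ for some invariant polynomial $c$ of form degree $n-1$ and antighost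 number $1$ if and only if there are unique real constants $\lambda^a_\mu$ such that $$a=\lambda^a_\mu C_a^{*\mu}\,dx^0dx^1\cdots dx^{n-1}+\delta b+de$$ for some invariant polynomials $b$ (form degree $n$, antighost number $3$) and $e$ (form degree $n-1$, antighost number $2$). -/

import Mathlib

noncomputable section

/-! ### The free graded-commutative algebra on a set of generators with parities -/

namespace GradedPoly

/-- `x y = (-1)^{|x||y|} y x` for all generators `x`, `y`. -/
inductive Rel {G : Type} (par : G → ℕ) : FreeAlgebra ℝ G → FreeAlgebra ℝ G → Prop
  | comm (x y : G) : Rel par (FreeAlgebra.ι ℝ x * FreeAlgebra.ι ℝ y)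
      ((-1 : ℝ) ^ (par x * par y) • (FreeAlgebra.ι ℝ y * FreeAlgebra.ι ℝ x))

end GradedPoly

/-- Real polynomials in the generators `G`; those of even parity commute with everything, those of
odd parity anticommute with each other (in particular they square to zero). -/
def GradedPoly {G : Type} (par : G → ℕ) : Type := RingQuot (GradedPoly.Rel par)

namespace GradedPoly

variable {G : Type} {par : G → ℕ}

instance : Ring (GradedPoly par) := inferInstanceAs (Ring (RingQuot (Rel par)))

instance : Algebra ℝ (GradedPoly par) := inferInstanceAs (Algebra ℝ (RingQuot (Rel par)))

/-- The quotient map from the free associative algebra. -/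
def mk (par : G → ℕ) : FreeAlgebra ℝ G →ₐ[ℝ] GradedPoly par := RingQuot.mkAlgHom ℝ (Rel par)

theorem mk_surjective : Function.Surjective (mk par) := RingQuot.mkAlgHom_surjective ℝ (Rel par)

theorem mk_rel {u v : FreeAlgebra ℝ G} (h : Rel par u v) : mk par u = mk par v :=
  RingQuot.mkAlgHom_rel ℝ h

/-- The algebra map out of the quotient. -/
def lift {B : Type} [Semiring B] [Algebra ℝ B] (f : FreeAlgebra ℝ G →ₐ[ℝ] B)
    (h : ∀ ⦃u v⦄, Rel par u v → f u = f v) : GradedPoly par →ₐ[ℝ] B :=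
  RingQuot.liftAlgHom ℝ ⟨f, h⟩

theorem lift_mk {B : Type} [Semiring B] [Algebra ℝ B] (f : FreeAlgebra ℝ G →ₐ[ℝ] B)
    (h : ∀ ⦃u v⦄, Rel par u v → f u = f v) (w : FreeAlgebra ℝ G) : lift f h (mk par w) = f w :=
  RingQuot.liftAlgHom_mkAlgHom_apply ..

/-- The generator `x`, as a polynomial. -/
def gen (par : G → ℕ) (x : G) : GradedPoly par :=
  mk par (FreeAlgebra.ι ℝ x)

theorem gen_comm (x y : G) :
    gen par x * gen par y = (-1 : ℝ) ^ (par x * par y) • (gen par y * gen par x) := by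
  simpa only [gen, map_mul, map_smul] using mk_rel (Rel.comm (par := par) x y)

/-- `a` commutes with the generators, up to the sign that an element of parity `p` produces. -/
def SuperCommutes (p : ℕ) (a : GradedPoly par) : Prop :=
  ∀ y : G, a * gen par y = (-1 : ℝ) ^ (p * par y) • (gen par y * a)

theorem SuperCommutes.gen (x : G) : SuperCommutes (par x) (gen par x) := fun y => gen_comm x y

theorem SuperCommutes.zero (p : ℕ) : SuperCommutes p (0 : GradedPoly par) := fun y => by simp

theorem SuperCommutes.add {p : ℕ} {a b : GradedPoly par} (ha : SuperCommutes p a)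
    (hb : SuperCommutes p b) : SuperCommutes p (a + b) := fun y => by
  rw [add_mul, ha y, hb y, mul_add, smul_add]

theorem SuperCommutes.smul {p : ℕ} {a : GradedPoly par} (r : ℝ) (ha : SuperCommutes p a) :
    SuperCommutes p (r • a) := fun y => by
  rw [smul_mul_assoc, ha y, mul_smul_comm, smul_comm]

theorem SuperCommutes.sub {p : ℕ} {a b : GradedPoly par} (ha : SuperCommutes p a)
    (hb : SuperCommutes p b) : SuperCommutes p (a - b) := by
  have h : a - b = a + (-1 : ℝ) • b := by rw [neg_one_smul ℝ b, sub_eq_add_neg]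
  rw [h]
  exact ha.add (hb.smul _)

theorem SuperCommutes.sum {ι : Type} {p : ℕ} (s : Finset ι) {f : ι → GradedPoly par}
    (hf : ∀ i, SuperCommutes p (f i)) : SuperCommutes p (∑ i ∈ s, f i) := by
  classical
  induction s using Finset.induction_on with
  | empty => simpa using SuperCommutes.zero p
  | insert i s hi ih => rw [Finset.sum_insert hi]; exact (hf i).add ih

theorem SuperCommutes.mul {p q : ℕ} {a b : GradedPoly par} (ha : SuperCommutes p a)
    (hb : SuperCommutes q b) : SuperCommutes (p + q) (a * b) := fun y => by
  rw [mul_assoc, hb y, mul_smul_comm, ← mul_assoc, ha y, smul_mul_assoc, smul_smul, mul_assoc,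
    add_mul, pow_add, mul_comm]

/-- The parity involution `a ↦ (-1)^{|a|} a`. -/
def parityInv (par : G → ℕ) : GradedPoly par →ₐ[ℝ] GradedPoly par :=
  lift (FreeAlgebra.lift ℝ fun x => (-1 : ℝ) ^ par x • gen par x) <| by
    rintro _ _ ⟨x, y⟩
    simp only [map_mul, map_smul, FreeAlgebra.lift_ι_apply]
    rw [smul_mul_smul_comm, smul_mul_smul_comm, gen_comm x y, smul_smul, smul_smul]
    ring_nf

theorem parityInv_gen (x : G) : parityInv par (gen par x) = (-1 : ℝ) ^ par x • gen par x := by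
  simp [parityInv, gen, lift_mk]

/-- The algebra map `a ↦ (σ a, D a; 0, a)` that encodes the odd derivation `D` with values `D₀` on
the generators, `σ` being the parity involution. -/
def oddDerivMatrix (D₀ : G → GradedPoly par) (h : ∀ x, SuperCommutes (par x + 1) (D₀ x)) :
    GradedPoly par →ₐ[ℝ] Matrix (Fin 2) (Fin 2) (GradedPoly par) :=
  lift (FreeAlgebra.lift ℝ fun x =>
      !![(-1 : ℝ) ^ par x • gen par x, D₀ x; 0, gen par x]) <| by
    rintro _ _ ⟨x, y⟩
    simp only [map_mul, map_smul, FreeAlgebra.lift_ι_apply]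
    ext i j
    fin_cases i <;> fin_cases j
    · simp only [Fin.zero_eta, Fin.isValue, Matrix.mul_apply, Fin.sum_univ_two, Matrix.of_apply,
        Matrix.cons_val', Matrix.cons_val_zero, Matrix.cons_val_fin_one, Matrix.cons_val_one,
        mul_zero, add_zero, Matrix.smul_apply]
      rw [smul_mul_smul_comm, smul_mul_smul_comm, gen_comm x y, smul_smul, smul_smul]
      ring_nf
    · simp only [Fin.zero_eta, Fin.isValue, Fin.mk_one, Matrix.mul_apply, Fin.sum_univ_two,
        Matrix.of_apply, Matrix.cons_val', Matrix.cons_val_zero, Matrix.cons_val_fin_one,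
        Matrix.cons_val_one, Matrix.smul_apply]
      rw [h x y, h y x, smul_mul_assoc, smul_mul_assoc, smul_add, smul_smul, smul_smul,
        add_comm]
      have e₁ : (-1 : ℝ) ^ (par x * par y) * (-1 : ℝ) ^ ((par y + 1) * par x)
          = (-1 : ℝ) ^ par x := by
        rw [← pow_add, add_mul, one_mul, mul_comm (par y) (par x), ← add_assoc, ← two_mul,
          pow_add, pow_mul, neg_one_sq, one_pow, one_mul]
      have e₂ : (-1 : ℝ) ^ (par x * par y) * (-1 : ℝ) ^ par y
          = (-1 : ℝ) ^ ((par x + 1) * par y) := by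
        rw [← pow_add, add_mul, one_mul]
      rw [e₂, ← e₁]
    · simp [Matrix.mul_apply, Fin.sum_univ_two]
    · simp only [Fin.isValue, Fin.mk_one, Matrix.mul_apply, Fin.sum_univ_two,
        Matrix.of_apply, Matrix.cons_val', Matrix.cons_val_zero, Matrix.cons_val_fin_one,
        Matrix.cons_val_one, Matrix.smul_apply, zero_mul, zero_add]
      exact gen_comm x y

/-- The odd derivation with prescribed values `D₀` on the generators, i.e. the linear map `D` with
`D x = D₀ x` on generators and `D (a b) = (D a) b + (-1)^{|a|} a (D b)`. -/
def oddDeriv (D₀ : G → GradedPoly par) (h : ∀ x, SuperCommutes (par x + 1) (D₀ x)) :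
    GradedPoly par →ₗ[ℝ] GradedPoly par where
  toFun a := oddDerivMatrix D₀ h a 0 1
  map_add' a b := by simp
  map_smul' r a := by simp

theorem oddDeriv_gen (D₀ : G → GradedPoly par) (h : ∀ x, SuperCommutes (par x + 1) (D₀ x))
    (x : G) : oddDeriv D₀ h (gen par x) = D₀ x := by
  simp [oddDeriv, oddDerivMatrix, gen, lift_mk]

theorem oddDerivMatrix_eq (D₀ : G → GradedPoly par)
    (h : ∀ x, SuperCommutes (par x + 1) (D₀ x)) (a : GradedPoly par) :
    oddDerivMatrix D₀ h a = !![parityInv par a, oddDeriv D₀ h a; 0, a] := by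
  obtain ⟨w, rfl⟩ := mk_surjective a
  suffices H : oddDerivMatrix D₀ h (mk par w) 0 0
        = parityInv par (mk par w) ∧
      oddDerivMatrix D₀ h (mk par w) 1 0 = 0 ∧
      oddDerivMatrix D₀ h (mk par w) 1 1
        = mk par w by
    ext i j
    fin_cases i <;> fin_cases j
    · exact H.1
    · rfl
    · exact H.2.1
    · exact H.2.2
  induction w using FreeAlgebra.induction with
  | grade0 r =>
    simp only [AlgHom.commutes]
    simp [Matrix.algebraMap_matrix_apply]
  | grade1 x =>
    simp [oddDerivMatrix, parityInv, gen, lift_mk]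
  | mul u v hu hv =>
    simp only [map_mul, Matrix.mul_apply, Fin.sum_univ_two, hu.1, hu.2.1, hu.2.2, hv.1, hv.2.1,
      hv.2.2]
    simp
  | add u v hu hv =>
    simp only [map_add, Matrix.add_apply, hu.1, hu.2.1, hu.2.2, hv.1, hv.2.1, hv.2.2]
    simp

theorem oddDeriv_mul (D₀ : G → GradedPoly par) (h : ∀ x, SuperCommutes (par x + 1) (D₀ x))
    (a b : GradedPoly par) :
    oddDeriv D₀ h (a * b) = oddDeriv D₀ h a * b + parityInv par a * oddDeriv D₀ h b := by
  have H : oddDeriv D₀ h (a * b) = (oddDerivMatrix D₀ h a * oddDerivMatrix D₀ h b) 0 1 := by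
    rw [← map_mul]; rfl
  rw [H, oddDerivMatrix_eq, oddDerivMatrix_eq]
  simp [Matrix.mul_apply, Fin.sum_univ_two, add_comm]

end GradedPoly

/-! ### Local forms of `N` free massless spin-2 fields on `n`-dimensional Minkowski space -/

namespace PauliFierz

open GradedPoly

/-- The generators of the algebra of ghost-free local forms. A multi-index `I` stands for the
partial derivative `∂_I`; symmetric pairs of Lorentz indices are elements of `Sym2`. -/
inductive Gen (n N : ℕ) : Type
  /-- the differential `dx^μ` -/
  | dx (μ : Fin n)
  /-- `∂_I h^a_{αβ}`, the derivatives of the fields -/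
  | h (a : Fin N) (αβ : Sym2 (Fin n)) (I : Fin n →₀ ℕ)
  /-- `∂_I h_a^{*αβ}`, the derivatives of the antifields -/
  | hStar (a : Fin N) (αβ : Sym2 (Fin n)) (I : Fin n →₀ ℕ)
  /-- `∂_I C_a^{*α}`, the derivatives of the antifields conjugate to the ghosts -/
  | CStar (a : Fin N) (α : Fin n) (I : Fin n →₀ ℕ)

variable {n N : ℕ}

/-- Grassmann parity: `dx^μ` and `h*` are odd, `h` and `C*` are even. -/
def Gen.parity : Gen n N → ℕ
  | .dx _ => 1
  | .h _ _ _ => 0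
  | .hStar _ _ _ => 1
  | .CStar _ _ _ => 0

/-- Antighost number. -/
def Gen.antigh : Gen n N → ℕ
  | .dx _ => 0
  | .h _ _ _ => 0
  | .hStar _ _ _ => 1
  | .CStar _ _ _ => 2

/-- Form degree. -/
def Gen.formDeg : Gen n N → ℕ
  | .dx _ => 1
  | .h _ _ _ => 0
  | .hStar _ _ _ => 0
  | .CStar _ _ _ => 0

/-- Ghost-free local forms: polynomials, with constant coefficients, in the `dx^μ`, the fields,
the antifields and their derivatives. -/
abbrev LocalForm (n N : ℕ) : Type := GradedPoly (Gen.parity (n := n) (N := N))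

/-- A generator as a local form. -/
abbrev var (x : Gen n N) : LocalForm n N := gen Gen.parity x

/-- The Minkowski metric `η = diag(-1, 1, …, 1)`: its diagonal entries, which are also those of
its inverse. -/
def eta (α : Fin n) : ℝ := if α.val = 0 then -1 else 1

/-- The coordinate `∂_I ∂_ρ ∂_σ h^a_{αβ}`. -/
def ddh (a : Fin N) (ρ σ α β : Fin n) (I : Fin n →₀ ℕ) : LocalForm n N :=
  var (.h a s(α, β) (I + Finsupp.single ρ 1 + Finsupp.single σ 1))

/-- `∂_I K^a_{αβμν}`, where `K` is the linearized Riemann tensor,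
`K_{αβμν} = -½ (∂_α∂_μ h_{βν} + ∂_β∂_ν h_{αμ} - ∂_α∂_ν h_{βμ} - ∂_β∂_μ h_{αν})`. -/
def curvature (a : Fin N) (α β μ ν : Fin n) (I : Fin n →₀ ℕ) : LocalForm n N :=
  (-1 / 2 : ℝ) • (ddh a α μ β ν I + ddh a β ν α μ I - ddh a α ν β μ I - ddh a β μ α ν I)

/-- `∂_I K^a_{βν}`, the linearized Ricci tensor `K_{βν} = η^{αμ} K_{αβμν}`. -/
def ricci (a : Fin N) (β ν : Fin n) (I : Fin n →₀ ℕ) : LocalForm n N :=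
  ∑ α, eta α • curvature a α β α ν I

/-- `∂_I K^a`, the linearized scalar curvature `K = η^{βν} K_{βν}`. -/
def scalarCurvature (a : Fin N) (I : Fin n →₀ ℕ) : LocalForm n N :=
  ∑ β, eta β • ricci a β β I

/-- `∂_I H^a_{αβ}`, the linearized Einstein tensor `H_{αβ} = K_{αβ} - ½ η_{αβ} K`. -/
def einstein (a : Fin N) (α β : Fin n) (I : Fin n →₀ ℕ) : LocalForm n N :=
  ricci a α β I - ((1 / 2 : ℝ) * if α = β then eta α else 0) • scalarCurvature a I

/-- `∂_I (δS₀/δh^a_{αβ}) = -2 ∂_I H_a^{αβ}`, the left-hand side of the field equations of the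
Pauli-Fierz action `S₀`, with upper Lorentz indices. -/
def fieldEq (a : Fin N) (α β : Fin n) (I : Fin n →₀ ℕ) : LocalForm n N :=
  (-2 * eta α * eta β) • einstein a α β I

theorem ricci_comm (a : Fin N) (β ν : Fin n) (I : Fin n →₀ ℕ) :
    ricci a β ν I = ricci a ν β I := by
  unfold ricci
  refine Finset.sum_congr rfl fun α _ => ?_
  simp only [curvature, ddh]
  rw [Sym2.eq_swap (a := β) (b := ν), Sym2.eq_swap (a := β) (b := α),
    Sym2.eq_swap (a := α) (b := ν), add_right_comm I (Finsupp.single β 1) (Finsupp.single ν 1),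
    add_right_comm I (Finsupp.single α 1) (Finsupp.single ν 1),
    add_right_comm I (Finsupp.single β 1) (Finsupp.single α 1)]
  abel_nf

theorem fieldEq_comm (a : Fin N) (α β : Fin n) (I : Fin n →₀ ℕ) :
    fieldEq a α β I = fieldEq a β α I := by
  unfold fieldEq einstein
  rw [ricci_comm a α β]
  rcases eq_or_ne α β with rfl | hne
  · rfl
  · rw [if_neg hne, if_neg hne.symm, mul_right_comm]

/-- The values of the Koszul-Tate differential on the generators:
`δh = 0`, `δh* = δS₀/δh`, `δC*^α = -2 ∂_β h*^{βα}`, and likewise for their derivatives. -/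
def deltaGen : Gen n N → LocalForm n N
  | .dx _ => 0
  | .h _ _ _ => 0
  | .hStar a αβ I => Sym2.lift ⟨fun α β => fieldEq a α β I, fun α β => fieldEq_comm a α β I⟩ αβ
  | .CStar a α I => (-2 : ℝ) • ∑ β, var (.hStar a s(β, α) (I + Finsupp.single β 1))

/-- The values of the total derivative `∂_μ` on the generators. -/
def partialGen (μ : Fin n) : Gen n N → LocalForm n N
  | .dx _ => 0
  | .h a αβ I => var (.h a αβ (I + Finsupp.single μ 1))
  | .hStar a αβ I => var (.hStar a αβ (I + Finsupp.single μ 1))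
  | .CStar a α I => var (.CStar a α (I + Finsupp.single μ 1))

/-- The values of `d = dx^μ ∂_μ` on the generators. -/
def dGen (x : Gen n N) : LocalForm n N := ∑ μ, var (.dx μ) * partialGen μ x

theorem superCommutes_ddh (a : Fin N) (ρ σ α β : Fin n) (I : Fin n →₀ ℕ) :
    SuperCommutes 0 (ddh a ρ σ α β I) :=
  SuperCommutes.gen (par := Gen.parity) (Gen.h a _ _)

theorem superCommutes_curvature (a : Fin N) (α β μ ν : Fin n) (I : Fin n →₀ ℕ) :
    SuperCommutes 0 (curvature a α β μ ν I) :=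
  ((((superCommutes_ddh _ _ _ _ _ _).add (superCommutes_ddh _ _ _ _ _ _)).sub
    (superCommutes_ddh _ _ _ _ _ _)).sub (superCommutes_ddh _ _ _ _ _ _)).smul _

theorem superCommutes_ricci (a : Fin N) (β ν : Fin n) (I : Fin n →₀ ℕ) :
    SuperCommutes 0 (ricci a β ν I) :=
  SuperCommutes.sum _ fun _ => (superCommutes_curvature _ _ _ _ _ _).smul _

theorem superCommutes_fieldEq (a : Fin N) (α β : Fin n) (I : Fin n →₀ ℕ) :
    SuperCommutes 0 (fieldEq a α β I) :=
  ((superCommutes_ricci _ _ _ _).sub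
    ((SuperCommutes.sum _ fun _ => (superCommutes_ricci _ _ _ _).smul _).smul _)).smul _

theorem SuperCommutes.add_two {p : ℕ} {a : LocalForm n N} (h : SuperCommutes p a) :
    SuperCommutes (p + 2) a := fun y => by
  rw [h y, add_mul, pow_add, pow_mul (-1 : ℝ) 2, neg_one_sq, one_pow, mul_one]

theorem superCommutes_deltaGen (x : Gen n N) : SuperCommutes (x.parity + 1) (deltaGen x) := by
  cases x with
  | dx μ => exact SuperCommutes.zero _
  | h a αβ I => exact SuperCommutes.zero _
  | hStar a αβ I =>
    induction αβ using Sym2.ind with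
    | _ α β => exact SuperCommutes.add_two (superCommutes_fieldEq a α β I)
  | CStar a α I =>
    change SuperCommutes 1 ((-2 : ℝ) • _)
    exact (SuperCommutes.sum _ fun β =>
      SuperCommutes.gen (par := Gen.parity) (Gen.hStar a s(β, α) _)).smul _

theorem superCommutes_dGen (x : Gen n N) : SuperCommutes (x.parity + 1) (dGen x) := by
  refine SuperCommutes.sum _ fun μ => ?_
  rw [add_comm]
  refine (SuperCommutes.gen (par := Gen.parity) (Gen.dx μ)).mul ?_
  cases x with
  | dx ν => exact SuperCommutes.zero _
  | h a αβ I => exact SuperCommutes.gen (par := Gen.parity) (Gen.h a αβ _)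
  | hStar a αβ I => exact SuperCommutes.gen (par := Gen.parity) (Gen.hStar a αβ _)
  | CStar a α I => exact SuperCommutes.gen (par := Gen.parity) (Gen.CStar a α _)

/-- The Koszul-Tate differential `δ`, an odd derivation. -/
def delta : LocalForm n N →ₗ[ℝ] LocalForm n N := oddDeriv deltaGen superCommutes_deltaGen

/-- The exterior (horizontal) differential `d = dx^μ ∂_μ`, an odd derivation. -/
def extD : LocalForm n N →ₗ[ℝ] LocalForm n N := oddDeriv dGen superCommutes_dGen

/-- The invariant polynomials: polynomials in the `dx^μ`, the linearized curvatures, the antifields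
and all their derivatives. -/
def invariantPolys (n N : ℕ) : Subalgebra ℝ (LocalForm n N) :=
  Algebra.adjoin ℝ
    (Set.range (fun μ => var (.dx μ)) ∪
      {K | ∃ a α β μ ν I, K = curvature a α β μ ν I} ∪
      {u | ∃ a αβ I, u = var (.hStar a αβ I)} ∪
      {u | ∃ a α I, u = var (.CStar a α I)})

/-- The monomial that is the product of a list of generators. -/
def monomial (l : List (Gen n N)) : LocalForm n N := (l.map var).prod

/-- The local forms all of whose terms have strictly positive antighost number. -/
def positiveAntigh (n N : ℕ) : Submodule ℝ (LocalForm n N) :=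
  Submodule.span ℝ {m | ∃ l : List (Gen n N), 0 < (l.map Gen.antigh).sum ∧ m = monomial l}

/-- The local forms of form degree `p` and antighost number `k`. -/
def bidegree (n N p k : ℕ) : Submodule ℝ (LocalForm n N) :=
  Submodule.span ℝ {m | ∃ l : List (Gen n N),
    (l.map Gen.formDeg).sum = p ∧ (l.map Gen.antigh).sum = k ∧ m = monomial l}

/-- The invariant polynomials of form degree `p` and antighost number `k`. -/
def invariantForms (n N p k : ℕ) : Submodule ℝ (LocalForm n N) :=
  (invariantPolys n N).toSubmodule ⊓ bidegree n N p k

/-- The volume form `dx^0 dx^1 ⋯ dx^{n-1}`. -/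
def volumeForm (n N : ℕ) : LocalForm n N := (List.ofFn fun μ : Fin n => var (.dx μ)).prod

end PauliFierz

end

/-! ### Monomials and parity in a free graded-commutative algebra -/

noncomputable section

namespace GradedPoly

variable {G : Type} {par : G → ℕ}

/-! The work is done in a larger graded-commutative algebra `MAlg`. To the local forms it adds odd
ghosts and a second copy of `h`, `h*`, `C*` with opposite parities. The inclusion `emb` and the
retraction `ret` intertwine the differentials and match the invariant polynomials on both sides, so
it suffices to treat homogeneous elements of `MAlg`.

Two homotopies carry everything. For `d`, let K^μ be the derivation that differentiates a field
formally with respect to ∂_μ, times a weight of the field. The K^μ and ∂_μ satisfy Heisenberg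
relations, and `rho` = ∑ ι_μ K^μ has an anticommutator with `d` whose eigenvalues are w(n - p + i),
with i a natural number, in form degree p and weight w (`lap_posSpec`). It is invertible for p < n
and w > 0. The weight may be any degree that ignores `dx`, and it is chosen so that `rho` preserves
the structure of interest. For `δ`, the jets are modules over ℝ[∂], and for n ≥ 3 the sequence C* →
h* → h is injective at C* and exact at h* (`D2_injective`, `exact_D1`); this makes `δ` acyclic in
positive antighost number (`dl_acyclic`).

Cohomology of `δ` modulo `d` in top degree: if some positive weight is invisible to `δ`, a form that
is `δ`-closed modulo `d` can be made `δ`-closed by adding a `d`-exact form (`exists_dl_closed`),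
hence is trivial. The ghost number is such a weight. Without ghosts, an odd derivation τ moves one
field into the second copy, whose field number is then such a weight. The form τa is closed for `δ`
plus its analogue on the second copy. Its components are removed in order of decreasing antighost
number t ≤ 2 of that copy, which works while k - t > 0. Moving the field back gives m·a, where m is
the polynomial degree (`exists_of_closed`).

For k = 2 this leaves the component of τa with t = 2. Integration by parts shows that its
coefficients z solve the Killing equations modulo `δ`; differentiating twice and descending from
antighost number n ≥ 3 gives z = δu when m ≥ 2 (`exists_of_closed_two`). For m = 1 integration by
parts leaves the constant multiples of C* times the volume form, and these are independent by
`Ibp.unique`.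

Invariance: let γ send h_{αβ} to ∂_α C_β + ∂_β C_α. Its kernel in ghost number 0 consists exactly of
the invariant polynomials (`mem_Inv_of_gamO`). If δb + dc is invariant in top degree, γb is
`δ`-closed modulo `d`. If γb = δγβ + dγε up to signs, then correcting b by δβ + dε makes it
invariant. This needs the vanishing of the cohomology on the γ-closed forms that contain the ghosts
through gauge variations only (`Zg_van`). It follows from the full algebra by long exact sequences
(`Van.ker`) for three kinds of odd operators: those removing the ghosts C_α, those removing ∂_[α
C_β], and γ itself. Lower form degrees are reached from the top one by a descent argument
(`exists_invariant`). -/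

theorem adjoin_gen : Algebra.adjoin ℝ (Set.range (gen par)) = ⊤ := by
  have h := congrArg (Subalgebra.map (mk par)) (FreeAlgebra.adjoin_range_ι ℝ G)
  rw [AlgHom.map_adjoin, Algebra.map_top, (AlgHom.range_eq_top _).2 mk_surjective,
    ← Set.range_comp] at h
  exact h

/-- The product of a list of generators. -/
def mon (par : G → ℕ) (l : List G) : GradedPoly par := (l.map (gen par)).prod

@[simp] theorem mon_nil : mon par [] = 1 := rfl

@[simp] theorem mon_cons (x : G) (l : List G) : mon par (x :: l) = gen par x * mon par l := by
  simp [mon]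

@[simp] theorem mon_append (l m : List G) : mon par (l ++ m) = mon par l * mon par m := by
  simp [mon]

theorem span_mon : Submodule.span ℝ (Set.range (mon par)) = ⊤ := by
  rw [eq_top_iff, ← Algebra.top_toSubmodule, ← adjoin_gen, Algebra.adjoin_eq_span]
  refine Submodule.span_mono ?_
  intro x hx
  obtain ⟨l, hl, rfl⟩ := Submonoid.exists_list_of_mem_closure hx
  clear hx
  induction l with
  | nil => exact ⟨[], rfl⟩
  | cons y l ih =>
    obtain ⟨z, hz⟩ := hl y (by simp)
    obtain ⟨m, hm⟩ := ih fun w hw => hl w (by simp [hw])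
    exact ⟨z :: m, by simp [hz, hm]⟩

theorem mon_induction {P : GradedPoly par → Prop} (hm : ∀ l, P (mon par l))
    (hadd : ∀ a b, P a → P b → P (a + b)) (hsmul : ∀ (r : ℝ) a, P a → P (r • a))
    (a : GradedPoly par) : P a := by
  have ha : a ∈ Submodule.span ℝ (Set.range (mon par)) := by rw [span_mon]; trivial
  induction ha using Submodule.span_induction with
  | mem x hx => obtain ⟨l, rfl⟩ := hx; exact hm l
  | zero => simpa using hsmul 0 _ (hm [])
  | add x y _ _ hx hy => exact hadd x y hx hy
  | smul r x _ hx => exact hsmul r x hx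

theorem parityInv_parityInv (a : GradedPoly par) : parityInv par (parityInv par a) = a := by
  suffices h : (parityInv par).comp (parityInv par) = AlgHom.id ℝ _ from DFunLike.congr_fun h a
  refine AlgHom.ext_of_adjoin_eq_top adjoin_gen ?_
  rintro _ ⟨x, rfl⟩
  simp [parityInv_gen, smul_smul, ← pow_add, ← two_mul]

theorem mul_gen_of_even {x : G} (hx : Even (par x)) (a : GradedPoly par) :
    a * gen par x = gen par x * a := by
  induction a using mon_induction with
  | hm l =>
    induction l with
    | nil => simp
    | cons y l ih =>
      rw [mon_cons, mul_assoc, ih, ← mul_assoc, gen_comm, Even.neg_one_pow (hx.mul_left _),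
        one_smul, mul_assoc]
  | hadd a b ha hb => rw [add_mul, ha, hb, mul_add]
  | hsmul r a ha => rw [smul_mul_assoc, ha, mul_smul_comm]

theorem mul_gen_of_odd {x : G} (hx : Odd (par x)) (a : GradedPoly par) :
    a * gen par x = gen par x * parityInv par a := by
  induction a using mon_induction with
  | hm l =>
    induction l with
    | nil => simp
    | cons y l ih =>
      rw [mon_cons, mul_assoc, ih, ← mul_assoc, gen_comm, map_mul, parityInv_gen,
        smul_mul_assoc, mul_assoc, smul_mul_assoc, mul_smul_comm]
      congr 1
      rcases Nat.even_or_odd (par y) with hy | hy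
      · rw [Even.neg_one_pow (hy.mul_right _), Even.neg_one_pow hy]
      · rw [Odd.neg_one_pow (hy.mul hx), Odd.neg_one_pow hy]
  | hadd a b ha hb => rw [add_mul, ha, hb, map_add, mul_add]
  | hsmul r a ha => rw [smul_mul_assoc, ha, map_smul, mul_smul_comm]

/-- `a` is homogeneous of parity `p`. -/
def HasParity (p : ℕ) (a : GradedPoly par) : Prop := parityInv par a = (-1 : ℝ) ^ p • a

theorem HasParity.superCommutes {p : ℕ} {a : GradedPoly par} (h : HasParity p a) :
    SuperCommutes p a := by
  intro x
  rcases Nat.even_or_odd (par x) with hx | hx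
  · rw [mul_gen_of_even hx, Even.neg_one_pow (hx.mul_left _), one_smul]
  · rw [mul_gen_of_odd hx, h, mul_smul_comm]
    congr 1
    rcases Nat.even_or_odd p with hy | hy
    · rw [Even.neg_one_pow (hy.mul_right _), Even.neg_one_pow hy]
    · rw [Odd.neg_one_pow (hy.mul hx), Odd.neg_one_pow hy]

theorem odd_mul {c : GradedPoly par} (hc : HasParity 1 c) (a : GradedPoly par) :
    c * a = parityInv par a * c := by
  induction a using mon_induction with
  | hm l =>
    induction l with
    | nil => simp
    | cons y l ih =>
      rw [mon_cons, ← mul_assoc, hc.superCommutes, smul_mul_assoc, mul_assoc, ih, map_mul,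
        parityInv_gen, smul_mul_assoc, smul_mul_assoc, ← mul_assoc, one_mul]
  | hadd a b ha hb => rw [mul_add, ha, hb, map_add, add_mul]
  | hsmul r a ha => rw [mul_smul_comm, ha, map_smul, smul_mul_assoc]

theorem odd_sq_gen {x : G} (hx : Odd (par x)) : gen par x * gen par x = 0 := by
  have h := gen_comm (par := par) x x
  rw [Odd.neg_one_pow (hx.mul hx), neg_one_smul] at h
  have h2 : (2 : ℝ) • (gen par x * gen par x) = 0 := by
    rw [two_smul]; nth_rewrite 1 [h]; simp
  simpa using h2

/-! ### Derivations -/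

/-- `D` is an odd derivation. -/
structure IsOdd (D : Module.End ℝ (GradedPoly par)) : Prop where
  leib : ∀ a b, D (a * b) = D a * b + parityInv par a * D b
  anti : ∀ a, D (parityInv par a) = -parityInv par (D a)

/-- `E` is an even derivation. -/
structure IsEven (E : Module.End ℝ (GradedPoly par)) : Prop where
  leib : ∀ a b, E (a * b) = E a * b + a * E b
  comm : ∀ a, E (parityInv par a) = parityInv par (E a)

theorem IsOdd.map_one {D : Module.End ℝ (GradedPoly par)} (hD : IsOdd D) : D 1 = 0 := by
  simpa using hD.leib 1 1

theorem IsEven.map_one {D : Module.End ℝ (GradedPoly par)} (hD : IsEven D) : D 1 = 0 := by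
  simpa using hD.leib 1 1

theorem IsOdd.ext {D D' : Module.End ℝ (GradedPoly par)} (hD : IsOdd D) (hD' : IsOdd D')
    (h : ∀ x, D (gen par x) = D' (gen par x)) : D = D' := by
  ext a
  induction a using mon_induction with
  | hm l =>
    induction l with
    | nil => rw [mon_nil, hD.map_one, hD'.map_one]
    | cons y l ih => rw [mon_cons, hD.leib, hD'.leib, h, ih]
  | hadd a b ha hb => rw [map_add, map_add, ha, hb]
  | hsmul r a ha => rw [map_smul, map_smul, ha]

theorem IsEven.ext {D D' : Module.End ℝ (GradedPoly par)} (hD : IsEven D) (hD' : IsEven D')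
    (h : ∀ x, D (gen par x) = D' (gen par x)) : D = D' := by
  ext a
  induction a using mon_induction with
  | hm l =>
    induction l with
    | nil => rw [mon_nil, hD.map_one, hD'.map_one]
    | cons y l ih => rw [mon_cons, hD.leib, hD'.leib, h, ih]
  | hadd a b ha hb => rw [map_add, map_add, ha, hb]
  | hsmul r a ha => rw [map_smul, map_smul, ha]

theorem IsOdd.zero : IsOdd (0 : Module.End ℝ (GradedPoly par)) := ⟨by simp, by simp⟩

theorem IsEven.zero : IsEven (0 : Module.End ℝ (GradedPoly par)) := ⟨by simp, by simp⟩

theorem IsOdd.add {D D' : Module.End ℝ (GradedPoly par)} (hD : IsOdd D) (hD' : IsOdd D') :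
    IsOdd (D + D') where
  leib a b := by simp only [LinearMap.add_apply, hD.leib, hD'.leib]; noncomm_ring
  anti a := by simp only [LinearMap.add_apply, hD.anti, hD'.anti, map_add]; abel

theorem IsEven.add {D D' : Module.End ℝ (GradedPoly par)} (hD : IsEven D) (hD' : IsEven D') :
    IsEven (D + D') where
  leib a b := by simp only [LinearMap.add_apply, hD.leib, hD'.leib]; noncomm_ring
  comm a := by simp only [LinearMap.add_apply, hD.comm, hD'.comm, map_add]

theorem IsOdd.smul (r : ℝ) {D : Module.End ℝ (GradedPoly par)} (hD : IsOdd D) :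
    IsOdd (r • D) where
  leib a b := by simp [LinearMap.smul_apply, hD.leib]
  anti a := by simp only [LinearMap.smul_apply, hD.anti, map_smul, smul_neg]

theorem IsOdd.sum {ι : Type*} (s : Finset ι) {D : ι → Module.End ℝ (GradedPoly par)}
    (hD : ∀ i ∈ s, IsOdd (D i)) : IsOdd (∑ i ∈ s, D i) :=
  Finset.sum_induction _ _ (fun _ _ => IsOdd.add) IsOdd.zero hD

theorem IsEven.sum {ι : Type*} (s : Finset ι) {D : ι → Module.End ℝ (GradedPoly par)}
    (hD : ∀ i ∈ s, IsEven (D i)) : IsEven (∑ i ∈ s, D i) :=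
  Finset.sum_induction _ _ (fun _ _ => IsEven.add) IsEven.zero hD

theorem IsOdd.anticomm {D D' : Module.End ℝ (GradedPoly par)} (hD : IsOdd D) (hD' : IsOdd D') :
    IsEven (D * D' + D' * D) where
  leib a b := by
    simp only [LinearMap.add_apply, Module.End.mul_apply, hD.leib, hD'.leib, map_add, hD.anti,
      hD'.anti, parityInv_parityInv]
    noncomm_ring
  comm a := by
    simp only [LinearMap.add_apply, Module.End.mul_apply, hD.anti, hD'.anti, map_add, map_neg,
      neg_neg]

theorem IsEven.comm_odd {E D : Module.End ℝ (GradedPoly par)} (hE : IsEven E) (hD : IsOdd D) :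
    IsOdd (E * D - D * E) where
  leib a b := by
    simp only [LinearMap.sub_apply, Module.End.mul_apply, hD.leib, hE.leib, map_add, hE.comm]
    noncomm_ring
  anti a := by
    simp only [LinearMap.sub_apply, Module.End.mul_apply, hD.anti, hE.comm, map_sub, map_neg]
    abel

theorem IsEven.comm_even {E D : Module.End ℝ (GradedPoly par)} (hE : IsEven E) (hD : IsEven D) :
    IsEven (E * D - D * E) where
  leib a b := by
    simp only [LinearMap.sub_apply, Module.End.mul_apply, hD.leib, hE.leib, map_add]
    noncomm_ring
  comm a := by
    simp only [LinearMap.sub_apply, Module.End.mul_apply, hD.comm, hE.comm, map_sub]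

/-- Left multiplication. -/
abbrev lmul (c : GradedPoly par) : Module.End ℝ (GradedPoly par) := LinearMap.mulLeft ℝ c

theorem IsEven.odd_mul {E : Module.End ℝ (GradedPoly par)} (hE : IsEven E) {c : GradedPoly par}
    (hc : HasParity 1 c) : IsOdd (lmul c * E) where
  leib a b := by
    simp only [Module.End.mul_apply, hE.leib, LinearMap.mulLeft_apply, mul_add]
    rw [← mul_assoc c a, GradedPoly.odd_mul hc a, mul_assoc, mul_assoc]
  anti a := by
    have h1 : parityInv par c = -c := by simpa [HasParity] using hc
    simp only [Module.End.mul_apply, hE.comm, LinearMap.mulLeft_apply, map_mul, h1, neg_mul,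
      neg_neg]

theorem IsOdd.odd_mul {D : Module.End ℝ (GradedPoly par)} (hD : IsOdd D) {c : GradedPoly par}
    (hc : HasParity 1 c) : IsEven (lmul c * D) where
  leib a b := by
    simp only [Module.End.mul_apply, hD.leib, LinearMap.mulLeft_apply, mul_add]
    rw [← mul_assoc c (parityInv par a), GradedPoly.odd_mul hc (parityInv par a),
      parityInv_parityInv, mul_assoc, mul_assoc]
  comm a := by
    have h1 : parityInv par c = -c := by simpa [HasParity] using hc
    simp only [Module.End.mul_apply, hD.anti, LinearMap.mulLeft_apply, map_mul, h1, neg_mul,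
      mul_neg]

/-- The odd derivation with given values on the generators. -/
def oddEnd (D₀ : G → GradedPoly par) (h : ∀ x, HasParity (par x + 1) (D₀ x)) :
    Module.End ℝ (GradedPoly par) := oddDeriv D₀ fun x => (h x).superCommutes

theorem oddEnd_gen (D₀ : G → GradedPoly par) (h : ∀ x, HasParity (par x + 1) (D₀ x)) (x : G) :
    oddEnd D₀ h (gen par x) = D₀ x := oddDeriv_gen ..

/-- The parity of an odd derivation need only be checked on generators: the Leibniz rule carries the
sign along monomials. -/
theorem anti_of_leib {D : Module.End ℝ (GradedPoly par)}
    (leib : ∀ a b, D (a * b) = D a * b + parityInv par a * D b)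
    (h : ∀ x, HasParity (par x + 1) (D (gen par x))) (a : GradedPoly par) :
    D (parityInv par a) = -parityInv par (D a) := by
  have h1 : D 1 = 0 := by simpa using leib 1 1
  induction a using mon_induction with
  | hm l =>
    induction l with
    | nil => simp [h1]
    | cons y l ih =>
      have hy : parityInv par (D (gen par y)) = (-1 : ℝ) ^ (par y + 1) • D (gen par y) := h y
      rw [mon_cons, map_mul, leib, leib, ih, map_add, map_mul, map_mul, hy, parityInv_parityInv,
        parityInv_gen, map_smul, pow_succ, mul_neg_one, neg_smul, neg_mul, mul_neg, neg_add,
        neg_neg]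
  | hadd a b ha hb => simp only [map_add, ha, hb]; abel
  | hsmul r a ha => simp only [map_smul, ha, smul_neg]

theorem oddEnd_isOdd (D₀ : G → GradedPoly par) (h : ∀ x, HasParity (par x + 1) (D₀ x)) :
    IsOdd (oddEnd D₀ h) where
  leib := oddDeriv_mul D₀ _
  anti := anti_of_leib (oddDeriv_mul D₀ _) fun x => by
    have h1 := oddEnd_gen D₀ h x
    rw [oddEnd] at h1 ⊢
    rw [h1]; exact h x

/-- The algebra map `a ↦ (a, E a; 0, a)` that encodes an even derivation. -/
def evenMatrix (E₀ : G → GradedPoly par) (h : ∀ x, HasParity (par x) (E₀ x)) :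
    GradedPoly par →ₐ[ℝ] Matrix (Fin 2) (Fin 2) (GradedPoly par) :=
  lift (FreeAlgebra.lift ℝ fun x => !![gen par x, E₀ x; 0, gen par x]) <| by
    rintro _ _ ⟨x, y⟩
    simp only [map_mul, map_smul, FreeAlgebra.lift_ι_apply]
    have e := gen_comm (par := par) x y
    ext i j
    fin_cases i <;> fin_cases j
    · simp [Matrix.mul_apply, Fin.sum_univ_two, e]
    · simp only [Matrix.mul_apply, Fin.sum_univ_two, Matrix.smul_apply]
      simp only [Fin.zero_eta, Fin.isValue, Fin.mk_one, Matrix.of_apply, Matrix.cons_val',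
        Matrix.cons_val_zero, Matrix.cons_val_fin_one, Matrix.cons_val_one]
      rw [(h x).superCommutes y, (h y).superCommutes x, smul_add, smul_smul, mul_comm (par y),
        ← pow_add, ← two_mul, pow_mul (-1 : ℝ) 2, neg_one_sq, one_pow, one_smul, add_comm]
    · simp [Matrix.mul_apply, Fin.sum_univ_two]
    · simp [Matrix.mul_apply, Fin.sum_univ_two, e]

/-- The even derivation with given values on the generators. -/
def evenEnd (E₀ : G → GradedPoly par) (h : ∀ x, HasParity (par x) (E₀ x)) :
    Module.End ℝ (GradedPoly par) where
  toFun a := evenMatrix E₀ h a 0 1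
  map_add' a b := by simp
  map_smul' r a := by simp

theorem evenEnd_gen (E₀ : G → GradedPoly par) (h : ∀ x, HasParity (par x) (E₀ x)) (x : G) :
    evenEnd E₀ h (gen par x) = E₀ x := by
  simp [evenEnd, evenMatrix, gen, lift_mk]

theorem evenMatrix_diag (E₀ : G → GradedPoly par) (h : ∀ x, HasParity (par x) (E₀ x))
    (a : GradedPoly par) : evenMatrix E₀ h a 0 0 = a ∧ evenMatrix E₀ h a 1 0 = 0 ∧
      evenMatrix E₀ h a 1 1 = a := by
  induction a using mon_induction with
  | hm l =>
    induction l with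
    | nil => simp
    | cons y l ih =>
      simp only [mon_cons, map_mul, Matrix.mul_apply, Fin.sum_univ_two, ih.1, ih.2.1, ih.2.2]
      simp [evenMatrix, gen, lift_mk]
  | hadd a b ha hb =>
    simp only [map_add, Matrix.add_apply, ha.1, ha.2.1, ha.2.2, hb.1, hb.2.1, hb.2.2]
    simp
  | hsmul r a ha => simp [ha.1, ha.2.1, ha.2.2]

theorem evenEnd_leib (E₀ : G → GradedPoly par) (h : ∀ x, HasParity (par x) (E₀ x))
    (a b : GradedPoly par) :
    evenEnd E₀ h (a * b) = evenEnd E₀ h a * b + a * evenEnd E₀ h b := by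
  change evenMatrix E₀ h (a * b) 0 1 = evenMatrix E₀ h a 0 1 * b + a * evenMatrix E₀ h b 0 1
  rw [map_mul, Matrix.mul_apply, Fin.sum_univ_two, (evenMatrix_diag E₀ h a).1,
    (evenMatrix_diag E₀ h b).2.2, add_comm]

theorem evenEnd_isEven (E₀ : G → GradedPoly par) (h : ∀ x, HasParity (par x) (E₀ x)) :
    IsEven (evenEnd E₀ h) where
  leib := evenEnd_leib E₀ h
  comm a := by
    have leib := evenEnd_leib E₀ h
    have h1 : evenEnd E₀ h 1 = 0 := by simpa using leib 1 1
    induction a using mon_induction with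
    | hm l =>
      induction l with
      | nil => simp [h1]
      | cons y l ih =>
        have hy : parityInv par (E₀ y) = (-1 : ℝ) ^ par y • E₀ y := h y
        rw [mon_cons, map_mul, leib, leib, ih, map_add, map_mul, map_mul, evenEnd_gen,
          parityInv_gen, map_smul, evenEnd_gen, hy]
    | hadd a b ha hb => simp only [map_add, ha, hb]
    | hsmul r a ha => simp only [map_smul, ha]

/-! ### Gradings -/

section Grading

variable {Deg : Type} [AddCommGroup Deg] (deg : G → Deg)

/-- The algebra map that records the degrees. -/
def degHom : GradedPoly par →ₐ[ℝ] AddMonoidAlgebra (GradedPoly par) Deg :=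
  lift (FreeAlgebra.lift ℝ fun x => AddMonoidAlgebra.single (deg x) (gen par x)) <| by
    rintro _ _ ⟨x, y⟩
    simp only [map_mul, map_smul, FreeAlgebra.lift_ι_apply]
    rw [AddMonoidAlgebra.single_mul_single, AddMonoidAlgebra.single_mul_single, gen_comm,
      AddMonoidAlgebra.smul_single, add_comm]

theorem degHom_gen (x : G) :
    degHom deg (gen par x) = AddMonoidAlgebra.single (deg x) (gen par x) := by
  simp [degHom, gen, lift_mk]

/-- The homogeneous elements of degree `r`. -/
def hom (par : G → ℕ) (r : Deg) : Submodule ℝ (GradedPoly par) where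
  carrier := {a | degHom deg a = AddMonoidAlgebra.single r a}
  add_mem' {a b} ha hb := by
    simp only [Set.mem_ofPred_eq] at *
    rw [map_add, ha, hb, AddMonoidAlgebra.single_add]
  zero_mem' := by simp
  smul_mem' c a ha := by
    simp only [Set.mem_ofPred_eq] at *
    rw [map_smul, ha, AddMonoidAlgebra.smul_single]

/-- The component of degree `r`. -/
def proj (r : Deg) : Module.End ℝ (GradedPoly par) where
  toFun a := (degHom deg a).coeff r
  map_add' a b := by simp
  map_smul' c a := by simp

variable {deg}

theorem mem_hom {r : Deg} {a : GradedPoly par} :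
    a ∈ hom deg par r ↔ degHom deg a = AddMonoidAlgebra.single r a := Iff.rfl

theorem gen_mem_hom (x : G) : gen par x ∈ hom deg par (deg x) := degHom_gen deg x

theorem one_mem_hom : (1 : GradedPoly par) ∈ hom deg par (0 : Deg) := by
  rw [mem_hom, map_one]; rfl

theorem mul_mem_hom {r s : Deg} {a b : GradedPoly par} (ha : a ∈ hom deg par r)
    (hb : b ∈ hom deg par s) : a * b ∈ hom deg par (r + s) := by
  rw [mem_hom] at *
  rw [map_mul, ha, hb, AddMonoidAlgebra.single_mul_single]

theorem mon_mem_hom (l : List G) : mon par l ∈ hom deg par (l.map deg).sum := by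
  induction l with
  | nil => exact one_mem_hom
  | cons x l ih => simpa using mul_mem_hom (gen_mem_hom (deg := deg) x) ih

theorem proj_of_mem {r : Deg} {a : GradedPoly par} (ha : a ∈ hom deg par r) :
    proj deg r a = a := by
  change (degHom deg a).coeff r = a
  rw [mem_hom.1 ha]; simp

theorem proj_of_mem_ne {r s : Deg} (h : s ≠ r) {a : GradedPoly par} (ha : a ∈ hom deg par s) :
    proj deg r a = 0 := by
  classical
  change (degHom deg a).coeff r = 0
  rw [mem_hom.1 ha, AddMonoidAlgebra.coeff_single, Finsupp.single_apply, if_neg h]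

theorem iSup_hom : ⨆ r, hom deg par r = ⊤ := by
  rw [eq_top_iff, ← span_mon, Submodule.span_le]
  rintro _ ⟨l, rfl⟩
  exact Submodule.mem_iSup_of_mem _ (mon_mem_hom l)

/-- Induction on the homogeneous components. -/
theorem hom_induction {P : GradedPoly par → Prop} (a : GradedPoly par)
    (h0 : ∀ r, ∀ x ∈ hom deg par r, P x) (hadd : ∀ a b, P a → P b → P (a + b)) : P a := by
  have ha : a ∈ ⨆ r, hom deg par r := by rw [iSup_hom]; trivial
  induction ha using Submodule.iSup_induction' with
  | mem r x hx => exact h0 r x hx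
  | zero => exact h0 0 0 (zero_mem _)
  | add x y _ _ hx hy => exact hadd x y hx hy

theorem proj_mem (r : Deg) (a : GradedPoly par) : proj deg r a ∈ hom deg par r := by
  classical
  induction a using hom_induction (deg := deg) with
  | h0 s x hx =>
    by_cases h : s = r
    · subst h; rwa [proj_of_mem hx]
    · rw [proj_of_mem_ne h hx]; exact zero_mem _
  | hadd a b ha hb => rw [map_add]; exact add_mem ha hb

/-- Elements of degree `r` are combinations of monomials of degree `r`. -/
theorem hom_eq_span (r : Deg) :
    hom deg par r = Submodule.span ℝ {m | ∃ l : List G, (l.map deg).sum = r ∧ m = mon par l} := by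
  refine le_antisymm (fun a ha => ?_) ?_
  · rw [← proj_of_mem ha]
    clear ha
    induction a using mon_induction with
    | hm l =>
      by_cases h : (l.map deg).sum = r
      · rw [proj_of_mem (h ▸ mon_mem_hom l)]
        exact Submodule.subset_span ⟨l, h, rfl⟩
      · rw [proj_of_mem_ne h (mon_mem_hom l)]; exact zero_mem _
    | hadd a b ha hb => rw [map_add]; exact add_mem ha hb
    | hsmul c a ha => rw [map_smul]; exact Submodule.smul_mem _ _ ha
  · rw [Submodule.span_le]
    rintro _ ⟨l, rfl, rfl⟩
    exact mon_mem_hom l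

theorem sum_proj (a : GradedPoly par) : ∃ s : Finset Deg, a = ∑ r ∈ s, proj deg r a := by
  classical
  refine ⟨(degHom deg a).coeff.support, ?_⟩
  have h : ∀ a : GradedPoly par, (degHom deg a).coeff.sum (fun _ x => x) = a := fun a => by
    induction a using hom_induction (deg := deg) with
    | h0 s x hx => rw [mem_hom.1 hx, AddMonoidAlgebra.coeff_single, Finsupp.sum_single_index rfl]
    | hadd a b ha hb =>
      rw [map_add, AddMonoidAlgebra.coeff_add, Finsupp.sum_add_index' (fun _ => rfl)
        (fun _ _ _ => rfl), ha, hb]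
  exact (h a).symm

/-- `T` shifts degrees by `c`. -/
def Shifts (deg : G → Deg) (T : Module.End ℝ (GradedPoly par)) (c : Deg) : Prop :=
  ∀ ⦃r⦄ ⦃a : GradedPoly par⦄, a ∈ hom deg par r → T a ∈ hom deg par (r + c)

/-- Used to cut an equation between inhomogeneous elements down to one degree. -/
theorem Shifts.proj {T : Module.End ℝ (GradedPoly par)} {c : Deg} (h : Shifts deg T c) (r : Deg)
    (a : GradedPoly par) : GradedPoly.proj deg (r + c) (T a) = T (GradedPoly.proj deg r a) := by
  classical
  induction a using hom_induction (deg := deg) with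
  | h0 s x hx =>
    by_cases hs : s = r
    · subst hs; rw [proj_of_mem hx, proj_of_mem (h hx)]
    · rw [proj_of_mem_ne hs hx, map_zero,
        proj_of_mem_ne (fun h' => hs (add_right_cancel h')) (h hx)]
  | hadd a b ha hb => simp only [map_add, ha, hb]

theorem Shifts.comp {T U : Module.End ℝ (GradedPoly par)} {c e : Deg} (hT : Shifts deg T c)
    (hU : Shifts deg U e) : Shifts deg (T * U) (e + c) := fun r a ha => by
  rw [← add_assoc]; exact hT (hU ha)

theorem Shifts.add {T U : Module.End ℝ (GradedPoly par)} {c : Deg} (hT : Shifts deg T c)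
    (hU : Shifts deg U c) : Shifts deg (T + U) c := fun _ _ ha => add_mem (hT ha) (hU ha)

theorem Shifts.sum {ι : Type*} (s : Finset ι) {T : ι → Module.End ℝ (GradedPoly par)} {c : Deg}
    (hT : ∀ i, Shifts deg (T i) c) : Shifts deg (∑ i ∈ s, T i) c := fun r a ha => by
  rw [LinearMap.sum_apply]; exact Submodule.sum_mem _ fun i _ => hT i ha

/-- Odd and even derivations are treated together: `S` is the parity involution for the former and
the identity for the latter. -/
theorem shifts_of_leib {T S : Module.End ℝ (GradedPoly par)} {c : Deg}
    (hS : Shifts deg S 0) (leib : ∀ a b, T (a * b) = T a * b + S a * T b)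
    (h1 : T 1 = 0) (h : ∀ x, T (gen par x) ∈ hom deg par (deg x + c)) : Shifts deg T c := by
  intro r a ha
  rw [hom_eq_span] at ha
  induction ha using Submodule.span_induction with
  | mem x hx =>
    obtain ⟨l, rfl, rfl⟩ := hx
    induction l with
    | nil => rw [mon_nil, h1]; exact zero_mem _
    | cons x l ih =>
      rw [mon_cons, leib, List.map_cons, List.sum_cons]
      refine add_mem ?_ ?_
      · have := mul_mem_hom (h x) (mon_mem_hom (par := par) (deg := deg) l)
        rwa [add_right_comm] at this
      · have := mul_mem_hom (hS (gen_mem_hom x)) ih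
        rwa [add_zero, ← add_assoc] at this
  | zero => rw [map_zero]; exact zero_mem _
  | add x y _ _ hx hy => rw [map_add]; exact add_mem hx hy
  | smul c x _ hx => rw [map_smul]; exact Submodule.smul_mem _ _ hx

theorem shifts_parityInv : Shifts deg (parityInv par).toLinearMap 0 := by
  intro r a ha
  rw [hom_eq_span] at ha
  induction ha using Submodule.span_induction with
  | mem x hx =>
    obtain ⟨l, rfl, rfl⟩ := hx
    have h : ∃ c : ℝ, parityInv par (mon par l) = c • mon par l := by
      induction l with
      | nil => exact ⟨1, by simp⟩
      | cons x l ih =>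
        obtain ⟨c, hc⟩ := ih
        exact ⟨(-1) ^ par x * c, by rw [mon_cons, map_mul, hc, parityInv_gen, smul_mul_smul_comm]⟩
    obtain ⟨c, hc⟩ := h
    rw [AlgHom.toLinearMap_apply, hc, add_zero]
    exact Submodule.smul_mem _ _ (mon_mem_hom l)
  | zero => rw [map_zero]; exact zero_mem _
  | add x y _ _ hx hy => rw [map_add]; exact add_mem hx hy
  | smul c x _ hx => rw [map_smul]; exact Submodule.smul_mem _ _ hx

theorem IsOdd.shifts {T : Module.End ℝ (GradedPoly par)} (hT : IsOdd T) {c : Deg}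
    (h : ∀ x, T (gen par x) ∈ hom deg par (deg x + c)) : Shifts deg T c :=
  shifts_of_leib shifts_parityInv hT.leib hT.map_one h

theorem IsEven.shifts {T : Module.End ℝ (GradedPoly par)} (hT : IsEven T) {c : Deg}
    (h : ∀ x, T (gen par x) ∈ hom deg par (deg x + c)) : Shifts deg T c :=
  shifts_of_leib (S := 1) (fun r a ha => by simpa using ha) hT.leib hT.map_one h

/-- There is nothing in degrees that no monomial has. -/
theorem eq_zero_of_neg (κ : Deg →+ ℤ) (hκ : ∀ x, 0 ≤ κ (deg x)) {r : Deg} (hr : κ r < 0)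
    {a : GradedPoly par} (ha : a ∈ hom deg par r) : a = 0 := by
  rw [hom_eq_span] at ha
  have : {m | ∃ l : List G, (l.map deg).sum = r ∧ m = mon par l} = ∅ := by
    ext m
    simp only [Set.mem_ofPred_eq, Set.mem_empty_iff_false, iff_false, not_exists, not_and]
    rintro l rfl
    rw [map_list_sum, List.map_map] at hr
    have : 0 ≤ (l.map (κ ∘ deg)).sum := List.sum_nonneg (by simp; exact fun x _ => hκ x)
    exact absurd hr (not_lt.2 this)
  simpa [this] using ha

/-- An element of degree `0` for a nonnegative grading is a polynomial in generators of
degree `0`. -/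
theorem hom_le_of_zero (κ : Deg →+ ℤ) (hκ : ∀ x, 0 ≤ κ (deg x)) {r : Deg} (hr : κ r = 0)
    (W : Submodule ℝ (GradedPoly par)) (hW : ∀ l : List G, (∀ x ∈ l, κ (deg x) = 0) →
      (l.map deg).sum = r → mon par l ∈ W) :
    hom deg par r ≤ W := by
  rw [hom_eq_span, Submodule.span_le]
  rintro _ ⟨l, hl, rfl⟩
  refine hW l ?_ hl
  rw [← hl, map_list_sum, List.map_map] at hr
  clear hl
  induction l with
  | nil => simp
  | cons y l ih =>
    have h1 : 0 ≤ (l.map (κ ∘ deg)).sum := List.sum_nonneg (by simp; exact fun x _ => hκ x)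
    have h2 := hκ y
    simp only [List.map_cons, List.sum_cons, Function.comp_apply] at hr
    intro x hx
    rcases List.mem_cons.1 hx with rfl | hx
    · lia
    · exact ih (by lia) x hx

/-- As no generator has negative degree, an element of degree zero is a polynomial in generators of
degree zero, and these are killed by `T`. -/
theorem IsEven.eq_zero_of_degree {T : Module.End ℝ (GradedPoly par)} (hT : IsEven T)
    (κ : Deg →+ ℤ)
    (hκ : ∀ x, 0 ≤ κ (deg x)) (h : ∀ x, κ (deg x) = 0 → T (gen par x) = 0) {r : Deg}
    (hr : κ r = 0) {a : GradedPoly par} (ha : a ∈ hom deg par r) : T a = 0 := by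
  refine hom_le_of_zero κ hκ hr (LinearMap.ker T) (fun l hl hs => ?_) ha
  rw [LinearMap.mem_ker]
  clear hs
  induction l with
  | nil => exact hT.map_one
  | cons x l ih =>
    rw [mon_cons, hT.leib, h x (hl x (by simp)), zero_mul, ih (fun y hy => hl y (by simp [hy])),
      mul_zero, add_zero]

/-- An even derivation that is diagonal on the generators, with eigenvalues additive in the
degree. -/
theorem IsEven.eigen {T : Module.End ℝ (GradedPoly par)} (hT : IsEven T) (ω : Deg →+ ℝ)
    (h : ∀ x, T (gen par x) = ω (deg x) • gen par x) {r : Deg} {a : GradedPoly par}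
    (ha : a ∈ hom deg par r) : T a = ω r • a := by
  rw [hom_eq_span] at ha
  induction ha using Submodule.span_induction with
  | mem x hx =>
    obtain ⟨l, rfl, rfl⟩ := hx
    induction l with
    | nil => simp [hT.map_one]
    | cons x l ih =>
      rw [mon_cons, hT.leib, ih, h, List.map_cons, List.sum_cons, map_add, add_smul,
        smul_mul_assoc, mul_smul_comm]
  | zero => simp
  | add x y _ _ hx hy => rw [map_add, hx, hy, smul_add]
  | smul c x _ hx => rw [map_smul, hx, smul_comm]

end Grading

/-- A multiplicative family of subspaces whose sum contains the generators has the whole algebra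
as its sum. -/
theorem adjoin_le_iSup {Λ : Type*} [AddMonoid Λ] (E : Λ → Submodule ℝ (GradedPoly par))
    (one : 1 ∈ E 0) (mul : ∀ i j, ∀ a ∈ E i, ∀ b ∈ E j, a * b ∈ E (i + j))
    {S : Set (GradedPoly par)} (hS : ∀ x ∈ S, x ∈ ⨆ i, E i) {a : GradedPoly par}
    (ha : a ∈ Algebra.adjoin ℝ S) : a ∈ ⨆ i, E i := by
  have hmul : ∀ a ∈ ⨆ i, E i, ∀ b ∈ ⨆ i, E i, a * b ∈ ⨆ i, E i := by
    intro a ha b hb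
    induction ha using Submodule.iSup_induction' with
    | mem i x hx =>
      induction hb using Submodule.iSup_induction' with
      | mem j y hy => exact Submodule.mem_iSup_of_mem _ (mul i j x hx y hy)
      | zero => simp
      | add y z _ _ hy hz => rw [mul_add]; exact add_mem hy hz
    | zero => simp
    | add y z _ _ hy hz => rw [add_mul]; exact add_mem hy hz
  induction ha using Algebra.adjoin_induction with
  | mem x hx => exact hS x hx
  | algebraMap r =>
    rw [Algebra.algebraMap_eq_smul_one]
    exact Submodule.smul_mem _ _ (Submodule.mem_iSup_of_mem _ one)
  | add x y _ _ hx hy => exact add_mem hx hy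
  | mul x y _ _ hx hy => exact hmul x hx y hy

/-- Reordering the factors of a monomial changes it at most by a sign. -/
theorem mon_perm {l m : List G} (h : l.Perm m) : ∃ c : ℝ, mon par l = c • mon par m := by
  induction h with
  | nil => exact ⟨1, by simp⟩
  | cons x _ ih => obtain ⟨c, hc⟩ := ih; exact ⟨c, by simp [hc]⟩
  | swap x y l =>
    refine ⟨(-1) ^ (par y * par x), ?_⟩
    rw [mon_cons, mon_cons, mon_cons, mon_cons, ← mul_assoc, gen_comm, smul_mul_assoc, mul_assoc]
  | trans _ _ h1 h2 =>
    obtain ⟨c, hc⟩ := h1; obtain ⟨e, he⟩ := h2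
    exact ⟨c * e, by rw [hc, he, smul_smul]⟩

end GradedPoly
end

/-! ### Inverting an operator on a vector by a polynomial in the operator -/

noncomputable section

section PosSpec

open Polynomial

variable {M : Type} [AddCommGroup M] [Module ℝ M]

/-- `a` is killed by a polynomial in `T` that does not vanish at `0`. -/
def PosSpec (T : Module.End ℝ M) (a : M) : Prop := ∃ p : ℝ[X], p.eval 0 ≠ 0 ∧ aeval T p a = 0

theorem aeval_apply_mem {T : Module.End ℝ M} {Y : Submodule ℝ M} (hY : ∀ x ∈ Y, T x ∈ Y)
    (q : ℝ[X]) {a : M} (ha : a ∈ Y) : aeval T q a ∈ Y := by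
  induction q using Polynomial.induction_on' with
  | add p q hp hq => rw [map_add]; exact add_mem hp hq
  | monomial n r =>
    rw [aeval_monomial, Module.End.mul_apply, Module.algebraMap_end_apply]
    refine Y.smul_mem _ ?_
    induction n with
    | zero => simpa
    | succ n ih => rw [pow_succ', Module.End.mul_apply]; exact hY _ ih

theorem aeval_apply_comm {T U : Module.End ℝ M} (h : T * U = U * T) (q : ℝ[X]) (a : M) :
    aeval T q (U a) = U (aeval T q a) := by
  have h1 : Commute (aeval T q) U := by
    induction q using Polynomial.induction_on' with
    | add p q hp hq => rw [map_add]; exact hp.add_left hq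
    | monomial n r =>
      rw [aeval_monomial]
      exact Commute.mul_left (Algebra.commutes r U) (Commute.pow_left h n)
  exact DFunLike.congr_fun h1.eq a

theorem aeval_mul_apply (T : Module.End ℝ M) (p q : ℝ[X]) (a : M) :
    aeval T (p * q) a = aeval T p (aeval T q a) := by rw [map_mul, Module.End.mul_apply]

theorem aeval_apply_congr {T U : Module.End ℝ M} {Y : Submodule ℝ M} (hY : ∀ x ∈ Y, T x ∈ Y)
    (h : ∀ x ∈ Y, T x = U x) (q : ℝ[X]) {a : M} (ha : a ∈ Y) : aeval T q a = aeval U q a := by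
  induction q using Polynomial.induction_on' with
  | add p q hp hq => simp only [map_add, LinearMap.add_apply, hp, hq]
  | monomial n r =>
    simp only [aeval_monomial, Module.End.mul_apply]
    congr 1
    have : (T ^ n) a ∈ Y ∧ (T ^ n) a = (U ^ n) a := by
      induction n with
      | zero => simpa
      | succ n ih =>
        simp only [pow_succ', Module.End.mul_apply]
        exact ⟨hY _ ih.1, by rw [h _ ih.1, ih.2]⟩
    exact this.2

/-- From p = X·p.divX + p(0) one solves p(T)a = 0 for a. That the inverse is a polynomial in `T` is
essential: it preserves every `T`-stable subspace and commutes with whatever commutes with `T`. -/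
theorem PosSpec.exists_inv {T : Module.End ℝ M} {a : M} (h : PosSpec T a) :
    ∃ q : ℝ[X], a = T (aeval T q a) := by
  obtain ⟨p, hp, ha⟩ := h
  refine ⟨C (-(p.eval 0)⁻¹) * p.divX, ?_⟩
  have h1 : aeval T (X * p.divX + C (p.coeff 0)) a = 0 := by rw [X_mul_divX_add]; exact ha
  rw [map_add, LinearMap.add_apply, aeval_mul_apply, aeval_X, aeval_C,
    Module.algebraMap_end_apply, coeff_zero_eq_eval_zero] at h1
  rw [aeval_mul_apply, aeval_C, Module.algebraMap_end_apply, map_smul,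
    eq_neg_of_add_eq_zero_left h1, smul_neg, neg_smul, neg_neg, smul_smul, inv_mul_cancel₀ hp,
    one_smul]

theorem PosSpec.zero (T : Module.End ℝ M) : PosSpec T 0 := ⟨1, by simp, by simp⟩

theorem PosSpec.add {T : Module.End ℝ M} {a b : M} (ha : PosSpec T a) (hb : PosSpec T b) :
    PosSpec T (a + b) := by
  obtain ⟨p, hp, ha⟩ := ha
  obtain ⟨q, hq, hb⟩ := hb
  refine ⟨p * q, by simp [hp, hq], ?_⟩
  rw [map_add, mul_comm p q, aeval_mul_apply, ha, mul_comm q p, aeval_mul_apply, hb]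
  simp

theorem PosSpec.of_eigen {T : Module.End ℝ M} {r : ℝ} (hr : r ≠ 0) {a : M} (h : T a = r • a) :
    PosSpec T a :=
  ⟨X - C r, by simpa, by simp [h]⟩

theorem PosSpec.eq_zero {T : Module.End ℝ M} {a : M} (h : PosSpec T a) (h0 : T a = 0) :
    a = 0 := by
  obtain ⟨q, hq⟩ := h.exists_inv
  rw [hq, ← aeval_apply_comm rfl, h0, map_zero]

/-- A contracting homotopy from an operator with trivial kernel. -/
theorem PosSpec.homotopy {D S : Module.End ℝ M} (hD : D * D = 0) {a : M}
    (h : PosSpec (D * S + S * D) a) :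
    ∃ q : ℝ[X], a = D (S (aeval (D * S + S * D) q a)) +
      S (aeval (D * S + S * D) q (D a)) := by
  obtain ⟨q, hq⟩ := h.exists_inv
  refine ⟨q, ?_⟩
  rw [aeval_apply_comm (U := D)]
  · exact hq
  · rw [add_mul, mul_add, mul_assoc, mul_assoc, hD, ← mul_assoc D D, hD]; simp

end PosSpec

/-! ### Number operators from canonical commutation relations -/

section Heisenberg

open Polynomial

variable {M : Type} [AddCommGroup M] [Module ℝ M] {ι : Type}

/-- All products of `R` of the operators `K μ` vanish on `a`. -/
def Nil (K : ι → Module.End ℝ M) : ℕ → M → Prop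
  | 0, a => a = 0
  | R + 1, a => ∀ μ, Nil K R (K μ a)

theorem Nil.add {K : ι → Module.End ℝ M} {R : ℕ} {a b : M} (ha : Nil K R a) (hb : Nil K R b) :
    Nil K R (a + b) := by
  induction R generalizing a b with
  | zero => change a + b = 0; rw [show a = 0 from ha, show b = 0 from hb, add_zero]
  | succ R ih => intro μ; rw [map_add]; exact ih (ha μ) (hb μ)

theorem Nil.succ {K : ι → Module.End ℝ M} {R : ℕ} {a : M} (ha : Nil K R a) :
    Nil K (R + 1) a := by
  induction R generalizing a with
  | zero => intro μ; rw [show a = 0 from ha, map_zero]; rfl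
  | succ R ih => intro μ; exact ih (ha μ)

theorem Nil.mono {K : ι → Module.End ℝ M} {R R' : ℕ} (h : R ≤ R') {a : M} (ha : Nil K R a) :
    Nil K R' a := by
  induction h with
  | refl => exact ha
  | step _ ih => exact ih.succ

variable {del K : ι → Module.End ℝ M} {N : Module.End ℝ M}

/-- The number operator `∑ ∂_μ K^μ` is diagonalizable with eigenvalues `0, w, 2w, …` on the
elements of weight `w` on which the `K^μ` are nilpotent. -/
theorem Nil.aeval_prod [Fintype ι] [DecidableEq ι]
    (hKK : ∀ μ ν, K μ * K ν = K ν * K μ)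
    (hK : ∀ μ ν, K μ * del ν = del ν * K μ + if μ = ν then N else 0)
    (hKN : ∀ μ, K μ * N = N * K μ) (hdN : ∀ μ, del μ * N = N * del μ) {w : ℝ} {R : ℕ} {a : M}
    (ha : Nil K R a) (hw : N a = w • a) :
    aeval (∑ μ, del μ * K μ) (∏ i ∈ Finset.range R, (X - C (w * i))) a = 0 := by
  set T := ∑ μ, del μ * K μ with hT
  have hTN : T * N = N * T := by
    simp only [hT, Finset.sum_mul, Finset.mul_sum]
    refine Finset.sum_congr rfl fun μ _ => ?_
    rw [mul_assoc, hKN, ← mul_assoc, hdN, mul_assoc]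
  have hKT : ∀ μ, K μ * T = (T + N) * K μ := by
    intro μ
    simp only [hT, Finset.mul_sum, ← mul_assoc, hK, add_mul, Finset.sum_add_distrib, ite_mul,
      zero_mul, Finset.sum_ite_eq, Finset.mem_univ, if_true, Finset.sum_mul]
    congr 1
    exact Finset.sum_congr rfl fun ν _ => by rw [mul_assoc, hKK, ← mul_assoc]
  -- From K T = (T + N) K one gets K (T - w) = T K on weight w, so moving K through a polynomial in
  -- T shifts its argument.
  have key : ∀ (P : ℝ[X]) (μ : ι) (b : M), N b = w • b →
      K μ (aeval T (P.comp (X - C w)) b) = aeval T P (K μ b) := by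
    intro P μ b hb
    induction P using Polynomial.induction_on' with
    | add p q hp hq => simp only [add_comp, map_add, LinearMap.add_apply, hp, hq]
    | monomial n r =>
      rw [monomial_comp, aeval_mul_apply, aeval_monomial, aeval_C, Module.algebraMap_end_apply,
        map_smul, Module.End.mul_apply, Module.algebraMap_end_apply]
      congr 1
      have : N (aeval T ((X - C w) ^ n) b) = w • aeval T ((X - C w) ^ n) b ∧
          K μ (aeval T ((X - C w) ^ n) b) = (T ^ n) (K μ b) := by
        induction n with
        | zero => simp [hb]
        | succ n ih =>
          rw [pow_succ', aeval_mul_apply, pow_succ', Module.End.mul_apply, ← ih.2]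
          set c := aeval T ((X - C w) ^ n) b
          have h1 : N (T c) = w • T c := by
            rw [← Module.End.mul_apply, ← hTN, Module.End.mul_apply, ih.1, map_smul]
          have h2 : N (K μ c) = w • K μ c := by
            rw [← Module.End.mul_apply, ← hKN, Module.End.mul_apply, ih.1, map_smul]
          have h3 : K μ (T c) = T (K μ c) + w • K μ c := by
            rw [← Module.End.mul_apply, hKT, Module.End.mul_apply, LinearMap.add_apply, h2]
          simp only [map_sub, aeval_X, aeval_C, LinearMap.sub_apply, Module.algebraMap_end_apply,
            h1, ih.1, map_smul, h3]
          constructor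
          · rw [smul_sub]
          · abel
      exact this.2
  induction R generalizing a with
  | zero => rw [show a = 0 from ha, map_zero]
  | succ R ih =>
    -- The factor X for the root 0 becomes T = ∑ ∂_μ K^μ. By `key`, K^μ turns the remaining factors
    -- into the product for K^μ a, which needs one factor less.
    rw [Finset.prod_range_succ', mul_comm]
    have h0 : (X - C (w * ((0 : ℕ) : ℝ)) : ℝ[X]) = X := by simp
    have h1 : (∏ k ∈ Finset.range R, (X - C (w * ((k + 1 : ℕ) : ℝ))) : ℝ[X])
        = (∏ k ∈ Finset.range R, (X - C (w * (k : ℝ)))).comp (X - C w) := by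
      rw [prod_comp]
      refine Finset.prod_congr rfl fun k _ => ?_
      simp only [sub_comp, X_comp, C_comp]
      push_cast
      rw [mul_add, mul_one, C_add]; ring
    rw [h0, h1, aeval_mul_apply, aeval_X, hT, LinearMap.sum_apply]
    refine Finset.sum_eq_zero fun μ _ => ?_
    rw [Module.End.mul_apply, ← hT, key _ μ a hw, ih (ha μ), map_zero]
    rw [← Module.End.mul_apply, ← hKN, Module.End.mul_apply, hw, map_smul]

/-- The double sums of e_μ ι_ν ∂_μ K^ν cancel because e and ι anticommute up to a Kronecker symbol;
only diagonal terms survive. Since ∑ e_μ ι_μ measures the form degree p, the right-hand side is the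
number operator plus (n - p) times the weight. -/
theorem lap_eq [Fintype ι] [DecidableEq ι] {e io : ι → Module.End ℝ M}
    (hK : ∀ μ ν, K μ * del ν = del ν * K μ + if μ = ν then N else 0)
    (hio : ∀ μ ν, io μ * e ν = (if μ = ν then 1 else 0) - e ν * io μ)
    (hid : ∀ μ ν, del μ * io ν = io ν * del μ)
    (heK : ∀ μ ν, K μ * e ν = e ν * K μ) :
    (∑ μ, e μ * del μ) * (∑ μ, io μ * K μ) + (∑ μ, io μ * K μ) * (∑ μ, e μ * del μ) =
      ∑ μ, del μ * K μ + (Fintype.card ι : ℝ) • N - (∑ μ, e μ * io μ) * N := by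
  have h1 : (∑ μ, e μ * del μ) * (∑ ν, io ν * K ν) =
      ∑ μ, ∑ ν, e μ * io ν * (del μ * K ν) := by
    rw [Finset.sum_mul_sum]
    refine Finset.sum_congr rfl fun μ _ => Finset.sum_congr rfl fun ν _ => ?_
    rw [mul_assoc, ← mul_assoc (del μ), hid, mul_assoc, mul_assoc]
  have h2 : (∑ ν, io ν * K ν) * (∑ μ, e μ * del μ) =
      ∑ μ, ∑ ν, ((if ν = μ then (del μ * K ν + N) else 0) -
        (e μ * io ν * (del μ * K ν) + if ν = μ then e μ * io ν * N else 0)) := by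
    rw [Finset.sum_mul_sum, Finset.sum_comm]
    refine Finset.sum_congr rfl fun μ _ => Finset.sum_congr rfl fun ν _ => ?_
    rw [mul_assoc, ← mul_assoc (K ν), heK, mul_assoc, hK, ← mul_assoc, hio]
    split_ifs with h
    · noncomm_ring
    · noncomm_ring
  rw [h1, h2, ← Finset.sum_add_distrib, Finset.sum_mul]
  simp only [← Finset.sum_add_distrib]
  have h3 : ∀ μ : ι, (∑ ν, (e μ * io ν * (del μ * K ν) + ((if ν = μ then (del μ * K ν + N) else 0) -
        (e μ * io ν * (del μ * K ν) + if ν = μ then e μ * io ν * N else 0)))) =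
        del μ * K μ + N - e μ * io μ * N := by
    intro μ
    have : ∀ ν, (e μ * io ν * (del μ * K ν) + ((if ν = μ then (del μ * K ν + N) else 0) -
        (e μ * io ν * (del μ * K ν) + if ν = μ then e μ * io ν * N else 0))) =
        if ν = μ then del μ * K ν + N - e μ * io ν * N else 0 := by
      intro ν
      split_ifs <;> abel
    simp only [this, Finset.sum_ite_eq', Finset.mem_univ, if_true]
  simp only [h3, Finset.sum_sub_distrib, Finset.sum_add_distrib, Finset.sum_const,
    Finset.card_univ]
  rw [← Nat.cast_smul_eq_nsmul ℝ]

end Heisenberg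
end

/-! ### The complex of symbols of the linearized Einstein operator -/

noncomputable section

namespace PauliFierz

/-- A symbol of the derivatives, the metric and one half in a ring. -/
structure Symb (n : ℕ) (R : Type) [CommRing R] where
  /-- the derivatives -/
  x : Fin n → R
  /-- the metric -/
  e : Fin n → R
  /-- one half -/
  hf : R
  two : hf + hf = 1
  sq : ∀ α, e α * e α = 1

variable {n : ℕ} {R : Type} [CommRing R]

/-- Symmetric tensors with coefficients in the ring `R`. -/
abbrev STen (n : ℕ) (R : Type) : Type := Sym2 (Fin n) → R

/-- Vectors with coefficients in the ring `R`. -/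
abbrev Vec (n : ℕ) (R : Type) : Type := Fin n → R

/-- The basis element that corresponds to a pair of indices. -/
def eS (R : Type) [CommRing R] (α β : Fin n) : STen n R := Pi.single s(α, β) 1

theorem eS_comm (α β : Fin n) : eS R α β = eS R β α := by rw [eS, Sym2.eq_swap, eS]

/-- An off-diagonal basis element is hit by two ordered pairs of indices, a diagonal one by a single
pair; the factor in front makes the two cases uniform. -/
theorem STen.sum_apply (c : Fin n → Fin n → R) (γ δ : Fin n) :
    (1 + if γ = δ then 1 else 0) * (∑ α, ∑ β, c α β • eS R α β) s(γ, δ) = c γ δ + c δ γ := by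
  have h : ∀ α β : Fin n, (1 + if γ = δ then 1 else 0) * (eS R α β s(γ, δ)) =
      (if α = γ then (if β = δ then (1 : R) else 0) else 0) +
        if α = δ then (if β = γ then 1 else 0) else 0 := by
    intro α β
    simp only [eS, Pi.single_apply, Sym2.eq_iff]
    by_cases h1 : α = γ <;> by_cases h2 : β = δ <;> by_cases h3 : α = δ <;> by_cases h4 : β = γ <;>
      grind
  have h2 : ∀ α β : Fin n, (1 + if γ = δ then 1 else 0) * (c α β * eS R α β s(γ, δ)) =
      (if α = γ then (if β = δ then c α β else 0) else 0) +
        if α = δ then (if β = γ then c α β else 0) else 0 := by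
    intro α β
    rw [mul_left_comm, h]
    simp only [mul_add, mul_ite, mul_one, mul_zero]
  simp only [Finset.sum_apply, Pi.smul_apply, smul_eq_mul, Finset.mul_sum, h2,
    Finset.sum_add_distrib]
  have h3 : ∀ (γ δ : Fin n), ∑ α, ∑ β, (if α = γ then (if β = δ then c α β else 0) else 0) =
      c γ δ := by
    intro γ δ
    rw [Finset.sum_eq_single γ, Finset.sum_eq_single δ] <;> simp +contextual
  rw [h3, h3]

variable (P : Symb n R)

theorem STen.exists_coeff [IsDomain R] [CharZero R] (P : Symb n R) (x : STen n R) :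
    ∃ c : Fin n → Fin n → R,
    (∀ α β, c α β = c β α) ∧ x = ∑ α, ∑ β, c α β • eS R α β := by
  -- The full value on the diagonal, half of it off the diagonal.
  refine ⟨fun α β => (1 + if α = β then 1 else 0) * P.hf * x s(α, β), fun α β => ?_, ?_⟩
  · simp only [eq_comm (a := α) (b := β), Sym2.eq_swap (a := α) (b := β)]
  · funext s
    induction s using Sym2.ind with
    | _ γ δ =>
      have h := STen.sum_apply
        (fun α β => (1 + if α = β then 1 else 0) * P.hf * x s(α, β)) γ δ
      rw [Sym2.eq_swap (a := δ) (b := γ)] at h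
      have hne : (1 + if γ = δ then 1 else 0 : R) ≠ 0 := by
        split_ifs
        · norm_num
        · simp
      refine mul_left_cancel₀ hne ?_
      rw [h]
      simp only [eq_comm (a := δ) (b := γ)]
      calc _ = (1 + if γ = δ then 1 else 0) * (P.hf + P.hf) * x s(γ, δ) := by
            rw [P.two, mul_one]
        _ = _ := by ring

theorem STen.eq_zero_of_sum [IsDomain R] [CharZero R] {c : Fin n → Fin n → R}
    (hc : ∀ α β, c α β = c β α)
    (h : ∑ α, ∑ β, c α β • eS R α β = 0) (γ δ : Fin n) : c γ δ = 0 := by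
  have := STen.sum_apply c γ δ
  rw [h, Pi.zero_apply, mul_zero, hc δ γ, ← two_mul] at this
  simpa using this.symm

theorem STen.hom_ext {W : Type*} [AddCommGroup W] [Module R W] {f g : STen n R →ₗ[R] W}
    (h : ∀ α β, f (eS R α β) = g (eS R α β)) : f = g := by
  refine LinearMap.pi_ext' fun s => LinearMap.ext_ring ?_
  induction s using Sym2.ind with
  | _ α β => exact h α β

/-- The linearized Riemann tensor. -/
def curvV (α β μ ν : Fin n) : STen n R :=
  (-P.hf) • ((P.x α * P.x μ) • eS R β ν + (P.x β * P.x ν) • eS R α μ - (P.x α * P.x ν) • eS R β μ -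
    (P.x β * P.x μ) • eS R α ν)

/-- The linearized Ricci tensor. -/
def ricV (β ν : Fin n) : STen n R := ∑ α, P.e α • curvV P α β α ν

/-- The linearized scalar curvature. -/
def scalV : STen n R := ∑ β, P.e β • ricV P β β

/-- The field equations. -/
def feV (α β : Fin n) : STen n R :=
  ((-2 : R) * P.e α * P.e β) • (ricV P α β - (P.hf * if α = β then P.e α else 0) • scalV P)

theorem ricV_comm (β ν : Fin n) : ricV P β ν = ricV P ν β := by
  unfold ricV
  refine Finset.sum_congr rfl fun α _ => ?_
  rw [curvV, curvV, eS_comm β ν, eS_comm β α, eS_comm α ν, mul_comm (P.x β) (P.x ν),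
    mul_comm (P.x α) (P.x ν), mul_comm (P.x β) (P.x α)]
  congr 2
  abel

theorem feV_comm (α β : Fin n) : feV P α β = feV P β α := by
  unfold feV
  rw [ricV_comm P α β]
  rcases eq_or_ne α β with rfl | hne
  · rfl
  · rw [if_neg hne, if_neg hne.symm, mul_right_comm]

/-- The map `h* ↦ δS₀/δh`. -/
def D1 : STen n R →ₗ[R] STen n R :=
  Fintype.linearCombination R (Sym2.lift ⟨feV P, feV_comm P⟩)

theorem D1_eS (α β : Fin n) : (D1 P) (eS R α β) = feV P α β := by
  simp [D1, eS]

/-- The map `C* ↦ -2 ∂ h*`. -/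
def D2 : Vec n R →ₗ[R] STen n R :=
  Fintype.linearCombination R fun α => (-2 : R) • ∑ β, P.x β • eS R β α

theorem D2_apply (ξ : Vec n R) : (D2 P) ξ = ∑ α, ξ α • ((-2 : R) • ∑ β, P.x β • eS R β α) := rfl

theorem D2_single (α : Fin n) : (D2 P) (Pi.single α 1 : Vec n R) =
    (-2 : R) • ∑ β, P.x β • eS R β α := by
  simp [D2]

/-- The gauge variation `h_{αβ} ↦ ∂_α C_β + ∂_β C_α`. -/
def gamV : STen n R →ₗ[R] Vec n R :=
  Fintype.linearCombination R (Sym2.lift ⟨fun α β =>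
    P.x α • (Pi.single β 1 : Vec n R) + P.x β • Pi.single α 1, fun _ _ => add_comm _ _⟩)

theorem gamV_eS (α β : Fin n) :
    (gamV P) (eS R α β) = P.x α • (Pi.single β 1 : Vec n R) + P.x β • Pi.single α 1 := by
  simp [gamV, eS]

/-- Two of the four terms of the Riemann tensor contract to minus the d'Alembertian of the trace,
the other two to the double divergence. -/
theorem scalV_eq : scalV P = ∑ α, ∑ β, (-(P.e α * P.e β * P.x α * P.x α)) • eS R β β +
    ∑ α, ∑ β, (P.e α * P.e β * P.x α * P.x β) • eS R α β := by
  have h : scalV P = ∑ α, ∑ β, (((-P.hf) * P.e α * P.e β * P.x α * P.x α) • eS R β β +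
      ((-P.hf) * P.e α * P.e β * P.x β * P.x β) • eS R α α +
      (P.hf * P.e α * P.e β * P.x α * P.x β) • eS R α β +
      (P.hf * P.e α * P.e β * P.x α * P.x β) • eS R α β) := by
    rw [scalV, Finset.sum_comm]
    refine Finset.sum_congr rfl fun β _ => ?_
    rw [ricV, Finset.smul_sum]
    refine Finset.sum_congr rfl fun α _ => ?_
    rw [curvV, eS_comm β α]
    module
  rw [h]
  simp only [Finset.sum_add_distrib]
  have h2 : ∑ α : Fin n, ∑ β, ((-P.hf) * P.e α * P.e β * P.x β * P.x β) • eS R α α =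
      ∑ α : Fin n, ∑ β, ((-P.hf) * P.e α * P.e β * P.x α * P.x α) • eS R β β := by
    rw [Finset.sum_comm]
    refine Finset.sum_congr rfl fun β _ => Finset.sum_congr rfl fun α _ => ?_
    congr 1; ring
  rw [h2, add_assoc]
  simp only [← Finset.sum_add_distrib]
  have h12' : (-P.hf) + (-P.hf) = -1 := by linear_combination -P.two
  refine Finset.sum_congr rfl fun α _ => Finset.sum_congr rfl fun β _ => ?_
  rw [← add_smul, ← add_smul]
  congr 2
  · linear_combination (P.e α * P.e β * P.x α * P.x α) * h12'
  · linear_combination (P.e α * P.e β * P.x α * P.x β) * P.two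

/-- This is the contracted linearized Bianchi identity; `h3` is the form ∂^β K_{βν} = ½ ∂_ν K. -/
theorem D1_D2 (ξ : Vec n R) : (D1 P) ((D2 P) ξ) = 0 := by
  suffices h : ((D1 P) ∘ₗ (D2 P) : Vec n R →ₗ[R] STen n R) = 0 from DFunLike.congr_fun h ξ
  refine LinearMap.pi_ext' fun ν => LinearMap.ext_ring ?_
  simp only [LinearMap.comp_apply, LinearMap.single_apply, LinearMap.zero_apply]
  rw [D2_single, map_smul, map_sum]
  simp only [map_smul, D1_eS]
  have h1 : ∑ β, P.x β • feV P β ν = ((-2 : R) * P.e ν) • (∑ β, (P.e β * P.x β) • ricV P β ν -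
      (P.hf * P.x ν) • scalV P) := by
    rw [smul_sub, Finset.smul_sum, smul_smul]
    have h2 : ∀ β : Fin n, P.x β • feV P β ν = ((-2 : R) * P.e ν) • (P.e β * P.x β) • ricV P β ν -
        if β = ν then ((-2 : R) * P.e ν * (P.hf * P.x ν)) • scalV P else 0 := by
      intro β
      rw [feV]
      split_ifs with h
      · subst h
        have := P.sq β
        rw [smul_sub, smul_sub, smul_smul, smul_smul, smul_smul, smul_smul]
        congr 2
        · ring
        · linear_combination ((-2 : R) * P.hf * P.x β * P.e β) * this
      · rw [mul_zero, zero_smul, sub_zero, sub_zero, smul_smul, smul_smul]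
        congr 1; ring
    rw [Finset.sum_congr rfl fun β _ => h2 β, Finset.sum_sub_distrib]
    simp
  have h3 : ∑ β : Fin n, (P.e β * P.x β) • ricV P β ν = (P.hf * P.x ν) • scalV P := by
    have h4 : ∑ β : Fin n, (P.e β * P.x β) • ricV P β ν = ∑ α : Fin n, ∑ β,
        (((-P.hf) * P.e α * P.e β * P.x α * P.x α * P.x β) • eS R β ν +
        ((-P.hf) * P.e α * P.e β * P.x α * P.x α * P.x ν) • eS R β β +
        (P.hf * P.e α * P.e β * P.x α * P.x β * P.x ν) • eS R α β -
        ((-P.hf) * P.e α * P.e β * P.x α * P.x α * P.x β) • eS R β ν) := by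
      have h5 : ∀ β : Fin n, (P.e β * P.x β) • ricV P β ν = ∑ α : Fin n,
        (((-P.hf) * P.e α * P.e β * P.x α * P.x α * P.x β) • eS R β ν +
        ((-P.hf) * P.e α * P.e β * P.x β * P.x β * P.x ν) • eS R α α +
        (P.hf * P.e α * P.e β * P.x α * P.x β * P.x ν) • eS R α β -
        ((-P.hf) * P.e α * P.e β * P.x β * P.x β * P.x α) • eS R α ν) := by
        intro β
        rw [ricV, Finset.smul_sum]
        refine Finset.sum_congr rfl fun α _ => ?_
        rw [curvV, eS_comm β α]
        module
      simp only [h5, Finset.sum_sub_distrib, Finset.sum_add_distrib]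
      congr 1
      · congr 1
        · congr 1
          · rw [Finset.sum_comm]
          · refine Finset.sum_congr rfl fun β _ => Finset.sum_congr rfl fun α _ => ?_
            congr 1; ring
        · rw [Finset.sum_comm]
      · refine Finset.sum_congr rfl fun β _ => Finset.sum_congr rfl fun α _ => ?_
        congr 1; ring
    rw [h4, scalV_eq, smul_add, Finset.smul_sum, Finset.smul_sum]
    simp only [Finset.smul_sum, ← Finset.sum_add_distrib]
    refine Finset.sum_congr rfl fun α _ => Finset.sum_congr rfl fun β _ => ?_
    module
  rw [h1, h3, sub_self, smul_zero, smul_zero]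

/-- Let B be the symbol of the d'Alembertian, b the trace-reversed tensor with raised indices, v its
divergence and S its double divergence. The equation expresses B·b through v and S. Its trace
determines S, after which B·c_{γδ} = x_δ w_γ + x_γ w_δ, where w is v with its index lowered. On the
diagonal the prime x_γ divides B·c_{γγ} but not B, so w is divisible by B. Cancelling B shows that c
is a symmetrized gradient. -/
theorem exact_D1 [IsDomain R] [CharZero R] (hp : ∀ γ, Prime (P.x γ))
    (hP : ∀ γ, ¬ P.x γ ∣ ∑ α, P.e α * P.x α * P.x α) (hn : 3 ≤ n) {x : STen n R}
    (hx : (D1 P) x = 0) : ∃ ξ, x = (D2 P) ξ := by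
  obtain ⟨c, hc, rfl⟩ := STen.exists_coeff P x
  set B : R := ∑ α, P.e α * P.x α * P.x α with hB
  set t : R := ∑ α, P.e α * c α α with ht
  set b : Fin n → Fin n → R := fun α β =>
    P.e α * P.e β * c α β - if α = β then P.hf * t * P.e α else 0 with hb
  have hbs : ∀ α β, b α β = b β α := fun α β => by
    simp only [hb, hc α β]
    rcases eq_or_ne α β with rfl | h
    · rfl
    · rw [if_neg h, if_neg h.symm, mul_comm (P.e α)]
  set v : Fin n → R := fun γ => ∑ ν, b γ ν * P.x ν with hv
  set S : R := ∑ γ, P.x γ * v γ with hS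
  have e1 : (D1 P) (∑ α, ∑ β, c α β • eS R α β) = (-2 : R) • ∑ α, ∑ β, b α β • ricV P α β := by
    have e2 : ∑ α, ∑ β, c α β • feV P α β =
        (-2 : R) • (∑ α, ∑ β, (P.e α * P.e β * c α β) • ricV P α β -
        (P.hf * t) • scalV P) := by
      have e3 : (P.hf * t) • scalV P = ∑ α : Fin n, ∑ β : Fin n,
          (if α = β then (P.hf * P.e α * c α α) • scalV P else 0) := by
        simp only [Finset.sum_ite_eq, Finset.mem_univ, if_true]
        rw [← Finset.sum_smul, ht, Finset.mul_sum]
        congr 1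
        exact Finset.sum_congr rfl fun α _ => by ring
      rw [e3]
      simp only [← Finset.sum_sub_distrib, Finset.smul_sum]
      refine Finset.sum_congr rfl fun α _ => Finset.sum_congr rfl fun β _ => ?_
      rw [feV]
      split_ifs with h
      · subst h
        have := P.sq α
        rw [smul_sub, smul_sub, smul_sub, smul_smul, smul_smul, smul_smul, smul_smul, smul_smul]
        congr 2
        · ring
        · linear_combination ((-2 : R) * P.hf * c α α * P.e α) * this
      · rw [mul_zero, zero_smul, sub_zero, sub_zero, smul_smul, smul_smul]
        congr 1; ring
    simp only [map_sum, map_smul, D1_eS]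
    rw [e2]
    congr 1
    simp only [hb, sub_smul, Finset.sum_sub_distrib, ite_smul, zero_smul, Finset.sum_ite_eq,
      Finset.mem_univ, if_true]
    congr 1
    rw [scalV, Finset.smul_sum]
    exact Finset.sum_congr rfl fun α _ => by rw [smul_smul]
  -- The components of the equation, symmetric in the two indices, so that `STen.eq_zero_of_sum`
  -- makes each of them vanish.
  set Y : Fin n → Fin n → R := fun γ δ => B * b γ δ + (if γ = δ then P.e γ * S else 0) -
    P.e δ * P.x δ * v γ - P.e γ * P.x γ * v δ with hY
  have e4 : (-2 : R) • ∑ α, ∑ β, b α β • ricV P α β = ∑ γ, ∑ δ, Y γ δ • eS R γ δ := by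
    have h22 : ((-2 : R) * (-P.hf) : R) = 1 := by linear_combination P.two
    have e5 : (-2 : R) • ∑ α, ∑ β, b α β • ricV P α β = ∑ β, ∑ ν, ∑ α,
        ((P.e α * P.x α * P.x α * b β ν) • eS R β ν + (P.x β * P.x ν * b β ν * P.e α) • eS R α α -
          (P.e α * P.x α * (b β ν * P.x ν)) • eS R β α -
          (P.e α * P.x α * (b β ν * P.x β)) • eS R α ν) := by
      rw [Finset.smul_sum]
      refine Finset.sum_congr rfl fun β _ => ?_
      rw [Finset.smul_sum]
      refine Finset.sum_congr rfl fun ν _ => ?_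
      rw [ricV, Finset.smul_sum, Finset.smul_sum]
      refine Finset.sum_congr rfl fun α _ => ?_
      rw [curvV, smul_comm (P.e α), smul_comm (b β ν), smul_smul, h22, one_smul]
      module
    rw [e5]
    simp only [hY, sub_smul, add_smul, Finset.sum_sub_distrib, Finset.sum_add_distrib]
    congr 1
    · congr 1
      · congr 1
        · refine Finset.sum_congr rfl fun β _ => Finset.sum_congr rfl fun ν _ => ?_
          rw [← Finset.sum_smul, hB, Finset.sum_mul]
        · have : ∀ β ν : Fin n, ∑ α, (P.x β * P.x ν * b β ν * P.e α) • eS R α α =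
              (P.x β * (b β ν * P.x ν)) • ∑ α, P.e α • eS R α α := by
            intro β ν
            rw [Finset.smul_sum]
            refine Finset.sum_congr rfl fun α _ => ?_
            rw [smul_smul]; congr 1; ring
          simp only [this, ← Finset.sum_smul, ite_smul, zero_smul, Finset.sum_ite_eq,
            Finset.mem_univ, if_true]
          rw [Finset.smul_sum]
          refine Finset.sum_congr rfl fun α _ => ?_
          rw [smul_smul, mul_comm (P.e α), hS]
          congr 2
          exact Finset.sum_congr rfl fun β _ => by rw [hv, Finset.mul_sum]
      · refine Finset.sum_congr rfl fun β _ => ?_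
        rw [Finset.sum_comm]
        refine Finset.sum_congr rfl fun α _ => ?_
        rw [← Finset.sum_smul, hv, Finset.mul_sum]
    · have : ∀ β : Fin n, ∑ ν, ∑ α, (P.e α * P.x α * (b β ν * P.x β)) • eS R α ν =
          ∑ α, ∑ ν, (P.e α * P.x α * (b ν β * P.x β)) • eS R α ν := by
        intro β
        rw [Finset.sum_comm]
        refine Finset.sum_congr rfl fun α _ => Finset.sum_congr rfl fun ν _ => ?_
        rw [hbs]
      simp only [this]
      rw [Finset.sum_comm]
      refine Finset.sum_congr rfl fun α _ => ?_
      rw [Finset.sum_comm]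
      refine Finset.sum_congr rfl fun ν _ => ?_
      rw [← Finset.sum_smul, hv, Finset.mul_sum]
  have hYs : ∀ α β, Y α β = Y β α := fun α β => by
    simp only [hY, hbs α β]
    rcases eq_or_ne α β with rfl | h
    · rfl
    · rw [if_neg h, if_neg h.symm]; ring
  have hY0 : ∀ α β, Y α β = 0 := STen.eq_zero_of_sum hYs (by rw [← e4, ← e1, hx])
  -- The trace of the equation is (n - 2)(S - ½ B t) = 0; this is where n ≠ 2 enters.
  have hSt : S = P.hf * B * t := by
    have tr : ∑ γ, P.e γ * Y γ γ = B * (t - P.hf * t * n) + n * S - 2 * S := by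
      have : ∀ γ, P.e γ * Y γ γ = B * (P.e γ * c γ γ - P.hf * t) + S - 2 * (P.x γ * v γ) := by
        intro γ
        have := P.sq γ
        simp only [hY, hb, if_true]
        linear_combination (B * P.e γ * c γ γ - B * P.hf * t + S - 2 * P.x γ * v γ) * this
      simp only [this, Finset.sum_sub_distrib, Finset.sum_add_distrib, ← Finset.mul_sum]
      rw [← ht, ← hS]
      simp only [Finset.sum_const, Finset.card_univ, Fintype.card_fin, nsmul_eq_mul]
      ring
    simp only [hY0, mul_zero, Finset.sum_const_zero] at tr
    have h3 : ((n : R) - 2) * (S - P.hf * B * t) = 0 := by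
      linear_combination -tr + B * t * P.two
    rcases mul_eq_zero.1 h3 with h | h
    · exfalso
      have h4 : (n : R) = (2 : ℕ) := by linear_combination h
      have := Nat.cast_injective (R := R) h4
      omega
    · linear_combination h
  have hw : ∀ γ δ, B * c γ δ = P.x δ * (P.e γ * v γ) + P.x γ * (P.e δ * v δ) := by
    intro γ δ
    have h1 := hY0 γ δ
    have h2 := P.sq γ
    have h3 := P.sq δ
    simp only [hY, hb, hSt] at h1
    rcases eq_or_ne γ δ with rfl | h
    · simp only [if_true] at h1
      linear_combination h1 - B * c γ γ * h2
    · simp only [if_neg h] at h1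
      linear_combination (P.e γ * P.e δ) * h1 - (B * c γ δ) * h2 * (P.e δ * P.e δ) - (B * c γ δ) * h3
        + (P.x δ * v γ * P.e γ) * h3 + (P.x γ * v δ * P.e δ) * h2
  -- Primality of x_γ moves the divisibility from B·c_{γγ} to c_{γγ}; cancelling x_γ then leaves w_γ
  -- = B ξ_γ.
  have hBX : ∀ γ, ∃ ξ, c γ γ = 2 * P.x γ * ξ ∧ P.e γ * v γ = B * ξ := by
    intro γ
    have h1 := hw γ γ
    have h2 : P.x γ ∣ B * c γ γ := ⟨2 * (P.e γ * v γ), by linear_combination h1⟩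
    rcases (hp γ).dvd_or_dvd h2 with h | h
    · exact absurd h (hP γ)
    · obtain ⟨q, hq⟩ := h
      refine ⟨P.hf * q, by linear_combination hq - P.x γ * q * P.two, ?_⟩
      refine mul_left_cancel₀ (hp γ).ne_zero ?_
      have h22 : (P.hf : R) * 2 = 1 := by linear_combination P.two
      linear_combination (-P.hf) * h1 - P.x γ * (P.e γ * v γ) * h22 + P.hf * B * hq
  choose ξ hξ1 hξ2 using hBX
  have hB0 : B ≠ 0 := by
    intro h0
    refine hP ⟨0, by omega⟩ ?_
    rw [h0]; exact dvd_zero _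
  have hcξ : ∀ γ δ, c γ δ = P.x δ * ξ γ + P.x γ * ξ δ := by
    intro γ δ
    refine mul_left_cancel₀ hB0 ?_
    rw [hw, hξ2, hξ2]; ring
  -- Summing the symmetrized gradient against symmetric basis elements doubles it; the factor -2 in
  -- `D2` then leaves the sign.
  refine ⟨-ξ, ?_⟩
  rw [D2_apply]
  have h5 : ∑ α, ∑ β, c α β • eS R α β = ∑ α, ∑ β, (P.x β * ξ α) • eS R α β +
      ∑ α, ∑ β, (P.x β * ξ α) • eS R α β := by
    have : ∑ α, ∑ β, (P.x α * ξ β) • eS R α β = ∑ α, ∑ β, (P.x β * ξ α) • eS R α β := by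
      rw [Finset.sum_comm]
      exact Finset.sum_congr rfl fun α _ => Finset.sum_congr rfl fun β _ => by rw [eS_comm]
    nth_rewrite 2 [← this]
    simp only [hcξ, add_smul, Finset.sum_add_distrib]
  rw [h5, ← Finset.sum_add_distrib]
  refine Finset.sum_congr rfl fun α _ => ?_
  rw [← Finset.sum_add_distrib, smul_smul, Finset.smul_sum]
  refine Finset.sum_congr rfl fun β _ => ?_
  rw [smul_smul, eS_comm β α, ← add_smul]
  congr 1
  have h2 : (-2 : R) = -2 := by simp
  rw [h2, Pi.neg_apply]; ring

/-- The diagonal components of the image of ξ are multiples of x_α ξ_α, and x_α is not a zero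
divisor. -/
theorem D2_injective [IsDomain R] [CharZero R] (hp : ∀ γ, P.x γ ≠ 0) :
    Function.Injective ((D2 P) : Vec n R →ₗ[R] STen n R) := by
  rw [← LinearMap.ker_eq_bot, LinearMap.ker_eq_bot']
  intro ξ hξ
  have h1 : ∑ α, ∑ β, ((-1 : R) * (P.x β * ξ α + P.x α * ξ β)) • eS R α β = 0 := by
    rw [← hξ, D2_apply]
    have h2 : ∑ α, ∑ β, ((-1 : R) * (P.x α * ξ β)) • eS R α β =
        ∑ α, ∑ β, ((-1 : R) * (P.x β * ξ α)) • eS R α β := by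
      rw [Finset.sum_comm]
      exact Finset.sum_congr rfl fun α _ => Finset.sum_congr rfl fun β _ => by rw [eS_comm]
    simp only [mul_add, add_smul, Finset.sum_add_distrib]
    rw [h2, ← Finset.sum_add_distrib]
    refine Finset.sum_congr rfl fun α _ => ?_
    rw [← Finset.sum_add_distrib, smul_smul, Finset.smul_sum]
    refine Finset.sum_congr rfl fun β _ => ?_
    rw [smul_smul, eS_comm β α, ← add_smul]
    congr 1
    ring
  have h2 := STen.eq_zero_of_sum (fun α β => by ring) h1
  funext α
  have h3 := h2 α α
  have : ((-1 : R) : R) ≠ 0 := by simp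
  have h4 : P.x α * ξ α = 0 := by
    rcases mul_eq_zero.1 h3 with h | h
    · exact absurd h this
    · rw [← two_mul] at h
      simpa using h
  rcases mul_eq_zero.1 h4 with h | h
  · exact absurd h (hp α)
  · exact h

/-- Polynomials in the derivatives. -/
abbrev Poly (n : ℕ) : Type := MvPolynomial (Fin n) ℝ

/-- The derivatives and the Minkowski metric. -/
def symb (n : ℕ) : Symb n (Poly n) where
  x := MvPolynomial.X
  e α := MvPolynomial.C (eta α)
  hf := MvPolynomial.C (1 / 2)
  two := by rw [← map_add]; norm_num
  sq α := by
    rw [← map_mul, eta]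
    split_ifs <;> simp

/-- Evaluating at the unit vector of another coordinate kills x_γ, while the quadratic form takes
the value 1 or -1. -/
theorem symb_not_dvd (hn : 2 ≤ n) (γ : Fin n) :
    ¬ (symb n).x γ ∣ ∑ α, (symb n).e α * (symb n).x α * (symb n).x α := by
  rintro ⟨q, hq⟩
  obtain ⟨δ, hδ⟩ : ∃ δ : Fin n, δ ≠ γ := by
    have : Nontrivial (Fin n) := Fin.nontrivial_iff_two_le.2 hn
    exact exists_ne γ
  have h := congrArg (MvPolynomial.eval fun i => if i = δ then (1 : ℝ) else 0) hq
  simp only [symb] at h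
  rw [map_mul, MvPolynomial.eval_X, if_neg hδ.symm, zero_mul, map_sum] at h
  have h2 : eta δ = 0 := by simpa using h
  unfold eta at h2
  split_ifs at h2 <;> norm_num at h2

theorem symb_exact (hn : 3 ≤ n) {x : STen n (Poly n)} (hx : D1 (symb n) x = 0) :
    ∃ ξ, x = D2 (symb n) ξ :=
  exact_D1 _ (fun _ => MvPolynomial.X_prime) (symb_not_dvd (by omega)) hn hx

theorem symb_injective : Function.Injective (D2 (symb n)) :=
  D2_injective _ fun γ => MvPolynomial.X_ne_zero γ

end PauliFierz
end

noncomputable section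

namespace PauliFierz

open GradedPoly

variable {n N : ℕ}

/-! ### The extended algebra -/

/-- The kinds of fields: the fields `h`, the antifields `h*` and `C*`, the ghosts and a second copy
of the fields and antifields with the opposite parity. -/
inductive Kind : Type
  | h | hs | cs | gh | th | ths | tcs
  deriving DecidableEq

instance : Fintype Kind :=
  ⟨{.h, .hs, .cs, .gh, .th, .ths, .tcs}, fun k => by cases k <;> decide⟩

/-- The indices of the fields of a kind. -/
abbrev Idx (n : ℕ) : Kind → Type
  | .h | .hs | .th | .ths => Sym2 (Fin n)
  | .cs | .gh | .tcs => Fin n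

instance (k : Kind) : Fintype (Idx n k) := by cases k <;> unfold Idx <;> infer_instance

instance (k : Kind) : DecidableEq (Idx n k) := by cases k <;> unfold Idx <;> infer_instance

/-- The generators of the extended algebra. -/
inductive MGen (n N : ℕ) : Type
  /-- the differential `dx^μ` -/
  | dx (μ : Fin n)
  /-- the derivative `∂_I` of a field -/
  | u (k : Kind) (a : Fin N) (i : Idx n k) (I : Fin n →₀ ℕ)

/-- Parity of the fields of a kind. -/
def Kind.par : Kind → ℕ
  | .h | .cs | .ths => 0
  | .hs | .gh | .th | .tcs => 1

/-- Parity of the generators. -/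
def MGen.par : MGen n N → ℕ
  | .dx _ => 1
  | .u k _ _ _ => k.par

/-- The extended algebra. -/
abbrev MAlg (n N : ℕ) : Type := GradedPoly (MGen.par (n := n) (N := N))

/-- Form degree, antighost number, polynomial degree in the fields, ghost number, number of fields
of the second copy and their antighost number. -/
abbrev Deg : Type := ℤ × ℤ × ℤ × ℤ × ℤ × ℤ

namespace Deg

/-- Form degree. -/
def fm : Deg →+ ℤ := AddMonoidHom.fst _ _
/-- Antighost number. -/
def ag : Deg →+ ℤ := (AddMonoidHom.fst _ _).comp (AddMonoidHom.snd _ _)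
/-- Polynomial degree. -/
def ml : Deg →+ ℤ := (AddMonoidHom.fst _ _).comp
    ((AddMonoidHom.snd _ _).comp (AddMonoidHom.snd _ _))
/-- Ghost number. -/
def gn : Deg →+ ℤ := (AddMonoidHom.fst _ _).comp
  ((AddMonoidHom.snd _ _).comp ((AddMonoidHom.snd _ _).comp (AddMonoidHom.snd _ _)))
/-- Number of fields of the second copy. -/
def tl : Deg →+ ℤ := (AddMonoidHom.fst _ _).comp ((AddMonoidHom.snd _ _).comp
  ((AddMonoidHom.snd _ _).comp ((AddMonoidHom.snd _ _).comp (AddMonoidHom.snd _ _))))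
/-- Antighost number of the second copy. -/
def ta : Deg →+ ℤ := (AddMonoidHom.snd _ _).comp ((AddMonoidHom.snd _ _).comp
  ((AddMonoidHom.snd _ _).comp ((AddMonoidHom.snd _ _).comp (AddMonoidHom.snd _ _))))

variable (p k m g e t : ℤ)

@[simp] theorem fm_mk : fm (p, k, m, g, e, t) = p := rfl
@[simp] theorem ag_mk : ag (p, k, m, g, e, t) = k := rfl
@[simp] theorem ml_mk : ml (p, k, m, g, e, t) = m := rfl
@[simp] theorem gn_mk : gn (p, k, m, g, e, t) = g := rfl
@[simp] theorem tl_mk : tl (p, k, m, g, e, t) = e := rfl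
@[simp] theorem ta_mk : ta (p, k, m, g, e, t) = t := rfl

end Deg

/-- The degree of the fields of a kind. -/
def Kind.deg : Kind → Deg
  | .h => (0, 0, 1, 0, 0, 0)
  | .hs => (0, 1, 1, 0, 0, 0)
  | .cs => (0, 2, 1, 0, 0, 0)
  | .gh => (0, 0, 1, 1, 0, 0)
  | .th => (0, 0, 1, 0, 1, 0)
  | .ths => (0, 1, 1, 0, 1, 1)
  | .tcs => (0, 2, 1, 0, 1, 2)

/-- The degree of the generators. -/
def MGen.deg : MGen n N → Deg
  | .dx _ => (1, 0, 0, 0, 0, 0)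
  | .u k _ _ _ => k.deg

/-- The homogeneous elements of the extended algebra. -/
abbrev Hom (n N : ℕ) (r : Deg) : Submodule ℝ (MAlg n N) := hom MGen.deg MGen.par r

/-- The projection on the homogeneous elements. -/
abbrev pr (r : Deg) : Module.End ℝ (MAlg n N) := proj MGen.deg r

/-- The parity of a degree. -/
def Deg.par : Deg →+ ℤ := Deg.fm + Deg.ag + Deg.gn + Deg.tl

theorem MGen.par_eq (x : MGen n N) : (-1 : ℝ) ^ x.par = (-1 : ℝ) ^ (Deg.par x.deg) := by
  cases x with
  | dx μ => norm_num [MGen.par, MGen.deg, Deg.par]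
  | u k a i I => cases k <;> norm_num [MGen.par, MGen.deg, Deg.par, Kind.par, Kind.deg]

theorem parityInv_of_mem {r : Deg} {a : MAlg n N} (ha : a ∈ Hom n N r) :
    parityInv _ a = (-1 : ℝ) ^ (Deg.par r) • a := by
  rw [Hom, hom_eq_span] at ha
  induction ha using Submodule.span_induction with
  | mem x hx =>
    obtain ⟨l, rfl, rfl⟩ := hx
    induction l with
    | nil => simp
    | cons y l ih =>
      rw [mon_cons, map_mul, ih, parityInv_gen, List.map_cons, List.sum_cons, map_add,
        zpow_add₀ (by norm_num), MGen.par_eq, smul_mul_smul_comm]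
  | zero => simp
  | add x y _ _ hx hy => rw [map_add, hx, hy, smul_add]
  | smul c x _ hx => rw [map_smul, hx, smul_comm]

theorem hasParity_of_mem {r : Deg} {a : MAlg n N} (ha : a ∈ Hom n N r) {p : ℕ}
    (hp : (-1 : ℝ) ^ p = (-1 : ℝ) ^ (Deg.par r)) : HasParity p a := by
  rw [HasParity, parityInv_of_mem ha, hp]

/-! ### Jets -/

/-- Differential polynomials that are linear in the fields. -/
abbrev Jet (n : ℕ) : Type := (k : Kind) → Idx n k → Poly n

/-- `dx^μ` -/
def dx (μ : Fin n) : MAlg n N := gen _ (MGen.dx μ)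

/-- The element of the algebra that corresponds to the polynomial `p` in the derivatives, applied to
a field. -/
def U (k : Kind) (a : Fin N) (i : Idx n k) : Poly n →ₗ[ℝ] MAlg n N :=
  (MvPolynomial.basisMonomials (Fin n) ℝ).constr ℝ fun I => gen _ (MGen.u k a i I)

theorem U_monomial (k : Kind) (a : Fin N) (i : Idx n k) (I : Fin n →₀ ℕ) :
    U k a i (MvPolynomial.monomial I 1) = gen _ (MGen.u k a i I) := by
  have := (MvPolynomial.basisMonomials (Fin n) ℝ).constr_basis ℝ
    (fun I => gen MGen.par (MGen.u k a i I)) I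
  rwa [MvPolynomial.coe_basisMonomials] at this

/-- The element of the algebra that corresponds to a jet. -/
def L (a : Fin N) : Jet n →ₗ[ℝ] MAlg n N :=
  ∑ k, ∑ i, U k a i ∘ₗ LinearMap.proj i ∘ₗ LinearMap.proj k

/-- The jet with the single component `p`. -/
def js (k : Kind) (i : Idx n k) : Poly n →ₗ[ℝ] Jet n :=
  LinearMap.single ℝ _ k ∘ₗ LinearMap.single ℝ (fun _ : Idx n k => Poly n) i

theorem L_js (a : Fin N) (k : Kind) (i : Idx n k) (p : Poly n) : L a (js k i p) = U k a i p := by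
  simp only [L, LinearMap.sum_apply, LinearMap.comp_apply, LinearMap.proj_apply, js,
    LinearMap.single_apply]
  rw [Finset.sum_eq_single k, Finset.sum_eq_single i]
  · simp
  · intro j _ hj; simp [Pi.single_eq_of_ne hj]
  · simp
  · intro l _ hl; simp [Pi.single_eq_of_ne hl]
  · simp

theorem Jet.hom_ext {W : Type*} [AddCommGroup W] [Module ℝ W] {f g : Jet n →ₗ[ℝ] W}
    (h : ∀ k i I, f (js k i (MvPolynomial.monomial I 1)) =
      g (js k i (MvPolynomial.monomial I 1))) : f = g := by
  refine LinearMap.pi_ext' fun k => LinearMap.pi_ext' fun i => ?_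
  refine (MvPolynomial.basisMonomials (Fin n) ℝ).ext fun I => ?_
  simpa [js] using h k i I

theorem U_mem (k : Kind) (a : Fin N) (i : Idx n k) (p : Poly n) :
    U k a i p ∈ Hom n N k.deg := by
  induction p using MvPolynomial.induction_on' with
  | monomial I r =>
    have : MvPolynomial.monomial I r = r • MvPolynomial.monomial I (1 : ℝ) := by
      rw [MvPolynomial.smul_monomial, smul_eq_mul, mul_one]
    rw [this, map_smul, U_monomial]
    exact Submodule.smul_mem _ _ (gen_mem_hom (MGen.u k a i I))
  | add p q hp hq => rw [map_add]; exact add_mem hp hq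

theorem L_mem (a : Fin N) {r : Deg} {v : Jet n} (hv : ∀ k, v k ≠ 0 → k.deg = r) :
    L a v ∈ Hom n N r := by
  simp only [L, LinearMap.sum_apply, LinearMap.comp_apply, LinearMap.proj_apply]
  refine Submodule.sum_mem _ fun k _ => Submodule.sum_mem _ fun i _ => ?_
  by_cases h : v k = 0
  · rw [h, Pi.zero_apply, map_zero]; exact zero_mem _
  · rw [← hv k h]; exact U_mem k a i _

/-! ### Derivations -/

/-- The value of a derivation on a generator. -/
def genVal (A : Fin n → MAlg n N) (F : Fin N → Jet n →ₗ[ℝ] MAlg n N) : MGen n N → MAlg n N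
  | .dx μ => A μ
  | .u k a i I => F a (js k i (MvPolynomial.monomial I 1))

open Classical in
/-- The odd derivation with given values. -/
def derO (A : Fin n → MAlg n N) (F : Fin N → Jet n →ₗ[ℝ] MAlg n N) : Module.End ℝ (MAlg n N) :=
  if h : ∀ x, HasParity (MGen.par x + 1) (genVal A F x) then oddEnd _ h else 0

open Classical in
/-- The even derivation with given values. -/
def derE (A : Fin n → MAlg n N) (F : Fin N → Jet n →ₗ[ℝ] MAlg n N) : Module.End ℝ (MAlg n N) :=
  if h : ∀ x, HasParity (MGen.par x) (genVal A F x) then evenEnd _ h else 0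

theorem derO_isOdd (A : Fin n → MAlg n N) (F : Fin N → Jet n →ₗ[ℝ] MAlg n N) :
    IsOdd (derO A F) := by
  unfold derO; split_ifs
  · exact oddEnd_isOdd _ _
  · exact IsOdd.zero

theorem derE_isEven (A : Fin n → MAlg n N) (F : Fin N → Jet n →ₗ[ℝ] MAlg n N) :
    IsEven (derE A F) := by
  unfold derE; split_ifs
  · exact evenEnd_isEven _ _
  · exact IsEven.zero

theorem IsOdd.ext_jet {D D' : Module.End ℝ (MAlg n N)} (hD : IsOdd D) (hD' : IsOdd D')
    (hdx : ∀ μ, D (dx μ) = D' (dx μ)) (hL : ∀ a v, D (L a v) = D' (L a v)) : D = D' := by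
  refine hD.ext hD' fun x => ?_
  cases x with
  | dx μ => exact hdx μ
  | u k a i I => rw [← U_monomial, ← L_js]; exact hL _ _

theorem IsEven.ext_jet {D D' : Module.End ℝ (MAlg n N)} (hD : IsEven D) (hD' : IsEven D')
    (hdx : ∀ μ, D (dx μ) = D' (dx μ)) (hL : ∀ a v, D (L a v) = D' (L a v)) : D = D' := by
  refine hD.ext hD' fun x => ?_
  cases x with
  | dx μ => exact hdx μ
  | u k a i I => rw [← U_monomial, ← L_js]; exact hL _ _

/-- The values of a derivation of degree `c`. -/
structure Valid (A : Fin n → MAlg n N) (F : Fin N → Jet n →ₗ[ℝ] MAlg n N) (c : Deg) : Prop where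
  dx : ∀ μ, A μ ∈ Hom n N ((1, 0, 0, 0, 0, 0) + c)
  jet : ∀ a k i p, F a (js k i p) ∈ Hom n N (k.deg + c)

variable {A : Fin n → MAlg n N} {F : Fin N → Jet n →ₗ[ℝ] MAlg n N} {c : Deg}

theorem Valid.genVal_mem (h : Valid A F c) (x : MGen n N) :
    genVal A F x ∈ Hom n N (x.deg + c) := by
  cases x with
  | dx μ => exact h.dx μ
  | u k a i I => exact h.jet a k i _

theorem Valid.odd (h : Valid A F c) (hc : (-1 : ℝ) ^ (Deg.par c) = -1) (x : MGen n N) :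
    HasParity (MGen.par x + 1) (genVal A F x) :=
  hasParity_of_mem (h.genVal_mem x) <| by
    rw [pow_succ, map_add, zpow_add₀ (by norm_num), hc, MGen.par_eq]

theorem Valid.even (h : Valid A F c) (hc : (-1 : ℝ) ^ (Deg.par c) = 1) (x : MGen n N) :
    HasParity (MGen.par x) (genVal A F x) :=
  hasParity_of_mem (h.genVal_mem x) <| by
    rw [map_add, zpow_add₀ (by norm_num), hc, MGen.par_eq, mul_one]

theorem derO_gen (h : ∀ x, HasParity (MGen.par x + 1) (genVal A F x)) (x : MGen n N) :
    derO A F (gen _ x) = genVal A F x := by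
  rw [derO, dif_pos h, oddEnd_gen]

theorem derE_gen (h : ∀ x, HasParity (MGen.par x) (genVal A F x)) (x : MGen n N) :
    derE A F (gen _ x) = genVal A F x := by
  rw [derE, dif_pos h, evenEnd_gen]

theorem derO_L (h : Valid A F c) (hc : (-1 : ℝ) ^ (Deg.par c) = -1) (a : Fin N) (v : Jet n) :
    derO A F (L a v) = F a v := by
  suffices H : derO A F ∘ₗ L a = F a from DFunLike.congr_fun H v
  refine Jet.hom_ext fun k i I => ?_
  rw [LinearMap.comp_apply, L_js, U_monomial, derO_gen (h.odd hc), genVal]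

theorem derE_L (h : Valid A F c) (hc : (-1 : ℝ) ^ (Deg.par c) = 1) (a : Fin N) (v : Jet n) :
    derE A F (L a v) = F a v := by
  suffices H : derE A F ∘ₗ L a = F a from DFunLike.congr_fun H v
  refine Jet.hom_ext fun k i I => ?_
  rw [LinearMap.comp_apply, L_js, U_monomial, derE_gen (h.even hc), genVal]

theorem derO_dx (h : Valid A F c) (hc : (-1 : ℝ) ^ (Deg.par c) = -1) (μ : Fin n) :
    derO A F (dx μ) = A μ := derO_gen (h.odd hc) (.dx μ)

theorem derE_dx (h : Valid A F c) (hc : (-1 : ℝ) ^ (Deg.par c) = 1) (μ : Fin n) :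
    derE A F (dx μ) = A μ := derE_gen (h.even hc) (.dx μ)

theorem derO_shifts (h : Valid A F c) (hc : (-1 : ℝ) ^ (Deg.par c) = -1) :
    Shifts MGen.deg (derO A F) c := (derO_isOdd A F).shifts fun x => by
  rw [derO_gen (h.odd hc)]; exact h.genVal_mem x

theorem derE_shifts (h : Valid A F c) (hc : (-1 : ℝ) ^ (Deg.par c) = 1) :
    Shifts MGen.deg (derE A F) c := (derE_isEven A F).shifts fun x => by
  rw [derE_gen (h.even hc)]; exact h.genVal_mem x

/-! ### Derivations from linear maps of the jets -/

/-- `T` has degree `c`. -/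
def JShifts (T : Jet n →ₗ[ℝ] Jet n) (c : Deg) : Prop :=
  ∀ k i p l, T (js k i p) l ≠ 0 → l.deg = k.deg + c

/-- The odd derivation that acts on the fields by `T`. -/
def jO (N : ℕ) (T : Jet n →ₗ[ℝ] Jet n) : Module.End ℝ (MAlg n N) := derO 0 fun a => L a ∘ₗ T

/-- The even derivation that acts on the fields by `T`. -/
def jE (N : ℕ) (T : Jet n →ₗ[ℝ] Jet n) : Module.End ℝ (MAlg n N) := derE 0 fun a => L a ∘ₗ T

theorem JShifts.valid {T : Jet n →ₗ[ℝ] Jet n} (h : JShifts T c) :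
    Valid (N := N) 0 (fun a => L a ∘ₗ T) c :=
  ⟨fun _ => zero_mem _, fun a k i p => L_mem a fun l hl => h k i p l hl⟩

/-- The odd derivation is well defined. -/
structure OddJet (T : Jet n →ₗ[ℝ] Jet n) (c : Deg) : Prop where
  shifts : JShifts T c
  odd : Odd (Deg.par c)

/-- The even derivation is well defined. -/
structure EvenJet (T : Jet n →ₗ[ℝ] Jet n) (c : Deg) : Prop where
  shifts : JShifts T c
  even : Even (Deg.par c)

variable {T T' : Jet n →ₗ[ℝ] Jet n} {c' : Deg}

theorem jO_isOdd (T : Jet n →ₗ[ℝ] Jet n) : IsOdd (jO N T) := derO_isOdd _ _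

theorem jE_isEven (T : Jet n →ₗ[ℝ] Jet n) : IsEven (jE N T) := derE_isEven _ _

theorem OddJet.L (h : OddJet T c) (a : Fin N) (v : Jet n) : jO N T (L a v) = PauliFierz.L a (T v) :=
  derO_L h.shifts.valid h.odd.neg_one_zpow a v

theorem EvenJet.L (h : EvenJet T c) (a : Fin N) (v : Jet n) :
    jE N T (L a v) = PauliFierz.L a (T v) :=
  derE_L h.shifts.valid h.even.neg_one_zpow a v

theorem OddJet.dx (h : OddJet T c) (μ : Fin n) : jO N T (dx μ) = 0 :=
  derO_dx h.shifts.valid h.odd.neg_one_zpow μ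

theorem EvenJet.dx (h : EvenJet T c) (μ : Fin n) : jE N T (dx μ) = 0 :=
  derE_dx h.shifts.valid h.even.neg_one_zpow μ

theorem OddJet.shifts_jO (h : OddJet T c) : Shifts MGen.deg (jO N T) c :=
  derO_shifts h.shifts.valid h.odd.neg_one_zpow

theorem EvenJet.shifts_jE (h : EvenJet T c) : Shifts MGen.deg (jE N T) c :=
  derE_shifts h.shifts.valid h.even.neg_one_zpow

theorem jE_comm_jE (h : EvenJet T c) (h' : EvenJet T' c') (hTT : ∀ v, T (T' v) = T' (T v)) :
    jE N T * jE N T' = jE N T' * jE N T := by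
  refine sub_eq_zero.1 (IsEven.ext_jet ((jE_isEven T).comm_even (jE_isEven T')) IsEven.zero ?_ ?_)
  · intro μ; simp [h.dx, h'.dx]
  · intro a v; simp [h.L, h'.L, hTT]

theorem jE_comm_jO (h : EvenJet T c) (h' : OddJet T' c') (hTT : ∀ v, T (T' v) = T' (T v)) :
    jE N T * jO N T' = jO N T' * jE N T := by
  refine sub_eq_zero.1 (IsOdd.ext_jet ((jE_isEven T).comm_odd (jO_isOdd T')) IsOdd.zero ?_ ?_)
  · intro μ; simp [h.dx, h'.dx]
  · intro a v; simp [h.L, h'.L, hTT]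

/-- The map of jets from the fields of kind `k` to those of kind `l`. -/
def el (k l : Kind) (f : (Idx n k → Poly n) →ₗ[ℝ] (Idx n l → Poly n)) : Jet n →ₗ[ℝ] Jet n :=
  LinearMap.single ℝ _ l ∘ₗ f ∘ₗ LinearMap.proj k

theorem el_apply_self (k l : Kind) (f : (Idx n k → Poly n) →ₗ[ℝ] (Idx n l → Poly n)) (v : Jet n) :
    el k l f v l = f (v k) := by simp [el]

theorem el_apply_ne {k l m : Kind} (h : m ≠ l) (f : (Idx n k → Poly n) →ₗ[ℝ] (Idx n l → Poly n))
    (v : Jet n) : el k l f v m = 0 := by simp [el, Pi.single_eq_of_ne h]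

theorem el_shifts {k l : Kind} (f : (Idx n k → Poly n) →ₗ[ℝ] (Idx n l → Poly n)) {c : Deg}
    (h : l.deg = k.deg + c) : JShifts (el k l f) c := by
  intro k' i p l' hl
  by_cases h1 : l' = l
  · subst h1
    rw [el_apply_self] at hl
    by_cases h2 : k' = k
    · subst h2; exact h
    · exact absurd (by simp [js, Pi.single_eq_of_ne (Ne.symm h2)]) hl
  · exact absurd (el_apply_ne h1 f _) hl

theorem JShifts.add (h : JShifts T c) (h' : JShifts T' c) : JShifts (T + T') c := by
  intro k i p l hl
  by_cases h1 : T (js k i p) l = 0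
  · refine h' k i p l fun h2 => hl ?_
    rw [LinearMap.add_apply, Pi.add_apply, h1, h2, add_zero]
  · exact h k i p l h1

theorem JShifts.neg (h : JShifts T c) : JShifts (-T) c := by
  intro k i p l hl
  exact h k i p l fun h2 => hl (by simp [h2])

/-- A map that acts on each kind of field separately. -/
theorem JShifts.diag (hT : ∀ v k, v k = 0 → T v k = 0) : JShifts T 0 := by
  intro k i p l hl
  rw [add_zero]
  by_contra h
  refine hl (hT _ _ ?_)
  have hk : l ≠ k := fun h' => h (by rw [h'])
  simp [js, Pi.single_eq_of_ne hk]

end PauliFierz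
end

noncomputable section

namespace PauliFierz

open GradedPoly

variable {n N : ℕ}

/-! ### The horizontal differential and its homotopies -/

/-- Multiplication of the jets by a polynomial. -/
def mulP (p : Poly n) : Jet n →ₗ[ℝ] Jet n where
  toFun v := p • v
  map_add' := smul_add _
  map_smul' _ := smul_comm _ _

@[simp] theorem mulP_apply (p : Poly n) (v : Jet n) : mulP p v = p • v := rfl

/-- The weight of the fields of kind `k`. -/
def wt (κ : Deg →+ ℤ) (k : Kind) : ℝ := κ k.deg

/-- Formal derivatives of the jets with respect to the derivatives. -/
def wpd (κ : Deg →+ ℤ) (μ : Fin n) : Jet n →ₗ[ℝ] Jet n where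
  toFun v k i := wt κ k • MvPolynomial.pderiv μ (v k i)
  map_add' v w := by ext1 k; ext1 i; simp
  map_smul' r v := by ext1 k; ext1 i; simp [smul_comm r]

/-- Multiplication of the jets by the weights. -/
def wn (κ : Deg →+ ℤ) : Jet n →ₗ[ℝ] Jet n where
  toFun v k i := wt κ k • v k i
  map_add' v w := by ext1 k; ext1 i; simp
  map_smul' r v := by ext1 k; ext1 i; simp [smul_comm r]

theorem mulP_even (p : Poly n) : EvenJet (mulP p) 0 :=
  ⟨JShifts.diag fun v k h => by simp [h], by simp⟩

theorem wpd_even (κ : Deg →+ ℤ) (μ : Fin n) : EvenJet (wpd κ μ) 0 :=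
  ⟨JShifts.diag fun v k h => by ext1 i; simp [wpd, h], by simp⟩

theorem wn_even (κ : Deg →+ ℤ) : EvenJet (wn (n := n) κ) 0 :=
  ⟨JShifts.diag fun v k h => by ext1 i; simp [wn, h], by simp⟩

/-- The total derivative. -/
def del (N : ℕ) (μ : Fin n) : Module.End ℝ (MAlg n N) := jE N (mulP (MvPolynomial.X μ))

/-- The weighted derivation conjugate to the total derivative. -/
def Kop (N : ℕ) (κ : Deg →+ ℤ) (μ : Fin n) : Module.End ℝ (MAlg n N) := jE N (wpd κ μ)

/-- The weight operator. -/
def Nop (n N : ℕ) (κ : Deg →+ ℤ) : Module.End ℝ (MAlg n N) := jE N (wn κ)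

/-- The contraction. -/
def io (N : ℕ) (μ : Fin n) : Module.End ℝ (MAlg n N) :=
  derO (fun ν => if μ = ν then 1 else 0) 0

/-- Multiplication by `dx^μ`. -/
def em (N : ℕ) (μ : Fin n) : Module.End ℝ (MAlg n N) := lmul (dx μ)

/-- The horizontal differential. -/
def dH (n N : ℕ) : Module.End ℝ (MAlg n N) := ∑ μ, em N μ * del N μ

/-- The contracting homotopy of the horizontal differential. -/
def rho (n N : ℕ) (κ : Deg →+ ℤ) : Module.End ℝ (MAlg n N) := ∑ μ, io N μ * Kop N κ μ

/-- The anticommutator of the horizontal differential and its homotopy. -/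
def lap (n N : ℕ) (κ : Deg →+ ℤ) : Module.End ℝ (MAlg n N) :=
  dH n N * rho n N κ + rho n N κ * dH n N

@[simp] theorem del_L (μ : Fin n) (a : Fin N) (v : Jet n) :
    del N μ (L a v) = L a ((MvPolynomial.X μ : Poly n) • v) := (mulP_even _).L a v

@[simp] theorem del_dx (μ ν : Fin n) : del N μ (dx ν) = 0 := (mulP_even _).dx ν

theorem del_isEven (μ : Fin n) : IsEven (del N μ) := jE_isEven _

theorem del_shifts (μ : Fin n) : Shifts MGen.deg (del N μ) 0 := (mulP_even _).shifts_jE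

theorem Kop_shifts (κ : Deg →+ ℤ) (μ : Fin n) : Shifts MGen.deg (Kop N κ μ) 0 :=
  (wpd_even _ _).shifts_jE

theorem dx_mem (μ : Fin n) : (dx μ : MAlg n N) ∈ Hom n N (1, 0, 0, 0, 0, 0) :=
  gen_mem_hom (MGen.dx μ)

theorem dx_parity (μ : Fin n) : HasParity 1 (dx μ : MAlg n N) :=
  hasParity_of_mem (dx_mem μ) (by norm_num [Deg.par])

@[simp] theorem parityInv_dx (μ : Fin n) : parityInv _ (dx μ : MAlg n N) = -dx μ := by
  have : parityInv _ (dx μ : MAlg n N) = _ := dx_parity μ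
  rw [this, pow_one, neg_one_smul]

theorem io_valid (μ : Fin n) : Valid (N := N) (fun ν => if μ = ν then 1 else 0) 0
    (-1, 0, 0, 0, 0, 0) where
  dx ν := by
    split_ifs
    · exact one_mem_hom
    · exact zero_mem _
  jet a k i p := zero_mem _

theorem io_isOdd (μ : Fin n) : IsOdd (io N μ) := derO_isOdd _ _

@[simp] theorem io_dx (μ ν : Fin n) : io N μ (dx ν) = if μ = ν then 1 else 0 :=
  derO_dx (io_valid μ) (by norm_num [Deg.par]) ν

@[simp] theorem io_L (μ : Fin n) (a : Fin N) (v : Jet n) : io N μ (L a v) = 0 :=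
  derO_L (io_valid μ) (by norm_num [Deg.par]) a v

theorem io_shifts (μ : Fin n) : Shifts MGen.deg (io N μ) (-1, 0, 0, 0, 0, 0) :=
  derO_shifts (io_valid μ) (by norm_num [Deg.par])

theorem em_shifts (μ : Fin n) : Shifts MGen.deg (em N μ) (1, 0, 0, 0, 0, 0) := fun r a ha => by
  rw [add_comm]; exact mul_mem_hom (dx_mem μ) ha

theorem em_apply (μ : Fin n) (x : MAlg n N) : em N μ x = dx μ * x := rfl

theorem dH_apply (x : MAlg n N) : dH n N x = ∑ μ, dx μ * del N μ x := by
  simp [dH, em_apply]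

theorem dH_isOdd : IsOdd (dH n N) :=
  IsOdd.sum _ fun μ _ => (del_isEven μ).odd_mul (dx_parity μ)

theorem dH_shifts : Shifts MGen.deg (dH n N) (1, 0, 0, 0, 0, 0) :=
  Shifts.sum _ fun μ => by simpa using (em_shifts μ).comp (del_shifts μ)

theorem rho_shifts (κ : Deg →+ ℤ) : Shifts MGen.deg (rho n N κ) (-1, 0, 0, 0, 0, 0) :=
  Shifts.sum _ fun μ => by simpa using (io_shifts μ).comp (Kop_shifts κ μ)

theorem lap_shifts (κ : Deg →+ ℤ) : Shifts MGen.deg (lap n N κ) 0 :=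
  Shifts.add (dH_shifts.comp (rho_shifts κ)) ((rho_shifts κ).comp dH_shifts)

/-- `D` anticommutes with `d` on `x` if it commutes there with the derivatives. -/
theorem _root_.GradedPoly.IsOdd.dH_anti {D : Module.End ℝ (MAlg n N)} (hD : IsOdd D)
    (hdx : ∀ μ, D (dx μ) = 0)
    {x : MAlg n N} (hx : ∀ μ, D (del N μ x) = del N μ (D x)) : D (dH n N x) = -dH n N (D x) := by
  rw [dH_apply, dH_apply, map_sum, ← Finset.sum_neg_distrib]
  refine Finset.sum_congr rfl fun μ _ => ?_
  rw [hD.leib, hdx, zero_mul, zero_add, hx, parityInv_dx, neg_mul]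

/-- `T` is linear over the derivatives. -/
def PLin (T : Jet n →ₗ[ℝ] Jet n) : Prop := ∀ (p : Poly n) v, T (p • v) = p • T v

variable {T : Jet n →ₗ[ℝ] Jet n} {c : Deg}

theorem OddJet.del_comm (h : OddJet T c) (hT : PLin T) (μ : Fin n) (x : MAlg n N) :
    jO N T (del N μ x) = del N μ (jO N T x) :=
  (DFunLike.congr_fun (jE_comm_jO (N := N) (mulP_even (MvPolynomial.X μ)) h
    fun v => by simp [hT _ v]) x).symm

theorem del_comm (μ ν : Fin n) (x : MAlg n N) : del N μ (del N ν x) = del N ν (del N μ x) :=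
  DFunLike.congr_fun (jE_comm_jE (N := N) (mulP_even (MvPolynomial.X μ))
    (mulP_even (MvPolynomial.X ν)) fun v => by simp [smul_smul, mul_comm]) x

theorem dx_anticomm (μ ν : Fin n) : (dx μ * dx ν : MAlg n N) = -(dx ν * dx μ) := by
  have := gen_comm (par := MGen.par (n := n) (N := N)) (MGen.dx μ) (MGen.dx ν)
  rw [show (-1 : ℝ) ^ _ = -1 from by simp [MGen.par], neg_one_smul] at this
  exact this

theorem dH_dH (x : MAlg n N) : dH n N (dH n N x) = 0 := by
  have h1 : dH n N (dH n N x) = ∑ μ, ∑ ν, dx μ * (dx ν * del N μ (del N ν x)) := by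
    rw [dH_apply]
    refine Finset.sum_congr rfl fun μ _ => ?_
    rw [dH_apply, map_sum, Finset.mul_sum]
    refine Finset.sum_congr rfl fun ν _ => ?_
    rw [(del_isEven μ).leib, del_dx, zero_mul, zero_add]
  have h2 : dH n N (dH n N x) = -dH n N (dH n N x) := by
    nth_rewrite 2 [h1]
    rw [Finset.sum_comm, h1, ← Finset.sum_neg_distrib]
    refine Finset.sum_congr rfl fun μ _ => ?_
    rw [← Finset.sum_neg_distrib]
    refine Finset.sum_congr rfl fun ν _ => ?_
    rw [← mul_assoc, ← mul_assoc, dx_anticomm, neg_mul, del_comm]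
  rw [eq_neg_iff_add_eq_zero, ← two_smul ℝ, smul_eq_zero] at h2
  exact h2.resolve_left (by norm_num)

theorem dH_sq : dH n N * dH n N = 0 := LinearMap.ext dH_dH

theorem Kop_isEven (κ : Deg →+ ℤ) (μ : Fin n) : IsEven (Kop N κ μ) := jE_isEven _

@[simp] theorem Kop_L (κ : Deg →+ ℤ) (μ : Fin n) (a : Fin N) (v : Jet n) :
    Kop N κ μ (L a v) = L a (wpd κ μ v) := (wpd_even _ _).L a v

@[simp] theorem Kop_dx (κ : Deg →+ ℤ) (μ ν : Fin n) : Kop N κ μ (dx ν) = 0 := (wpd_even _ _).dx ν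

@[simp] theorem Nop_L (κ : Deg →+ ℤ) (a : Fin N) (v : Jet n) :
    Nop n N κ (L a v) = L a (wn κ v) := (wn_even _).L a v

@[simp] theorem Nop_dx (κ : Deg →+ ℤ) (ν : Fin n) : Nop n N κ (dx ν) = 0 := (wn_even _).dx ν

theorem wpd_wpd (κ : Deg →+ ℤ) (μ ν : Fin n) (v : Jet n) :
    wpd κ μ (wpd κ ν v) = wpd κ ν (wpd κ μ v) := by
  ext1 k; ext1 i
  simp only [wpd, LinearMap.coe_mk, AddHom.coe_mk, Derivation.map_smul]
  have h : MvPolynomial.pderiv μ (MvPolynomial.pderiv ν (v k i)) =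
      MvPolynomial.pderiv ν (MvPolynomial.pderiv μ (v k i)) := by
    have : ⁅MvPolynomial.pderiv (R := ℝ) μ, MvPolynomial.pderiv (R := ℝ) ν⁆ = 0 :=
      MvPolynomial.derivation_ext fun j => by
        simp only [Derivation.commutator_apply, MvPolynomial.pderiv_X, Derivation.coe_zero,
          Pi.zero_apply]
        rcases eq_or_ne j μ with rfl | h1 <;> rcases eq_or_ne j ν with rfl | h2 <;>
          simp [*]
    have h2 := DFunLike.congr_fun this (v k i)
    rw [Derivation.commutator_apply, Derivation.coe_zero, Pi.zero_apply, sub_eq_zero] at h2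
    exact h2
  rw [h]

theorem Kop_comm (κ : Deg →+ ℤ) (μ ν : Fin n) : Kop N κ μ * Kop N κ ν = Kop N κ ν * Kop N κ μ :=
  jE_comm_jE (wpd_even _ _) (wpd_even _ _) (wpd_wpd κ μ ν)

theorem Kop_Nop (κ : Deg →+ ℤ) (μ : Fin n) : Kop N κ μ * Nop n N κ = Nop n N κ * Kop N κ μ :=
  jE_comm_jE (wpd_even _ _) (wn_even _) fun v => by ext1 k; ext1 i; simp [wpd, wn]

theorem del_Nop (κ : Deg →+ ℤ) (μ : Fin n) : del N μ * Nop n N κ = Nop n N κ * del N μ :=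
  jE_comm_jE (mulP_even _) (wn_even _) fun v => by ext1 k; ext1 i; simp [wn]

theorem Kop_del (κ : Deg →+ ℤ) (μ ν : Fin n) :
    Kop N κ μ * del N ν = del N ν * Kop N κ μ + if μ = ν then Nop n N κ else 0 := by
  have h0 : IsEven (if μ = ν then Nop n N κ else 0) := by
    split_ifs
    · exact jE_isEven _
    · exact IsEven.zero
  rw [← sub_eq_iff_eq_add']
  refine IsEven.ext_jet ((Kop_isEven κ μ).comm_even (del_isEven ν)) h0 ?_ ?_
  · intro ρ; split_ifs <;> simp
  · intro a v
    simp only [LinearMap.sub_apply, Module.End.mul_apply, Kop_L, del_L, ← map_sub]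
    have : wpd κ μ ((MvPolynomial.X ν : Poly n) • v) - (MvPolynomial.X ν : Poly n) • wpd κ μ v =
        if μ = ν then wn κ v else 0 := by
      ext1 k; ext1 i
      rcases eq_or_ne μ ν with rfl | h
      · simp [wpd, wn]
      · simp [wpd, h, MvPolynomial.pderiv_X_of_ne h.symm]
    rw [this]
    split_ifs <;> simp

theorem io_em (μ ν : Fin n) : io N μ * em N ν = (if μ = ν then 1 else 0) - em N ν * io N μ := by
  ext x
  simp only [Module.End.mul_apply, em_apply, (io_isOdd μ).leib, io_dx, LinearMap.sub_apply,
    parityInv_dx, neg_mul]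
  split_ifs <;> simp [sub_eq_add_neg]

theorem del_io (μ ν : Fin n) : del N μ * io N ν = io N ν * del N μ := by
  refine sub_eq_zero.1 (IsOdd.ext_jet ((del_isEven μ).comm_odd (io_isOdd ν)) IsOdd.zero ?_ ?_)
  · intro ρ; simp only [LinearMap.sub_apply, Module.End.mul_apply, io_dx, del_dx, map_zero]
    split_ifs <;> simp [(del_isEven μ).map_one]
  · intro a v; simp

theorem Kop_em (κ : Deg →+ ℤ) (μ ν : Fin n) : Kop N κ μ * em N ν = em N ν * Kop N κ μ := by
  ext x
  simp [em_apply, (Kop_isEven κ μ).leib]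

theorem lap_eq_sum (κ : Deg →+ ℤ) : lap n N κ =
    ∑ μ, del N μ * Kop N κ μ + (n : ℝ) • Nop n N κ - (∑ μ, em N μ * io N μ) * Nop n N κ := by
  have := lap_eq (Kop_del (n := n) (N := N) κ) io_em del_io (Kop_em κ)
  rwa [Fintype.card_fin] at this

/-- The weights of the generators define a degree. -/
theorem Nop_of_mem {κ : Deg →+ ℤ} (hκ : κ (1, 0, 0, 0, 0, 0) = 0) {r : Deg} {x : MAlg n N}
    (hx : x ∈ Hom n N r) : Nop n N κ x = (κ r : ℝ) • x := by
  refine (jE_isEven _).eigen ((Int.castAddHom ℝ).comp κ) (fun y => ?_) hx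
  cases y with
  | dx μ => exact (Nop_dx κ μ).trans (by simp [MGen.deg, hκ])
  | u k a i I =>
    have h : wn κ (js k i (MvPolynomial.monomial I 1)) =
        (κ k.deg : ℝ) • js k i (MvPolynomial.monomial I 1) := by
      ext1 l
      by_cases hl : l = k
      · subst hl; rfl
      · ext1 j; simp [wn, js, Pi.single_eq_of_ne hl]
    rw [← U_monomial, ← L_js]
    change Nop n N κ _ = _
    rw [Nop_L, h, map_smul]; rfl

theorem sum_em_io {r : Deg} {x : MAlg n N} (hx : x ∈ Hom n N r) :
    (∑ μ, em N μ * io N μ) x = (r.1 : ℝ) • x := by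
  refine IsEven.eigen (IsEven.sum _ fun μ _ => (io_isOdd μ).odd_mul (dx_parity μ))
    ((Int.castAddHom ℝ).comp Deg.fm) (fun y => ?_) hx
  cases y with
  | dx μ =>
    change (∑ ν, em N ν * io N ν : Module.End ℝ (MAlg n N)) (dx μ) = _
    simp [em_apply, MGen.deg]
    rfl
  | u k a i I =>
    rw [← U_monomial, ← L_js]
    simp only [LinearMap.sum_apply, Module.End.mul_apply, io_L, map_zero, Finset.sum_const_zero]
    cases k <;> simp [MGen.deg, Kind.deg]

/-- On a homogeneous element the weight and the form degree are scalars, so the anticommutator is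
the number operator plus a constant. -/
theorem lap_of_mem {κ : Deg →+ ℤ} (hκ : κ (1, 0, 0, 0, 0, 0) = 0) {r : Deg} {x : MAlg n N}
    (hx : x ∈ Hom n N r) : lap n N κ x =
      (∑ μ, del N μ * Kop N κ μ + algebraMap ℝ _ ((n - r.1) * κ r)) x := by
  rw [lap_eq_sum, LinearMap.sub_apply, LinearMap.add_apply, LinearMap.add_apply,
    LinearMap.smul_apply, Module.End.mul_apply (∑ μ, em N μ * io N μ), Nop_of_mem hκ hx, map_smul,
    sum_em_io hx, Module.algebraMap_end_apply]
  module

/-- The number of derivatives. -/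
def MGen.ord : MGen n N → ℤ
  | .dx _ => 0
  | .u _ _ _ I => I.degree

theorem Kop_ord (κ : Deg →+ ℤ) (μ : Fin n) : Shifts MGen.ord (Kop N κ μ) (-1) := by
  refine (Kop_isEven κ μ).shifts fun x => ?_
  cases x with
  | dx ν => exact (Kop_dx (N := N) κ μ ν).symm ▸ zero_mem _
  | u k a i I =>
    have h : wpd κ μ (js k i (MvPolynomial.monomial I 1)) =
        (κ k.deg * I μ : ℝ) • js k i (MvPolynomial.monomial (I - Finsupp.single μ 1) 1) := by
      ext1 l
      by_cases hl : l = k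
      · subst hl
        ext1 j
        by_cases hj : j = i
        · subst hj
          simp [wpd, js, MvPolynomial.pderiv_monomial, wt, MvPolynomial.smul_monomial]
        · simp [wpd, js, Pi.single_eq_of_ne hj]
      · ext1 j; simp [wpd, js, Pi.single_eq_of_ne hl]
    rw [← U_monomial, ← L_js, Kop_L, h, map_smul, L_js, U_monomial]
    by_cases hI : I μ = 0
    · simp [hI]
    · refine Submodule.smul_mem _ _ ?_
      have h2 : (MGen.u k a i I : MGen n N).ord + -1 =
          (MGen.u k a i (I - Finsupp.single μ 1) : MGen n N).ord := by
        have : I = (I - Finsupp.single μ 1) + Finsupp.single μ 1 := by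
          rw [tsub_add_cancel_of_le]
          exact Finsupp.single_le_iff.2 (Nat.one_le_iff_ne_zero.2 hI)
        simp only [MGen.ord]
        nth_rewrite 1 [this]
        rw [map_add]; simp
      rw [h2]
      exact gen_mem_hom _

/-- Each K^μ lowers the number of derivatives by one, and this number cannot become negative. -/
theorem Kop_nil (κ : Deg →+ ℤ) (x : MAlg n N) : ∃ R, Nil (Kop N κ) R x := by
  induction x using hom_induction (deg := MGen.ord) with
  | h0 r x hx =>
    refine ⟨(r + 1).toNat, ?_⟩
    generalize hR : (r + 1).toNat = R
    induction R generalizing r x with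
    | zero =>
      refine eq_zero_of_neg (AddMonoidHom.id ℤ) (fun y => ?_) (?_ : r < 0) hx
      · cases y with
        | dx μ => exact le_rfl
        | u k a i I => exact Int.natCast_nonneg _
      · omega
    | succ R ih =>
      intro μ
      exact ih (r + -1) _ (Kop_ord κ μ hx) (by omega)
  | hadd a b ha hb =>
    obtain ⟨R, ha⟩ := ha
    obtain ⟨R', hb⟩ := hb
    exact ⟨max R R', (ha.mono (le_max_left _ _)).add (hb.mono (le_max_right _ _))⟩

/-- The number operator has eigenvalues w·i with i ≥ 0, and the constant added to it is (n - p)·w,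
so no eigenvalue is zero below the top degree in positive weight. -/
theorem lap_posSpec {κ : Deg →+ ℤ} (hκ : κ (1, 0, 0, 0, 0, 0) = 0) {r : Deg} {x : MAlg n N}
    (hx : x ∈ Hom n N r) (hr : 0 < κ r) (hn : r.1 < n) : PosSpec (lap n N κ) x := by
  obtain ⟨R, hR⟩ := Kop_nil κ x
  have h1 := hR.aeval_prod (Kop_comm κ) (Kop_del κ) (Kop_Nop κ) (del_Nop κ)
    (Nop_of_mem hκ hx)
  have hw : (0 : ℝ) < (n - r.1) * κ r := by
    have h3 : (r.1 : ℝ) < n := by exact_mod_cast hn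
    have h4 : (0 : ℝ) < κ r := by exact_mod_cast hr
    exact mul_pos (by linarith) h4
  -- The annihilating polynomial of the number operator, translated by (n - p)·w; its roots are
  -- positive.
  refine ⟨(∏ i ∈ Finset.range R, (Polynomial.X - Polynomial.C ((κ r : ℝ) * i))).comp
    (Polynomial.X - Polynomial.C ((n - r.1) * κ r : ℝ)), ?_, ?_⟩
  · rw [Polynomial.eval_comp, Polynomial.eval_prod, Finset.prod_ne_zero_iff]
    intro i _
    have h4 : (0 : ℝ) < κ r := by exact_mod_cast hr
    have : (0 : ℝ) ≤ κ r * i := by positivity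
    simp only [Polynomial.eval_sub, Polynomial.eval_X, Polynomial.eval_C]
    intro h
    linarith
  · rw [aeval_apply_congr (Y := Hom n N r) (fun y hy => by simpa using lap_shifts κ hy)
      (fun y hy => lap_of_mem hκ hy) _ hx, Polynomial.aeval_comp]
    simpa using h1

end PauliFierz
end

noncomputable section

namespace PauliFierz

open GradedPoly

variable {n N : ℕ}

/-! ### Derivations that act linearly on the jets -/

/-- `D` is the odd derivation that acts on the jets by `T`. -/
structure OActs (D : Module.End ℝ (MAlg n N)) (T : Jet n →ₗ[ℝ] Jet n) : Prop where
  isOdd : IsOdd D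
  dx : ∀ μ, D (dx μ) = 0
  L : ∀ a v, D (L a v) = L a (T v)

/-- `E` is the even derivation that acts on the jets by `T`. -/
structure EActs (E : Module.End ℝ (MAlg n N)) (T : Jet n →ₗ[ℝ] Jet n) : Prop where
  isEven : IsEven E
  dx : ∀ μ, E (dx μ) = 0
  L : ∀ a v, E (L a v) = L a (T v)

variable {D D' E : Module.End ℝ (MAlg n N)} {T T' : Jet n →ₗ[ℝ] Jet n} {c : Deg}

theorem OddJet.acts (h : OddJet T c) : OActs (jO N T) T := ⟨jO_isOdd T, h.dx, h.L⟩

theorem EvenJet.acts (h : EvenJet T c) : EActs (jE N T) T := ⟨jE_isEven T, h.dx, h.L⟩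

theorem OActs.add (h : OActs D T) (h' : OActs D' T') : OActs (D + D') (T + T') :=
  ⟨h.isOdd.add h'.isOdd, fun μ => by simp [h.dx, h'.dx], fun a v => by simp [h.L, h'.L]⟩

theorem OActs.anticomm (h : OActs D T) (h' : OActs D' T') :
    EActs (D * D' + D' * D) (T ∘ₗ T' + T' ∘ₗ T) :=
  ⟨h.isOdd.anticomm h'.isOdd, fun μ => by simp [h.dx, h'.dx], fun a v => by simp [h.L, h'.L]⟩

theorem EActs.eq {E' : Module.End ℝ (MAlg n N)} (h : EActs E T) (h' : EActs E' T') (hT : T = T') :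
    E = E' :=
  IsEven.ext_jet h.isEven h'.isEven (fun μ => by rw [h.dx, h'.dx])
    fun a v => by rw [h.L, h'.L, hT]

theorem EActs.zero : EActs (0 : Module.End ℝ (MAlg n N)) 0 :=
  ⟨IsEven.zero, fun _ => rfl, fun _ _ => (map_zero _).symm⟩

theorem OActs.anti (h : OActs D T) (h' : OActs D' T') (hT : T ∘ₗ T' + T' ∘ₗ T = 0)
    (x : MAlg n N) : D (D' x) = -D' (D x) :=
  eq_neg_of_add_eq_zero_left (DFunLike.congr_fun ((h.anticomm h').eq EActs.zero hT) x)

theorem OActs.sq (h : OActs D T) (hT : T ∘ₗ T = 0) : D * D = 0 := by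
  have : D * D + D * D = 0 := (h.anticomm h).eq EActs.zero (by rw [hT, add_zero])
  rwa [← two_smul ℝ, smul_eq_zero, or_iff_right (by norm_num)] at this

theorem OActs.dH_anti (h : OActs D T) (hT : PLin T) (x : MAlg n N) :
    D (dH n N x) = -dH n N (D x) :=
  h.isOdd.dH_anti h.dx fun μ => by
    have : del N μ * D - D * del N μ = 0 :=
      IsOdd.ext_jet ((del_isEven μ).comm_odd h.isOdd) IsOdd.zero (fun ν => by simp [h.dx])
        fun a v => by simp [h.L, hT _ v]
    exact (sub_eq_zero.1 (DFunLike.congr_fun this x)).symm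

theorem OActs.io_anti (h : OActs D T) (μ : Fin n) (x : MAlg n N) :
    D (io N μ x) = -io N μ (D x) := by
  refine eq_neg_of_add_eq_zero_left (DFunLike.congr_fun (f := D * io N μ + io N μ * D)
    (IsEven.ext_jet (h.isOdd.anticomm (io_isOdd μ)) IsEven.zero (fun ν => ?_) fun a v => ?_) x)
  · simp only [LinearMap.add_apply, Module.End.mul_apply, io_dx, h.dx, map_zero, add_zero]
    split_ifs <;> simp [h.isOdd.map_one]
  · simp [h.L]

/-- `T` does not touch the fields that have a weight. -/
def KLin (κ : Deg →+ ℤ) (T : Jet n →ₗ[ℝ] Jet n) : Prop := ∀ μ v, T (wpd κ μ v) = wpd κ μ (T v)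

theorem OActs.Kop_comm (h : OActs D T) {κ : Deg →+ ℤ} (hT : KLin κ T) (μ : Fin n)
    (x : MAlg n N) : D (Kop N κ μ x) = Kop N κ μ (D x) := by
  have : Kop N κ μ * D - D * Kop N κ μ = 0 :=
    IsOdd.ext_jet ((Kop_isEven κ μ).comm_odd h.isOdd) IsOdd.zero (fun ν => by simp [h.dx])
      fun a v => by simp [h.L, hT _ v]
  exact (sub_eq_zero.1 (DFunLike.congr_fun this x)).symm

theorem OActs.rho_anti (h : OActs D T) {κ : Deg →+ ℤ} (hT : KLin κ T) (x : MAlg n N) :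
    D (rho n N κ x) = -rho n N κ (D x) := by
  simp only [rho, LinearMap.sum_apply, Module.End.mul_apply, map_sum, ← Finset.sum_neg_distrib]
  exact Finset.sum_congr rfl fun μ _ => by rw [h.io_anti, h.Kop_comm hT]

theorem OActs.lap_comm (h : OActs D T) (hT : PLin T) {κ : Deg →+ ℤ} (hK : KLin κ T)
    (x : MAlg n N) : D (lap n N κ x) = lap n N κ (D x) := by
  simp only [lap, LinearMap.add_apply, Module.End.mul_apply, map_add, h.dH_anti hT,
    h.rho_anti hK, map_neg, neg_neg]

theorem el_el {k l m : Kind} (f : (Idx n l → Poly n) →ₗ[ℝ] (Idx n m → Poly n))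
    (g : (Idx n k → Poly n) →ₗ[ℝ] (Idx n l → Poly n)) : el l m f ∘ₗ el k l g = el k m (f ∘ₗ g) :=
  LinearMap.ext fun v => by simp [el]

theorem el_zero (k l : Kind) : el (n := n) k l 0 = 0 := LinearMap.ext fun v => by simp [el]

theorem el_el_ne {k l l' m : Kind} (h : l' ≠ l) (f : (Idx n l → Poly n) →ₗ[ℝ] (Idx n m → Poly n))
    (g : (Idx n k → Poly n) →ₗ[ℝ] (Idx n l' → Poly n)) : el l m f ∘ₗ el k l' g = 0 := by
  refine LinearMap.ext fun v => ?_
  simp [el, Pi.single_eq_of_ne h.symm]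

theorem PLin.add (h : PLin T) (h' : PLin T') : PLin (T + T') := fun p v => by
  simp [h p v, h' p v]

theorem PLin.neg (h : PLin T) : PLin (-T) := fun p v => by simp [h p v]

theorem KLin.add {κ : Deg →+ ℤ} (h : KLin κ T) (h' : KLin κ T') : KLin κ (T + T') := fun p v => by
  simp [h p v, h' p v]

theorem el_pLin {k l : Kind} (f : (Idx n k → Poly n) →ₗ[Poly n] (Idx n l → Poly n)) :
    PLin (el k l (f.restrictScalars ℝ)) := fun p v => by
  simp only [el, LinearMap.comp_apply, LinearMap.proj_apply, Pi.smul_apply, LinearMap.single_apply,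
    LinearMap.restrictScalars_apply, map_smul]
  exact Pi.single_smul (f := fun k => Idx n k → Poly n) l p (f (v k))

theorem el_kLin {κ : Deg →+ ℤ} {k l : Kind} (hk : κ k.deg = 0) (hl : κ l.deg = 0)
    (f : (Idx n k → Poly n) →ₗ[ℝ] (Idx n l → Poly n)) : KLin κ (el k l f) := fun μ v => by
  have h1 : wpd κ μ v k = 0 := by ext1 i; simp [wpd, wt, hk]
  have h2 : wpd κ μ (el k l f v) = 0 := by
    ext1 m
    by_cases hm : m = l
    · subst hm; ext1 i; simp [wpd, wt, hl]
    · ext1 i; simp [wpd, el_apply_ne hm]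
  rw [h2, el, LinearMap.comp_apply, LinearMap.comp_apply, LinearMap.proj_apply, h1, map_zero,
    map_zero]

/-! ### The Koszul-Tate differential -/

/-- The map `D1` over the reals. -/
def rD1 (n : ℕ) : STen n (Poly n) →ₗ[ℝ] STen n (Poly n) := (D1 (symb n)).restrictScalars ℝ

/-- The map `D2` over the reals. -/
def rD2 (n : ℕ) : Vec n (Poly n) →ₗ[ℝ] STen n (Poly n) := (D2 (symb n)).restrictScalars ℝ

theorem rD1_rD2 : rD1 n ∘ₗ rD2 n = 0 := LinearMap.ext fun ξ => D1_D2 (symb n) ξ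

/-- The Koszul-Tate differential of the jets. -/
def tdl (n : ℕ) : Jet n →ₗ[ℝ] Jet n := el .hs .h (rD1 n) + el .cs .hs (rD2 n)

/-- The Koszul-Tate differential of the jets of the second copy. -/
def tdl1 (n : ℕ) : Jet n →ₗ[ℝ] Jet n := -(el .ths .th (rD1 n) + el .tcs .ths (rD2 n))

theorem tdl_odd : OddJet (tdl n) (0, -1, 0, 0, 0, 0) :=
  ⟨(el_shifts _ (by decide)).add (el_shifts _ (by decide)), by decide⟩

theorem tdl1_odd : OddJet (tdl1 n) (0, -1, 0, 0, 0, -1) :=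
  ⟨((el_shifts _ (by decide)).add (el_shifts _ (by decide))).neg, by decide⟩

theorem tdl_pLin : PLin (tdl n) := (el_pLin _).add (el_pLin _)

theorem tdl1_pLin : PLin (tdl1 n) := ((el_pLin _).add (el_pLin _)).neg

/-- Under the two conditions `h`, `h*` and `C*` all have weight zero, so K^μ does not act on the
fields between which the Koszul-Tate differential maps. -/
theorem tdl_kLin {κ : Deg →+ ℤ} (h : κ (0, 1, 0, 0, 0, 0) = 0) (h' : κ (0, 0, 1, 0, 0, 0) = 0) :
    KLin κ (tdl n) := by
  have h0 : κ Kind.h.deg = 0 := h'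
  have h1 : κ Kind.hs.deg = 0 := by
    have : Kind.hs.deg = (0, 1, 0, 0, 0, 0) + (0, 0, 1, 0, 0, 0) := by decide
    rw [this, map_add, h, h', add_zero]
  have h2 : κ Kind.cs.deg = 0 := by
    have : Kind.cs.deg = (0, 1, 0, 0, 0, 0) + Kind.hs.deg := by decide
    rw [this, map_add, h, h1, add_zero]
  exact (el_kLin h1 h0 _).add (el_kLin h2 h1 _)

theorem tdl_tdl : tdl n ∘ₗ tdl n = 0 := by
  simp [tdl, LinearMap.add_comp, LinearMap.comp_add, el_el, el_el_ne, rD1_rD2, el_zero]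

/-- The Koszul-Tate differential. -/
def dl (n N : ℕ) : Module.End ℝ (MAlg n N) := jO N (tdl n)

/-- The Koszul-Tate differential of the second copy. -/
def dl1 (n N : ℕ) : Module.End ℝ (MAlg n N) := jO N (tdl1 n)

theorem dl_acts : OActs (dl n N) (tdl n) := tdl_odd.acts

theorem dl1_acts : OActs (dl1 n N) (tdl1 n) := tdl1_odd.acts

theorem dl_shifts : Shifts MGen.deg (dl n N) (0, -1, 0, 0, 0, 0) := tdl_odd.shifts_jO

theorem dl1_shifts : Shifts MGen.deg (dl1 n N) (0, -1, 0, 0, 0, -1) := tdl1_odd.shifts_jO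

theorem dl_sq : dl n N * dl n N = 0 := dl_acts.sq tdl_tdl

theorem dl_dl (x : MAlg n N) : dl n N (dl n N x) = 0 := DFunLike.congr_fun dl_sq x

theorem dl_dH (x : MAlg n N) : dl n N (dH n N x) = -dH n N (dl n N x) := dl_acts.dH_anti tdl_pLin x

/-! ### Vanishing degrees -/

/-- By the pigeonhole principle a monomial of form degree above n repeats some `dx`, whose square is
zero. -/
theorem eq_zero_of_form {r : Deg} (hr : n < r.1) {x : MAlg n N} (hx : x ∈ Hom n N r) : x = 0 := by
  classical
  rw [Hom, hom_eq_span] at hx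
  induction hx using Submodule.span_induction with
  | mem x hx =>
    obtain ⟨l, rfl, rfl⟩ := hx
    have h1 : ∀ l : List (MGen n N), ((l.map MGen.deg).sum).1 =
        ∑ μ : Fin n, (l.count (.dx μ) : ℤ) := by
      intro l
      induction l with
      | nil => simp
      | cons y l ih =>
        rw [List.map_cons, List.sum_cons, Prod.fst_add, ih]
        cases y with
        | dx ν =>
          simp only [List.count_cons, beq_iff_eq, MGen.dx.injEq]
          push_cast
          rw [Finset.sum_add_distrib]
          simp [MGen.deg, add_comm]
        | u k a i I =>
          have : (MGen.u k a i I : MGen n N).deg.1 = 0 := by cases k <;> rfl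
          simp [this]
    by_cases h : ∃ μ : Fin n, 2 ≤ l.count (.dx μ)
    · obtain ⟨μ, hμ⟩ := h
      have m1 : MGen.dx μ ∈ l := List.count_pos_iff.1 (by omega)
      have m2 : MGen.dx μ ∈ l.erase (.dx μ) := List.count_pos_iff.1 (by
        rw [List.count_erase_self]; omega)
      obtain ⟨c, hc⟩ := mon_perm (par := MGen.par) (List.perm_cons_erase m1)
      obtain ⟨c', hc'⟩ := mon_perm (par := MGen.par) (List.perm_cons_erase m2)
      rw [hc, mon_cons, hc', mon_cons, mul_smul_comm, ← mul_assoc,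
        odd_sq_gen (x := MGen.dx μ) odd_one]
      simp
    · push Not at h
      exfalso
      rw [h1] at hr
      have : ∑ μ : Fin n, (l.count (.dx μ) : ℤ) ≤ ∑ _μ : Fin n, 1 :=
        Finset.sum_le_sum fun μ _ => by have := h μ; omega
      simp at this
      omega
  | zero => rfl
  | add x y _ _ hx hy => rw [hx, hy, add_zero]
  | smul c x _ hx => rw [hx, smul_zero]

/-- Besides the plain degrees this is applied to combinations such as `(2 : ℤ) • Deg.ml - Deg.ag`,
which is nonnegative because every field has antighost number at most 2. -/
theorem eq_zero_of_nonneg (κ : Deg →+ ℤ) (h1 : 0 ≤ κ (1, 0, 0, 0, 0, 0))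
    (h : ∀ k : Kind, 0 ≤ κ k.deg) {r : Deg} (hr : κ r < 0) {x : MAlg n N} (hx : x ∈ Hom n N r) :
    x = 0 :=
  eq_zero_of_neg κ (fun y => by cases y with | dx μ => exact h1 | u k a i I => exact h k) hr hx

/-! ### Acyclicity -/

theorem mul_mem_ker_sub {E : Module.End ℝ (MAlg n N)} (hE : IsEven E) {r s : ℝ} {x y : MAlg n N}
    (hx : E x = r • x) (hy : E y = s • y) : E (x * y) = (r + s) • (x * y) := by
  rw [hE.leib, hx, hy, smul_mul_assoc, mul_smul_comm, add_smul]

/-- The elements of degree `i.1` and eigenvalue `i.2`, if this is large enough. -/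
def diagE (E : Module.End ℝ (MAlg n N)) (κ : Deg →+ ℤ) (C : ℤ) (i : Deg × ℕ) :
    Submodule ℝ (MAlg n N) :=
  if κ i.1 ≤ C * i.2 then Hom n N i.1 ⊓ LinearMap.ker (E - algebraMap ℝ _ i.2) else ⊥

theorem mem_diagE {E : Module.End ℝ (MAlg n N)} {κ : Deg →+ ℤ} {C : ℤ} {i : Deg × ℕ}
    (h : κ i.1 ≤ C * i.2) {x : MAlg n N} (hx : x ∈ Hom n N i.1) (hE : E x = (i.2 : ℝ) • x) :
    x ∈ diagE E κ C i := by
  rw [diagE, if_pos h]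
  refine ⟨hx, LinearMap.mem_ker.2 ?_⟩
  rw [LinearMap.sub_apply, hE, Module.algebraMap_end_apply, sub_self]

theorem diagE_cases {E : Module.End ℝ (MAlg n N)} {κ : Deg →+ ℤ} {C : ℤ} {i : Deg × ℕ}
    {x : MAlg n N} (hx : x ∈ diagE E κ C i) :
    x = 0 ∨ (κ i.1 ≤ C * i.2 ∧ x ∈ Hom n N i.1 ∧ E x = (i.2 : ℝ) • x) := by
  rw [diagE] at hx
  split_ifs at hx with h
  · refine Or.inr ⟨h, hx.1, ?_⟩
    have := LinearMap.mem_ker.1 hx.2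
    rwa [LinearMap.sub_apply, Module.algebraMap_end_apply, sub_eq_zero] at this
  · exact Or.inl hx

/-- An even derivation that acts on the jets by a projector which is the identity on the fields of
positive degree is invertible in positive degree. -/
theorem EActs.posSpec (hE : EActs E T) (hT : T ∘ₗ T = T) (hs : ∀ v k, v k = 0 → T v k = 0)
    (κ : Deg →+ ℤ) (C : ℤ) (hC : 0 ≤ C) (hdx : κ (1, 0, 0, 0, 0, 0) ≤ 0)
    (hk : ∀ k : Kind, κ k.deg ≤ 0 ∨ (κ k.deg ≤ C ∧ ∀ i p, T (js k i p) = js k i p))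
    {r : Deg} (hr : 0 < κ r) {x : MAlg n N} (hx : x ∈ Hom n N r) : PosSpec E x := by
  -- The algebra is spanned by products of eigenvectors. The eigenvalue j counts the factors in the
  -- image of the projector, and κ ≤ C·j for every product, so κ > 0 forces j > 0.
  have htop : ∀ x : MAlg n N, x ∈ ⨆ i, diagE E κ C i := fun x => by
    refine adjoin_le_iSup (diagE E κ C) (mem_diagE (by simp) one_mem_hom ?_) ?_ ?_
      (by rw [adjoin_gen]; trivial : x ∈ Algebra.adjoin ℝ (Set.range (gen MGen.par)))
    · simp [hE.isEven.map_one]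
    · intro i j x hx y hy
      rcases diagE_cases hx with rfl | ⟨h1, h2, h3⟩
      · rw [zero_mul]; exact zero_mem _
      rcases diagE_cases hy with rfl | ⟨h1', h2', h3'⟩
      · rw [mul_zero]; exact zero_mem _
      refine mem_diagE ?_ (mul_mem_hom h2 h2') ?_
      · rw [Prod.fst_add, map_add, Prod.snd_add]; push_cast; linarith
      · rw [mul_mem_ker_sub hE.isEven h3 h3', Prod.snd_add]; push_cast; rfl
    · rintro _ ⟨y, rfl⟩
      cases y with
      | dx μ =>
        refine Submodule.mem_iSup_of_mem ((1, 0, 0, 0, 0, 0), 0)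
          (mem_diagE (by simpa) (dx_mem μ) ?_)
        exact (hE.dx μ).trans (by simp)
      | u k a i I =>
        rw [← U_monomial, ← L_js]
        set v := js k i (MvPolynomial.monomial I (1 : ℝ)) with hv
        have hvk : ∀ l, l ≠ k → v l = 0 := fun l hl => by simp [hv, js, Pi.single_eq_of_ne hl]
        have hm : ∀ w : Jet n, (∀ l, v l = 0 → w l = 0) → PauliFierz.L a w ∈ Hom n N k.deg := fun w hw =>
          L_mem a fun l hl => by
            by_contra h
            exact hl (hw l (hvk l fun h' => h (by rw [h'])))
        have h1 : κ k.deg ≤ C → PauliFierz.L a (T v) ∈ ⨆ i, diagE E κ C i := fun h =>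
          Submodule.mem_iSup_of_mem (k.deg, 1) (mem_diagE (by simpa) (hm _ fun l => hs v l) (by
            rw [hE.L, ← LinearMap.comp_apply T T, hT]; simp))
        rcases hk k with h | ⟨h, h'⟩
        -- A generator is split by the projector into eigenvectors with eigenvalues 1 and 0.
        · rw [← add_sub_cancel (T v) v, map_add]
          refine add_mem (h1 (h.trans hC)) (Submodule.mem_iSup_of_mem (k.deg, 0)
            (mem_diagE (by simpa) (hm _ fun l hl => ?_) ?_))
          · rw [Pi.sub_apply, hs v l hl, hl, sub_zero]
          · rw [hE.L, map_sub, ← LinearMap.comp_apply T T, hT]; simp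
        · have h2 : T v = v := h' i _
          rw [← h2]; exact h1 h
  rw [← proj_of_mem hx]
  clear hx
  have hx := htop x
  induction hx using Submodule.iSup_induction' with
  | mem i x hx =>
    rcases diagE_cases hx with rfl | ⟨h1, h2, h3⟩
    · rw [map_zero]; exact PosSpec.zero _
    by_cases hi : i.1 = r
    · subst hi
      rw [proj_of_mem h2]
      refine PosSpec.of_eigen (r := i.2) ?_ h3
      rintro h
      have : i.2 = 0 := by exact_mod_cast h
      rw [this] at h1
      simp at h1
      omega
    · rw [proj_of_mem_ne hi h2]; exact PosSpec.zero _
  | zero => rw [map_zero]; exact PosSpec.zero _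
  | add x y _ _ hx hy => rw [map_add]; exact hx.add hy

end PauliFierz
end

noncomputable section

namespace PauliFierz

open GradedPoly

variable {n N : ℕ}

/-! ### The contracting homotopy of the Koszul-Tate differential -/

/-- Over ℝ everything splits: take a left inverse `s1` of `rD2` and a section `g` of `rD1` on its
image. Since x - g(D1 x) is in the kernel of `rD1`, it lies in the image of `rD2`, where `rD2 ∘ s1`
is the identity; hence the corrected section (1 - D2 s1) g. These maps are only claimed to be linear
over ℝ, not over the derivatives, so they do not settle the cohomology modulo `d`. -/
theorem exists_homotopy (hn : 3 ≤ n) : ∃ (s0 : STen n (Poly n) →ₗ[ℝ] STen n (Poly n))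
    (s1 : STen n (Poly n) →ₗ[ℝ] Vec n (Poly n)),
    s1 ∘ₗ rD2 n = LinearMap.id ∧ s0 ∘ₗ rD1 n + rD2 n ∘ₗ s1 = LinearMap.id := by
  obtain ⟨s1, h1⟩ := (rD2 n).exists_leftInverse_of_injective
    (LinearMap.ker_eq_bot.2 (symb_injective (n := n)))
  obtain ⟨g', hg'⟩ := (rD1 n).rangeRestrict.exists_rightInverse_of_surjective
    (LinearMap.range_rangeRestrict _)
  obtain ⟨g, hg⟩ := g'.exists_extend
  refine ⟨(LinearMap.id - rD2 n ∘ₗ s1) ∘ₗ g, s1, h1, LinearMap.ext fun x => ?_⟩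
  have h2 : rD1 n (g (rD1 n x)) = rD1 n x := by
    have h3 := DFunLike.congr_fun hg ((rD1 n).rangeRestrict x)
    have h4 := DFunLike.congr_fun hg' ((rD1 n).rangeRestrict x)
    simp only [LinearMap.comp_apply, Submodule.subtype_apply, LinearMap.id_apply] at h3 h4
    have h5 := congrArg Subtype.val h4
    rw [← h3] at h5
    exact h5
  obtain ⟨ξ, hξ⟩ := symb_exact hn (x := x - g (rD1 n x)) (by
    change rD1 n _ = 0
    rw [map_sub, h2, sub_self])
  have hξ' : x - g (rD1 n x) = rD2 n ξ := hξ
  have h6 : x - g (rD1 n x) = rD2 n (s1 (x - g (rD1 n x))) := by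
    rw [hξ', ← LinearMap.comp_apply s1, h1]; rfl
  rw [map_sub, map_sub] at h6
  simp only [LinearMap.add_apply, LinearMap.comp_apply, LinearMap.sub_apply, LinearMap.id_apply]
  rw [sub_eq_iff_eq_add] at h6
  nth_rewrite 4 [h6]
  abel

/-- A homotopy of the jets. -/
def hs0 (hn : 3 ≤ n) : STen n (Poly n) →ₗ[ℝ] STen n (Poly n) := (exists_homotopy hn).choose

/-- A homotopy of the jets. -/
def hs1 (hn : 3 ≤ n) : STen n (Poly n) →ₗ[ℝ] Vec n (Poly n) :=
  (exists_homotopy hn).choose_spec.choose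

theorem hs1_rD2 (hn : 3 ≤ n) : hs1 hn ∘ₗ rD2 n = LinearMap.id :=
  (exists_homotopy hn).choose_spec.choose_spec.1

theorem hs0_rD1 (hn : 3 ≤ n) : hs0 hn ∘ₗ rD1 n + rD2 n ∘ₗ hs1 hn = LinearMap.id :=
  (exists_homotopy hn).choose_spec.choose_spec.2

/-- The homotopy of the Koszul-Tate differential of the jets. -/
def ts (hn : 3 ≤ n) : Jet n →ₗ[ℝ] Jet n := el .h .hs (hs0 hn) + el .hs .cs (hs1 hn)

theorem ts_odd (hn : 3 ≤ n) : OddJet (ts hn) (0, 1, 0, 0, 0, 0) :=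
  ⟨(el_shifts _ (by decide)).add (el_shifts _ (by decide)), by decide⟩

/-- The homotopy of the Koszul-Tate differential. -/
def sO (hn : 3 ≤ n) (N : ℕ) : Module.End ℝ (MAlg n N) := jO N (ts hn)

theorem sO_acts (hn : 3 ≤ n) : OActs (sO hn N) (ts hn) := (ts_odd hn).acts

theorem sO_shifts (hn : 3 ≤ n) : Shifts MGen.deg (sO hn N) (0, 1, 0, 0, 0, 0) :=
  (ts_odd hn).shifts_jO

/-- The projector on the fields and antifields on which the Koszul-Tate differential is
acyclic. -/
theorem tdl_ts (hn : 3 ≤ n) : tdl n ∘ₗ ts hn + ts hn ∘ₗ tdl n =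
    el .h .h (rD1 n ∘ₗ hs0 hn) + el .hs .hs LinearMap.id + el .cs .cs LinearMap.id := by
  rw [← hs0_rD1 hn, ← hs1_rD2 hn]
  have h1 : ∀ (k l : Kind) (f g : (Idx n k → Poly n) →ₗ[ℝ] (Idx n l → Poly n)),
      el k l (f + g) = el k l f + el k l g := fun k l f g => LinearMap.ext fun v => by
    simp [el, Pi.single_add]
  rw [h1]
  simp [tdl, ts, LinearMap.add_comp, LinearMap.comp_add, el_el, el_el_ne]
  abel

theorem el_js {k l : Kind} (f : (Idx n k → Poly n) →ₗ[ℝ] (Idx n l → Poly n)) (i : Idx n k)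
    (p : Poly n) : el k l f (js k i p) = Pi.single l (f (Pi.single i p)) := by
  simp [el, js]

theorem el_js_ne {k k' l : Kind} (h : k' ≠ k) (f : (Idx n k → Poly n) →ₗ[ℝ] (Idx n l → Poly n))
    (i : Idx n k') (p : Poly n) : el k l f (js k' i p) = 0 := by
  simp [el, js, Pi.single_eq_of_ne h.symm]

/-- Only the component on `h` needs an argument: D1 s0 D1 s0 = D1 s0 because s0 D1 differs from the
identity by a map into the kernel of D1. -/
theorem tdl_ts_idem (hn : 3 ≤ n) : (tdl n ∘ₗ ts hn + ts hn ∘ₗ tdl n) ∘ₗ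
    (tdl n ∘ₗ ts hn + ts hn ∘ₗ tdl n) = tdl n ∘ₗ ts hn + ts hn ∘ₗ tdl n := by
  have h : (rD1 n ∘ₗ hs0 hn) ∘ₗ (rD1 n ∘ₗ hs0 hn) = rD1 n ∘ₗ hs0 hn := by
    refine LinearMap.ext fun x => ?_
    have h1 := DFunLike.congr_fun (hs0_rD1 hn) (hs0 hn x)
    have h2 := DFunLike.congr_fun (rD1_rD2 (n := n)) (hs1 hn (hs0 hn x))
    simp only [LinearMap.add_apply, LinearMap.comp_apply, LinearMap.id_apply,
      LinearMap.zero_apply] at h1 h2 ⊢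
    rw [eq_sub_of_add_eq h1, map_sub, h2, sub_zero]
  rw [tdl_ts]
  simp [LinearMap.add_comp, LinearMap.comp_add, el_el, el_el_ne, h]

theorem aeval_mem_hom {T : Module.End ℝ (MAlg n N)} (hT : Shifts MGen.deg T 0)
    (q : Polynomial ℝ) {r : Deg} {x : MAlg n N} (hx : x ∈ Hom n N r) :
    Polynomial.aeval T q x ∈ Hom n N r :=
  aeval_apply_mem (fun y hy => by simpa using hT hy) q hx

/-- The anticommutator of the Koszul-Tate differential and its homotopy. -/
def lapK (hn : 3 ≤ n) (N : ℕ) : Module.End ℝ (MAlg n N) := dl n N * sO hn N + sO hn N * dl n N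

theorem lapK_shifts (hn : 3 ≤ n) : Shifts MGen.deg (lapK hn N) 0 :=
  Shifts.add (dl_shifts.comp (sO_shifts hn)) ((sO_shifts hn).comp dl_shifts)

/-- The degree `Deg.ag - Deg.ta` is the antighost number of the first copy, the only one on which
`dl` acts. It is at most 2 per field, whence the bound passed to `EActs.posSpec`. -/
theorem dl_homotopy (hn : 3 ≤ n) {r : Deg} (hr : 0 < Deg.ag r - Deg.ta r) {x : MAlg n N}
    (hx : x ∈ Hom n N r) : ∃ q : Polynomial ℝ,
      x = dl n N (sO hn N (Polynomial.aeval (lapK hn N) q x)) +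
        sO hn N (Polynomial.aeval (lapK hn N) q (dl n N x)) := by
  refine PosSpec.homotopy dl_sq ?_
  refine (dl_acts.anticomm (sO_acts hn)).posSpec (tdl_ts_idem hn) ?_ (Deg.ag - Deg.ta) 2
    (by norm_num) (by simp) ?_ (by simpa using hr) hx
  · intro v k hv
    rw [tdl_ts]
    by_cases h1 : k = .h
    · subst h1; simp [el, hv]
    by_cases h2 : k = .hs
    · subst h2; simp [el, hv]
    by_cases h3 : k = .cs
    · subst h3; simp [el, hv]
    simp [el, Pi.single_eq_of_ne h1, Pi.single_eq_of_ne h2, Pi.single_eq_of_ne h3]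
  · rw [tdl_ts]
    intro k
    cases k
    case hs => refine Or.inr ⟨by decide, fun i p => ?_⟩; simp [el_js, el_js_ne]; rfl
    case cs => refine Or.inr ⟨by decide, fun i p => ?_⟩; simp [el_js, el_js_ne]; rfl
    all_goals exact Or.inl (by decide)

/-- The Koszul-Tate differential is acyclic in positive antighost number. -/
theorem dl_acyclic (hn : 3 ≤ n) {r : Deg} (hr : 0 < Deg.ag r - Deg.ta r) {x : MAlg n N}
    (hx : x ∈ Hom n N r) (h0 : dl n N x = 0) :
    ∃ y ∈ Hom n N (r + (0, 1, 0, 0, 0, 0)), x = dl n N y := by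
  obtain ⟨q, hq⟩ := dl_homotopy hn hr hx
  rw [h0, map_zero, map_zero, add_zero] at hq
  exact ⟨_, sO_shifts hn (aeval_mem_hom (lapK_shifts hn) q hx), hq⟩

/-! ### The horizontal differential in positive antighost number -/

/-- The horizontal differential is acyclic below the top degree, in positive weight. -/
theorem dH_acyclic {κ : Deg →+ ℤ} (hκ : κ (1, 0, 0, 0, 0, 0) = 0) (Y : Submodule ℝ (MAlg n N))
    (hd : ∀ x ∈ Y, dH n N x ∈ Y) (hρ : ∀ x ∈ Y, rho n N κ x ∈ Y) {r : Deg} {x : MAlg n N}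
    (hx : x ∈ Hom n N r) (hY : x ∈ Y) (hr : 0 < κ r) (hn : r.1 < n) (h0 : dH n N x = 0) :
    ∃ y ∈ Hom n N (r + (-1, 0, 0, 0, 0, 0)), y ∈ Y ∧ x = dH n N y := by
  obtain ⟨q, hq⟩ := PosSpec.homotopy dH_sq (lap_posSpec hκ hx hr hn)
  rw [h0, map_zero, map_zero, add_zero] at hq
  exact ⟨_, rho_shifts κ (aeval_mem_hom (lap_shifts κ) q hx),
    hρ _ (aeval_apply_mem (fun y hy => add_mem (hd _ (hρ _ hy)) (hρ _ (hd _ hy))) q hY), hq⟩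

/-- Modulo exact forms a top form that is `dl`-closed modulo exact forms is `dl`-closed, if it
has a positive weight that `dl` does not see. -/
theorem exists_dl_closed {κ : Deg →+ ℤ} (hκ : κ (1, 0, 0, 0, 0, 0) = 0)
    (hκ' : κ (0, 1, 0, 0, 0, 0) = 0) (hκ'' : κ (0, 0, 1, 0, 0, 0) = 0) {r r' : Deg}
    (hr : r.1 = n) (hr' : r'.1 < n) (hpos : 0 < κ r') {x y : MAlg n N} (hx : x ∈ Hom n N r)
    (hy : y ∈ Hom n N r') (h : dl n N x = dH n N y) :
    ∃ f ∈ Hom n N (r + (-1, 0, 0, 0, 0, 0)), dl n N (x + dH n N f) = 0 := by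
  -- P(lap) annihilates y and P(0) ≠ 0. Both differentials commute with `lap`, so P(lap) x is
  -- `dl`-closed; on top forms `lap` is d ∘ rho, so P(lap) x is P(0)·x up to an exact form.
  obtain ⟨P, hP, hP0⟩ := lap_posSpec hκ hy hpos hr'
  have hcomm : ∀ z, dH n N (lap n N κ z) = lap n N κ (dH n N z) := fun z => by
    simp only [lap, LinearMap.add_apply, Module.End.mul_apply, map_add, dH_dH, map_zero, zero_add,
      add_zero]
  have h1 : dl n N (Polynomial.aeval (lap n N κ) P x) = 0 := by
    rw [← aeval_apply_comm (U := dl n N) (LinearMap.ext fun z => ?_), h,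
      aeval_apply_comm (U := dH n N) (LinearMap.ext fun z => (hcomm z).symm), hP0, map_zero]
    exact (dl_acts.lap_comm tdl_pLin (tdl_kLin hκ' hκ'') z).symm
  have h2 : Polynomial.aeval (lap n N κ) P x =
      dH n N (rho n N κ (Polynomial.aeval (lap n N κ) P.divX x)) + P.eval 0 • x := by
    have h3 : dH n N (Polynomial.aeval (lap n N κ) P.divX x) = 0 := by
      refine eq_zero_of_form ?_ (dH_shifts (aeval_mem_hom (lap_shifts κ) _ hx))
      simp [hr]
    conv_lhs => rw [← Polynomial.X_mul_divX_add P]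
    rw [map_add, LinearMap.add_apply, aeval_mul_apply, Polynomial.aeval_X, Polynomial.aeval_C,
      Module.algebraMap_end_apply, Polynomial.coeff_zero_eq_eval_zero]
    nth_rewrite 1 [lap]
    rw [LinearMap.add_apply, Module.End.mul_apply, Module.End.mul_apply, h3, map_zero, add_zero]
  refine ⟨(P.eval 0)⁻¹ • rho n N κ (Polynomial.aeval (lap n N κ) P.divX x),
    Submodule.smul_mem _ _ (rho_shifts κ (aeval_mem_hom (lap_shifts κ) _ hx)), ?_⟩
  have h4 : x + dH n N ((P.eval 0)⁻¹ • rho n N κ (Polynomial.aeval (lap n N κ) P.divX x)) =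
      (P.eval 0)⁻¹ • Polynomial.aeval (lap n N κ) P x := by
    rw [h2, smul_add, smul_smul, inv_mul_cancel₀ hP, one_smul, map_smul, add_comm]
  rw [h4, map_smul, h1, smul_zero]

/-! ### The cohomology of the Koszul-Tate differential modulo the horizontal differential -/

/-- `Y` contains the homogeneous components of its elements. -/
def PrStable (Y : Submodule ℝ (MAlg n N)) : Prop := ∀ r, ∀ x ∈ Y, pr r x ∈ Y

theorem PrStable.top : PrStable (⊤ : Submodule ℝ (MAlg n N)) := fun _ _ _ => trivial

/-- In `Y`, the cohomology of `dl` modulo `d` vanishes in form degree `n`, antighost number `k`,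
polynomial degree `m` and ghost number `g`. -/
def Van (Y : Submodule ℝ (MAlg n N)) (k m g : ℤ) : Prop :=
  ∀ a ∈ Y, a ∈ Hom n N (n, k, m, g, 0, 0) → ∀ c ∈ Y, dl n N a = dH n N c →
    ∃ b ∈ Y, ∃ e ∈ Y, a = dl n N b + dH n N e

theorem pr_dl (r : Deg) (x : MAlg n N) :
    pr r (dl n N x) = dl n N (pr (r + (0, 1, 0, 0, 0, 0)) x) := by
  rw [← dl_shifts.proj, add_assoc,
    show ((0, 1, 0, 0, 0, 0) + (0, -1, 0, 0, 0, 0) : Deg) = 0 from rfl,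
    add_zero]

theorem pr_dH (r : Deg) (x : MAlg n N) :
    pr r (dH n N x) = dH n N (pr (r + (-1, 0, 0, 0, 0, 0)) x) := by
  rw [← dH_shifts.proj, add_assoc,
    show ((-1, 0, 0, 0, 0, 0) + (1, 0, 0, 0, 0, 0) : Deg) = 0 from rfl,
    add_zero]

/-- Homogeneous solutions. -/
theorem exists_homogeneous {Y : Submodule ℝ (MAlg n N)} (hY : PrStable Y) {r : Deg}
    {a b c : MAlg n N} (ha : a ∈ Hom n N r) (hb : b ∈ Y) (hc : c ∈ Y)
    (h : a = dl n N b + dH n N c) : ∃ b' ∈ Y, ∃ c' ∈ Y,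
      b' ∈ Hom n N (r + (0, 1, 0, 0, 0, 0)) ∧ c' ∈ Hom n N (r + (-1, 0, 0, 0, 0, 0)) ∧
      a = dl n N b' + dH n N c' := by
  refine ⟨_, hY _ b hb, _, hY _ c hc, proj_mem _ b, proj_mem _ c, ?_⟩
  rw [← pr_dl, ← pr_dH, ← map_add, ← h]
  exact (proj_of_mem ha).symm

theorem exists_homogeneous_c {Y : Submodule ℝ (MAlg n N)} (hY : PrStable Y) {r : Deg}
    {a c : MAlg n N} (ha : a ∈ Hom n N r) (hc : c ∈ Y) (h : dl n N a = dH n N c) :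
    ∃ c' ∈ Y, c' ∈ Hom n N (r + (-1, -1, 0, 0, 0, 0)) ∧ dl n N a = dH n N c' := by
  refine ⟨_, hY (r + (-1, -1, 0, 0, 0, 0)) c hc, proj_mem _ c, ?_⟩
  have h1 := pr_dH (r + (0, -1, 0, 0, 0, 0)) c
  rw [← h, add_assoc] at h1
  exact (proj_of_mem (dl_shifts ha)).symm.trans h1

/-- The base case: a positive weight that `dl` does not see. -/
theorem exists_of_weight (hn : 3 ≤ n) {κ : Deg →+ ℤ} (hκ : κ (1, 0, 0, 0, 0, 0) = 0)
    (hκ' : κ (0, 1, 0, 0, 0, 0) = 0) (hκ'' : κ (0, 0, 1, 0, 0, 0) = 0) {r : Deg}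
    (hr : r.1 = n) (hpos : 0 < κ r) (hag : 0 < Deg.ag r - Deg.ta r) {x y : MAlg n N}
    (hx : x ∈ Hom n N r) (h : dl n N x = dH n N y) :
    ∃ b ∈ Hom n N (r + (0, 1, 0, 0, 0, 0)), ∃ e ∈ Hom n N (r + (-1, 0, 0, 0, 0, 0)),
      x = dl n N b + dH n N e := by
  obtain ⟨y', -, hy', h'⟩ := exists_homogeneous_c PrStable.top hx (c := y) trivial h
  have h2 : κ (r + (-1, -1, 0, 0, 0, 0)) = κ r := by
    have : ((-1, -1, 0, 0, 0, 0) : Deg) = -(1, 0, 0, 0, 0, 0) - (0, 1, 0, 0, 0, 0) := rfl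
    rw [this, map_add, map_sub, map_neg, hκ, hκ']; ring
  obtain ⟨f, hf, hf0⟩ := exists_dl_closed hκ hκ' hκ'' hr (by simp [hr]) (by rw [h2]; exact hpos)
    hx hy' h'
  have h3 : x + dH n N f ∈ Hom n N r := by
    refine add_mem hx ?_
    have := dH_shifts hf
    rwa [add_assoc, show ((-1, 0, 0, 0, 0, 0) + (1, 0, 0, 0, 0, 0) : Deg) = 0 from rfl,
      add_zero] at this
  obtain ⟨b, hb, hb'⟩ := dl_acyclic hn hag h3 hf0
  exact ⟨b, hb, -f, neg_mem hf, by rw [← hb', map_neg, add_neg_cancel_right]⟩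

/-- The ghost number serves as the weight that `dl` does not see. -/
theorem Van.of_weight (hn : 3 ≤ n) {k m g : ℤ} (hk : 0 < k) (hg : 0 < g) :
    Van (⊤ : Submodule ℝ (MAlg n N)) k m g := fun a _ ha c _ h => by
  obtain ⟨b, -, e, -, h'⟩ := exists_of_weight hn (κ := Deg.gn) rfl rfl rfl rfl (by simpa)
    (by simpa) ha h
  exact ⟨b, trivial, e, trivial, h'⟩

/-! ### No ghosts -/

/-- The map from the fields and antifields to the second copy. -/
def ttau (n : ℕ) : Jet n →ₗ[ℝ] Jet n :=
  el .h .th LinearMap.id + el .hs .ths LinearMap.id + el .cs .tcs LinearMap.id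

/-- The map from the second copy to the fields and antifields. -/
def tmu (n : ℕ) : Jet n →ₗ[ℝ] Jet n :=
  el .th .h LinearMap.id + el .ths .hs LinearMap.id + el .tcs .cs LinearMap.id

/-- The derivation from the fields and antifields to the second copy. -/
def tauO (n N : ℕ) (t : Fin 3) : Module.End ℝ (MAlg n N) :=
  match t with
  | 0 => jO N (el .h .th LinearMap.id)
  | 1 => jO N (el .hs .ths LinearMap.id)
  | 2 => jO N (el .cs .tcs LinearMap.id)

theorem tauO_shifts (t : Fin 3) : Shifts MGen.deg (tauO n N t) (0, 0, 0, 0, 1, (t : ℕ)) := by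
  fin_cases t
  · exact OddJet.shifts_jO ⟨el_shifts _ (by decide), by decide⟩
  · exact OddJet.shifts_jO ⟨el_shifts _ (by decide), by decide⟩
  · exact OddJet.shifts_jO ⟨el_shifts _ (by decide), by decide⟩

/-- The derivation from the second copy to the fields and antifields. -/
def muO (n N : ℕ) : Module.End ℝ (MAlg n N) :=
  jO N (el .th .h LinearMap.id) + jO N (el .ths .hs LinearMap.id) + jO N (el .tcs .cs LinearMap.id)

theorem tau_acts : OActs (tauO n N 0 + tauO n N 1 + tauO n N 2) (ttau n) :=
  ((OddJet.acts (c := (0, 0, 0, 0, 1, 0)) ⟨el_shifts _ (by decide), by decide⟩).add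
    (OddJet.acts (c := (0, 0, 0, 0, 1, 1)) ⟨el_shifts _ (by decide), by decide⟩)).add
    (OddJet.acts (c := (0, 0, 0, 0, 1, 2)) ⟨el_shifts _ (by decide), by decide⟩)

theorem mu_acts : OActs (muO n N) (tmu n) :=
  ((OddJet.acts (c := (0, 0, 0, 0, -1, 0)) ⟨el_shifts _ (by decide), by decide⟩).add
    (OddJet.acts (c := (0, 0, 0, 0, -1, -1)) ⟨el_shifts _ (by decide), by decide⟩)).add
    (OddJet.acts (c := (0, 0, 0, 0, -1, -2)) ⟨el_shifts _ (by decide), by decide⟩)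

theorem ttau_pLin : PLin (ttau n) :=
  ((el_pLin (k := .h) (l := .th) LinearMap.id).add (el_pLin (k := .hs) (l := .ths) LinearMap.id)).add
    (el_pLin (k := .cs) (l := .tcs) LinearMap.id)

theorem tmu_pLin : PLin (tmu n) :=
  ((el_pLin (k := .th) (l := .h) LinearMap.id).add (el_pLin (k := .ths) (l := .hs) LinearMap.id)).add
    (el_pLin (k := .tcs) (l := .cs) LinearMap.id)

/-- The minus sign in `tdl1` is there for this: the copying map is odd, and the differential of the
second copy must have the opposite sign to anticommute with it. -/
theorem ttau_anti : ttau n ∘ₗ (tdl n + tdl1 n) + (tdl n + tdl1 n) ∘ₗ ttau n = 0 := by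
  simp [ttau, tdl, tdl1, LinearMap.add_comp, LinearMap.comp_add, LinearMap.neg_comp,
    LinearMap.comp_neg, el_el, el_el_ne]
  abel

theorem tmu_anti : tmu n ∘ₗ (tdl n + tdl1 n) + (tdl n + tdl1 n) ∘ₗ tmu n = 0 := by
  simp [tmu, tdl, tdl1, LinearMap.add_comp, LinearMap.comp_add, LinearMap.neg_comp,
    LinearMap.comp_neg, el_el, el_el_ne]

theorem tmu_ttau : tmu n ∘ₗ ttau n + ttau n ∘ₗ tmu n =
    el .h .h LinearMap.id + el .hs .hs LinearMap.id + el .cs .cs LinearMap.id +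
    (el .th .th LinearMap.id + el .ths .ths LinearMap.id + el .tcs .tcs LinearMap.id) := by
  simp [tmu, ttau, LinearMap.add_comp, LinearMap.comp_add, el_el, el_el_ne]

theorem dlt_sq : (dl n N + dl1 n N) * (dl n N + dl1 n N) = 0 := by
  refine (dl_acts.add dl1_acts).sq ?_
  simp [tdl, tdl1, LinearMap.add_comp, LinearMap.comp_add, LinearMap.neg_comp, LinearMap.comp_neg,
    el_el, el_el_ne, rD1_rD2, el_zero]

theorem dlt_dlt (x : MAlg n N) : dl n N (dl n N x) + dl n N (dl1 n N x) +
    (dl1 n N (dl n N x) + dl1 n N (dl1 n N x)) = 0 := by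
  have := DFunLike.congr_fun (dlt_sq (n := n) (N := N)) x
  simp only [Module.End.mul_apply, LinearMap.add_apply, map_add, LinearMap.zero_apply] at this
  rwa [add_add_add_comm] at this

theorem dl1_dH (x : MAlg n N) : dl1 n N (dH n N x) = -dH n N (dl1 n N x) :=
  dl1_acts.dH_anti tdl1_pLin x

/-- The elements with one field of the second copy, of antighost number less than `T`. -/
def Fl (n N : ℕ) (p k m : ℤ) : ℕ → Submodule ℝ (MAlg n N)
  | 0 => ⊥
  | T + 1 => Fl n N p k m T ⊔ Hom n N (p, k, m, 0, 1, T)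

theorem dl_Fl {p k m : ℤ} {T : ℕ} {x : MAlg n N} (hx : x ∈ Fl n N p k m T) :
    dl n N x ∈ Fl n N p (k - 1) m T := by
  induction T generalizing x with
  | zero => rw [show x = 0 from hx, map_zero]; exact zero_mem _
  | succ T ih =>
    obtain ⟨x0, h0, x1, h1, rfl⟩ := Submodule.mem_sup.1 hx
    rw [map_add]
    exact Submodule.add_mem_sup (ih h0) (by simpa [sub_eq_add_neg] using dl_shifts h1)

/-- Since `dl1` lowers the antighost number of the second copy, it goes strictly down in the
filtration. -/
theorem dl1_Hom {p k m : ℤ} {T : ℕ} {x : MAlg n N} (hx : x ∈ Hom n N (p, k, m, 0, 1, T)) :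
    dl1 n N x ∈ Fl n N p (k - 1) m T := by
  have h := dl1_shifts hx
  cases T with
  | zero =>
    rw [eq_zero_of_nonneg Deg.ta (by decide) (by decide) (by simp) h]
    exact zero_mem _
  | succ T => exact Submodule.mem_sup_right (by simpa [sub_eq_add_neg] using h)

theorem dl1_Fl {p k m : ℤ} {T : ℕ} {x : MAlg n N} (hx : x ∈ Fl n N p k m T) :
    dl1 n N x ∈ Fl n N p (k - 1) m T := by
  induction T generalizing x with
  | zero => rw [show x = 0 from hx, map_zero]; exact zero_mem _
  | succ T ih =>
    obtain ⟨x0, h0, x1, h1, rfl⟩ := Submodule.mem_sup.1 hx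
    rw [map_add]
    exact Submodule.mem_sup_left (add_mem (ih h0) (dl1_Hom h1))

theorem pr_Fl {p k m : ℤ} {T : ℕ} {x : MAlg n N} (hx : x ∈ Fl n N p k m T) {T' : ℕ}
    (hT : T ≤ T') : pr (p, k, m, 0, 1, (T' : ℤ)) x = 0 := by
  induction T generalizing x with
  | zero => rw [show x = 0 from hx, map_zero]
  | succ T ih =>
    obtain ⟨x0, h0, x1, h1, rfl⟩ := Submodule.mem_sup.1 hx
    rw [map_add, ih h0 (by omega), zero_add]
    refine proj_of_mem_ne ?_ h1
    simp only [ne_eq, Prod.mk.injEq, true_and]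
    omega

/-- In the component of highest second-copy antighost number the equation involves `dl` alone, as
`dl1` lowers that number. The count of second-copy fields is a weight invisible to `dl`, and the
antighost number left to the first copy is positive because T ≤ k; so `exists_of_weight` trivializes
the component. Subtracting the total differential of its primitive leaves an element lower in the
filtration. -/
theorem Fl_elim (hn : 3 ≤ n) {k m : ℤ} {T : ℕ} (hT : T ≤ k) {x y : MAlg n N}
    (hx : x ∈ Fl n N n k m T) (h : dl n N x + dl1 n N x = dH n N y) :
    ∃ z f, x = dl n N z + dl1 n N z + dH n N f := by
  induction T generalizing x y with
  | zero => exact ⟨0, 0, by rw [show x = 0 from hx]; simp⟩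
  | succ T ih =>
    obtain ⟨x0, h0, x1, h1, rfl⟩ := Submodule.mem_sup.1 hx
    push_cast at hT
    have h2 : dl n N x1 = dH n N (pr (n + -1, k - 1, m, 0, 1, (T : ℤ)) y) := by
      have h3 := congrArg (pr (n, k - 1, m, 0, 1, (T : ℤ))) h
      rw [map_add, map_add, map_add, map_add, map_add, pr_Fl (dl_Fl h0) le_rfl,
        pr_Fl (dl1_Fl h0) le_rfl, pr_Fl (dl1_Hom h1) le_rfl, pr_dH, zero_add, add_zero,
        add_zero] at h3
      have h4 : dl n N x1 ∈ Hom n N (n, k - 1, m, 0, 1, T) := by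
        simpa [sub_eq_add_neg] using dl_shifts h1
      rw [proj_of_mem h4] at h3
      simpa using h3
    obtain ⟨b, hb, e, -, hbe⟩ := exists_of_weight hn (κ := Deg.tl) rfl rfl rfl rfl (by simp)
      (by simp; omega) h1 h2
    have hb' : b ∈ Hom n N (n, k + 1, m, 0, 1, T) := by simpa using hb
    have h5 : dl1 n N b ∈ Fl n N n k m T := by simpa using dl1_Hom hb'
    obtain ⟨z, f, hzf⟩ := ih (by omega) (x := x0 - dl1 n N b)
      (y := y + dl n N e + dl1 n N e) (sub_mem h0 h5) (by
        have h6 := dlt_dlt b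
        rw [map_add, map_add, ← h, hbe]
        simp only [map_add, map_sub, dl_dH, dl1_dH]
        rw [← sub_eq_zero, ← neg_eq_zero, ← h6]
        abel)
    refine ⟨z + b, f + e, ?_⟩
    rw [eq_add_of_sub_eq hzf, hbe]
    simp only [map_add]
    abel

theorem muO_eq_zero {r : Deg} (hr : Deg.tl r = 0) {x : MAlg n N} (hx : x ∈ Hom n N r) :
    muO n N x = 0 := by
  have h1 : ∀ (T : Jet n →ₗ[ℝ] Jet n) (c : Deg), OddJet T c → Deg.tl c = -1 → jO N T x = 0 :=
    fun T c hT hc => eq_zero_of_nonneg Deg.tl (by decide) (by decide)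
      (by rw [map_add, hr, hc]; norm_num) (hT.shifts_jO hx)
  simp only [muO, LinearMap.add_apply]
  rw [h1 _ (0, 0, 0, 0, -1, 0) ⟨el_shifts _ (by decide), by decide⟩ rfl,
    h1 _ (0, 0, 0, 0, -1, -1) ⟨el_shifts _ (by decide), by decide⟩ rfl,
    h1 _ (0, 0, 0, 0, -1, -2) ⟨el_shifts _ (by decide), by decide⟩ rfl, add_zero, add_zero]

/-- Moving a field to the other copy and back, in both orders, counts the fields of the two copies;
ghosts are not counted. -/
theorem tau_mu {r : Deg} {x : MAlg n N} (hx : x ∈ Hom n N r) :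
    (muO n N * (tauO n N 0 + tauO n N 1 + tauO n N 2) +
      (tauO n N 0 + tauO n N 1 + tauO n N 2) * muO n N) x =
      ((Deg.ml r - Deg.gn r : ℤ) : ℝ) • x := by
  have h := (mu_acts (n := n) (N := N)).anticomm tau_acts
  refine h.isEven.eigen ((Int.castAddHom ℝ).comp (Deg.ml - Deg.gn)) (fun y => ?_) hx
  cases y with
  | dx μ => exact (h.dx μ).trans (by simp [MGen.deg])
  | u k a i I =>
    rw [← U_monomial, ← L_js, h.L, tmu_ttau]
    cases k <;> simp [el_js, el_js_ne, MGen.deg, Kind.deg] <;> rfl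

/-- The cohomology of `dl` modulo `d` vanishes on the forms without ghosts of antighost number
`≥ 3`; in antighost number `2` it vanishes on those on which the terms with `C*` are trivial. -/
theorem exists_of_closed (hn : 3 ≤ n) {k m : ℤ} (hk : 2 ≤ k) {a c : MAlg n N}
    (ha : a ∈ Hom n N (n, k, m, 0, 0, 0)) (hcs : 3 ≤ k ∨ ∃ u f, tauO n N 2 a = dl n N u + dH n N f)
    (h : dl n N a = dH n N c) : ∃ b e, a = dl n N b + dH n N e := by
  -- The antighost number is at most twice the polynomial degree, so there is nothing here.
  by_cases hm : m ≤ 0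
  · refine ⟨0, 0, ?_⟩
    rw [eq_zero_of_nonneg ((2 : ℤ) • Deg.ml - Deg.ag) (by decide) (by decide) ?_ ha]
    · simp
    · simp; omega
  set τ := tauO n N 0 + tauO n N 1 + tauO n N 2 with hτ
  have h0 : dl1 n N a = 0 :=
    eq_zero_of_nonneg Deg.ta (by decide) (by decide) (by simp) (dl1_shifts ha)
  have t0 : tauO n N 0 a ∈ Hom n N (n, k, m, 0, 1, (0 : ℕ)) := by simpa using tauO_shifts 0 ha
  have t1 : tauO n N 1 a ∈ Hom n N (n, k, m, 0, 1, (1 : ℕ)) := by simpa using tauO_shifts 1 ha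
  have t2 : tauO n N 2 a ∈ Hom n N (n, k, m, 0, 1, (2 : ℕ)) := by simpa using tauO_shifts 2 ha
  have t01 : tauO n N 0 a + tauO n N 1 a ∈ Fl n N n k m 2 :=
    Submodule.add_mem_sup (Submodule.mem_sup_right t0) t1
  -- The form a contains no second-copy field, so `dl1` kills it, and τ anticommutes with the total
  -- differential and with `d`.
  have hx : dl n N (τ a) + dl1 n N (τ a) = dH n N (τ c) := by
    have h1 := (tau_acts (n := n) (N := N)).anti (dl_acts.add dl1_acts) ttau_anti a
    have e1 : (dl n N + dl1 n N) a = dH n N c := by rw [LinearMap.add_apply, h0, add_zero, h]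
    rw [e1] at h1
    have h2 := (tau_acts (n := n) (N := N)).dH_anti ttau_pLin c
    rw [← hτ] at h1 h2
    rw [h1] at h2
    exact neg_injective h2
  obtain ⟨z, f, hzf⟩ : ∃ z f, τ a = dl n N z + dl1 n N z + dH n N f := by
    -- For k ≥ 3 all three filtration levels are removed by `Fl_elim`. For k = 2 the highest one,
    -- with the second copy of C*, would be left with antighost number 0; it is removed by the
    -- hypothesis instead.
    rcases hcs with h3 | h3
    · exact Fl_elim hn (T := 3) (by exact_mod_cast h3) (Submodule.add_mem_sup t01 t2) hx
    · obtain ⟨u, f, huf⟩ := h3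
      obtain ⟨u, -, f, -, hu, -, huf⟩ := exists_homogeneous PrStable.top t2 (b := u) (c := f)
        trivial trivial huf
      have hu' : dl1 n N u ∈ Fl n N n k m 2 := by
        refine dl1_Hom (T := 2) (k := k + 1) ?_ |> fun h => by simpa using h
        simpa using hu
      obtain ⟨z, f', hzf⟩ := Fl_elim hn (T := 2) (by exact_mod_cast hk) (sub_mem t01 hu')
        (y := τ c + dl n N f + dl1 n N f) (by
          have h6 := dlt_dlt u
          rw [map_add, map_add, ← hx, hτ, LinearMap.add_apply, LinearMap.add_apply, huf]
          simp only [map_add, map_sub, dl_dH, dl1_dH]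
          rw [← sub_eq_zero, ← neg_eq_zero, ← h6]
          abel)
      refine ⟨z + u, f + f', ?_⟩
      rw [hτ, LinearMap.add_apply, LinearMap.add_apply, eq_add_of_sub_eq hzf, huf]
      simp only [map_add]
      abel
  -- Moving the field back turns τa into m·a.
  have h1 : (m : ℝ) • a = -(dl n N (muO n N z) + dl1 n N (muO n N z)) - dH n N (muO n N f) := by
    have h2 := tau_mu ha
    simp only [Deg.ml_mk, Deg.gn_mk, sub_zero] at h2
    rw [← hτ, LinearMap.add_apply, Module.End.mul_apply, Module.End.mul_apply,
      muO_eq_zero (by simp) ha, map_zero, add_zero, hzf] at h2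
    have h3 := (mu_acts (n := n) (N := N)).anti (dl_acts.add dl1_acts) tmu_anti z
    have h4 := (mu_acts (n := n) (N := N)).dH_anti tmu_pLin f
    rw [← h2, map_add, h4, ← LinearMap.add_apply, h3, LinearMap.add_apply, ← sub_eq_add_neg]
  have h5 := congrArg (pr (n, k, m, 0, 0, 0)) h1
  -- Only the part without second-copy fields matters. There `dl1` contributes nothing, because its
  -- argument would have second-copy antighost number 1 and no second-copy field.
  have h6 : pr (n, k, m, 0, 0, 0) (dl1 n N (muO n N z)) = 0 := by
    have := dl1_shifts.proj ((n : ℤ), k + 1, m, 0, 0, 1) (muO n N z)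
    have h7 : (((n : ℤ), k + 1, m, 0, 0, 1) + (0, -1, 0, 0, 0, -1) : Deg) =
        ((n : ℤ), k, m, 0, 0, 0) := by
      simp
    rw [h7] at this
    rw [pr, this, eq_zero_of_nonneg ((2 : ℤ) • Deg.tl - Deg.ta) (by decide) (by decide) ?_
      (proj_mem ((n : ℤ), k + 1, m, 0, 0, 1) (muO n N z)), map_zero]
    simp
  rw [map_smul, proj_of_mem ha, map_sub, map_neg, map_add, h6, add_zero, pr_dl, pr_dH] at h5
  have hm' : (m : ℝ) ≠ 0 := by
    have : m ≠ 0 := by omega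
    exact_mod_cast this
  refine ⟨(-(m : ℝ)⁻¹) • pr (((n : ℤ), k, m, 0, 0, 0) + (0, 1, 0, 0, 0, 0)) (muO n N z),
    (-(m : ℝ)⁻¹) • pr (((n : ℤ), k, m, 0, 0, 0) + (-1, 0, 0, 0, 0, 0)) (muO n N f), ?_⟩
  rw [map_smul, map_smul, neg_smul, neg_smul, ← neg_add, ← smul_add, ← smul_neg, neg_add,
    ← sub_eq_add_neg, ← h5, smul_smul, inv_mul_cancel₀ hm', one_smul]

end PauliFierz
end

noncomputable section

namespace PauliFierz

open GradedPoly

variable {n N : ℕ}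

/-! ### Passing to the kernel of an odd operator -/

/-- The subspaces that are preserved by the operators. -/
structure Stable (Y : Submodule ℝ (MAlg n N)) : Prop where
  pr : PrStable Y
  dH : ∀ x ∈ Y, dH n N x ∈ Y
  dl : ∀ x ∈ Y, dl n N x ∈ Y
  rho : ∀ x ∈ Y, rho n N Deg.ag x ∈ Y

theorem Stable.top : Stable (⊤ : Submodule ℝ (MAlg n N)) :=
  ⟨PrStable.top, fun _ _ => trivial, fun _ _ => trivial, fun _ _ => trivial⟩

/-- `D` anticommutes with the operators on `Y`. -/
structure Anti (D : Module.End ℝ (MAlg n N)) (Y : Submodule ℝ (MAlg n N)) : Prop where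
  dH : ∀ x ∈ Y, D (dH n N x) = -PauliFierz.dH n N (D x)
  dl : ∀ x ∈ Y, D (dl n N x) = -PauliFierz.dl n N (D x)
  rho : ∀ x ∈ Y, D (rho n N Deg.ag x) = -PauliFierz.rho n N Deg.ag (D x)

variable {D : Module.End ℝ (MAlg n N)} {Y Z : Submodule ℝ (MAlg n N)}

theorem Anti.mono (h : Anti D Y) (hZ : Z ≤ Y) : Anti D Z :=
  ⟨fun x hx => h.dH x (hZ hx), fun x hx => h.dl x (hZ hx), fun x hx => h.rho x (hZ hx)⟩

theorem shifts_pr {c : Deg} (hs : Shifts MGen.deg D c) (r : Deg) (x : MAlg n N) :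
    D (pr r x) = pr (r + c) (D x) := (hs.proj r x).symm

theorem Stable.inf_ker (hY : Stable Y) (hD : Anti D Y) {c : Deg} (hs : Shifts MGen.deg D c) :
    Stable (Y ⊓ LinearMap.ker D) := by
  have h : ∀ {x}, x ∈ Y ⊓ LinearMap.ker D → x ∈ Y ∧ D x = 0 := fun hx =>
    ⟨hx.1, LinearMap.mem_ker.1 hx.2⟩
  refine ⟨fun r x hx => ⟨hY.pr r x hx.1, LinearMap.mem_ker.2 ?_⟩,
    fun x hx => ⟨hY.dH x hx.1, LinearMap.mem_ker.2 ?_⟩,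
    fun x hx => ⟨hY.dl x hx.1, LinearMap.mem_ker.2 ?_⟩,
    fun x hx => ⟨hY.rho x hx.1, LinearMap.mem_ker.2 ?_⟩⟩
  · rw [shifts_pr hs, (h hx).2, map_zero]
  · rw [hD.dH x hx.1, (h hx).2, map_zero, neg_zero]
  · rw [hD.dl x hx.1, (h hx).2, map_zero, neg_zero]
  · rw [hD.rho x hx.1, (h hx).2, map_zero, neg_zero]

/-- The long exact sequence of the kernel of a surjection. -/
theorem Van.ker (hY : Stable Y) (hZ : Stable Z) (hD : Anti D Y) {cm cg : ℤ}
    (hs : Shifts MGen.deg D (0, 0, cm, cg, 0, 0)) (hDZ : ∀ x ∈ Y, D x ∈ Z) {k m g : ℤ}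
    (lift : ∀ r : Deg, Deg.gn r = g + cg → ∀ z ∈ Z, z ∈ Hom n N r → ∃ y ∈ Y, D y = z)
    (hk : 0 < k) (h1 : Van Y k m g) (h2 : Van Z (k + 1) (m + cm) (g + cg)) :
    Van (Y ⊓ LinearMap.ker D) k m g := by
  intro a ha har c hc hac
  have haD : D a = 0 := LinearMap.mem_ker.1 ha.2
  obtain ⟨b, hb, e, he, habe⟩ := h1 a ha.1 har c hc.1 hac
  obtain ⟨b, hb, e, he, hbr, her, habe⟩ := exists_homogeneous hY.pr har hb he habe
  -- Connecting map: D b is again `dl`-closed modulo `d`, with antighost number k + 1, and lies in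
  -- the target space.
  have h3 : dl n N (D b) = dH n N (-D e) := by
    have h4 : D a = -dl n N (D b) - dH n N (D e) := by
      rw [habe, map_add, hD.dl b hb, hD.dH e he, sub_eq_add_neg]
    rw [haD] at h4
    rw [map_neg]
    refine eq_neg_of_add_eq_zero_left ?_
    rw [← neg_eq_zero, neg_add, ← sub_eq_add_neg]
    exact h4.symm
  have hDb := hs hbr
  have hDe := hs her
  simp only [Prod.mk_add_mk, add_zero] at hDb hDe
  obtain ⟨b1, hb1, e1, he1, hbe1⟩ := h2 (D b) (hDZ b hb) hDb _ (neg_mem (hDZ e he)) h3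
  obtain ⟨b1, hb1, e1, he1, hb1r, he1r, hbe1⟩ := exists_homogeneous hZ.pr hDb hb1 he1 hbe1
  obtain ⟨b2, hb2, hDb2⟩ := lift _ (by simp) b1 hb1 hb1r
  obtain ⟨e2, he2, hDe2⟩ := lift _ (by simp) e1 he1 he1r
  -- Changing b by lifts of a primitive of D b puts it in the kernel of D; e is changed accordingly
  -- so that a is unaffected.
  set b' := b + dl n N b2 + dH n N e2 with hb'
  have hb'Y : b' ∈ Y := add_mem (add_mem hb (hY.dl _ hb2)) (hY.dH _ he2)
  have hDb' : D b' = 0 := by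
    rw [hb', map_add, map_add, hD.dl b2 hb2, hD.dH e2 he2, hDb2, hDe2, hbe1]; abel
  set e' := e + dl n N e2 with he'
  have he'Y : e' ∈ Y := add_mem he (hY.dl _ he2)
  have hab : a = dl n N b' + dH n N e' := by
    rw [habe, hb', he', map_add, map_add, map_add, dl_dl, dl_dH]; abel
  have hDe' : D e' ∈ Hom n N (n + -1, k, m + cm, g + cg, 0, 0) := by
    rw [he', map_add, hD.dl e2 he2, hDe2]
    refine add_mem (by simpa using hDe) (neg_mem ?_)
    have := dl_shifts he1r
    simpa using this
  -- Now D e' is `d`-closed in form degree n - 1 and positive antighost number, hence exact in the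
  -- target space; lifting its primitive corrects e'.
  have hd0 : dH n N (D e') = 0 := by
    have : D (dH n N e') = 0 := by
      rw [← sub_eq_of_eq_add' hab, map_sub, haD, hD.dl b' hb'Y, hDb', map_zero, neg_zero, sub_zero]
    rw [hD.dH e' he'Y, neg_eq_zero] at this
    exact this
  obtain ⟨f, hfr, hf, hef⟩ := dH_acyclic (κ := Deg.ag) rfl Z hZ.dH hZ.rho hDe' (hDZ _ he'Y)
    (by simpa) (by simp) hd0
  obtain ⟨f2, hf2, hDf2⟩ := lift _ (by simp) f hf hfr
  refine ⟨b', ⟨hb'Y, LinearMap.mem_ker.2 hDb'⟩, e' + dH n N f2,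
    ⟨add_mem he'Y (hY.dH _ hf2), LinearMap.mem_ker.2 ?_⟩, ?_⟩
  · rw [map_add, hD.dH f2 hf2, hDf2, hef, add_neg_cancel]
  · have : dH n N (e' + dH n N f2) = dH n N e' := by rw [map_add, dH_dH, add_zero]
    rw [this]
    exact hab

/-- The common kernel in `Y` of a list of operators. -/
def KerL {I : Type} (Y : Submodule ℝ (MAlg n N)) (D : I → Module.End ℝ (MAlg n N)) :
    List I → Submodule ℝ (MAlg n N)
  | [] => Y
  | i :: l => KerL Y D l ⊓ LinearMap.ker (D i)

theorem mem_KerL {I : Type} {D : I → Module.End ℝ (MAlg n N)} {l : List I} {x : MAlg n N} :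
    x ∈ KerL Y D l ↔ x ∈ Y ∧ ∀ i ∈ l, D i x = 0 := by
  induction l with
  | nil => simp [KerL]
  | cons i l ih =>
    rw [KerL, Submodule.mem_inf, ih, LinearMap.mem_ker]
    simp only [List.mem_cons, forall_eq_or_imp]
    tauto

/-- Odd operators that remove an independent ghost. -/
structure GhostOps {I : Type} [DecidableEq I] (Y : Submodule ℝ (MAlg n N))
    (D : I → Module.End ℝ (MAlg n N)) (c : I → MAlg n N) : Prop where
  isOdd : ∀ i, IsOdd (D i)
  shifts : ∀ i, Shifts MGen.deg (D i) (0, 0, -1, -1, 0, 0)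
  anti : ∀ i, Anti (D i) Y
  anticomm : ∀ i j x, D i (D j x) = -D j (D i x)
  dual : ∀ i j, D i (c j) = if i = j then 1 else 0
  mem : ∀ i, ∀ x ∈ Y, D i x ∈ Y
  mul_mem : ∀ i, ∀ x ∈ Y, c i * x ∈ Y
  zero : ∀ r : Deg, Deg.gn r = 0 → Hom n N r ≤ Y
  c_mem : ∀ i, c i ∈ Hom n N (0, 0, 1, 1, 0, 0)

variable {I : Type} [DecidableEq I] {Dl : I → Module.End ℝ (MAlg n N)} {c : I → MAlg n N}

theorem KerL_le {I : Type} {Dl : I → Module.End ℝ (MAlg n N)} (l : List I) : KerL Y Dl l ≤ Y :=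
    fun _ hx => (mem_KerL.1 hx).1

theorem GhostOps.stable (h : GhostOps Y Dl c) (hY : Stable Y) (l : List I) :
    Stable (KerL Y Dl l) := by
  induction l with
  | nil => exact hY
  | cons i l ih => exact ih.inf_ker ((h.anti i).mono (KerL_le l)) (h.shifts i)

theorem GhostOps.hom_le (h : GhostOps Y Dl c) (l : List I) {r : Deg} (hr : Deg.gn r = 0) :
    Hom n N r ≤ KerL Y Dl l := fun x hx => mem_KerL.2 ⟨h.zero r hr hx, fun i _ =>
  eq_zero_of_nonneg Deg.gn (by decide) (by decide) (by simp [hr]) (h.shifts i hx)⟩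

/-- The operators remove ghosts, so in ghost number zero their kernels are no restriction. -/
theorem GhostOps.van_zero (hn : 3 ≤ n) (h : GhostOps Y Dl c) (l : List I) {k m : ℤ}
    (hk : 3 ≤ k) : Van (KerL Y Dl l) k m 0 := by
  intro a _ har c' _ hac
  obtain ⟨b, e, habe⟩ := exists_of_closed hn (by omega) har (Or.inl hk) hac
  obtain ⟨b, -, e, -, hbr, her, habe⟩ := exists_homogeneous PrStable.top har (b := b) (c := e)
    trivial trivial habe
  exact ⟨b, h.hom_le l (by simp) hbr, e, h.hom_le l (by simp) her, habe⟩

/-- Induction on the list of operators, and for each list on the ghost number. Multiplication by c_i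
is a section of D_i, so the long exact sequence applies with target the new kernel itself. The
connecting map trades one ghost for one unit of antighost number, and the recursion ends in ghost
number zero with antighost number at least 3. -/
theorem GhostOps.van (hn : 3 ≤ n) (h : GhostOps Y Dl c) (hY : Stable Y)
    (h0 : ∀ k m g : ℤ, 2 ≤ k → 0 < g → Van Y k m g) (l : List I) (g : ℕ) (k m : ℤ) (hk : 2 ≤ k) :
    Van (KerL Y Dl l) k m (g + 1) := by
  induction l generalizing g k m with
  | nil => exact h0 k m _ hk (by omega)
  | cons i l ih =>
    by_cases hi : i ∈ l
    · have : KerL Y Dl (i :: l) = KerL Y Dl l := by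
        ext x
        rw [mem_KerL, mem_KerL]
        simp only [List.mem_cons, forall_eq_or_imp]
        constructor
        · rintro ⟨hx, -, h⟩; exact ⟨hx, h⟩
        · rintro ⟨hx, h⟩; exact ⟨hx, h i hi, h⟩
      rw [this]
      exact ih g k m hk
    have step : ∀ (g : ℕ) (k m : ℤ), 2 ≤ k → Van (KerL Y Dl (i :: l)) (k + 1) (m + -1) g →
        Van (KerL Y Dl (i :: l)) k m (g + 1) := by
      intro g k m hk hv
      refine Van.ker (h.stable hY l) (h.stable hY (i :: l)) ((h.anti i).mono (KerL_le l))
        (h.shifts i) (fun x hx => ?_) (fun r _ z hz _ => ⟨c i * z, ?_, ?_⟩) (by omega)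
        (ih g k m hk) (by simpa using hv)
      · rw [mem_KerL] at hx ⊢
        refine ⟨h.mem i x hx.1, fun j hj => ?_⟩
        rcases List.mem_cons.1 hj with rfl | hj
        · have := h.anticomm j j x
          rw [eq_neg_iff_add_eq_zero, ← two_smul ℝ, smul_eq_zero] at this
          exact this.resolve_left (by norm_num)
        · rw [h.anticomm, hx.2 j hj, map_zero, neg_zero]
      · rw [mem_KerL] at hz ⊢
        refine ⟨h.mul_mem i z hz.1, fun j hj => ?_⟩
        have hji : j ≠ i := fun h => hi (h ▸ hj)
        rw [(h.isOdd j).leib, h.dual, if_neg hji, zero_mul, zero_add,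
          hz.2 j (List.mem_cons_of_mem _ hj), mul_zero]
      · rw [mem_KerL] at hz
        rw [(h.isOdd i).leib, h.dual, if_pos rfl, one_mul, hz.2 i List.mem_cons_self, mul_zero,
          add_zero]
    induction g generalizing k m with
    | zero => exact step 0 k m hk (h.van_zero hn (i :: l) (by omega))
    | succ g ihg =>
      refine step (g + 1) k m hk ?_
      exact_mod_cast ihg (k + 1) (m + -1) (by omega)

/-! ### The derivatives of the ghosts that are not gauge variations -/

/-- The odd derivation that removes a ghost. -/
def phiO (a : Fin N) (φ : Vec n (Poly n) →ₗ[ℝ] ℝ) : Module.End ℝ (MAlg n N) :=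
  derO 0 fun b => if b = a then
    LinearMap.toSpanSingleton ℝ _ 1 ∘ₗ φ ∘ₗ LinearMap.proj Kind.gh else 0

theorem par_ghost : (-1 : ℝ) ^ (Deg.par (0, 0, -1, -1, 0, 0)) = -1 := by norm_num [Deg.par]

theorem phiO_valid (a : Fin N) (φ : Vec n (Poly n) →ₗ[ℝ] ℝ) : Valid (n := n) (N := N) 0
    (fun b => if b = a then LinearMap.toSpanSingleton ℝ (MAlg n N) 1 ∘ₗ φ ∘ₗ
      LinearMap.proj Kind.gh else 0) (0, 0, -1, -1, 0, 0) := by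
  refine ⟨fun μ => zero_mem _, fun b k i p => ?_⟩
  split_ifs
  · by_cases hk : k = .gh
    · subst hk
      simp only [LinearMap.comp_apply, LinearMap.toSpanSingleton_apply]
      exact Submodule.smul_mem _ _ one_mem_hom
    · have : (js k i p : Jet n) .gh = 0 := by simp [js, Pi.single_eq_of_ne (Ne.symm hk)]
      simp only [LinearMap.comp_apply, LinearMap.proj_apply, this, map_zero]
      exact zero_mem _
  · exact zero_mem _

variable (a : Fin N) (φ : Vec n (Poly n) →ₗ[ℝ] ℝ)

theorem phiO_isOdd : IsOdd (phiO a φ) := derO_isOdd _ _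

@[simp] theorem phiO_dx (μ : Fin n) : phiO a φ (dx μ) = 0 := derO_dx (phiO_valid a φ) par_ghost μ

@[simp] theorem phiO_L (b : Fin N) (v : Jet n) :
    phiO a φ (L b v) = if b = a then φ (v .gh) • 1 else 0 := by
  rw [phiO, derO_L (phiO_valid a φ) par_ghost]
  split_ifs <;> simp

theorem phiO_shifts : Shifts MGen.deg (phiO a φ) (0, 0, -1, -1, 0, 0) :=
  derO_shifts (phiO_valid a φ) par_ghost

theorem phiO_anticomm (b : Fin N) (ψ : Vec n (Poly n) →ₗ[ℝ] ℝ) (x : MAlg n N) :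
    phiO a φ (phiO b ψ x) = -phiO b ψ (phiO a φ x) := by
  refine eq_neg_of_add_eq_zero_left (DFunLike.congr_fun
    (f := phiO a φ * phiO b ψ + phiO b ψ * phiO a φ)
    (IsEven.ext_jet ((phiO_isOdd a φ).anticomm (phiO_isOdd b ψ)) IsEven.zero ?_ ?_) x)
  · intro μ; simp
  · intro c v
    simp only [LinearMap.add_apply, Module.End.mul_apply, phiO_L]
    split_ifs <;> simp [(phiO_isOdd a φ).map_one, (phiO_isOdd b ψ).map_one]

variable {a φ}

theorem phiO_anti_acts {T : Jet n →ₗ[ℝ] Jet n} (hD : OActs D T) (h : ∀ v, φ (T v .gh) = 0)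
    (x : MAlg n N) : phiO a φ (D x) = -D (phiO a φ x) := by
  refine eq_neg_of_add_eq_zero_left (DFunLike.congr_fun (f := phiO a φ * D + D * phiO a φ)
    (IsEven.ext_jet ((phiO_isOdd a φ).anticomm hD.isOdd) IsEven.zero ?_ ?_) x)
  · intro μ; simp [hD.dx]
  · intro c v
    simp only [LinearMap.add_apply, Module.End.mul_apply, phiO_L, hD.L, h]
    split_ifs <;> simp [hD.isOdd.map_one]

theorem phiO_dl (x : MAlg n N) : phiO a φ (dl n N x) = -dl n N (phiO a φ x) :=
  phiO_anti_acts dl_acts (fun v => by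
    have : tdl n v .gh = 0 := by
      simp [tdl, el_apply_ne (show Kind.gh ≠ .h by decide),
        el_apply_ne (show Kind.gh ≠ .hs by decide)]
    rw [this, map_zero]) x

/-- Ghosts have antighost number zero, so for this weight K^μ does not see them. -/
theorem phiO_rho (x : MAlg n N) :
    phiO a φ (rho n N Deg.ag x) = -rho n N Deg.ag (phiO a φ x) := by
  have h1 : ∀ (μ : Fin n) (x : MAlg n N), phiO a φ (io N μ x) = -io N μ (phiO a φ x) := by
    intro μ x
    refine eq_neg_of_add_eq_zero_left (DFunLike.congr_fun
      (f := phiO a φ * io N μ + io N μ * phiO a φ)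
      (IsEven.ext_jet ((phiO_isOdd a φ).anticomm (io_isOdd μ)) IsEven.zero ?_ ?_) x)
    · intro ν
      simp only [LinearMap.add_apply, Module.End.mul_apply, io_dx, phiO_dx, map_zero, add_zero]
      split_ifs <;> simp [(phiO_isOdd a φ).map_one]
    · intro c v
      simp only [LinearMap.add_apply, Module.End.mul_apply, phiO_L, io_L, map_zero, zero_add]
      split_ifs <;> simp [(io_isOdd μ).map_one]
  have h2 : ∀ (μ : Fin n) (x : MAlg n N),
      phiO a φ (Kop N Deg.ag μ x) = Kop N Deg.ag μ (phiO a φ x) := by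
    intro μ x
    have : Kop N Deg.ag μ * phiO a φ - phiO a φ * Kop N Deg.ag μ = 0 := by
      refine IsOdd.ext_jet ((Kop_isEven _ μ).comm_odd (phiO_isOdd a φ)) IsOdd.zero ?_ ?_
      · intro ν; simp
      · intro c v
        have hv : wpd Deg.ag μ v .gh = 0 := by ext1 i; simp [wpd, wt, Kind.deg]
        simp only [LinearMap.sub_apply, Module.End.mul_apply, phiO_L, Kop_L, hv, map_zero]
        split_ifs <;> simp [(Kop_isEven _ μ).map_one]
    exact (sub_eq_zero.1 (DFunLike.congr_fun this x)).symm
  simp only [rho, LinearMap.sum_apply, Module.End.mul_apply, map_sum, ← Finset.sum_neg_distrib]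
  exact Finset.sum_congr rfl fun μ _ => by rw [h1, h2]

/-- The functional `φ` after a derivative. -/
def phiX (φ : Vec n (Poly n) →ₗ[ℝ] ℝ) (μ : Fin n) : Vec n (Poly n) →ₗ[ℝ] ℝ :=
  φ ∘ₗ (LinearMap.lsmul (Poly n) (Vec n (Poly n)) (MvPolynomial.X μ)).restrictScalars ℝ

/-- A functional of the ghost jets does not commute with ∂_μ: the commutator is given by the
functional precomposed with ∂_μ. This is what dictates the order in which ghosts are removed. -/
theorem phiO_del (μ : Fin n) (x : MAlg n N) :
    phiO a φ (del N μ x) = del N μ (phiO a φ x) + phiO a (phiX φ μ) x := by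
  have : phiO a φ * del N μ - del N μ * phiO a φ = phiO a (phiX φ μ) := by
    rw [← neg_sub, neg_eq_iff_eq_neg]
    refine IsOdd.ext_jet ((del_isEven μ).comm_odd (phiO_isOdd a φ)) ?_ ?_ ?_
    · have : -phiO a (phiX φ μ) = (-1 : ℝ) • phiO a (phiX φ μ) := by ext x; simp
      rw [this]
      exact (phiO_isOdd a (phiX φ μ)).smul (-1)
    · intro ν; simp
    · intro c v
      simp only [LinearMap.sub_apply, Module.End.mul_apply, phiO_L, del_L, LinearMap.neg_apply]
      split_ifs
      · simp [(del_isEven μ).map_one, phiX]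
      · simp
  rw [← this]; simp

theorem phiO_dH {x : MAlg n N} (h : ∀ μ, phiO a (phiX φ μ) x = 0) :
    phiO a φ (dH n N x) = -dH n N (phiO a φ x) :=
  (phiO_isOdd a φ).dH_anti (phiO_dx a φ) fun μ => by rw [phiO_del, h, add_zero]

end PauliFierz
end

noncomputable section

namespace PauliFierz

open GradedPoly

variable {n N : ℕ}

/-! ### Gauge variations -/

section Symb

variable {R : Type} [CommRing R] (P : Symb n R)

theorem gamV_curvV (α β μ ν : Fin n) : gamV P (curvV P α β μ ν) = 0 := by
  simp only [curvV, map_smul, map_sub, map_add, gamV_eS]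
  module

theorem gamV_D1 (x : STen n R) : gamV P (D1 P x) = 0 := by
  suffices h : gamV P ∘ₗ D1 P = 0 from DFunLike.congr_fun h x
  refine STen.hom_ext fun α β => ?_
  simp only [LinearMap.comp_apply, D1_eS, feV, ricV, scalV, map_smul, map_sub, map_sum, gamV_curvV,
    smul_zero, Finset.sum_const_zero, sub_zero, LinearMap.zero_apply]

/-- The Christoffel symbols. -/
def Gam (α β γ : Fin n) : STen n R :=
  P.x α • eS R β γ + P.x β • eS R α γ - P.x γ • eS R α β

theorem Gam_comm (α β γ : Fin n) : Gam P α β γ = Gam P β α γ := by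
  rw [Gam, Gam, eS_comm α β]; abel

/-- The Christoffel symbols exhibit the second derivatives of the ghosts as gauge variations. -/
theorem gamV_Gam (α β γ : Fin n) :
    gamV P (Gam P α β γ) = (2 * P.x α * P.x β) • (Pi.single γ 1 : Vec n R) := by
  simp only [Gam, map_smul, map_sub, map_add, gamV_eS]
  module

/-- The curvature is the curl of the Christoffel symbols, so modulo curvatures an index of a
Christoffel symbol can be exchanged with a derivative. -/
theorem Gam_sub (ρ α β γ : Fin n) :
    P.x ρ • Gam P α β γ - P.x α • Gam P ρ β γ = (2 : R) • curvV P ρ α γ β := by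
  have h : (2 : R) * -P.hf = -1 := by linear_combination -P.two
  rw [curvV, smul_smul, h, Gam, Gam]
  module

/-- Metricity: first derivatives of the field are recovered from the Christoffel symbols. -/
theorem Gam_add (ρ α β : Fin n) :
    Gam P ρ α β + Gam P ρ β α = (2 * P.x ρ) • eS R α β := by
  rw [Gam, Gam, eS_comm β α]
  module

end Symb

/-- The gauge variations over the reals. -/
def rgam (n : ℕ) : STen n (Poly n) →ₗ[ℝ] Vec n (Poly n) := (gamV (symb n)).restrictScalars ℝ

/-- The span of the curvatures. -/
def W0 (n : ℕ) : Submodule (Poly n) (STen n (Poly n)) :=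
  Submodule.span _ {w | ∃ α β μ ν, w = curvV (symb n) α β μ ν}

theorem rgam_W0 {w : STen n (Poly n)} (hw : w ∈ W0 n) : rgam n w = 0 := by
  have h : W0 n ≤ LinearMap.ker (gamV (symb n)) := by
    rw [W0, Submodule.span_le]
    rintro _ ⟨α, β, μ, ν, rfl⟩
    exact LinearMap.mem_ker.2 (gamV_curvV _ _ _ _ _)
  exact LinearMap.mem_ker.1 (h hw)

theorem rD1_mem_W0 (x : STen n (Poly n)) : rD1 n x ∈ W0 n := by
  have hc : ∀ α β μ ν, curvV (symb n) α β μ ν ∈ W0 n := fun α β μ ν =>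
    Submodule.subset_span ⟨α, β, μ, ν, rfl⟩
  have hr : ∀ α β, ricV (symb n) α β ∈ W0 n := fun α β =>
    Submodule.sum_mem _ fun μ _ => Submodule.smul_mem _ _ (hc _ _ _ _)
  obtain ⟨c, -, rfl⟩ := STen.exists_coeff (symb n) x
  change D1 (symb n) _ ∈ _
  rw [map_sum]
  refine Submodule.sum_mem _ fun α _ => ?_
  rw [map_sum]
  refine Submodule.sum_mem _ fun β _ => ?_
  rw [map_smul, D1_eS, feV]
  refine Submodule.smul_mem _ _ (Submodule.smul_mem _ _ (sub_mem (hr _ _) ?_))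
  exact Submodule.smul_mem _ _
    (Submodule.sum_mem _ fun μ _ => Submodule.smul_mem _ _ (hr _ _))

/-- Derivatives of the Christoffel symbols. -/
def GamI (J : Fin n →₀ ℕ) (α β γ : Fin n) : STen n (Poly n) :=
  MvPolynomial.monomial J (1 : ℝ) • Gam (symb n) α β γ

theorem monomial_add_single (M : Fin n →₀ ℕ) (β : Fin n) :
    (MvPolynomial.monomial (M + Finsupp.single β 1) (1 : ℝ) : Poly n) =
      MvPolynomial.monomial M 1 * MvPolynomial.X β := by
  rw [MvPolynomial.X, MvPolynomial.monomial_mul, mul_one]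

/-- Exchanging a derivative in J with the index β costs a curvature, by `Gam_sub`. -/
theorem GamI_step {J J' : Fin n →₀ ℕ} {α β β' γ : Fin n}
    (h : J + Finsupp.single β 1 = J' + Finsupp.single β' 1) :
    GamI J α β γ - GamI J' α β' γ ∈ W0 n := by
  rcases eq_or_ne β β' with rfl | hne
  · rw [add_right_cancel h, sub_self]; exact zero_mem _
  have h1 := DFunLike.congr_fun h β'
  simp only [Finsupp.add_apply, Finsupp.single_apply, hne, if_false, if_true] at h1
  have hM : J = (J - Finsupp.single β' 1) + Finsupp.single β' 1 := by
    rw [tsub_add_cancel_of_le]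
    exact Finsupp.single_le_iff.2 (by omega)
  set M := J - Finsupp.single β' 1
  have hM' : J' = M + Finsupp.single β 1 := by
    rw [hM, add_right_comm] at h
    exact (add_right_cancel h).symm
  have h2 : GamI J α β γ - GamI J' α β' γ =
      MvPolynomial.monomial M (1 : ℝ) • ((2 : Poly n) • curvV (symb n) β' β γ α) := by
    rw [← Gam_sub, GamI, GamI, hM, hM', monomial_add_single, monomial_add_single, mul_smul,
      mul_smul, ← smul_sub, Gam_comm _ α β, Gam_comm _ α β']
    rfl
  rw [h2]
  exact Submodule.smul_mem _ _ (Submodule.smul_mem _ _ (Submodule.subset_span ⟨_, _, _, _, rfl⟩))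

/-- Two exchanges, through an intermediate symbol with indices α, α', suffice. Thus, modulo
curvatures, ∂_J Γ_{αβγ} depends only on γ and on the multi-index formed by J, α and β. -/
theorem GamI_sub {J J' : Fin n →₀ ℕ} {α β α' β' γ : Fin n}
    (h : J + Finsupp.single α 1 + Finsupp.single β 1 =
      J' + Finsupp.single α' 1 + Finsupp.single β' 1) :
    GamI J α β γ - GamI J' α' β' γ ∈ W0 n := by
  rcases eq_or_ne α α' with rfl | hne
  · refine GamI_step (add_right_cancel (b := Finsupp.single α 1) ?_)
    rw [add_right_comm, h, add_right_comm]
  set I := J + Finsupp.single α 1 + Finsupp.single β 1 with hI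
  obtain ⟨J'', hJ⟩ : ∃ J'', I = J'' + Finsupp.single α 1 + Finsupp.single α' 1 := by
    have hle : Finsupp.single α 1 + Finsupp.single α' 1 ≤ I := by
      intro i
      rcases eq_or_ne i α with rfl | h1
      · rw [hI]; simp [hne.symm]; omega
      · rcases eq_or_ne i α' with rfl | h2
        · rw [h]; simp [hne]; omega
        · simp [h1.symm, h2.symm]
    exact ⟨I - (Finsupp.single α 1 + Finsupp.single α' 1), by
      rw [add_assoc, tsub_add_cancel_of_le hle]⟩
  have h1 : GamI J α β γ - GamI J'' α α' γ ∈ W0 n := by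
    refine GamI_step (add_right_cancel (b := Finsupp.single α 1) ?_)
    rw [add_right_comm, ← hI, hJ, add_right_comm]
  have h2 : GamI J'' α' α γ - GamI J' α' β' γ ∈ W0 n := by
    refine GamI_step (add_right_cancel (b := Finsupp.single α' 1) ?_)
    rw [← hJ, h, add_right_comm]
  have h3 : GamI J'' α α' γ = GamI J'' α' α γ := by rw [GamI, Gam_comm, GamI]
  rw [h3] at h1
  simpa using add_mem h1 h2

open Classical in
/-- The values of the homotopy of the gauge variations. -/
def sigB (γ : Fin n) (I : Fin n →₀ ℕ) : STen n (Poly n) :=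
  if h : ∃ J α β, I = J + Finsupp.single α 1 + Finsupp.single β 1 then
    (1 / 2 : ℝ) • GamI h.choose h.choose_spec.choose h.choose_spec.choose_spec.choose γ
  else if h : ∃ α, I = Finsupp.single α 1 then (1 / 2 : ℝ) • eS (Poly n) h.choose γ else 0

theorem sigB_add (γ : Fin n) (J : Fin n →₀ ℕ) (α β : Fin n) : ∃ J' α' β',
    J + Finsupp.single α 1 + Finsupp.single β 1 =
      J' + Finsupp.single α' 1 + Finsupp.single β' 1 ∧
    sigB γ (J + Finsupp.single α 1 + Finsupp.single β 1) = (1 / 2 : ℝ) • GamI J' α' β' γ := by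
  have h : ∃ J' α' β', J + Finsupp.single α 1 + Finsupp.single β 1 =
      J' + Finsupp.single α' 1 + Finsupp.single β' 1 := ⟨J, α, β, rfl⟩
  refine ⟨h.choose, h.choose_spec.choose, h.choose_spec.choose_spec.choose,
    h.choose_spec.choose_spec.choose_spec, ?_⟩
  rw [sigB, dif_pos h]

/-- The decomposition of the multi-index used in `sigB` is an arbitrary choice; modulo curvatures it
does not matter. -/
theorem sigB_mem (γ : Fin n) (J : Fin n →₀ ℕ) (α β : Fin n) :
    sigB γ (J + Finsupp.single α 1 + Finsupp.single β 1) - (1 / 2 : ℝ) • GamI J α β γ ∈ W0 n := by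
  obtain ⟨J', α', β', h, h'⟩ := sigB_add γ J α β
  rw [h', ← smul_sub]
  exact Submodule.smul_of_tower_mem _ _ (GamI_sub h.symm)

theorem sigB_single (γ α : Fin n) :
    sigB γ (Finsupp.single α 1) = (1 / 2 : ℝ) • eS (Poly n) α γ := by
  have h1 : ¬ ∃ J α' β', (Finsupp.single α 1 : Fin n →₀ ℕ) =
      J + Finsupp.single α' 1 + Finsupp.single β' 1 := by
    rintro ⟨J, α', β', h⟩
    have := congrArg Finsupp.degree h
    simp at this
  have h2 : ∃ α', (Finsupp.single α 1 : Fin n →₀ ℕ) = Finsupp.single α' 1 := ⟨α, rfl⟩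
  rw [sigB, dif_neg h1, dif_pos h2]
  rw [← (Finsupp.single_left_inj one_ne_zero).1 h2.choose_spec]

theorem sigB_zero (γ : Fin n) : sigB γ 0 = 0 := by
  rw [sigB, dif_neg, dif_neg]
  · rintro ⟨α, h⟩
    have := congrArg Finsupp.degree h
    simp at this
  · rintro ⟨J, α', β', h⟩
    have := congrArg Finsupp.degree h
    simp at this

/-- The homotopy of the gauge variations. -/
def sig (n : ℕ) : Vec n (Poly n) →ₗ[ℝ] STen n (Poly n) :=
  ∑ γ, (MvPolynomial.basisMonomials (Fin n) ℝ).constr ℝ (sigB γ) ∘ₗ LinearMap.proj γ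

theorem sig_single (γ : Fin n) (I : Fin n →₀ ℕ) :
    sig n (Pi.single γ (MvPolynomial.monomial I 1)) = sigB γ I := by
  have := (MvPolynomial.basisMonomials (Fin n) ℝ).constr_basis ℝ (sigB γ) I
  rw [MvPolynomial.coe_basisMonomials] at this
  simp only [sig, LinearMap.sum_apply, LinearMap.comp_apply, LinearMap.proj_apply]
  rw [Finset.sum_eq_single γ]
  · rw [Pi.single_eq_same, this]
  · intro δ _ hδ; rw [Pi.single_eq_of_ne hδ, map_zero]
  · simp

theorem Vec.hom_ext {W : Type*} [AddCommGroup W] [Module ℝ W] {f g : Vec n (Poly n) →ₗ[ℝ] W}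
    (h : ∀ γ I, f (Pi.single γ (MvPolynomial.monomial I 1)) =
      g (Pi.single γ (MvPolynomial.monomial I 1))) : f = g :=
  LinearMap.pi_ext' fun γ => (MvPolynomial.basisMonomials (Fin n) ℝ).ext fun I => by
    simpa using h γ I

theorem exists_single_of_ne {I : Fin n →₀ ℕ} (h : I ≠ 0) :
    ∃ J ρ, I = J + Finsupp.single ρ 1 := by
  obtain ⟨ρ, hρ⟩ := Finsupp.ne_iff.1 h
  exact ⟨I - Finsupp.single ρ 1, ρ, (tsub_add_cancel_of_le
    (Finsupp.single_le_iff.2 (Nat.one_le_iff_ne_zero.2 hρ))).symm⟩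

theorem rgam_monomial (I : Fin n →₀ ℕ) (α β : Fin n) :
    rgam n (MvPolynomial.monomial I (1 : ℝ) • eS (Poly n) α β) =
      Pi.single β (MvPolynomial.monomial (I + Finsupp.single α 1) 1) +
        Pi.single α (MvPolynomial.monomial (I + Finsupp.single β 1) 1) := by
  have hs : ∀ (p : Poly n) (γ : Fin n), p • (Pi.single γ 1 : Vec n (Poly n)) = Pi.single γ p :=
    fun p γ => by rw [← Pi.single_smul, smul_eq_mul, mul_one]
  change gamV (symb n) _ = _
  rw [map_smul, gamV_eS, smul_add, smul_smul, smul_smul, hs, hs, monomial_add_single,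
    monomial_add_single]
  rfl

theorem STen.real_hom_ext {W : Type*} [AddCommGroup W] [Module ℝ W]
    {f g : STen n (Poly n) →ₗ[ℝ] W}
    (h : ∀ (I : Fin n →₀ ℕ) (α β : Fin n), f (MvPolynomial.monomial I (1 : ℝ) • eS (Poly n) α β) =
      g (MvPolynomial.monomial I (1 : ℝ) • eS (Poly n) α β)) : f = g := by
  have h2 : ∀ (p : Poly n) (α β : Fin n), f (p • eS (Poly n) α β) = g (p • eS (Poly n) α β) := by
    intro p α β
    induction p using MvPolynomial.induction_on' with
    | monomial I r =>
      have h3 : (MvPolynomial.monomial I r : Poly n) • eS (Poly n) α β =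
          r • (MvPolynomial.monomial I (1 : ℝ) • eS (Poly n) α β) := by
        rw [← smul_assoc, MvPolynomial.smul_monomial, smul_eq_mul, mul_one]
      rw [h3, f.map_smul r, g.map_smul r, h]
    | add p q hp hq => rw [add_smul, map_add, map_add, hp, hq]
  refine LinearMap.ext fun x => ?_
  obtain ⟨c, -, rfl⟩ := STen.exists_coeff (symb n) x
  simp only [map_sum, h2]

theorem half_smul_two : (1 / 2 : ℝ) • (2 : Poly n) = 1 := by
  have : (2 : Poly n) = (2 : ℝ) • 1 := by rw [two_smul]; norm_num
  rw [this, smul_smul]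
  norm_num

/-- Modulo gauge variations, every symmetric tensor is a curvature. -/
theorem sub_sig_rgam (x : STen n (Poly n)) : x - sig n (rgam n x) ∈ W0 n := by
  have h1 : ∀ (I : Fin n →₀ ℕ) (α β : Fin n), MvPolynomial.monomial I (1 : ℝ) • eS (Poly n) α β -
      sig n (rgam n (MvPolynomial.monomial I (1 : ℝ) • eS (Poly n) α β)) ∈ W0 n := by
    intro I α β
    rw [rgam_monomial, map_add, sig_single, sig_single]
    rcases eq_or_ne I 0 with rfl | hI
    -- On the undifferentiated field the homotopy recovers h itself.
    · rw [zero_add, zero_add, sigB_single, sigB_single, eS_comm β α]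
      have : (MvPolynomial.monomial (0 : Fin n →₀ ℕ) (1 : ℝ)) • eS (Poly n) α β -
          ((1 / 2 : ℝ) • eS (Poly n) α β + (1 / 2 : ℝ) • eS (Poly n) α β) = 0 := by
        rw [← MvPolynomial.C_apply, map_one, one_smul, ← add_smul, add_halves, one_smul, sub_self]
      rw [this]; exact zero_mem _
    -- Peel off one derivative ∂_ρ: the homotopy returns half of ∂_J (Γ_{ραβ} + Γ_{ρβα}) modulo
    -- curvatures, and by `Gam_add` this is ∂_J ∂_ρ h_{αβ}.
    · obtain ⟨J, ρ, rfl⟩ := exists_single_of_ne hI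
      have h2 := add_mem (sigB_mem β J ρ α) (sigB_mem α J ρ β)
      have h3 : MvPolynomial.monomial (J + Finsupp.single ρ 1) (1 : ℝ) • eS (Poly n) α β =
          (1 / 2 : ℝ) • GamI J ρ α β + (1 / 2 : ℝ) • GamI J ρ β α := by
        rw [← smul_add, GamI, GamI, ← smul_add, Gam_add, smul_smul, monomial_add_single, mul_smul,
          smul_smul, ← smul_assoc]
        congr 1
        rw [mul_left_comm, ← smul_mul_assoc, half_smul_two, one_mul]
        rfl
      rw [h3, ← neg_mem_iff]
      convert h2 using 1
      abel
  have h2 : ((W0 n).restrictScalars ℝ).mkQ ∘ₗ (LinearMap.id - sig n ∘ₗ rgam n) = 0 :=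
    STen.real_hom_ext fun I α β => (Submodule.Quotient.mk_eq_zero _).2 (h1 I α β)
  exact (Submodule.Quotient.mk_eq_zero _).1 (DFunLike.congr_fun h2 x)

/-- The coefficient of the undifferentiated ghost. -/
def phi1 (α : Fin n) : Vec n (Poly n) →ₗ[ℝ] ℝ := MvPolynomial.lcoeff ℝ 0 ∘ₗ LinearMap.proj α

/-- The antisymmetric coefficient of the first derivatives of the ghosts. -/
def phi2 (α β : Fin n) : Vec n (Poly n) →ₗ[ℝ] ℝ :=
  MvPolynomial.lcoeff ℝ (Finsupp.single α 1) ∘ₗ LinearMap.proj β -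
    MvPolynomial.lcoeff ℝ (Finsupp.single β 1) ∘ₗ LinearMap.proj α

theorem phi1_apply (α : Fin n) (w : Vec n (Poly n)) : phi1 α w = (w α).coeff 0 := rfl

theorem phi2_apply (α β : Fin n) (w : Vec n (Poly n)) :
    phi2 α β w = (w β).coeff (Finsupp.single α 1) - (w α).coeff (Finsupp.single β 1) := rfl

/-- Pairs of indices. -/
abbrev Pairs (n : ℕ) : Type := {p : Fin n × Fin n // p.1 < p.2}

/-- The projector on the derivatives of the ghosts that are not gauge variations. -/
def projP (n : ℕ) : Vec n (Poly n) →ₗ[ℝ] Vec n (Poly n) :=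
  ∑ α, (phi1 α).smulRight (Pi.single α 1) +
    ∑ p : Pairs n, (phi2 p.1.1 p.1.2).smulRight ((1 / 2 : ℝ) •
      (Pi.single p.1.2 (MvPolynomial.X p.1.1) - Pi.single p.1.1 (MvPolynomial.X p.1.2)))

theorem single_coeff (γ δ : Fin n) (I J : Fin n →₀ ℕ) :
    MvPolynomial.coeff J ((Pi.single γ (MvPolynomial.monomial I (1 : ℝ)) : Vec n (Poly n)) δ) =
      if δ = γ ∧ I = J then 1 else 0 := by
  classical
  by_cases h : δ = γ
  · subst h; simp [MvPolynomial.coeff_monomial]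
  · simp [h]

/-- By the order of derivatives: C_γ is no gauge variation and is kept by `projP`; a first
derivative is half a gauge variation plus its antisymmetric part, kept by `projP`; a derivative of
order two or more is half the gauge variation of a differentiated Christoffel symbol. -/
theorem rgam_sig (w : Vec n (Poly n)) : rgam n (sig n w) + projP n w = w := by
  suffices h : rgam n ∘ₗ sig n + projP n = LinearMap.id from DFunLike.congr_fun h w
  refine Vec.hom_ext fun γ I => ?_
  rw [LinearMap.add_apply, LinearMap.comp_apply, sig_single, LinearMap.id_apply]
  have h1 : ∀ α, phi1 α (Pi.single γ (MvPolynomial.monomial I 1) : Vec n (Poly n)) =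
      if α = γ ∧ I = 0 then 1 else 0 := fun α => by rw [phi1_apply, single_coeff]
  have h2 : ∀ α β, phi2 α β (Pi.single γ (MvPolynomial.monomial I 1) : Vec n (Poly n)) =
      (if β = γ ∧ I = Finsupp.single α 1 then 1 else 0) -
        if α = γ ∧ I = Finsupp.single β 1 then 1 else 0 := fun α β => by
    rw [phi2_apply, single_coeff, single_coeff]
  simp only [projP, LinearMap.add_apply, LinearMap.sum_apply, LinearMap.smulRight_apply, h1, h2]
  have hI0 : ∀ α : Fin n, (0 : Fin n →₀ ℕ) ≠ Finsupp.single α 1 := fun α h => by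
    have := congrArg Finsupp.degree h
    simp at this
  rcases eq_or_ne I 0 with rfl | hI
  · rw [sigB_zero, map_zero]
    simp only [hI0, and_false, if_false, sub_zero, zero_smul, Finset.sum_const_zero, add_zero,
      and_true, zero_add]
    rw [Finset.sum_eq_single γ]
    · simp
    · intro b _ hb; simp [hb]
    · simp
  obtain ⟨J, α, rfl⟩ := exists_single_of_ne hI
  simp only [hI, and_false, if_false, zero_smul, Finset.sum_const_zero, zero_add]
  rcases eq_or_ne J 0 with rfl | hJ
  · simp only [zero_add, Finsupp.single_left_inj one_ne_zero]
    have h3 : rgam n (sigB γ (Finsupp.single α 1)) = (1 / 2 : ℝ) •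
        ((Pi.single γ (MvPolynomial.X α) : Vec n (Poly n)) +
          Pi.single α (MvPolynomial.X γ)) := by
      have := rgam_monomial 0 α γ
      rw [← MvPolynomial.C_apply, map_one, one_smul, zero_add, zero_add] at this
      rw [sigB_single, map_smul, this]
      rfl
    rw [h3]
    change _ = (Pi.single γ (MvPolynomial.X α) : Vec n (Poly n))
    -- At most one ordered pair contributes, the one with entries α and γ; their order decides the
    -- sign.
    rcases lt_trichotomy α γ with h | h | h
    · rw [Finset.sum_eq_single ⟨(α, γ), h⟩]
      · simp only [true_and, if_true, h.ne, false_and, if_false]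
        module
      · rintro ⟨⟨a, b⟩, hab⟩ - hne
        simp only at hab
        simp only [ne_eq, Subtype.mk.injEq, Prod.mk.injEq, not_and] at hne
        rw [if_neg (fun h' => hne h'.2.symm h'.1),
          if_neg (fun h' => lt_asymm h ((h'.1.symm.trans_lt hab).trans_eq h'.2.symm)), sub_zero,
            zero_smul]
      · simp
    · subst h
      rw [Finset.sum_eq_zero]
      · module
      · rintro ⟨⟨a, b⟩, hab⟩ -
        simp only at hab
        rw [if_neg (fun h => hab.ne (h.2.symm.trans h.1.symm)),
          if_neg (fun h => hab.ne (h.1.trans h.2)), sub_zero, zero_smul]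
    · rw [Finset.sum_eq_single ⟨(γ, α), h⟩]
      · simp only [true_and, if_true, h.ne', false_and, if_false]
        module
      · rintro ⟨⟨a, b⟩, hab⟩ - hne
        simp only at hab
        simp only [ne_eq, Subtype.mk.injEq, Prod.mk.injEq, not_and] at hne
        rw [if_neg (fun h' => lt_asymm h (h'.2.trans_lt (hab.trans_eq h'.1))),
          if_neg (fun h' => hne h'.1 h'.2.symm), sub_zero, zero_smul]
      · simp
  · obtain ⟨J, β, rfl⟩ := exists_single_of_ne hJ
    have h3 : ∀ δ : Fin n, (J + Finsupp.single β 1 + Finsupp.single α 1) ≠ Finsupp.single δ 1 := by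
      intro δ h
      have := congrArg Finsupp.degree h
      simp at this
    simp only [h3, and_false, if_false, sub_zero, zero_smul, Finset.sum_const_zero, add_zero]
    obtain ⟨J', α', β', h4, h5⟩ := sigB_add γ J β α
    rw [h5, map_smul, h4]
    change (1 / 2 : ℝ) • gamV (symb n) _ = _
    rw [GamI, map_smul, gamV_Gam, monomial_add_single, monomial_add_single]
    rw [smul_smul, ← smul_assoc, ← Pi.single_smul, smul_eq_mul, mul_one]
    congr 1
    rw [MvPolynomial.smul_eq_C_mul]
    have : (MvPolynomial.C (1 / 2) : Poly n) + MvPolynomial.C (1 / 2) = 1 := (symb n).two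
    simp only [symb]
    generalize (MvPolynomial.C (1 / 2) : Poly n) = q at this ⊢
    linear_combination (MvPolynomial.monomial J' 1 * MvPolynomial.X α' * MvPolynomial.X β') * this

theorem phi1_rgam (α : Fin n) (x : STen n (Poly n)) : phi1 α (rgam n x) = 0 := by
  suffices h : phi1 α ∘ₗ rgam n = 0 from DFunLike.congr_fun h x
  refine STen.real_hom_ext fun I β γ => ?_
  have h0 : ∀ δ : Fin n, I + Finsupp.single δ 1 ≠ 0 := fun δ h => by
    have := congrArg Finsupp.degree h
    simp at this
  rw [LinearMap.comp_apply, rgam_monomial, map_add, phi1_apply, phi1_apply, single_coeff,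
    single_coeff]
  simp [h0]

/-- The only first derivatives in a gauge variation come from the undifferentiated field, and they
are symmetric. -/
theorem phi2_rgam (α β : Fin n) (x : STen n (Poly n)) : phi2 α β (rgam n x) = 0 := by
  suffices h : phi2 α β ∘ₗ rgam n = 0 from DFunLike.congr_fun h x
  refine STen.real_hom_ext fun I γ δ => ?_
  rw [LinearMap.comp_apply, rgam_monomial, map_add, phi2_apply, phi2_apply, single_coeff,
    single_coeff, single_coeff, single_coeff]
  rcases eq_or_ne I 0 with rfl | hI
  · simp only [zero_add, Finsupp.single_left_inj one_ne_zero, LinearMap.zero_apply]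
    simp only [and_comm, eq_comm]
    ring
  · obtain ⟨J, ρ, rfl⟩ := exists_single_of_ne hI
    have h3 : ∀ δ ε : Fin n, (J + Finsupp.single ρ 1 + Finsupp.single δ 1) ≠
        Finsupp.single ε 1 := by
      intro δ ε h
      have := congrArg Finsupp.degree h
      simp at this
    simp [h3]

end PauliFierz
end

noncomputable section

namespace PauliFierz

open GradedPoly

variable {n N : ℕ}

/-! ### The forms that depend on the ghosts through their gauge variations only -/

theorem phiO_combo (a : Fin N) (φ ψ : Vec n (Poly n) →ₗ[ℝ] ℝ) (r s : ℝ) (x : MAlg n N) :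
    phiO a (r • φ + s • ψ) x = r • phiO a φ x + s • phiO a ψ x := by
  have : phiO a (r • φ + s • ψ) = r • phiO a φ + s • phiO (N := N) a ψ := by
    refine IsOdd.ext_jet (phiO_isOdd _ _)
      (((phiO_isOdd a φ).smul r).add ((phiO_isOdd a ψ).smul s)) ?_ ?_
    · intro μ; simp
    · intro b v
      simp only [phiO_L, LinearMap.add_apply, LinearMap.smul_apply]
      split_ifs
      · rw [add_smul, smul_assoc, smul_assoc]
      · simp
  rw [this]; rfl

theorem phiX_phi1 (α μ : Fin n) : phiX (phi1 α) μ = 0 := by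
  ext w
  simp [phiX, phi1, MvPolynomial.coeff_X_mul']

/-- The antisymmetric functional precomposed with ∂_μ falls back on `phi1`, while `phi1` precomposed
with ∂_μ vanishes. Hence the undifferentiated ghosts have to be removed first. -/
theorem phiX_phi2 (α β μ : Fin n) : phiX (phi2 α β) μ =
    (if μ = α then 1 else 0 : ℝ) • phi1 β + (-if μ = β then 1 else 0 : ℝ) • phi1 α := by
  refine LinearMap.ext fun w => ?_
  simp only [phiX, LinearMap.comp_apply, LinearMap.restrictScalars_apply, LinearMap.lsmul_apply,
    phi2_apply, Pi.smul_apply, smul_eq_mul, MvPolynomial.coeff_X_mul', LinearMap.add_apply,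
    LinearMap.smul_apply, phi1_apply, Finsupp.mem_support_iff, Finsupp.single_apply]
  by_cases h1 : μ = α <;> by_cases h2 : μ = β <;> simp [h1, h2, eq_comm] <;> aesop

/-- The operators that remove an undifferentiated ghost. -/
def Dgh1 (i : Fin N × Fin n) : Module.End ℝ (MAlg n N) := phiO i.1 (phi1 i.2)

/-- The undifferentiated ghosts. -/
def cgh1 (i : Fin N × Fin n) : MAlg n N := L i.1 (js .gh i.2 1)

/-- The operators that remove an antisymmetrized first derivative of a ghost. -/
def Dgh2 (i : Fin N × Pairs n) : Module.End ℝ (MAlg n N) := phiO i.1 (phi2 i.2.1.1 i.2.1.2)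

/-- The antisymmetrized first derivatives of the ghosts. -/
def cgh2 (i : Fin N × Pairs n) : MAlg n N :=
  L i.1 (js .gh i.2.1.2 ((1 / 2 : ℝ) • MvPolynomial.X i.2.1.1) -
    js .gh i.2.1.1 ((1 / 2 : ℝ) • MvPolynomial.X i.2.1.2))

theorem js_gh (α : Fin n) (p : Poly n) : (js .gh α p : Jet n) .gh = Pi.single α p := by
  simp [js]

theorem ghost_mem (a : Fin N) (α : Fin n) (p : Poly n) :
    L a (js .gh α p) ∈ Hom n N (0, 0, 1, 1, 0, 0) := by
  rw [L_js]; exact U_mem _ _ _ _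

theorem Dgh1_anti (i : Fin N × Fin n) : Anti (Dgh1 i) (⊤ : Submodule ℝ (MAlg n N)) where
  dH x _ := phiO_dH fun μ => by
    rw [phiX_phi1]
    have := phiO_combo i.1 (0 : Vec n (Poly n) →ₗ[ℝ] ℝ) 0 0 0 x
    simpa using this
  dl x _ := phiO_dl x
  rho x _ := phiO_rho x

theorem ghostOps1 : GhostOps (⊤ : Submodule ℝ (MAlg n N)) Dgh1 cgh1 where
  isOdd i := phiO_isOdd _ _
  shifts i := phiO_shifts _ _
  anti := Dgh1_anti
  anticomm i j x := phiO_anticomm _ _ _ _ x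
  dual i j := by
    simp only [Dgh1, cgh1, phiO_L, js_gh, phi1_apply]
    by_cases h1 : j.1 = i.1 <;> by_cases h2 : j.2 = i.2
    · have : i = j := Prod.ext h1.symm h2.symm
      subst this; simp
    · have : i ≠ j := fun h => h2 (by rw [h])
      simp [this, Pi.single_eq_of_ne (Ne.symm h2)]
    · have : i ≠ j := fun h => h1 (by rw [h])
      simp [h1, this]
    · have : i ≠ j := fun h => h1 (by rw [h])
      simp [h1, this]
  mem _ _ _ := trivial
  mul_mem _ _ _ := trivial
  zero _ _ _ _ := trivial
  c_mem i := ghost_mem _ _ _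

/-- The forms that do not contain undifferentiated ghosts. -/
def Y1 (n N : ℕ) : Submodule ℝ (MAlg n N) := KerL ⊤ Dgh1 Finset.univ.toList

theorem mem_Y1 {x : MAlg n N} : x ∈ Y1 n N ↔ ∀ a α, phiO a (phi1 α) x = 0 := by
  rw [Y1, mem_KerL]
  simp [Dgh1]

theorem Y1_stable : Stable (Y1 n N) := ghostOps1.stable Stable.top _

theorem Y1_van (hn : 3 ≤ n) {k m g : ℤ} (hk : 2 ≤ k) (hg : 0 < g) : Van (Y1 n N) k m g := by
  obtain ⟨g, rfl⟩ : ∃ g' : ℕ, g = g' + 1 := ⟨(g - 1).toNat, by omega⟩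
  exact ghostOps1.van hn Stable.top (fun k m g hk hg => Van.of_weight hn (by omega) hg) _ g k m hk

/-- This needs the restriction to `Y1`: the failure to anticommute with `d` consists of operators
removing undifferentiated ghosts, which vanish there. -/
theorem Dgh2_anti (i : Fin N × Pairs n) : Anti (Dgh2 i) (Y1 n N) where
  dH x hx := phiO_dH fun μ => by
    rw [phiX_phi2, phiO_combo, mem_Y1.1 hx, mem_Y1.1 hx, smul_zero, smul_zero, add_zero]
  dl x _ := phiO_dl x
  rho x _ := phiO_rho x

theorem phi1_cgh2 (a : Fin N) (α : Fin n) (i : Fin N × Pairs n) :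
    phiO a (phi1 α) (cgh2 i) = 0 := by
  rw [cgh2, phiO_L, Pi.sub_apply, js_gh, js_gh, map_sub, phi1_apply, phi1_apply]
  have h : ∀ (γ δ : Fin n), MvPolynomial.coeff 0
      ((Pi.single γ ((1 / 2 : ℝ) • MvPolynomial.X δ) : Vec n (Poly n)) α) = 0 := fun γ δ => by
    by_cases h : α = γ
    · subst h; simp
    · simp [Pi.single_eq_of_ne h]
  simp only [h, sub_zero, zero_smul, ite_self]

theorem coeff_single_X (γ δ β α : Fin n) : MvPolynomial.coeff (Finsupp.single α 1)
      ((Pi.single γ ((1 / 2 : ℝ) • MvPolynomial.X δ) : Vec n (Poly n)) β) =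
    if β = γ ∧ δ = α then 1 / 2 else 0 := by
  by_cases h : β = γ
  · subst h
    rw [Pi.single_eq_same, MvPolynomial.coeff_smul, MvPolynomial.coeff_X]
    simp [Finsupp.single_left_inj]
  · rw [Pi.single_eq_of_ne h]; simp [h]

theorem phi2_cgh2 (i j : Fin N × Pairs n) : Dgh2 i (cgh2 j) = if i = j then 1 else 0 := by
  obtain ⟨a, ⟨⟨α, β⟩, h⟩⟩ := i
  obtain ⟨b, ⟨⟨γ, δ⟩, h'⟩⟩ := j
  simp only [Dgh2, cgh2, phiO_L, js_gh, map_sub, phi2_apply, coeff_single_X]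
  simp only at h h'
  simp only [Prod.mk.injEq, Subtype.mk.injEq]
  by_cases hab : b = a
  · subst hab
    by_cases h1 : α = γ ∧ β = δ
    · obtain ⟨rfl, rfl⟩ := h1
      have h2 : ¬ (β = α ∧ β = α) := fun h2 => h.ne h2.1.symm
      have h3 : ¬ (α = β ∧ α = β) := fun h2 => h.ne h2.1
      simp only [h2, h3, if_true, if_false, and_self]
      norm_num
      rw [← add_smul, add_halves, one_smul]
    · have h2 : ¬ (β = δ ∧ γ = α) := fun h2 => h1 ⟨h2.2.symm, h2.1⟩
      have h3 : ¬ (α = γ ∧ δ = β) := fun h2 => h1 ⟨h2.1, h2.2.symm⟩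
      have h4 : ¬ (α = δ ∧ γ = β) := fun h4 => by
        obtain ⟨rfl, rfl⟩ := h4; exact lt_asymm h h'
      have h5 : ¬ (β = γ ∧ δ = α) := fun h4 => by
        obtain ⟨rfl, rfl⟩ := h4; exact lt_asymm h h'
      simp [h1, h2, h3, h4, h5]
  · simp [hab, Ne.symm hab]

theorem ghostOps2 : GhostOps (Y1 n N) Dgh2 cgh2 where
  isOdd i := phiO_isOdd _ _
  shifts i := phiO_shifts _ _
  anti := Dgh2_anti
  anticomm i j x := phiO_anticomm _ _ _ _ x
  dual := phi2_cgh2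
  mem i x hx := mem_Y1.2 fun a α => by
    rw [Dgh2, phiO_anticomm, mem_Y1.1 hx, map_zero, neg_zero]
  mul_mem i x hx := mem_Y1.2 fun a α => by
    rw [(phiO_isOdd _ _).leib, phi1_cgh2, mem_Y1.1 hx, zero_mul, mul_zero, add_zero]
  zero r hr := ghostOps1.hom_le _ hr
  c_mem i := by
    rw [cgh2, map_sub]
    exact sub_mem (ghost_mem _ _ _) (ghost_mem _ _ _)

/-- The forms that depend on the ghosts through their gauge variations only. -/
def Y2 (n N : ℕ) : Submodule ℝ (MAlg n N) := KerL (Y1 n N) Dgh2 Finset.univ.toList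

theorem mem_Y2 {x : MAlg n N} : x ∈ Y2 n N ↔
    (∀ i, Dgh1 i x = 0) ∧ ∀ i, Dgh2 i x = 0 := by
  rw [Y2, mem_KerL, mem_Y1]
  simp [Dgh1]

theorem Y2_stable : Stable (Y2 n N) := ghostOps2.stable Y1_stable _

theorem Y2_zero {r : Deg} (hr : Deg.gn r = 0) : Hom n N r ≤ Y2 n N := ghostOps2.hom_le _ hr

theorem Y2_van (hn : 3 ≤ n) {k m g : ℤ} (hk : 2 ≤ k) (hg : 0 < g) : Van (Y2 n N) k m g := by
  obtain ⟨g, rfl⟩ : ∃ g' : ℕ, g = g' + 1 := ⟨(g - 1).toNat, by omega⟩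
  exact ghostOps2.van hn Y1_stable (fun k m g hk hg => Y1_van hn hk hg) _ g k m hk

/-! ### The gauge variations -/

/-- The gauge variations of the jets. -/
def tgam (n : ℕ) : Jet n →ₗ[ℝ] Jet n := el .h .gh (rgam n)

/-- The homotopy of the gauge variations of the jets. -/
def tsig (n : ℕ) : Jet n →ₗ[ℝ] Jet n := el .gh .h (sig n)

theorem tgam_odd : OddJet (tgam n) (0, 0, 0, 1, 0, 0) := ⟨el_shifts _ (by decide), by decide⟩

theorem tsig_odd : OddJet (tsig n) (0, 0, 0, -1, 0, 0) := ⟨el_shifts _ (by decide), by decide⟩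

/-- The longitudinal differential. -/
def gamO (n N : ℕ) : Module.End ℝ (MAlg n N) := jO N (tgam n)

/-- The homotopy of the longitudinal differential. -/
def sigO (n N : ℕ) : Module.End ℝ (MAlg n N) := jO N (tsig n)

theorem gamO_acts : OActs (gamO n N) (tgam n) := tgam_odd.acts

theorem sigO_acts : OActs (sigO n N) (tsig n) := tsig_odd.acts

theorem gamO_shifts : Shifts MGen.deg (gamO n N) (0, 0, 0, 1, 0, 0) := tgam_odd.shifts_jO

theorem sigO_shifts : Shifts MGen.deg (sigO n N) (0, 0, 0, -1, 0, 0) := tsig_odd.shifts_jO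

theorem tgam_pLin : PLin (tgam n) := el_pLin _

theorem rgam_rD1 : rgam n ∘ₗ rD1 n = 0 := LinearMap.ext fun x => gamV_D1 (symb n) x

theorem tgam_tdl : tgam n ∘ₗ tdl n + tdl n ∘ₗ tgam n = 0 := by
  simp [tdl, tgam, LinearMap.add_comp, LinearMap.comp_add, el_el, el_el_ne, rgam_rD1, el_zero]

theorem gamO_sq : gamO n N * gamO n N = 0 := gamO_acts.sq (by simp [tgam, el_el_ne])

theorem gamO_anti (Y : Submodule ℝ (MAlg n N)) : Anti (gamO n N) Y where
  dH x _ := gamO_acts.dH_anti tgam_pLin x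
  dl x _ := gamO_acts.anti dl_acts tgam_tdl x
  rho x _ := gamO_acts.rho_anti (el_kLin (by decide) (by decide) _) x

theorem gamO_mem {x : MAlg n N} (hx : x ∈ Y2 n N) : gamO n N x ∈ Y2 n N := by
  rw [mem_Y2] at hx ⊢
  constructor
  · intro i
    have h := hx.1 i
    rw [Dgh1] at h ⊢
    rw [phiO_anti_acts gamO_acts (fun v => by rw [tgam, el_apply_self, phi1_rgam]), h, map_zero,
      neg_zero]
  · intro i
    have h := hx.2 i
    rw [Dgh2] at h ⊢
    rw [phiO_anti_acts gamO_acts (fun v => by rw [tgam, el_apply_self, phi2_rgam]), h, map_zero,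
      neg_zero]

theorem sigO_mem {x : MAlg n N} (hx : x ∈ Y2 n N) : sigO n N x ∈ Y2 n N := by
  have h0 : ∀ v : Jet n, tsig n v .gh = 0 := fun v => el_apply_ne (by decide) _ _
  rw [mem_Y2] at hx ⊢
  constructor
  · intro i
    have h := hx.1 i
    rw [Dgh1] at h ⊢
    rw [phiO_anti_acts sigO_acts (fun v => by rw [h0, map_zero]), h, map_zero, neg_zero]
  · intro i
    have h := hx.2 i
    rw [Dgh2] at h ⊢
    rw [phiO_anti_acts sigO_acts (fun v => by rw [h0, map_zero]), h, map_zero, neg_zero]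

theorem projP_even : EvenJet (n := n) (el .gh .gh (projP n)) 0 :=
  ⟨el_shifts _ (by decide), by decide⟩

/-- The derivation defined by `projP` vanishes on `Y2`. It can therefore be added to the
anticommutator of `gamO` and `sigO` without changing it there; the sum acts as the identity on all
ghosts. -/
theorem projP_eq (x : MAlg n N) : jE N (el .gh .gh (projP n)) x =
    ∑ i, cgh1 i * Dgh1 i x + ∑ i, cgh2 i * Dgh2 i x := by
  have hp : ∀ c ∈ Hom n N (0, 0, 1, 1, 0, 0), HasParity 1 c := fun c hc =>
    hasParity_of_mem hc (by norm_num [Deg.par])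
  have h : jE N (el .gh .gh (projP n)) = ∑ i, lmul (cgh1 (N := N) i) * Dgh1 i +
      ∑ i, lmul (cgh2 i) * Dgh2 i := by
    refine IsEven.ext_jet (jE_isEven _)
      ((IsEven.sum _ fun i _ => (phiO_isOdd _ _).odd_mul (hp _ (ghostOps1.c_mem i))).add
        (IsEven.sum _ fun i _ => (phiO_isOdd _ _).odd_mul (hp _ (ghostOps2.c_mem i)))) ?_ ?_
    · intro μ
      rw [projP_even.dx]
      simp [Dgh1, Dgh2]
    · intro a v
      rw [projP_even.L]
      simp only [LinearMap.add_apply, LinearMap.sum_apply, Module.End.mul_apply,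
        LinearMap.mulLeft_apply, Dgh1, Dgh2, phiO_L, Fintype.sum_prod_type]
      have e1 : ∑ b : Fin N, ∑ α, cgh1 (b, α) *
          (if a = b then phi1 α (v .gh) • (1 : MAlg n N) else 0) =
          ∑ α, phi1 α (v .gh) • cgh1 (a, α) := by
        rw [Finset.sum_eq_single a]
        · simp
        · intro b _ hb; simp [hb.symm]
        · simp
      have e2 : ∑ b : Fin N, ∑ p : Pairs n, cgh2 (b, p) *
          (if a = b then phi2 p.1.1 p.1.2 (v .gh) • (1 : MAlg n N) else 0) =
          ∑ p : Pairs n, phi2 p.1.1 p.1.2 (v .gh) • cgh2 (a, p) := by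
        rw [Finset.sum_eq_single a]
        · simp
        · intro b _ hb; simp [hb.symm]
        · simp
      rw [e1, e2]
      simp only [cgh1, cgh2, ← map_smul, ← map_sum, ← map_add]
      congr 1
      simp only [el, projP, LinearMap.comp_apply, LinearMap.add_apply, LinearMap.sum_apply,
        LinearMap.smulRight_apply, LinearMap.proj_apply, map_add, map_sum, js, map_smul, map_sub,
        smul_sub, LinearMap.single_apply]
  rw [h]
  simp

theorem rgam_comp_sig : rgam n ∘ₗ sig n + projP n = LinearMap.id := LinearMap.ext rgam_sig

theorem projP_rgam : projP n ∘ₗ rgam n = 0 := LinearMap.ext fun x => by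
  simp [projP, phi1_rgam, phi2_rgam]

/-- The anticommutator of the longitudinal differential and its homotopy, extended to all ghosts. -/
def lapM (n N : ℕ) : Module.End ℝ (MAlg n N) :=
  gamO n N * sigO n N + sigO n N * gamO n N + jE N (el .gh .gh (projP n))

/-- The action of `lapM` on the jets. -/
def tM (n : ℕ) : Jet n →ₗ[ℝ] Jet n := el .h .h (sig n ∘ₗ rgam n) + el .gh .gh LinearMap.id

theorem el_add {k l : Kind} (f g : (Idx n k → Poly n) →ₗ[ℝ] (Idx n l → Poly n)) :
    el k l (f + g) = el k l f + el k l g := by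
  rw [el, el, el, LinearMap.add_comp, LinearMap.comp_add]

theorem EActs.add {E E' : Module.End ℝ (MAlg n N)} {T T' : Jet n →ₗ[ℝ] Jet n} (h : EActs E T)
    (h' : EActs E' T') : EActs (E + E') (T + T') :=
  ⟨h.isEven.add h'.isEven, fun μ => by simp [h.dx, h'.dx], fun a v => by simp [h.L, h'.L]⟩

theorem tM_eq : tgam n ∘ₗ tsig n + tsig n ∘ₗ tgam n + el .gh .gh (projP n) = tM n := by
  rw [tM, tgam, tsig, el_el, el_el, ← rgam_comp_sig, el_add]
  abel

theorem lapM_acts : EActs (lapM n N) (tM n) := by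
  rw [← tM_eq]
  exact (gamO_acts.anticomm sigO_acts).add projP_even.acts

theorem tM_idem : tM n ∘ₗ tM n = tM n := by
  have h : (sig n ∘ₗ rgam n) ∘ₗ (sig n ∘ₗ rgam n) = sig n ∘ₗ rgam n := by
    have := congrArg (fun f => sig n ∘ₗ f ∘ₗ rgam n) (rgam_comp_sig (n := n))
    simpa [LinearMap.add_comp, LinearMap.comp_add, LinearMap.comp_assoc, projP_rgam] using this
  simp only [tM, LinearMap.add_comp, LinearMap.comp_add, el_el, h, LinearMap.id_comp]
  rw [el_el_ne (by decide), el_el_ne (by decide)]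
  simp

theorem tM_diag (v : Jet n) (k : Kind) (hv : v k = 0) : tM n v k = 0 := by
  by_cases h1 : k = .h
  · subst h1; simp [tM, el, hv]
  by_cases h2 : k = .gh
  · subst h2; simp [tM, el, hv]
  simp [tM, el, Pi.single_eq_of_ne h1, Pi.single_eq_of_ne h2]

theorem lapM_posSpec {r : Deg} (hr : 0 < Deg.gn r) {x : MAlg n N} (hx : x ∈ Hom n N r) :
    PosSpec (lapM n N) x := by
  refine lapM_acts.posSpec tM_idem tM_diag Deg.gn 1 (by norm_num) (by simp) ?_ hr hx
  intro k
  cases k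
  case gh => refine Or.inr ⟨by decide, fun i p => ?_⟩; simp [tM, el_js, el_js_ne]; rfl
  all_goals exact Or.inl (by decide)

theorem lapM_eq {x : MAlg n N} (hx : x ∈ Y2 n N) :
    (gamO n N * sigO n N + sigO n N * gamO n N) x = lapM n N x := by
  rw [mem_Y2] at hx
  rw [lapM, LinearMap.add_apply _ (jE N _), projP_eq]
  simp [hx.1, hx.2]

/-- The longitudinal differential is acyclic in positive ghost number. -/
theorem gamO_acyclic {r : Deg} (hr : 0 < Deg.gn r) {x : MAlg n N} (hx : x ∈ Hom n N r)
    (hY : x ∈ Y2 n N) (h0 : gamO n N x = 0) :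
    ∃ y ∈ Y2 n N, y ∈ Hom n N (r + (0, 0, 0, -1, 0, 0)) ∧ gamO n N y = x := by
  have hs : ∀ x ∈ Y2 n N, (gamO n N * sigO n N + sigO n N * gamO n N) x ∈ Y2 n N := fun x hx =>
    add_mem (gamO_mem (sigO_mem hx)) (sigO_mem (gamO_mem hx))
  have h1 : PosSpec (gamO n N * sigO n N + sigO n N * gamO n N) x := by
    obtain ⟨p, hp, hp'⟩ := lapM_posSpec hr hx
    exact ⟨p, hp, by rw [aeval_apply_congr hs (fun x hx => lapM_eq hx) p hY, hp']⟩
  obtain ⟨q, hq⟩ := h1.homotopy gamO_sq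
  rw [h0, map_zero, map_zero, add_zero] at hq
  refine ⟨_, sigO_mem (aeval_apply_mem hs q hY), sigO_shifts (aeval_mem_hom ?_ q hx), hq.symm⟩
  exact Shifts.add (gamO_shifts.comp sigO_shifts) (sigO_shifts.comp gamO_shifts)

/-- The gauge invariant forms without ghosts that are not gauge variations. -/
def Zg (n N : ℕ) : Submodule ℝ (MAlg n N) := Y2 n N ⊓ LinearMap.ker (gamO n N)

theorem Zg_stable : Stable (Zg n N) := Y2_stable.inf_ker (gamO_anti _) gamO_shifts

theorem eq_zero_of_gn {r : Deg} (hr : Deg.ml r < Deg.gn r) {x : MAlg n N} (hx : x ∈ Hom n N r) :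
    x = 0 :=
  eq_zero_of_nonneg (Deg.ml - Deg.gn) (by decide) (fun k => by cases k <;> decide)
    (by simpa using hr) hx

/-- The exact sequence of `gamO` on `Y2`, whose surjectivity onto `Zg` is `gamO_acyclic`. The
connecting map raises ghost number and antighost number at fixed polynomial degree, so the induction
is on m - g: every ghost is a field, and nothing exists for g > m. -/
theorem Zg_van (hn : 3 ≤ n) {k m g : ℤ} (hk : 2 ≤ k) (hg : 0 < g) : Van (Zg n N) k m g := by
  obtain ⟨d, hd⟩ : ∃ d : ℕ, m - g < d := ⟨(m - g + 1).toNat, by omega⟩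
  induction d generalizing k m g with
  | zero =>
    intro a _ ha c _ _
    have : a = 0 := eq_zero_of_gn (by simp; push_cast at hd; omega) ha
    exact ⟨0, zero_mem _, 0, zero_mem _, by simp [this]⟩
  | succ d ih =>
    refine Van.ker Y2_stable Zg_stable (gamO_anti _) gamO_shifts
      (fun x hx => ⟨gamO_mem hx, LinearMap.mem_ker.2 (DFunLike.congr_fun gamO_sq x)⟩)
      (fun r hr z hz hzr => ?_) (by omega) (Y2_van hn hk hg)
      (ih (by omega) (by omega) (by push_cast at hd; omega))
    obtain ⟨y, hy, -, h⟩ := gamO_acyclic (by omega) hzr hz.1 (LinearMap.mem_ker.1 hz.2)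
    exact ⟨y, hy, h⟩

end PauliFierz
end

noncomputable section

namespace PauliFierz

open GradedPoly

variable {n N : ℕ}

/-! ### The invariant polynomials -/

theorem _root_.GradedPoly.IsOdd.adjoin_mem {G : Type} {par : G → ℕ}
    {D : Module.End ℝ (GradedPoly par)} (hD : IsOdd D) {S : Set (GradedPoly par)}
    (hp : ∀ x ∈ S, parityInv par x ∈ Algebra.adjoin ℝ S)
    (h : ∀ x ∈ S, D x ∈ Algebra.adjoin ℝ S) {x : GradedPoly par}
    (hx : x ∈ Algebra.adjoin ℝ S) : D x ∈ Algebra.adjoin ℝ S := by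
  have hp' : ∀ x ∈ Algebra.adjoin ℝ S, parityInv par x ∈ Algebra.adjoin ℝ S := by
    have : Algebra.adjoin ℝ S ≤ (Algebra.adjoin ℝ S).comap (parityInv par) :=
      Algebra.adjoin_le fun x hx => hp x hx
    exact fun x hx => this hx
  induction hx using Algebra.adjoin_induction with
  | mem x hx => exact h x hx
  | algebraMap r =>
    rw [Algebra.algebraMap_eq_smul_one, map_smul, hD.map_one, smul_zero]
    exact zero_mem _
  | add x y _ _ hx hy => rw [map_add]; exact add_mem hx hy
  | mul x y hx hy ihx ihy =>
    rw [hD.leib]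
    exact add_mem (mul_mem ihx hy) (mul_mem (hp' x hx) ihy)

theorem _root_.GradedPoly.IsEven.adjoin_mem {G : Type} {par : G → ℕ}
    {D : Module.End ℝ (GradedPoly par)} (hD : IsEven D) {S : Set (GradedPoly par)}
    (h : ∀ x ∈ S, D x ∈ Algebra.adjoin ℝ S) {x : GradedPoly par}
    (hx : x ∈ Algebra.adjoin ℝ S) : D x ∈ Algebra.adjoin ℝ S := by
  induction hx using Algebra.adjoin_induction with
  | mem x hx => exact h x hx
  | algebraMap r =>
    rw [Algebra.algebraMap_eq_smul_one, map_smul, hD.map_one, smul_zero]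
    exact zero_mem _
  | add x y _ _ hx hy => rw [map_add]; exact add_mem hx hy
  | mul x y hx hy ihx ihy =>
    rw [hD.leib]
    exact add_mem (mul_mem ihx hy) (mul_mem hx ihy)

/-- The generators of the invariant polynomials. -/
def invGen (n N : ℕ) : Set (MAlg n N) :=
  {x | ∃ μ, x = dx μ} ∪ {x | ∃ a v, v .h ∈ W0 n ∧ v .gh = 0 ∧ x = L a v}

/-- The invariant polynomials of the extended algebra. -/
def Inv (n N : ℕ) : Submodule ℝ (MAlg n N) := (Algebra.adjoin ℝ (invGen n N)).toSubmodule

theorem dx_mem_Inv (μ : Fin n) : dx μ ∈ Inv n N := Algebra.subset_adjoin (Or.inl ⟨μ, rfl⟩)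

theorem L_mem_Inv (a : Fin N) {v : Jet n} (hv : v .h ∈ W0 n) (hv' : v .gh = 0) :
    L a v ∈ Inv n N := Algebra.subset_adjoin (Or.inr ⟨a, v, hv, hv', rfl⟩)

theorem one_mem_Inv : 1 ∈ Inv n N := one_mem (Algebra.adjoin ℝ (invGen n N))

theorem mul_mem_Inv {x y : MAlg n N} (hx : x ∈ Inv n N) (hy : y ∈ Inv n N) : x * y ∈ Inv n N :=
  mul_mem (S := Subalgebra ℝ (MAlg n N)) hx hy

/-- The parity involution of the jets. -/
def tpar (n : ℕ) : Jet n →ₗ[ℝ] Jet n where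
  toFun v k := (-1 : ℝ) ^ k.par • v k
  map_add' v w := by ext1 k; simp
  map_smul' r v := by ext1 k; simp [smul_comm r]

theorem parityInv_L (a : Fin N) (v : Jet n) : parityInv _ (L a v) = L a (tpar n v) := by
  suffices h : (parityInv _).toLinearMap ∘ₗ L a = L a ∘ₗ tpar n from DFunLike.congr_fun h v
  refine Jet.hom_ext fun k i I => ?_
  have h1 : tpar n (js k i (MvPolynomial.monomial I 1)) =
      (-1 : ℝ) ^ k.par • js k i (MvPolynomial.monomial I 1) := by
    ext1 l
    by_cases h : l = k
    · subst h; rfl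
    · simp [tpar, js, Pi.single_eq_of_ne h]
  rw [LinearMap.comp_apply, LinearMap.comp_apply, h1, map_smul, L_js, U_monomial]
  exact parityInv_gen _

theorem parityInv_invGen {x : MAlg n N} (hx : x ∈ invGen n N) :
    parityInv _ x ∈ Algebra.adjoin ℝ (invGen n N) := by
  rcases hx with ⟨μ, rfl⟩ | ⟨a, v, h1, h2, rfl⟩
  · rw [parityInv_dx]; exact neg_mem (dx_mem_Inv μ)
  · rw [parityInv_L]
    refine L_mem_Inv a ?_ ?_
    · simpa [tpar, Kind.par] using h1
    · simp [tpar, h2]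

theorem _root_.GradedPoly.IsOdd.mem_Inv {D : Module.End ℝ (MAlg n N)} (hD : IsOdd D)
    (hdx : ∀ μ, D (dx μ) ∈ Inv n N)
    (hL : ∀ a v, v .h ∈ W0 n → v .gh = 0 → D (L a v) ∈ Inv n N) {x : MAlg n N}
    (hx : x ∈ Inv n N) : D x ∈ Inv n N := by
  refine hD.adjoin_mem (fun _ => parityInv_invGen) ?_ hx
  rintro _ (⟨μ, rfl⟩ | ⟨a, v, h1, h2, rfl⟩)
  · exact hdx μ
  · exact hL a v h1 h2

theorem _root_.GradedPoly.IsEven.mem_Inv {D : Module.End ℝ (MAlg n N)} (hD : IsEven D)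
    (hdx : ∀ μ, D (dx μ) ∈ Inv n N)
    (hL : ∀ a v, v .h ∈ W0 n → v .gh = 0 → D (L a v) ∈ Inv n N) {x : MAlg n N}
    (hx : x ∈ Inv n N) : D x ∈ Inv n N := by
  refine hD.adjoin_mem ?_ hx
  rintro _ (⟨μ, rfl⟩ | ⟨a, v, h1, h2, rfl⟩)
  · exact hdx μ
  · exact hL a v h1 h2

theorem io_mem_Inv (μ : Fin n) {x : MAlg n N} (hx : x ∈ Inv n N) : io N μ x ∈ Inv n N := by
  refine (io_isOdd μ).mem_Inv (fun ν => ?_) (fun a v _ _ => ?_) hx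
  · rw [io_dx]; split_ifs
    · exact one_mem_Inv
    · exact zero_mem _
  · rw [io_L]; exact zero_mem _

theorem dH_mem_Inv {x : MAlg n N} (hx : x ∈ Inv n N) : dH n N x ∈ Inv n N := by
  refine dH_isOdd.mem_Inv (fun ν => ?_) (fun a v h1 h2 => ?_) hx
  · rw [dH_apply]
    exact Submodule.sum_mem _ fun μ _ => by rw [del_dx, mul_zero]; exact zero_mem _
  · rw [dH_apply]
    refine Submodule.sum_mem _ fun μ _ => mul_mem_Inv (dx_mem_Inv μ) ?_
    rw [del_L]
    exact L_mem_Inv a (Submodule.smul_mem _ _ h1) (by rw [Pi.smul_apply, h2, smul_zero])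

theorem dl_mem_Inv {x : MAlg n N} (hx : x ∈ Inv n N) : dl n N x ∈ Inv n N := by
  refine dl_acts.isOdd.mem_Inv (fun ν => ?_) (fun a v h1 h2 => ?_) hx
  · rw [dl_acts.dx]; exact zero_mem _
  · rw [dl_acts.L]
    refine L_mem_Inv a ?_ ?_
    · rw [tdl, LinearMap.add_apply, Pi.add_apply, el_apply_self, el_apply_ne (by decide), add_zero]
      exact rD1_mem_W0 _
    · rw [tdl, LinearMap.add_apply, Pi.add_apply, el_apply_ne (by decide),
        el_apply_ne (by decide), add_zero]

/-- The homotopy only produces antifields, which are invariant whatever map is used. -/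
theorem sO_mem_Inv (hn : 3 ≤ n) {x : MAlg n N} (hx : x ∈ Inv n N) : sO hn N x ∈ Inv n N := by
  refine (sO_acts hn).isOdd.mem_Inv (fun ν => ?_) (fun a v h1 h2 => ?_) hx
  · rw [(sO_acts hn).dx]; exact zero_mem _
  · rw [(sO_acts hn).L]
    refine L_mem_Inv a ?_ ?_
    · rw [ts, LinearMap.add_apply, Pi.add_apply, el_apply_ne (by decide), el_apply_ne (by decide),
        add_zero]
      exact zero_mem _
    · rw [ts, LinearMap.add_apply, Pi.add_apply, el_apply_ne (by decide),
        el_apply_ne (by decide), add_zero]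

/-- The weight by antighost number is chosen for this: h has weight zero, so K^μ kills the
curvatures and maps antifields to antifields. -/
theorem rho_mem_Inv {x : MAlg n N} (hx : x ∈ Inv n N) : rho n N Deg.ag x ∈ Inv n N := by
  rw [rho, LinearMap.sum_apply]
  refine Submodule.sum_mem _ fun μ _ => io_mem_Inv μ ?_
  refine (Kop_isEven _ μ).mem_Inv (fun ν => ?_) (fun a v h1 h2 => ?_) hx
  · rw [Kop_dx]; exact zero_mem _
  · rw [Kop_L]
    refine L_mem_Inv a ?_ ?_
    · have : wpd Deg.ag μ v .h = 0 := by ext1 i; simp [wpd, wt, Kind.deg]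
      rw [this]; exact zero_mem _
    · ext1 i; simp [wpd, h2]

theorem pr_mem_Inv : PrStable (Inv n N) := by
  intro r x hx
  have h1 : x ∈ ⨆ r, Hom n N r ⊓ Inv n N := by
    refine adjoin_le_iSup (fun r => Hom n N r ⊓ Inv n N) ⟨one_mem_hom, one_mem_Inv⟩
      (fun i j a ha b hb => ⟨mul_mem_hom ha.1 hb.1, mul_mem_Inv ha.2 hb.2⟩) ?_ hx
    rintro _ (⟨μ, rfl⟩ | ⟨a, v, h1, h2, rfl⟩)
    · exact Submodule.mem_iSup_of_mem _ ⟨dx_mem μ, dx_mem_Inv μ⟩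
    · have hv : v = ∑ k, Pi.single k (v k) := (Finset.univ_sum_single v).symm
      rw [hv, map_sum]
      refine Submodule.sum_mem _ fun k _ => Submodule.mem_iSup_of_mem k.deg ⟨?_, ?_⟩
      · refine L_mem a fun l hl => ?_
        by_contra h
        exact hl (Pi.single_eq_of_ne (fun h' => h (by rw [h'])) _)
      · refine L_mem_Inv a ?_ ?_
        · by_cases hk : k = .h
          · subst hk; rwa [Pi.single_eq_same]
          · rw [Pi.single_eq_of_ne (Ne.symm hk)]; exact zero_mem _
        · by_cases hk : k = .gh
          · subst hk; rwa [Pi.single_eq_same]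
          · rw [Pi.single_eq_of_ne (Ne.symm hk)]
  clear hx
  induction h1 using Submodule.iSup_induction' with
  | mem i y hy =>
    by_cases h : i = r
    · subst h; rw [pr, proj_of_mem hy.1]; exact hy.2
    · rw [pr, proj_of_mem_ne h hy.1]; exact zero_mem _
  | zero => rw [map_zero]; exact zero_mem _
  | add x y _ _ ihx ihy => rw [map_add]; exact add_mem ihx ihy

theorem gamO_Inv {x : MAlg n N} (hx : x ∈ Inv n N) : gamO n N x = 0 := by
  change x ∈ Algebra.adjoin ℝ (invGen n N) at hx
  induction hx using Algebra.adjoin_induction with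
  | mem x hx =>
    rcases hx with ⟨μ, rfl⟩ | ⟨a, v, h1, -, rfl⟩
    · exact gamO_acts.dx μ
    · rw [gamO_acts.L, tgam, el, LinearMap.comp_apply, LinearMap.comp_apply,
        LinearMap.proj_apply, rgam_W0 h1, map_zero, map_zero]
  | algebraMap r =>
    rw [Algebra.algebraMap_eq_smul_one, map_smul, gamO_acts.isOdd.map_one, smul_zero]
  | add x y _ _ hx hy => rw [map_add, hx, hy, add_zero]
  | mul x y _ _ hx hy => rw [gamO_acts.isOdd.leib, hx, hy, zero_mul, mul_zero, add_zero]

theorem lapM_Inv {x : MAlg n N} (hx : x ∈ Inv n N) : lapM n N x = 0 := by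
  change x ∈ Algebra.adjoin ℝ (invGen n N) at hx
  induction hx using Algebra.adjoin_induction with
  | mem x hx =>
    rcases hx with ⟨μ, rfl⟩ | ⟨a, v, h1, h2, rfl⟩
    · exact lapM_acts.dx μ
    · rw [lapM_acts.L, tM, LinearMap.add_apply, el, el]
      simp [rgam_W0 h1, h2]
  | algebraMap r =>
    rw [Algebra.algebraMap_eq_smul_one, map_smul, lapM_acts.isEven.map_one, smul_zero]
  | add x y _ _ hx hy => rw [map_add, hx, hy, add_zero]
  | mul x y _ _ hx hy => rw [lapM_acts.isEven.leib, hx, hy, zero_mul, mul_zero, add_zero]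

/-- The eigenspaces of `lapM`; the kernel is reduced to the invariant polynomials. -/
def eigM (n N : ℕ) (j : ℕ) : Submodule ℝ (MAlg n N) :=
  if j = 0 then Inv n N else LinearMap.ker (lapM n N - algebraMap ℝ _ j)

theorem eigM_apply {j : ℕ} {x : MAlg n N} (hx : x ∈ eigM n N j) : lapM n N x = (j : ℝ) • x := by
  rw [eigM] at hx
  split_ifs at hx with h
  · rw [lapM_Inv hx, h]; simp
  · have := LinearMap.mem_ker.1 hx
    rwa [LinearMap.sub_apply, Module.algebraMap_end_apply, sub_eq_zero] at this

theorem mem_eigM {j : ℕ} (hj : j ≠ 0) {x : MAlg n N} (hx : lapM n N x = (j : ℝ) • x) :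
    x ∈ eigM n N j := by
  rw [eigM, if_neg hj, LinearMap.mem_ker, LinearMap.sub_apply, hx, Module.algebraMap_end_apply,
    sub_self]

/-- A generator splits into its image under the projector `tM`, of eigenvalue 1, and a remainder of
eigenvalue 0. The `h`-part of the remainder is a combination of curvatures by `sub_sig_rgam`, and
its ghost part vanishes. Eigenvalues add up under products, so eigenvalue 0 arises only from
invariant factors. -/
theorem mem_iSup_eigM (x : MAlg n N) : x ∈ ⨆ j, eigM n N j := by
  refine adjoin_le_iSup (eigM n N) ?_ ?_ ?_
    (by rw [adjoin_gen]; trivial : x ∈ Algebra.adjoin ℝ (Set.range (gen MGen.par)))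
  · rw [eigM, if_pos rfl]; exact one_mem_Inv
  · intro i j a ha b hb
    by_cases h : i + j = 0
    · obtain ⟨rfl, rfl⟩ := Nat.add_eq_zero_iff.1 h
      rw [eigM, if_pos rfl] at *
      exact mul_mem_Inv ha hb
    · refine mem_eigM h ?_
      rw [mul_mem_ker_sub lapM_acts.isEven (eigM_apply ha) (eigM_apply hb)]
      push_cast; rfl
  · have h0 : ∀ x ∈ Inv n N, x ∈ ⨆ j, eigM n N j := fun x hx =>
      Submodule.mem_iSup_of_mem 0 (by rwa [eigM, if_pos rfl])
    rintro _ ⟨y, rfl⟩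
    cases y with
    | dx μ => exact h0 _ (dx_mem_Inv μ)
    | u k a i I =>
      rw [← U_monomial, ← L_js]
      set v := js k i (MvPolynomial.monomial I (1 : ℝ))
      rw [← add_sub_cancel (tM n v) v, map_add]
      refine add_mem (Submodule.mem_iSup_of_mem 1 (mem_eigM one_ne_zero ?_)) (h0 _ ?_)
      · rw [lapM_acts.L, ← LinearMap.comp_apply (tM n), tM_idem]; simp
      · refine L_mem_Inv a ?_ ?_
        · simp only [tM, Pi.sub_apply, LinearMap.add_apply, Pi.add_apply, el_apply_self,
            el_apply_ne (show Kind.h ≠ .gh by decide), add_zero]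
          exact sub_sig_rgam _
        · simp only [tM, Pi.sub_apply, LinearMap.add_apply, Pi.add_apply, el_apply_self,
            el_apply_ne (show Kind.gh ≠ .h by decide), zero_add, LinearMap.id_apply, sub_self]

theorem eq_zero_of_gn_neg {r : Deg} (hr : Deg.gn r < 0) {x : MAlg n N} (hx : x ∈ Hom n N r) :
    x = 0 :=
  eq_zero_of_nonneg Deg.gn (by decide) (fun k => by cases k <;> decide) hr hx

/-- The gauge invariant forms without ghosts are the invariant polynomials. -/
theorem mem_Inv_of_gamO {r : Deg} (hr : Deg.gn r = 0) {x : MAlg n N} (hx : x ∈ Hom n N r)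
    (h : gamO n N x = 0) : x ∈ Inv n N := by
  have h1 : ∃ y ∈ Inv n N, PosSpec (lapM n N) (x - y) := by
    have := mem_iSup_eigM x
    clear hx h
    induction this using Submodule.iSup_induction' with
    | mem j x hx =>
      by_cases hj : j = 0
      · subst hj
        rw [eigM, if_pos rfl] at hx
        exact ⟨x, hx, by rw [sub_self]; exact PosSpec.zero _⟩
      · exact ⟨0, zero_mem _, by
          rw [sub_zero]
          exact PosSpec.of_eigen (by exact_mod_cast hj) (eigM_apply hx)⟩
    | zero => exact ⟨0, zero_mem _, by rw [sub_self]; exact PosSpec.zero _⟩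
    | add x x' _ _ hx hx' =>
      obtain ⟨y, hy, hxy⟩ := hx
      obtain ⟨y', hy', hxy'⟩ := hx'
      exact ⟨y + y', add_mem hy hy', by rw [add_sub_add_comm]; exact hxy.add hxy'⟩
  obtain ⟨y, hy, hxy⟩ := h1
  -- Without ghosts `lapM` is the anticommutator of γ and σ; γx = 0 by hypothesis, and σx would have
  -- ghost number -1.
  have h2 : lapM n N x = 0 := by
    rw [← lapM_eq (Y2_zero hr hx)]
    simp only [LinearMap.add_apply, Module.End.mul_apply, h, map_zero, add_zero]
    rw [eq_zero_of_gn_neg (by simp [hr]) (sigO_shifts hx), map_zero]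
  have h3 := hxy.eq_zero (by rw [map_sub, h2, lapM_Inv hy, sub_zero])
  rwa [sub_eq_zero.1 h3]

/-! ### Triviality within the invariant polynomials -/

theorem lap_dH {κ : Deg →+ ℤ} : lap n N κ * dH n N = dH n N * lap n N κ := by
  rw [lap, add_mul, mul_add, mul_assoc (rho n N κ), dH_sq, mul_zero, add_zero,
    ← mul_assoc (dH n N) (dH n N), dH_sq, zero_mul, zero_add, mul_assoc]

/-- An exact form in `Y` is exact in `Y`, in positive weight. -/
theorem exists_primitive {κ : Deg →+ ℤ} (hκ : κ (1, 0, 0, 0, 0, 0) = 0)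
    (Y : Submodule ℝ (MAlg n N)) (hd : ∀ x ∈ Y, dH n N x ∈ Y) (hρ : ∀ x ∈ Y, rho n N κ x ∈ Y)
    {r : Deg} {x y : MAlg n N} (hy : y ∈ Hom n N r) (hx : x ∈ Y) (hr : 0 < κ r) (hn : r.1 < n)
    (h : x = dH n N y) : ∃ y' ∈ Y, x = dH n N y' := by
  have h1 : PosSpec (lap n N κ) x := by
    obtain ⟨p, hp, hp'⟩ := lap_posSpec hκ hy hr hn
    refine ⟨p, hp, ?_⟩
    rw [h, aeval_apply_comm lap_dH, hp', map_zero]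
  obtain ⟨q, hq⟩ := PosSpec.homotopy dH_sq h1
  rw [h, dH_dH, map_zero, map_zero, add_zero, ← h] at hq
  exact ⟨_, hρ _ (aeval_apply_mem (fun y hy => add_mem (hd _ (hρ _ hy)) (hρ _ (hd _ hy))) q hx),
    hq⟩

theorem dl_homotopy_Inv (hn : 3 ≤ n) {r : Deg} (hr : 0 < Deg.ag r - Deg.ta r) {x : MAlg n N}
    (hx : x ∈ Hom n N r) (hI : x ∈ Inv n N) (h0 : dl n N x = 0) :
    ∃ y ∈ Inv n N, y ∈ Hom n N (r + (0, 1, 0, 0, 0, 0)) ∧ x = dl n N y := by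
  obtain ⟨q, hq⟩ := dl_homotopy hn hr hx
  rw [h0, map_zero, map_zero, add_zero] at hq
  exact ⟨_, sO_mem_Inv hn (aeval_apply_mem (fun y hy => add_mem (dl_mem_Inv (sO_mem_Inv hn hy))
    (sO_mem_Inv hn (dl_mem_Inv hy))) q hI), sO_shifts hn (aeval_mem_hom (lapK_shifts hn) q hx), hq⟩

/-- Modulo trivial forms, the solutions can be chosen to be invariant. -/
theorem exists_invariant (hn : 3 ≤ n) {p k m : ℤ} (hk : 1 ≤ k) (hp : p ≤ n) {b c : MAlg n N}
    (hb : b ∈ Hom n N (p, k + 1, m, 0, 0, 0)) (h : dl n N b + dH n N c ∈ Inv n N) :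
    ∃ b0 ∈ Inv n N, ∃ u v, b = b0 + dl n N u + dH n N v := by
  obtain ⟨d, hd⟩ : ∃ d : ℕ, n - p = d := ⟨(n - p).toNat, by omega⟩
  induction d generalizing p k b c with
  | zero =>
    obtain rfl : p = n := by push_cast at hd; omega
    set c' := pr (n + -1, k, m, 0, 0, 0) c
    have hc' : c' ∈ Hom n N (n + -1, k, m, 0, 0, 0) := proj_mem _ _
    have hdb : dl n N b ∈ Hom n N (n, k, m, 0, 0, 0) := by simpa using dl_shifts hb
    have h' : dl n N b + dH n N c' ∈ Inv n N := by
      have := pr_mem_Inv (n, k, m, 0, 0, 0) _ h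
      rw [map_add, pr_dH, pr, proj_of_mem hdb] at this
      simpa using this
    -- Apply γ to the invariant form: γb is `dl`-closed modulo `d`, within `Zg`.
    have h1 : dl n N (gamO n N b) = dH n N (-gamO n N c') := by
      have := gamO_Inv h'
      rw [map_add, (gamO_anti ⊤).dl b trivial, (gamO_anti ⊤).dH c' trivial] at this
      rw [map_neg]
      exact (neg_add_eq_zero.1 this)
    have hZ : ∀ {r : Deg}, Deg.gn r = 0 → ∀ {x}, x ∈ Hom n N r → gamO n N x ∈ Zg n N :=
      fun hr x hx => ⟨gamO_mem (Y2_zero hr hx), LinearMap.mem_ker.2 (DFunLike.congr_fun gamO_sq x)⟩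
    have hgb : gamO n N b ∈ Hom n N (n, k + 1, m, 1, 0, 0) := by simpa using gamO_shifts hb
    obtain ⟨b1, hb1, e1, he1, hbe⟩ := Zg_van hn (by omega) (by omega) _ (hZ (by simp) hb) hgb _
      (neg_mem (hZ (by simp) hc')) h1
    obtain ⟨b1, hb1, e1, he1, hb1r, he1r, hbe⟩ := exists_homogeneous Zg_stable.pr hgb hb1 he1 hbe
    -- The primitives b1 and e1 have ghost number 1 and are γ-closed, hence γ-exact; β and ε correct
    -- b to a γ-closed form without ghosts.
    obtain ⟨β, -, hβr, hβ⟩ := gamO_acyclic (by simp) hb1r hb1.1 (LinearMap.mem_ker.1 hb1.2)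
    obtain ⟨ε, -, hεr, hε⟩ := gamO_acyclic (by simp) he1r he1.1 (LinearMap.mem_ker.1 he1.2)
    refine ⟨b + dl n N β + dH n N ε, mem_Inv_of_gamO (r := (n, k + 1, m, 0, 0, 0)) (by simp) ?_ ?_,
      -β, -ε, ?_⟩
    · have h2 := dl_shifts hβr
      have h3 := dH_shifts hεr
      simp only [Prod.mk_add_mk] at h2 h3
      refine add_mem (add_mem hb ?_) ?_
      · simpa using h2
      · simpa using h3
    · rw [map_add, map_add, (gamO_anti ⊤).dl β trivial, (gamO_anti ⊤).dH ε trivial, hβ, hε, hbe]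
      abel
    · rw [map_neg, map_neg]; abel
  | succ d ih =>
    set a := dl n N b + dH n N c with ha
    set a' := pr (p, k, m, 0, 0, 0) a with ha'
    have ha'I : a' ∈ Inv n N := pr_mem_Inv _ _ h
    have ha'r : a' ∈ Hom n N (p, k, m, 0, 0, 0) := proj_mem _ _
    have hdb : dl n N b ∈ Hom n N (p, k, m, 0, 0, 0) := by simpa using dl_shifts hb
    set c' := pr (p + -1, k, m, 0, 0, 0) c
    have hac : a' = dl n N b + dH n N c' := by
      rw [ha', ha, map_add, pr_dH, pr, proj_of_mem hdb]
      simp [c']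
    -- Apply `d`: the invariant form da' is `dl`-closed, so it is `dl` of an invariant g0, because
    -- the Koszul-Tate homotopy preserves invariance.
    have h1 : dH n N a' = -dl n N (dH n N b) := by
      rw [hac, map_add, dH_dH, add_zero, dl_dH, neg_neg]
    obtain ⟨g0, hg0I, hg0r, hg0⟩ := dl_homotopy_Inv hn (by simp; omega) (dH_shifts ha'r)
      (dH_mem_Inv ha'I) (by rw [h1, map_neg, dl_dl, neg_zero])
    have hg : dH n N b + g0 ∈ Hom n N (p + 1, k + 1, m, 0, 0, 0) := by
      have := dH_shifts hb
      simp only [Prod.mk_add_mk, add_zero] at this hg0r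
      exact add_mem this hg0r
    -- Then db + g0 is `dl`-closed, equal to dl g1. The equation dl g1 - db = g0 is the original
    -- problem one form degree higher, and g1 can be replaced by an invariant form modulo trivial
    -- terms.
    obtain ⟨g1, hg1r, hg1⟩ := dl_acyclic hn (by simp; omega) hg (by rw [map_add, ← hg0, h1]; abel)
    obtain ⟨β, hβ, u, v, huv⟩ := ih (p := p + 1) (k := k + 1) (b := g1) (c := -b) (by omega)
      (by push_cast at hd; omega) (by simpa using hg1r)
      (by rw [← hg1, map_neg, add_comm, neg_add_cancel_left]; exact hg0I)
      (by push_cast at hd; omega)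
    set v' := pr (p, k + 1 + 1, m, 0, 0, 0) v with hv'
    set β' := pr (p + 1, k + 1 + 1, m, 0, 0, 0) β with hβ'
    have huv' : g1 = β' + dl n N (pr (p + 1, k + 1 + 1 + 1, m, 0, 0, 0) u) + dH n N v' := by
      have h2 := congrArg (pr (p + 1, k + 1 + 1, m, 0, 0, 0)) huv
      rw [map_add, map_add, pr_dl, pr_dH, pr,
        proj_of_mem (r := (p + 1, k + 1 + 1, m, 0, 0, 0)) (by simpa using hg1r)] at h2
      rw [h2, hv']
      simp [hβ']
    have hv'r : v' ∈ Hom n N (p, k + 1 + 1, m, 0, 0, 0) := proj_mem _ _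
    have hbv : b + dl n N v' ∈ Hom n N (p, k + 1, m, 0, 0, 0) := by
      refine add_mem hb ?_
      simpa using dl_shifts hv'r
    -- The left side is invariant, so this exact form has an invariant primitive y'. It differs from
    -- b + dl v' by a `d`-closed, hence exact, form.
    have h3 : dl n N β' - g0 = dH n N (b + dl n N v') := by
      rw [map_add, sub_eq_iff_eq_add, add_right_comm, hg1, huv', map_add, map_add, dl_dl, dl_dH]
      abel
    obtain ⟨y, hy, hy'⟩ := exists_primitive (κ := Deg.ag) rfl (Inv n N) (fun _ => dH_mem_Inv)
      (fun _ => rho_mem_Inv) hbv (sub_mem (dl_mem_Inv (pr_mem_Inv _ _ hβ)) hg0I) (by simp; omega)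
      (by push_cast at hd; simp; omega) h3
    set y' := pr (p, k + 1, m, 0, 0, 0) y with hy'_def
    have hyr : dH n N y' = dH n N (b + dl n N v') := by
      have h4 := congrArg (pr (p + 1, k + 1, m, 0, 0, 0)) (h3.symm.trans hy')
      rw [pr_dH, pr_dH, pr, proj_of_mem (a := b + dl n N v') (by simpa using hbv)] at h4
      rw [h4, hy'_def]
      simp
    obtain ⟨w, -, -, hw⟩ := dH_acyclic (κ := Deg.ag) rfl ⊤ (fun _ _ => trivial)
      (fun _ _ => trivial) (sub_mem hbv (proj_mem _ y : y' ∈ _)) trivial (by simp; omega)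
      (by push_cast at hd; simp; omega) (by rw [map_sub, hyr, sub_self])
    refine ⟨y', pr_mem_Inv _ _ hy, -v', w, ?_⟩
    rw [← hw, map_neg]
    abel

/-- Triviality can be realized within the invariant polynomials. -/
theorem exists_invariant_solution (hn : 3 ≤ n) {p k m : ℤ} (hk : 1 ≤ k) {a b c : MAlg n N}
    (ha : a ∈ Hom n N (p, k, m, 0, 0, 0)) (haI : a ∈ Inv n N) (h : a = dl n N b + dH n N c) :
    ∃ b ∈ Inv n N, ∃ c ∈ Inv n N, b ∈ Hom n N (p, k + 1, m, 0, 0, 0) ∧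
      c ∈ Hom n N (p + -1, k, m, 0, 0, 0) ∧ a = dl n N b + dH n N c := by
  by_cases hp : n < p
  · refine ⟨0, zero_mem _, 0, zero_mem _, zero_mem _, zero_mem _, ?_⟩
    rw [eq_zero_of_form hp ha]; simp
  obtain ⟨b, -, c, -, hb, hc, h⟩ := exists_homogeneous PrStable.top ha (b := b) (c := c)
    trivial trivial h
  simp only [Prod.mk_add_mk, add_zero] at hb hc
  obtain ⟨b0, hb0, u, v, huv⟩ := exists_invariant hn hk (by omega) hb (h ▸ haI)
  -- The term d v in b contributes dl(dv) = -d(dl v), which is absorbed in c. What remains is an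
  -- invariant exact form.
  have h1 : a - dl n N b0 = dH n N (c - dl n N v) := by
    rw [h, huv, map_add, map_add, dl_dl, dl_dH, map_sub]; abel
  have h2 : dH n N (pr (p + -1, k, m, 0, 0, 0) (c - dl n N v)) =
      pr (p, k, m, 0, 0, 0) (a - dl n N b0) := by
    rw [h1, pr_dH]
    simp
  obtain ⟨c', hc', h3⟩ := exists_primitive (κ := Deg.ag) rfl (Inv n N) (fun _ => dH_mem_Inv)
    (fun _ => rho_mem_Inv) (proj_mem (p + -1, k, m, 0, 0, 0) (c - dl n N v))
    (pr_mem_Inv (p, k, m, 0, 0, 0) _ (sub_mem haI (dl_mem_Inv hb0))) (by simp; omega)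
    (by simp; omega) h2.symm
  have h4 : a = dl n N (pr (p, k + 1, m, 0, 0, 0) b0) + dH n N c' := by
    rw [← h3, map_sub, pr_dl, pr, proj_of_mem ha]
    simp
  obtain ⟨b', hb', c'', hc'', hbr, hcr, h5⟩ := exists_homogeneous pr_mem_Inv ha
    (pr_mem_Inv _ _ hb0) hc' h4
  exact ⟨b', hb', c'', hc'', by simpa using hbr, by simpa using hcr, h5⟩

end PauliFierz
end

noncomputable section

namespace PauliFierz

open GradedPoly

variable {n N : ℕ}

/-! ### Forms of top degree -/

/-- The product of differentials. -/
def dxs (N : ℕ) (l : List (Fin n)) : MAlg n N := (l.map dx).prod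

/-- The volume form. -/
def vol (n N : ℕ) : MAlg n N := dxs N (List.finRange n)

@[simp] theorem dxs_nil : dxs N ([] : List (Fin n)) = 1 := rfl

@[simp] theorem dxs_cons (μ : Fin n) (l : List (Fin n)) : dxs N (μ :: l) = dx μ * dxs N l := by
  simp [dxs]

theorem dxs_eq_mon (l : List (Fin n)) : dxs N l = mon MGen.par (l.map MGen.dx) := by
  induction l with
  | nil => rfl
  | cons μ l ih => rw [dxs_cons, List.map_cons, mon_cons, ih]; rfl

theorem dxs_mem (l : List (Fin n)) : dxs N l ∈ Hom n N (l.length, 0, 0, 0, 0, 0) := by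
  induction l with
  | nil => exact one_mem_hom
  | cons μ l ih => simpa [add_comm] using mul_mem_hom (dx_mem μ) ih

theorem vol_mem : vol n N ∈ Hom n N (n, 0, 0, 0, 0, 0) := by
  have := dxs_mem (N := N) (List.finRange n)
  rwa [List.length_finRange] at this

theorem _root_.GradedPoly.IsEven.dxs {E : Module.End ℝ (MAlg n N)} (hE : IsEven E)
    (h : ∀ μ, E (dx μ) = 0) (l : List (Fin n)) : E (dxs N l) = 0 := by
  induction l with
  | nil => exact hE.map_one
  | cons μ l ih => rw [dxs_cons, hE.leib, h, ih, zero_mul, mul_zero, add_zero]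

theorem _root_.GradedPoly.IsOdd.dxs {D : Module.End ℝ (MAlg n N)} (hD : IsOdd D)
    {l : List (Fin n)} (h : ∀ μ ∈ l, D (dx μ) = 0) : D (dxs N l) = 0 := by
  induction l with
  | nil => exact hD.map_one
  | cons μ l ih =>
    rw [dxs_cons, hD.leib, h μ List.mem_cons_self, ih fun ν hν => h ν (List.mem_cons_of_mem _ hν),
      zero_mul, mul_zero, add_zero]

theorem exists_dxs_eq {l : List (Fin n)} (hl : l.length = n) : ∃ c : ℝ, dxs N l = c • vol n N := by
  by_cases h : l.Nodup
  · have h1 : l.Perm (List.finRange n) := by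
      have h2 : l.toFinset = Finset.univ := by
        rw [← Finset.card_eq_iff_eq_univ, List.toFinset_card_of_nodup h, hl, Fintype.card_fin]
      refine (List.perm_ext_iff_of_nodup h (List.nodup_finRange n)).2 fun a => ?_
      rw [← List.mem_toFinset, h2]
      simp
    rw [vol, dxs_eq_mon, dxs_eq_mon]
    exact mon_perm (h1.map _)
  · refine ⟨0, ?_⟩
    rw [List.nodup_iff_count_le_one] at h
    push Not at h
    obtain ⟨μ, hμ⟩ := h
    have m1 : μ ∈ l := List.count_pos_iff.1 (by omega)
    have m2 : μ ∈ l.erase μ := List.count_pos_iff.1 (by rw [List.count_erase_self]; omega)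
    obtain ⟨c, hc⟩ := mon_perm (par := MGen.par (n := n) (N := N))
      ((List.perm_cons_erase m1).map MGen.dx)
    obtain ⟨c', hc'⟩ := mon_perm (par := MGen.par (n := n) (N := N))
      ((List.perm_cons_erase m2).map MGen.dx)
    rw [dxs_eq_mon, hc, List.map_cons, mon_cons, hc', List.map_cons, mon_cons, mul_smul_comm,
      ← mul_assoc, odd_sq_gen (x := MGen.dx μ) odd_one]
    simp

theorem exists_mul_vol {r : Deg} (hr : r.1 = n) {x : MAlg n N} (hx : x ∈ Hom n N r) :
    ∃ y ∈ Hom n N (0, r.2), x = y * vol n N := by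
  rw [Hom, hom_eq_span] at hx
  induction hx using Submodule.span_induction with
  | mem x hx =>
    obtain ⟨l, hl, rfl⟩ := hx
    have key : ∀ l : List (MGen n N), ∃ (l1 : List (MGen n N)) (l2 : List (Fin n)) (c : ℝ),
        mon MGen.par l = c • (mon MGen.par l1 * dxs N l2) ∧
        (l.map MGen.deg).sum = ((l2.length : ℤ), (l.map MGen.deg).sum.2) ∧
        (l1.map MGen.deg).sum = (0, (l.map MGen.deg).sum.2) := by
      intro l
      induction l with
      | nil => exact ⟨[], [], 1, by simp, by simp; rfl, by simp; rfl⟩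
      | cons y l ih =>
        obtain ⟨l1, l2, c, h1, h2, h3⟩ := ih
        cases y with
        | dx μ =>
          obtain ⟨c', hc'⟩ := mon_perm (par := MGen.par (n := n) (N := N))
            (List.perm_middle (l₁ := l1) (a := MGen.dx μ) (l₂ := l2.map MGen.dx)).symm
          refine ⟨l1, μ :: l2, c * c', ?_, ?_, ?_⟩
          · rw [mon_cons, h1, mul_smul_comm, mul_smul, dxs_eq_mon, ← mon_append, ← mon_cons, hc',
              dxs_eq_mon, mon_append, List.map_cons]
          · rw [List.map_cons, List.sum_cons, h2]
            simp [MGen.deg, add_comm]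
          · rw [h3, List.map_cons, List.sum_cons, Prod.snd_add]
            simp [MGen.deg]
        | u k a i I =>
          have h0 : (MGen.u k a i I : MGen n N).deg.1 = 0 := by cases k <;> rfl
          refine ⟨.u k a i I :: l1, l2, c, ?_, ?_, ?_⟩
          · rw [mon_cons, h1, mul_smul_comm, mon_cons, mul_assoc]
          · rw [List.map_cons, List.sum_cons]
            refine Prod.ext ?_ rfl
            rw [Prod.fst_add, h0, zero_add, h2]
          · rw [List.map_cons, List.sum_cons, List.map_cons, List.sum_cons, h3]
            refine Prod.ext ?_ rfl
            rw [Prod.fst_add, h0, zero_add]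
    obtain ⟨l1, l2, c, h1, h2, h3⟩ := key l
    rw [hl] at h2 h3
    obtain ⟨c', hc'⟩ := exists_dxs_eq (N := N) (l := l2) (by
      have := congrArg Prod.fst h2
      rw [hr] at this
      simpa using this.symm)
    refine ⟨(c * c') • mon MGen.par l1, Submodule.smul_mem _ _ (h3 ▸ mon_mem_hom l1), ?_⟩
    rw [h1, hc', mul_smul_comm, smul_smul, smul_mul_assoc]
  | zero => exact ⟨0, zero_mem _, by rw [zero_mul]⟩
  | add x x' _ _ hx hx' =>
    obtain ⟨y, hy, rfl⟩ := hx
    obtain ⟨y', hy', rfl⟩ := hx'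
    exact ⟨y + y', add_mem hy hy', by rw [add_mul]⟩
  | smul c x _ hx =>
    obtain ⟨y, hy, rfl⟩ := hx
    exact ⟨c • y, Submodule.smul_mem _ _ hy, by rw [smul_mul_assoc]⟩

theorem io_of_form {s : Deg} (hs : s.1 = 0) {y : MAlg n N} (hy : y ∈ Hom n N s) (μ : Fin n) :
    io N μ y = 0 :=
  eq_zero_of_nonneg Deg.fm (by decide) (fun k => by cases k <;> decide)
    (by rw [map_add]; change s.1 + -1 < 0; omega) (io_shifts μ hy)

/-- Contracting the differentials of the volume form one after the other leaves y up to a sign. -/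
theorem mul_vol_eq_zero {s : Deg} (hs : s.1 = 0) {y : MAlg n N} (hy : y ∈ Hom n N s)
    (h : y * vol n N = 0) : y = 0 := by
  have key : ∀ l : List (Fin n), l.Nodup → y * dxs N l = 0 → y = 0 := by
    intro l
    induction l with
    | nil => intro _ h; simpa using h
    | cons μ l ih =>
      intro hl h
      rw [List.nodup_cons] at hl
      refine ih hl.2 ?_
      have h1 := congrArg (io N μ) h
      have h2 : io N μ (dxs N l) = 0 := (io_isOdd μ).dxs fun ν hν => by
        rw [io_dx, if_neg]
        rintro rfl
        exact hl.1 hν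
      rw [dxs_cons, (io_isOdd μ).leib, io_of_form hs hy, (io_isOdd μ).leib, io_dx, if_pos rfl, h2,
        parityInv_of_mem hy, zero_mul, zero_add, one_mul, mul_zero, add_zero, map_zero,
        smul_mul_assoc, smul_eq_zero] at h1
      exact h1.resolve_left (zpow_ne_zero _ (by norm_num))
  exact key _ (List.nodup_finRange n) h

theorem del_mul_vol (μ : Fin n) (y : MAlg n N) : del N μ (y * vol n N) = del N μ y * vol n N := by
  rw [(del_isEven μ).leib, vol, (del_isEven μ).dxs (del_dx μ), mul_zero, add_zero]

theorem dx_mul_vol (ν : Fin n) (y : MAlg n N) : dx ν * (y * vol n N) = 0 := by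
  have h : (dx ν * vol n N : MAlg n N) = 0 :=
    eq_zero_of_form (by simp) (mul_mem_hom (dx_mem ν) vol_mem)
  rw [← mul_assoc, GradedPoly.odd_mul (dx_parity ν), mul_assoc, h, mul_zero]

/-- Total derivatives are exact. -/
theorem del_vol (y : MAlg n N) (μ : Fin n) :
    del N μ y * vol n N = dH n N (io N μ (y * vol n N)) := by
  have h1 : ∀ ν, dx ν * del N ν (io N μ (y * vol n N)) =
      if μ = ν then del N ν y * vol n N else 0 := by
    intro ν
    have h2 := DFunLike.congr_fun (del_io (N := N) ν μ) (y * vol n N)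
    have h3 := DFunLike.congr_fun (io_em (N := N) μ ν) (del N ν (y * vol n N))
    simp only [Module.End.mul_apply, LinearMap.sub_apply, em_apply] at h2 h3
    rw [del_mul_vol, dx_mul_vol, map_zero] at h3
    rw [h2, del_mul_vol, ← sub_eq_zero.1 h3.symm]
    split_ifs <;> simp
  rw [dH_apply]
  simp [h1]

/-- The total derivatives. -/
def TD (n N : ℕ) : Submodule ℝ (MAlg n N) := ⨆ μ, LinearMap.range (del N μ)

theorem del_mem_TD (μ : Fin n) (y : MAlg n N) : del N μ y ∈ TD n N :=
  Submodule.mem_iSup_of_mem μ ⟨y, rfl⟩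

theorem TD_induction {P : MAlg n N → Prop} (h0 : P 0) (hadd : ∀ x y, P x → P y → P (x + y))
    (h : ∀ μ y, P (del N μ y)) {x : MAlg n N} (hx : x ∈ TD n N) : P x := by
  induction hx using Submodule.iSup_induction' with
  | mem μ x hx => obtain ⟨y, rfl⟩ := hx; exact h μ y
  | zero => exact h0
  | add x y _ _ hx hy => exact hadd x y hx hy

theorem TD_mul_vol {y : MAlg n N} (hy : y ∈ TD n N) : ∃ e, y * vol n N = dH n N e := by
  refine TD_induction (P := fun y => ∃ e, y * vol n N = dH n N e) ⟨0, by simp⟩ ?_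
    (fun μ y => ⟨_, del_vol y μ⟩) hy
  rintro x y ⟨e, he⟩ ⟨e', he'⟩
  exact ⟨e + e', by rw [add_mul, he, he', map_add]⟩

/-! ### Integration by parts -/

/-- Up to total derivatives, `y` is linear in the undifferentiated fields of kind `k`, with
coefficients of degree `s`. -/
def Ibp (N : ℕ) (k : Kind) (s : Deg) (y : MAlg n N) : Prop :=
  ∃ z : Fin N → Idx n k → MAlg n N, (∀ a i, z a i ∈ Hom n N s) ∧
    y - ∑ a, ∑ i, U k a i 1 * z a i ∈ TD n N

variable {k : Kind} {s : Deg}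

theorem Ibp.of_TD {y : MAlg n N} (hy : y ∈ TD n N) : Ibp N k s y :=
  ⟨0, fun _ _ => zero_mem _, by simpa⟩

theorem Ibp.add {y y' : MAlg n N} (h : Ibp N k s y) (h' : Ibp N k s y') : Ibp N k s (y + y') := by
  obtain ⟨z, hz, h⟩ := h
  obtain ⟨z', hz', h'⟩ := h'
  refine ⟨z + z', fun a i => add_mem (hz a i) (hz' a i), ?_⟩
  convert add_mem h h' using 1
  simp only [Pi.add_apply, mul_add, Finset.sum_add_distrib]
  abel

theorem Ibp.smul (c : ℝ) {y : MAlg n N} (h : Ibp N k s y) : Ibp N k s (c • y) := by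
  obtain ⟨z, hz, h⟩ := h
  refine ⟨c • z, fun a i => Submodule.smul_mem _ c (hz a i), ?_⟩
  convert Submodule.smul_mem _ c h using 1
  simp only [Pi.smul_apply, mul_smul_comm, ← Finset.smul_sum, smul_sub]

theorem U_X_mul (a : Fin N) (i : Idx n k) (p : Poly n) (μ : Fin n) :
    U k a i (p * MvPolynomial.X μ) = del N μ (U k a i p) := by
  rw [← L_js, ← L_js, del_L]
  congr 1
  ext1 l
  by_cases h : l = k
  · subst h
    ext1 j
    by_cases hj : j = i
    · subst hj; simp [js, mul_comm]
    · simp [js, Pi.single_eq_of_ne hj]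
  · simp [js, Pi.single_eq_of_ne h]

/-- Derivatives are moved off the field one at a time by the Leibniz rule; each costs a sign and a
total derivative. -/
theorem Ibp.mul (a : Fin N) (i : Idx n k) (p : Poly n) {z : MAlg n N} (hz : z ∈ Hom n N s) :
    Ibp N k s (U k a i p * z) := by
  classical
  induction p using MvPolynomial.induction_on generalizing z with
  | C r =>
    refine ⟨fun b j => if b = a ∧ j = i then r • z else 0, fun b j => ?_, ?_⟩
    · dsimp only
      split_ifs
      · exact Submodule.smul_mem _ _ hz
      · exact zero_mem _
    · rw [Finset.sum_eq_single a, Finset.sum_eq_single i]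
      · have : (MvPolynomial.C r : Poly n) = r • 1 := by
          rw [MvPolynomial.smul_eq_C_mul, mul_one]
        rw [this, map_smul]
        simp
      · intro j _ hj; simp [hj]
      · simp
      · intro b _ hb; simp [hb]
      · simp
  | add p q hp hq => rw [map_add, add_mul]; exact (hp hz).add (hq hz)
  | mul_X p μ ih =>
    have h : U k a i (p * MvPolynomial.X μ) * z =
        del N μ (U k a i p * z) + (-1 : ℝ) • (U k a i p * del N μ z) := by
      rw [U_X_mul, (del_isEven μ).leib, neg_one_smul, add_neg_cancel_right]
    rw [h]
    exact (Ibp.of_TD (del_mem_TD _ _)).add ((ih (by simpa using del_shifts μ hz)).smul _)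

theorem Ibp.of_mem {r : Deg} (hr : r = k.deg + s)
    (H : ∀ l : List (MGen n N), (l.map MGen.deg).sum = r → ∃ a i I, MGen.u k a i I ∈ l)
    {y : MAlg n N} (hy : y ∈ Hom n N r) : Ibp N k s y := by
  classical
  rw [Hom, hom_eq_span] at hy
  induction hy using Submodule.span_induction with
  | mem y hy =>
    obtain ⟨l, hl, rfl⟩ := hy
    obtain ⟨a, i, I, hI⟩ := H l hl
    obtain ⟨c, hc⟩ := mon_perm (par := MGen.par) (List.perm_cons_erase hI)
    rw [hc, mon_cons, ← U_monomial]
    refine (Ibp.mul a i _ ?_).smul c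
    have h1 := (List.perm_cons_erase hI).map MGen.deg
    have h2 := h1.sum_eq
    rw [hl, List.map_cons, List.sum_cons, hr] at h2
    rw [add_left_cancel h2]
    exact mon_mem_hom _
  | zero => exact Ibp.of_TD (zero_mem _)
  | add y y' _ _ h h' => exact h.add h'
  | smul c y _ h => exact h.smul c

/-- Used to find a factor of a given kind in a monomial: P is an additive condition on degrees that
holds for all other kinds and fails for the whole monomial. -/
theorem exists_mem_not {P : Deg → Prop} (h0 : P 0) (hadd : ∀ r s, P r → P s → P (r + s))
    {l : List (MGen n N)} (h : ¬ P (l.map MGen.deg).sum) : ∃ y ∈ l, ¬ P y.deg := by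
  by_contra! hl
  refine h ?_
  induction l with
  | nil => exact h0
  | cons y l ih =>
    rw [List.map_cons, List.sum_cons]
    refine hadd _ _ (hl y List.mem_cons_self) ?_
    by_contra h'
    exact h' (ih h' fun z hz => hl z (List.mem_cons_of_mem _ hz))

/-- The derivation that removes a field. -/
def theta (k : Kind) (a : Fin N) (i : Idx n k) : Module.End ℝ (MAlg n N) :=
  derE 0 fun b => if b = a then LinearMap.toSpanSingleton ℝ _ 1 ∘ₗ MvPolynomial.lcoeff ℝ 0 ∘ₗ
    LinearMap.proj i ∘ₗ LinearMap.proj k else 0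

theorem theta_valid (k : Kind) (a : Fin N) (i : Idx n k) : Valid (n := n) (N := N) 0
    (fun b => if b = a then LinearMap.toSpanSingleton ℝ (MAlg n N) 1 ∘ₗ MvPolynomial.lcoeff ℝ 0 ∘ₗ
      LinearMap.proj i ∘ₗ LinearMap.proj k else 0) (-k.deg) := by
  refine ⟨fun μ => zero_mem _, fun b k' j p => ?_⟩
  split_ifs
  · by_cases hk : k' = k
    · subst hk
      rw [add_neg_cancel]
      simp only [LinearMap.comp_apply, LinearMap.toSpanSingleton_apply]
      exact Submodule.smul_mem _ _ one_mem_hom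
    · have : (js k' j p : Jet n) k = 0 := by simp [js, Pi.single_eq_of_ne (Ne.symm hk)]
      simp only [LinearMap.comp_apply, LinearMap.proj_apply, this, map_zero]
      exact zero_mem _
  · exact zero_mem _

theorem par_neg (hk : Even (Deg.par k.deg)) : (-1 : ℝ) ^ (Deg.par (-k.deg)) = 1 := by
  rw [map_neg]
  exact hk.neg.neg_one_zpow

theorem theta_dx (hk : Even (Deg.par k.deg)) (a : Fin N) (i : Idx n k) (μ : Fin n) :
    theta k a i (dx μ) = 0 :=
  derE_dx (theta_valid k a i) (par_neg hk) μ

theorem theta_L (hk : Even (Deg.par k.deg)) (a b : Fin N) (i : Idx n k) (v : Jet n) :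
    theta k a i (L b v) = if b = a then (v k i).coeff 0 • 1 else 0 := by
  rw [theta, derE_L (theta_valid k a i) (par_neg hk)]
  split_ifs <;> rfl

/-- The coefficients of the undifferentiated fields are unique. -/
theorem Ibp.unique (hk : Even (Deg.par k.deg)) {κ : Deg →+ ℤ} (hκ : κ (1, 0, 0, 0, 0, 0) = 0)
    (hκ' : ∀ k : Kind, 0 ≤ κ k.deg)
    (hκk : 0 < κ k.deg) (hs : s.1 = 0) (hκs : κ s = 0) {z : Fin N → Idx n k → MAlg n N}
    (hz : ∀ a i, z a i ∈ Hom n N s) {c : MAlg n N}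
    (h : (∑ a, ∑ i, U k a i 1 * z a i) * vol n N = dH n N c) (a : Fin N) (i : Idx n k) :
    z a i = 0 := by
  have hgen : ∀ x : MGen n N, 0 ≤ κ x.deg := fun x => by
    cases x with
    | dx μ => exact hκ.ge
    | u k a i I => exact hκ' k
  set X := (∑ a, ∑ i, U k a i 1 * z a i) * vol n N with hX
  set r : Deg := k.deg + s + ((n : ℤ), 0, 0, 0, 0, 0)
  have hXr : X ∈ Hom n N r := mul_mem_hom (Submodule.sum_mem _ fun a _ =>
    Submodule.sum_mem _ fun i _ => mul_mem_hom (U_mem k a i 1) (hz a i)) vol_mem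
  have hn0 : κ ((n : ℤ), 0, 0, 0, 0, 0) = 0 := by
    have : (((n : ℤ), 0, 0, 0, 0, 0) : Deg) = n • (1, 0, 0, 0, 0, 0) := by simp
    rw [this, map_nsmul, hκ, smul_zero]
  have hκr : κ (r + (-1, 0, 0, 0, 0, 0)) = κ k.deg := by
    have : ((-1, 0, 0, 0, 0, 0) : Deg) = -(1, 0, 0, 0, 0, 0) := rfl
    rw [this, map_add, map_add, map_add, map_neg, hκ, hn0, hκs]; ring
  have hk1 : k.deg.1 = 0 := by cases k <;> rfl
  have hXc : X = dH n N (pr (r + (-1, 0, 0, 0, 0, 0)) c) := by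
    rw [← pr_dH, ← h]; exact (proj_of_mem hXr).symm
  -- `lap` commutes with `d`, so a polynomial that inverts it on the primitive also does so on X,
  -- although X has top degree.
  have h1 : PosSpec (lap n N κ) X := by
    obtain ⟨p, hp, hp'⟩ := lap_posSpec hκ (proj_mem (r + (-1, 0, 0, 0, 0, 0)) c)
      (by rw [hκr]; exact hκk) (by simp [r, hk1, hs])
    refine ⟨p, hp, ?_⟩
    rw [hXc, aeval_apply_comm lap_dH, hp', map_zero]
  -- An undifferentiated field has no derivative to remove, and the coefficients have weight zero.
  -- Hence rho X = 0 as well as dX = 0, and X vanishes; `theta` then extracts the coefficients.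
  have h2 : ∀ μ, Kop N κ μ X = 0 := by
    intro μ
    have h3 : Kop N κ μ (vol n N) = 0 := (Kop_isEven κ μ).dxs (Kop_dx κ μ) _
    have h4 : ∀ a i, Kop N κ μ (z a i) = 0 := fun a i => by
      refine (Kop_isEven κ μ).eq_zero_of_degree κ hgen (fun x hx => ?_) hκs (hz a i)
      cases x with
      | dx ν => exact Kop_dx κ μ ν
      | u k a i I =>
        rw [← U_monomial, ← L_js, Kop_L]
        have : wpd κ μ (js k i (MvPolynomial.monomial I (1 : ℝ))) = 0 := by
          ext1 l
          by_cases hl : l = k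
          · subst hl
            have : κ l.deg = 0 := hx
            ext1 j; simp [wpd, wt, this]
          · ext1 j; simp [wpd, js, Pi.single_eq_of_ne hl]
        rw [this, map_zero]
    have h5 : ∀ a i, Kop N κ μ (U k a i 1) = 0 := fun a i => by
      rw [← L_js, Kop_L]
      have : wpd κ μ (js k i (1 : Poly n)) = 0 := by
        ext1 l
        by_cases hl : l = k
        · subst hl
          ext1 j
          by_cases hj : j = i
          · subst hj; simp [wpd, js]
          · simp [wpd, js, Pi.single_eq_of_ne hj]
        · ext1 j; simp [wpd, js, Pi.single_eq_of_ne hl]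
      rw [this, map_zero]
    rw [hX, (Kop_isEven κ μ).leib, h3, mul_zero, add_zero]
    simp [(Kop_isEven κ μ).leib, h4, h5]
  have h3 : X = 0 := by
    refine h1.eq_zero ?_
    have h4 : rho n N κ X = 0 := by simp [rho, h2]
    rw [lap, LinearMap.add_apply, Module.End.mul_apply, Module.End.mul_apply, h4, h, dH_dH,
      map_zero, map_zero, add_zero]
  have hθ : IsEven (theta k a i) := derE_isEven _ _
  have h4 := congrArg (theta k a i) h3
  have h5 : theta k a i (vol n N) = 0 := hθ.dxs (theta_dx hk a i) _
  have h6 : ∀ b j, theta k a i (z b j) = 0 := fun b j => by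
    refine hθ.eq_zero_of_degree κ hgen (fun x hx => ?_) hκs (hz b j)
    cases x with
    | dx ν => exact theta_dx hk a i ν
    | u k' b j I =>
      have hkk : k ≠ k' := fun hkk => by
        subst hkk
        have : κ k.deg = 0 := hx
        omega
      rw [← U_monomial, ← L_js, theta_L hk]
      simp [js, Pi.single_eq_of_ne hkk]
  have h7 : ∀ b j, theta k a i (U k b j 1) = if b = a ∧ j = i then 1 else 0 := fun b j => by
    rw [← L_js, theta_L hk]
    by_cases hb : b = a
    · by_cases hj : j = i
      · subst hj; simp [js, hb]
      · simp [js, hb, hj]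
    · simp [hb]
  rw [hX, hθ.leib, h5, mul_zero, add_zero, map_zero, map_sum, Finset.sum_eq_single a, map_sum,
    Finset.sum_eq_single i] at h4
  · rw [hθ.leib, h6, h7, if_pos ⟨rfl, rfl⟩, one_mul, mul_zero, add_zero] at h4
    exact mul_vol_eq_zero hs (hz a i) h4
  · intro j _ hj
    rw [hθ.leib, h6, h7, if_neg (fun h => hj h.2), zero_mul, mul_zero, add_zero]
  · simp
  · intro b _ hb
    rw [map_sum]
    refine Finset.sum_eq_zero fun j _ => ?_
    rw [hθ.leib, h6, h7, if_neg (fun h => hb h.1), zero_mul, mul_zero, add_zero]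
  · simp

end PauliFierz
end

noncomputable section

namespace PauliFierz

open GradedPoly

variable {n N : ℕ}

/-! ### Antighost number two -/

theorem del_dl (μ : Fin n) (x : MAlg n N) : dl n N (del N μ x) = del N μ (dl n N x) :=
  tdl_odd.del_comm tdl_pLin μ x

theorem del_dl1 (μ : Fin n) (x : MAlg n N) : dl1 n N (del N μ x) = del N μ (dl1 n N x) :=
  tdl1_odd.del_comm tdl1_pLin μ x

theorem dl_mul_vol (y : MAlg n N) : dl n N (y * vol n N) = dl n N y * vol n N := by
  rw [dl_acts.isOdd.leib, vol, dl_acts.isOdd.dxs fun μ _ => dl_acts.dx μ, mul_zero, add_zero]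

theorem dl1_mul_vol (y : MAlg n N) : dl1 n N (y * vol n N) = dl1 n N y * vol n N := by
  rw [dl1_acts.isOdd.leib, vol, dl1_acts.isOdd.dxs fun μ _ => dl1_acts.dx μ, mul_zero, add_zero]

theorem dl_TD {y : MAlg n N} (hy : y ∈ TD n N) : dl n N y ∈ TD n N :=
  TD_induction (P := fun y => dl n N y ∈ TD n N) (by rw [map_zero]; exact zero_mem _)
    (fun x y hx hy => by rw [map_add]; exact add_mem hx hy)
    (fun μ y => by rw [del_dl]; exact del_mem_TD _ _) hy

theorem dl1_TD {y : MAlg n N} (hy : y ∈ TD n N) : dl1 n N y ∈ TD n N :=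
  TD_induction (P := fun y => dl1 n N y ∈ TD n N) (by rw [map_zero]; exact zero_mem _)
    (fun x y hx hy => by rw [map_add]; exact add_mem hx hy)
    (fun μ y => by rw [del_dl1]; exact del_mem_TD _ _) hy

/-- Descent: forms whose differential is `dl`-exact. -/
theorem exists_of_descent (hn : 3 ≤ n) {m : ℤ} (hm : 1 ≤ m) {p : ℤ} (hp0 : 0 ≤ p) (hp : p ≤ n)
    {f g g' : MAlg n N} (hf : f ∈ Hom n N (p, p, m, 0, 0, 0)) (h1 : dH n N f = dl n N g)
    (h2 : dl n N f = dH n N g') : ∃ u v, f = dl n N u + dH n N v := by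
  obtain ⟨d, hd⟩ : ∃ d : ℕ, n - p = d := ⟨(n - p).toNat, by omega⟩
  induction d generalizing p f g g' with
  | zero =>
    obtain rfl : p = n := by push_cast at hd; omega
    -- In top form degree the antighost number is n ≥ 3.
    exact exists_of_closed hn (by omega) hf (Or.inl (by omega)) h2
  | succ d ih =>
    push_cast at hd
    have hdf : dH n N f ∈ Hom n N (p + 1, p, m, 0, 0, 0) := by simpa using dH_shifts hf
    set g1 := pr (p + 1, p + 1, m, 0, 0, 0) g with hg1
    have hg1r : g1 ∈ Hom n N (p + 1, p + 1, m, 0, 0, 0) := proj_mem _ _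
    have h3 : dH n N f = dl n N g1 := by
      have := congrArg (pr (p + 1, p, m, 0, 0, 0)) h1
      rw [pr_dl, pr, proj_of_mem hdf] at this
      simpa using this
    -- Since d g1 is `dl`-closed in positive antighost number, it is `dl`-exact: g1 satisfies the
    -- hypotheses one form degree and one antighost number higher.
    obtain ⟨w, -, hw⟩ := dl_acyclic hn (by simp; omega) (dH_shifts hg1r)
      (by rw [dl_dH, ← h3, dH_dH, neg_zero])
    obtain ⟨u, v, huv⟩ := ih (by omega) (by omega) hg1r hw h3.symm (by omega)
    have h4 : dH n N f = dl n N (dH n N (pr (p, p + 1, m, 0, 0, 0) v)) := by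
      have h5 := congrArg (pr (p + 1, p + 1, m, 0, 0, 0)) huv
      rw [map_add, pr_dl, pr_dH, pr, proj_of_mem hg1r] at h5
      rw [h3, h5, map_add, dl_dl, zero_add]
      simp
    have hv : pr (p, p + 1, m, 0, 0, 0) v ∈ Hom n N (p, p + 1, m, 0, 0, 0) := proj_mem _ _
    set v' := pr (p, p + 1, m, 0, 0, 0) v
    -- Adding dl v' makes f `d`-closed. The weight is now the polynomial degree, since the antighost
    -- number may be zero.
    obtain ⟨w', -, -, hw'⟩ := dH_acyclic (κ := Deg.ml) rfl ⊤ (fun _ _ => trivial)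
      (fun _ _ => trivial) (x := f + dl n N v') (r := (p, p, m, 0, 0, 0))
      (add_mem hf (by simpa using dl_shifts hv)) trivial (by simp; omega) (by simp; omega)
      (by rw [map_add, h4, dl_dH]; abel)
    exact ⟨-v', w', by rw [map_neg, ← hw']; abel⟩

/-- A function that is constant modulo `dl`-exact terms is itself `dl`-exact; constants are excluded
by the positive polynomial degree. It is the descent started in form degree and antighost number
zero. -/
theorem exists_of_del (hn : 3 ≤ n) {m : ℤ} (hm : 1 ≤ m) {f : MAlg n N}
    (hf : f ∈ Hom n N (0, 0, m, 0, 0, 0)) (h : ∀ μ, ∃ g, del N μ f = dl n N g) :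
    ∃ u ∈ Hom n N (0, 1, m, 0, 0, 0), f = dl n N u := by
  choose g hg using h
  have h1 : dH n N f = dl n N (-∑ μ, dx μ * g μ) := by
    rw [dH_apply, map_neg, map_sum, ← Finset.sum_neg_distrib]
    refine Finset.sum_congr rfl fun μ _ => ?_
    rw [dl_acts.isOdd.leib, dl_acts.dx, parityInv_dx, hg]
    simp
  have h2 : dl n N f = dH n N 0 := by
    rw [map_zero]
    exact eq_zero_of_nonneg Deg.ag (by decide) (by decide) (by simp) (dl_shifts hf)
  obtain ⟨u, v, huv⟩ := exists_of_descent hn hm le_rfl (by omega) hf h1 h2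
  refine ⟨pr (0, 1, m, 0, 0, 0) u, proj_mem _ _, ?_⟩
  have h3 := congrArg (pr (0, 0, m, 0, 0, 0)) huv
  rw [map_add, pr_dl, pr_dH, pr, proj_of_mem hf, eq_zero_of_nonneg Deg.fm (by decide) (by decide)
    (by simp) (proj_mem ((0, 0, m, 0, 0, 0) + (-1, 0, 0, 0, 0, 0) : Deg) v), map_zero,
    add_zero] at h3
  simpa using h3

/-- The Killing equations modulo `dl`-exact forms. -/
theorem exists_of_killing (hn : 3 ≤ n) {m : ℤ} (hm : 1 ≤ m) {ζ : Fin n → MAlg n N}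
    (hζ : ∀ α, ζ α ∈ Hom n N (0, 0, m, 0, 0, 0))
    (h : ∀ α β, ∃ g, del N α (ζ β) + del N β (ζ α) = dl n N g) (α : Fin n) :
    ∃ u ∈ Hom n N (0, 1, m, 0, 0, 0), ζ α = dl n N u := by
  refine exists_of_del hn hm (hζ α) fun μ => ?_
  suffices H : ∀ ν, ∃ g, del N ν (del N μ (ζ α)) = dl n N g by
    obtain ⟨u, -, hu⟩ := exists_of_del hn hm (f := del N μ (ζ α))
      (by simpa using del_shifts μ (hζ α)) H
    exact ⟨u, hu⟩
  intro ν
  obtain ⟨g1, h1⟩ := h μ α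
  obtain ⟨g2, h2⟩ := h ν α
  obtain ⟨g3, h3⟩ := h ν μ
  -- The combination that determines the Christoffel symbols from the metric: the Killing equations
  -- force all second derivatives to vanish modulo `dl`-exact terms. Two applications of
  -- `exists_of_del` then remove the derivatives.
  refine ⟨(1 / 2 : ℝ) • (del N ν g1 + del N μ g2 - del N α g3), ?_⟩
  rw [map_smul, map_sub, map_add, del_dl, del_dl, del_dl, ← h1, ← h2, ← h3, map_add, map_add,
    map_add, del_comm μ ν, del_comm α ν, del_comm α μ]
  have : del N ν (del N μ (ζ α)) + del N ν (del N α (ζ μ)) +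
      (del N ν (del N μ (ζ α)) + del N μ (del N α (ζ ν))) -
      (del N ν (del N α (ζ μ)) + del N μ (del N α (ζ ν))) =
      (2 : ℝ) • del N ν (del N μ (ζ α)) := by rw [two_smul]; abel
  rw [this, smul_smul]
  norm_num

theorem rD2_single (i : Fin n) : rD2 n (Pi.single i 1) =
    (-2 : ℝ) • ∑ β, (MvPolynomial.X β : Poly n) • eS (Poly n) β i := by
  change D2 (symb n) _ = _
  have h : ((-2 : Poly n)) = (-2 : ℝ) • 1 := by
    rw [neg_smul, two_smul, one_add_one_eq_two]
  rw [D2_single, h, smul_assoc, one_smul]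
  rfl

theorem dl_cs (a : Fin N) (i : Fin n) : dl n N (U .cs a i 1) =
    (-2 : ℝ) • ∑ β, del N β (U .hs a s(β, i) 1) := by
  rw [← L_js, dl_acts.L, tdl, LinearMap.add_apply, el_js_ne (by decide), el_js, rD2_single,
    zero_add]
  simp only [← L_js, del_L, ← map_sum, ← map_smul]
  congr 1
  rw [← LinearMap.single_apply (R := ℝ) (φ := fun k => Idx n k → Poly n), map_smul, map_sum]
  congr 1
  refine Finset.sum_congr rfl fun β _ => ?_
  exact Pi.single_smul (f := fun k => Idx n k → Poly n) Kind.hs _ _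

theorem dl1_tcs (a : Fin N) (i : Fin n) : dl1 n N (U .tcs a i 1) =
    (2 : ℝ) • ∑ β, del N β (U .ths a s(β, i) 1) := by
  rw [← L_js, dl1_acts.L, tdl1, LinearMap.neg_apply, LinearMap.add_apply, el_js_ne (by decide),
    el_js, rD2_single, zero_add]
  simp only [← L_js, del_L, ← map_sum, ← map_smul]
  congr 1
  rw [← LinearMap.single_apply (R := ℝ) (φ := fun k => Idx n k → Poly n), map_smul, map_sum,
    neg_smul, neg_neg]
  congr 1
  refine Finset.sum_congr rfl fun β _ => ?_
  exact Pi.single_smul (f := fun k => Idx n k → Poly n) Kind.ths _ _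

theorem dl_second (k : Kind) (hk : k = .ths ∨ k = .tcs) (a : Fin N) (i : Idx n k) :
    dl n N (U k a i 1) = 0 := by
  rw [← L_js, dl_acts.L, tdl, LinearMap.add_apply,
    el_js_ne (by rcases hk with rfl | rfl <;> decide),
    el_js_ne (by rcases hk with rfl | rfl <;> decide), add_zero, map_zero]

theorem parityInv_U (k : Kind) (a : Fin N) (i : Idx n k) :
    parityInv _ (U k a i 1 : MAlg n N) = (-1 : ℝ) ^ k.par • U k a i 1 := by
  have : (1 : Poly n) = MvPolynomial.monomial 0 1 := rfl
  rw [this, U_monomial]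
  exact parityInv_gen _

/-- The component with one antifield `h*` of the second copy. -/
theorem dl_tau (a : MAlg n N) : dl n N (tauO n N 1 a) + dl1 n N (tauO n N 2 a) =
    -tauO n N 1 (dl n N a) - tauO n N 2 (dl1 n N a) := by
  have A1 : OActs (tauO n N 1) (el .hs .ths LinearMap.id) :=
    OddJet.acts (c := (0, 0, 0, 0, 1, 1)) ⟨el_shifts _ (by decide), by decide⟩
  have A2 : OActs (tauO n N 2) (el .cs .tcs LinearMap.id) :=
    OddJet.acts (c := (0, 0, 0, 0, 1, 2)) ⟨el_shifts _ (by decide), by decide⟩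
  have h := ((dl_acts (N := N)).anticomm A1).add (dl1_acts.anticomm A2)
  have h0 := h.eq EActs.zero (by
    simp [tdl, tdl1, LinearMap.add_comp, LinearMap.comp_add, LinearMap.neg_comp,
      LinearMap.comp_neg, el_el, el_el_ne])
  have h1 := DFunLike.congr_fun h0 a
  simp only [LinearMap.add_apply, Module.End.mul_apply, LinearMap.zero_apply] at h1
  rw [← sub_eq_zero, ← h1]
  abel

/-- The second-copy antighost number is odd only on the copies of `h*`. -/
theorem ibp_ths {m : ℤ} {y : MAlg n N} (hy : y ∈ Hom n N (0, 2, m, 0, 1, 1)) :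
    Ibp N .ths (0, 1, m - 1, 0, 0, 0) y := by
  refine Ibp.of_mem (r := (0, 2, m, 0, 1, 1)) (by simp [Kind.deg]) (fun l hl => ?_) hy
  obtain ⟨x, hx, hx'⟩ := exists_mem_not (P := fun r => Even (Deg.ta r)) (by simp)
    (fun r s hr hs => by simpa using hr.add hs) (l := l) (by rw [hl]; simp)
  cases x with
  | dx μ => exact absurd (by decide : Even (Deg.ta (1,0,0,0,0,0))) hx'
  | u k a i I =>
    cases k
    case ths => exact ⟨a, i, I, hx⟩
    all_goals exact absurd (by decide : Even (Deg.ta (Kind.deg _))) hx'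

/-- Second-copy antighost number minus second-copy field number is positive only on the copies of
`C*`. -/
theorem ibp_tcs {m : ℤ} {y : MAlg n N} (hy : y ∈ Hom n N (0, 2, m, 0, 1, 2)) :
    Ibp N .tcs (0, 0, m - 1, 0, 0, 0) y := by
  refine Ibp.of_mem (r := (0, 2, m, 0, 1, 2)) (by simp [Kind.deg]) (fun l hl => ?_) hy
  obtain ⟨x, hx, hx'⟩ := exists_mem_not (P := fun r => (Deg.ta - Deg.tl) r ≤ 0) (by simp)
    (fun r s hr hs => by rw [map_add]; omega) (l := l) (by rw [hl]; simp)
  cases x with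
  | dx μ => exact absurd (by decide : (Deg.ta - Deg.tl) (1,0,0,0,0,0) ≤ 0) hx'
  | u k a i I =>
    cases k
    case tcs => exact ⟨a, i, I, hx⟩
    all_goals exact absurd (by decide : (Deg.ta - Deg.tl) (Kind.deg _) ≤ 0) hx'

/-- In a form linear in the fields, without second-copy fields, antighost number 2 can only come
from `C*`. -/
theorem ibp_cs {y : MAlg n N} (hy : y ∈ Hom n N (0, 2, 1, 0, 0, 0)) : Ibp N .cs 0 y := by
  refine Ibp.of_mem (r := (0, 2, 1, 0, 0, 0)) (by decide) (fun l hl => ?_) hy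
  obtain ⟨x, hx, hx'⟩ := exists_mem_not (P := fun r => (Deg.ag - Deg.ml - Deg.tl) r ≤ 0) (by simp)
    (fun r s hr hs => by rw [map_add]; omega) (l := l) (by rw [hl]; decide)
  cases x with
  | dx μ => exact absurd (by decide : (Deg.ag - Deg.ml - Deg.tl) (1,0,0,0,0,0) ≤ 0) hx'
  | u k a i I =>
    cases k
    case cs => exact ⟨a, i, I, hx⟩
    all_goals exact absurd (by decide : (Deg.ag - Deg.ml - Deg.tl) (Kind.deg _) ≤ 0) hx'

theorem hom_zero {y : MAlg n N} (hy : y ∈ Hom n N 0) : ∃ c : ℝ, y = c • 1 := by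
  have := hom_le_of_zero (par := MGen.par) (deg := MGen.deg) (Deg.fm + Deg.ml)
    (fun x => by
      cases x with
      | dx μ => exact (by decide : 0 ≤ (Deg.fm + Deg.ml) (1,0,0,0,0,0))
      | u k a i I => exact (by decide : ∀ k, 0 ≤ (Deg.fm + Deg.ml) (Kind.deg k)) k)
    (r := 0) (by simp) (Submodule.span ℝ {(1 : MAlg n N)}) (fun l hl _ => ?_) hy
  · obtain ⟨c, rfl⟩ := Submodule.mem_span_singleton.1 this
    exact ⟨c, rfl⟩
  · cases l with
    | nil => exact Submodule.mem_span_singleton_self _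
    | cons x l =>
      exfalso
      have := hl x List.mem_cons_self
      cases x with
      | dx μ => exact absurd this (by decide : ¬ (Deg.fm + Deg.ml) (1,0,0,0,0,0) = 0)
      | u k a i I => cases k <;> exact absurd this (by decide : ¬ (Deg.fm + Deg.ml) (Kind.deg _) = 0)

/-- In antighost number `2` and polynomial degree `≥ 2` the cohomology vanishes. -/
theorem exists_of_closed_two (hn : 3 ≤ n) {m : ℤ} (hm : 2 ≤ m) {a c : MAlg n N}
    (ha : a ∈ Hom n N (n, 2, m, 0, 0, 0)) (h : dl n N a = dH n N c) :
    ∃ b e, a = dl n N b + dH n N e := by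
  have t1 : tauO n N 1 a ∈ Hom n N (n, 2, m, 0, 1, 1) := by simpa using tauO_shifts 1 ha
  have t2 : tauO n N 2 a ∈ Hom n N (n, 2, m, 0, 1, 2) := by simpa using tauO_shifts 2 ha
  obtain ⟨y1, hy1, e1⟩ := exists_mul_vol rfl t1
  obtain ⟨y2, hy2, e2⟩ := exists_mul_vol rfl t2
  obtain ⟨w, hw, hw'⟩ := ibp_ths hy1
  obtain ⟨z, hz, hz'⟩ := ibp_tcs hy2
  have h0 : dl1 n N a = 0 :=
    eq_zero_of_nonneg Deg.ta (by decide) (by decide) (by simp) (dl1_shifts ha)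
  -- The part of the closedness of τa with one second-copy antifield `h*`. The term from τ_0 cannot
  -- contribute, as `dl1` lowers second-copy antighost number.
  have hrel : (dl n N y1 + dl1 n N y2) * vol n N = dH n N (tauO n N 1 c) := by
    have A1 : OActs (tauO n N 1) (el .hs .ths LinearMap.id) :=
      OddJet.acts (c := (0, 0, 0, 0, 1, 1)) ⟨el_shifts _ (by decide), by decide⟩
    have h1 := dl_tau a
    rw [h0, map_zero, sub_zero, h, A1.dH_anti (el_pLin (k := .hs) (l := .ths) LinearMap.id),
      neg_neg, e1, e2, dl_mul_vol, dl1_mul_vol, ← add_mul] at h1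
    exact h1
  -- The coefficient of the undifferentiated copy of `h*` after integration by parts: a `dl`-exact
  -- term minus twice the symmetrized derivative of z. It vanishes by uniqueness, which is the
  -- Killing equation modulo `dl`-exact terms.
  set ω : Fin N → Idx n .ths → MAlg n N := fun a s => dl n N (w a s) - (2 : ℝ) • ∑ i, ∑ β,
    if s = s(β, i) then del N β (z a i) else 0 with hω
  have hT1 : dl n N y1 - ∑ a, ∑ s, U .ths a s 1 * dl n N (w a s) ∈ TD n N := by
    have := dl_TD hw'
    rw [map_sub, map_sum] at this
    convert this using 2
    refine Finset.sum_congr rfl fun a _ => ?_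
    rw [map_sum]
    refine Finset.sum_congr rfl fun s _ => ?_
    rw [dl_acts.isOdd.leib, dl_second _ (Or.inl rfl), parityInv_U, zero_mul, zero_add]
    simp [Kind.par]
  have hz1 : ∀ a i, dl1 n N (z a i) = 0 := fun a i =>
    eq_zero_of_nonneg Deg.ta (by decide) (by decide) (by simp) (dl1_shifts (hz a i))
  have hT2 : dl1 n N y2 + (2 : ℝ) • ∑ a, ∑ i, ∑ β, U .ths a s(β, i) 1 * del N β (z a i) ∈
      TD n N := by
    have h1 := dl1_TD hz'
    rw [map_sub, map_sum] at h1
    have h2 : ∑ a, ∑ i, ∑ β, del N β (U .ths a s(β, i) 1 * z a i) ∈ TD n N :=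
      Submodule.sum_mem _ fun a _ => Submodule.sum_mem _ fun i _ => Submodule.sum_mem _ fun β _ =>
        del_mem_TD _ _
    convert add_mem h1 (Submodule.smul_mem _ (2 : ℝ) h2) using 1
    have h3 : ∀ a i, dl1 n N (U .tcs a i 1 * z a i) =
        (2 : ℝ) • ∑ β, del N β (U .ths a s(β, i) 1) * z a i := fun a i => by
      rw [dl1_acts.isOdd.leib, hz1, dl1_tcs, mul_zero, add_zero, smul_mul_assoc, Finset.sum_mul]
    have h4 : ∑ a, dl1 n N (∑ i, U .tcs a i 1 * z a i) =
        (2 : ℝ) • ∑ a, ∑ i, ∑ β, del N β (U .ths a s(β, i) 1) * z a i := by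
      rw [Finset.smul_sum]
      refine Finset.sum_congr rfl fun a _ => ?_
      rw [map_sum, Finset.smul_sum]
      exact Finset.sum_congr rfl fun i _ => h3 a i
    simp only [(del_isEven _).leib, Finset.sum_add_distrib]
    rw [h4, smul_add]
    abel
  have hT : dl n N y1 + dl1 n N y2 - ∑ a, ∑ s, U .ths a s 1 * ω a s ∈ TD n N := by
    convert add_mem hT1 hT2 using 1
    have h1 : ∀ a, ∑ s, U .ths a s 1 * ω a s = ∑ s, U .ths a s 1 * dl n N (w a s) -
        (2 : ℝ) • ∑ i, ∑ β, U .ths a s(β, i) 1 * del N β (z a i) := fun a => by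
      simp only [hω, mul_sub, Finset.sum_sub_distrib, mul_smul_comm, ← Finset.smul_sum,
        Finset.mul_sum]
      congr 2
      rw [Finset.sum_comm]
      refine Finset.sum_congr rfl fun i _ => ?_
      rw [Finset.sum_comm]
      refine Finset.sum_congr rfl fun β _ => ?_
      rw [Finset.sum_eq_single (s(β, i) : Idx n .ths)]
      · rw [if_pos rfl]
      · intro s _ hs; rw [if_neg hs, mul_zero]
      · simp
    simp only [h1, Finset.sum_sub_distrib, ← Finset.smul_sum]
    abel
  have hω0 : ∀ a s, ω a s = 0 := by
    obtain ⟨e, he⟩ := TD_mul_vol hT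
    refine Ibp.unique (k := .ths) (κ := Deg.tl)
      (s := (0, 0, m - 1, 0, 0, 0)) (by decide) (by decide)
      (by decide) (by decide) rfl rfl (fun a s => ?_) (c := tauO n N 1 c - e) ?_
    · refine sub_mem (by simpa using dl_shifts (hw a s)) (Submodule.smul_mem _ _
        (Submodule.sum_mem _ fun i _ => Submodule.sum_mem _ fun β _ => ?_))
      split_ifs
      · simpa using del_shifts β (hz a i)
      · exact zero_mem _
    · rw [map_sub, ← hrel, ← he, sub_mul, sub_sub_cancel]
  have hk : ∀ a α, ∃ u ∈ Hom n N (0, 1, m - 1, 0, 0, 0), z a α = dl n N u := by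
    intro a
    refine exists_of_killing hn (by omega) (hz a) fun α γ => ?_
    have h1 := hω0 a s(α, γ)
    simp only [hω] at h1
    rw [sub_eq_zero] at h1
    -- A diagonal pair occurs once in the double sum and an off-diagonal one in both orders; hence
    -- the different factors in the two witnesses.
    by_cases hαγ : α = γ
    · subst hαγ
      refine ⟨w a s(α, α), ?_⟩
      rw [h1, Finset.sum_eq_single α, Finset.sum_eq_single α]
      · rw [if_pos rfl, two_smul]
      · intro β _ hβ; rw [if_neg]; simpa using Ne.symm hβ
      · simp
      · intro i _ hi
        refine Finset.sum_eq_zero fun β _ => ?_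
        rw [if_neg]
        intro h
        rcases Sym2.eq_iff.1 h with h | h
        · exact hi h.2.symm
        · exact hi h.1.symm
      · simp
    · refine ⟨(1 / 2 : ℝ) • w a s(α, γ), ?_⟩
      rw [map_smul, h1, smul_smul]
      have h2 : ∀ i β, (if (s(α, γ) : Idx n .ths) = s(β, i) then del N β (z a i) else 0) =
          (if α = β then if γ = i then del N β (z a i) else 0 else 0) +
            (if α = i then if γ = β then del N β (z a i) else 0 else 0) := by
        intro i β
        by_cases h : α = β ∧ γ = i
        · obtain ⟨rfl, rfl⟩ := h
          simp [hαγ]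
        · by_cases h' : α = i ∧ γ = β
          · obtain ⟨rfl, rfl⟩ := h'
            rw [if_pos Sym2.eq_swap]
            simp [hαγ]
          · rw [if_neg]
            · rw [← ite_and, ← ite_and, if_neg h, if_neg h', add_zero]
            · intro h''
              rcases Sym2.eq_iff.1 h'' with h'' | h''
              · exact h h''
              · exact h' h''
      simp only [h2, Finset.sum_add_distrib, Finset.sum_ite_eq, Finset.mem_univ, if_true]
      rw [Finset.sum_comm]
      simp
  choose u hu hzu using hk
  obtain ⟨e, he⟩ := TD_mul_vol hz'
  -- With z = dl u the component along the copy of `C*` is trivial, as `exists_of_closed` requires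
  -- for k = 2; the sign comes from the odd parity of that copy.
  refine exists_of_closed hn (by omega) ha (Or.inr ⟨-(∑ a, ∑ i, U .tcs a i 1 * u a i) * vol n N, e,
    ?_⟩) h
  rw [e2, ← sub_eq_iff_eq_add', dl_mul_vol, ← he, sub_eq_iff_eq_add', ← sub_eq_iff_eq_add,
    ← sub_mul]
  congr 1
  rw [sub_sub_cancel, map_neg, map_sum, ← Finset.sum_neg_distrib]
  refine Finset.sum_congr rfl fun a _ => ?_
  rw [map_sum, ← Finset.sum_neg_distrib]
  refine Finset.sum_congr rfl fun i _ => ?_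
  rw [dl_acts.isOdd.leib, dl_second _ (Or.inr rfl), parityInv_U, hzu]
  simp [Kind.par]

end PauliFierz
end

noncomputable section

namespace PauliFierz

open GradedPoly

variable {n N : ℕ}

/-! ### The characteristic cohomology -/

/-- The span of the forms `C* dx^0 ⋯ dx^{n-1}`. -/
def CV (n N : ℕ) : Submodule ℝ (MAlg n N) :=
  Submodule.span ℝ (Set.range fun p : Fin N × Fin n => U .cs p.1 p.2 1 * vol n N)

theorem cs_mul_vol_mem (a : Fin N) (i : Fin n) :
    U .cs a i 1 * vol n N ∈ Hom n N ((n : ℤ), 2, 1, 0, 0, 0) := by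
  simpa [Kind.deg] using mul_mem_hom (U_mem .cs a i 1) (vol_mem (n := n) (N := N))

theorem vol_mem_Inv : vol n N ∈ Inv n N := by
  have : ∀ l : List (Fin n), dxs N l ∈ Inv n N := fun l => by
    induction l with
    | nil => exact one_mem_Inv
    | cons μ l ih => rw [dxs_cons]; exact mul_mem_Inv (dx_mem_Inv μ) ih
  exact this _

theorem U_mem_Inv {k : Kind} (h : k ≠ .h) (h' : k ≠ .gh) (a : Fin N) (i : Idx n k) (p : Poly n) :
    U k a i p ∈ Inv n N := by
  rw [← L_js]
  refine L_mem_Inv a ?_ ?_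
  · rw [show js k i p .h = 0 by simp [js, Pi.single_eq_of_ne h.symm]]; exact zero_mem _
  · simp [js, Pi.single_eq_of_ne h'.symm]

theorem CV_le_Inv : CV n N ≤ Inv n N := by
  refine Submodule.span_le.2 ?_
  rintro _ ⟨p, rfl⟩
  exact mul_mem_Inv (U_mem_Inv (by decide) (by decide) _ _ _) vol_mem_Inv

theorem CV_le_Hom : CV n N ≤ Hom n N ((n : ℤ), 2, 1, 0, 0, 0) := by
  refine Submodule.span_le.2 ?_
  rintro _ ⟨p, rfl⟩
  exact cs_mul_vol_mem _ _

/-- After integration by parts the coefficients of `C*` have degree zero, so they are constants. -/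
theorem exists_CV {a : MAlg n N} (ha : a ∈ Hom n N ((n : ℤ), 2, 1, 0, 0, 0)) :
    ∃ v ∈ CV n N, ∃ e, a = v + dH n N e := by
  obtain ⟨y, hy, rfl⟩ := exists_mul_vol rfl ha
  obtain ⟨z, hz, hz'⟩ := ibp_cs hy
  obtain ⟨e, he⟩ := TD_mul_vol hz'
  choose c hc using fun a i => hom_zero (hz a i)
  refine ⟨(∑ a, ∑ i, U .cs a i 1 * z a i) * vol n N, ?_, e, by rw [← he, ← add_mul]; simp⟩
  rw [Finset.sum_mul]
  refine Submodule.sum_mem _ fun a _ => ?_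
  rw [Finset.sum_mul]
  refine Submodule.sum_mem _ fun i _ => ?_
  rw [hc, mul_smul_comm, mul_one, smul_mul_assoc]
  exact Submodule.smul_mem _ _ (Submodule.subset_span ⟨(a, i), rfl⟩)

/-- The invariant characteristic cohomology in antighost number `> 2`. -/
theorem exists_invariant_of_closed (hn : 3 ≤ n) {k m : ℤ} (hk : 3 ≤ k) {a c : MAlg n N}
    (ha : a ∈ Hom n N (n, k, m, 0, 0, 0)) (haI : a ∈ Inv n N) (h : dl n N a = dH n N c) :
    ∃ b ∈ Inv n N, ∃ e ∈ Inv n N, b ∈ Hom n N (n, k + 1, m, 0, 0, 0) ∧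
      e ∈ Hom n N ((n : ℤ) + -1, k, m, 0, 0, 0) ∧ a = dl n N b + dH n N e := by
  obtain ⟨b, e, h⟩ := exists_of_closed hn (by omega) ha (Or.inl hk) h
  exact exists_invariant_solution hn (by omega) ha haI h

/-- The invariant characteristic cohomology in antighost number `2`. -/
theorem exists_invariant_of_closed_two (hn : 3 ≤ n) {m : ℤ} {a c : MAlg n N}
    (ha : a ∈ Hom n N (n, 2, m, 0, 0, 0)) (haI : a ∈ Inv n N) (h : dl n N a = dH n N c) :
    ∃ v ∈ CV n N, ∃ b ∈ Inv n N, ∃ e ∈ Inv n N, b ∈ Hom n N (n, 3, m, 0, 0, 0) ∧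
      e ∈ Hom n N ((n : ℤ) + -1, 2, m, 0, 0, 0) ∧ a = v + (dl n N b + dH n N e) := by
  obtain ⟨v, hv, hvm, b, e, hbe⟩ : ∃ v ∈ CV n N, v ∈ Hom n N (n, 2, m, 0, 0, 0) ∧
      ∃ b e, a - v = dl n N b + dH n N e := by
    -- There is nothing below degree 1; degree 1 carries the representatives; above it the
    -- cohomology vanishes.
    rcases lt_trichotomy m 1 with hm | rfl | hm
    · refine ⟨0, zero_mem _, zero_mem _, 0, 0, ?_⟩
      rw [eq_zero_of_nonneg ((2 : ℤ) • Deg.ml - Deg.ag) (by decide) (by decide) ?_ ha]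
      · simp
      · simp; omega
    · obtain ⟨v, hv, e, rfl⟩ := exists_CV ha
      exact ⟨v, hv, CV_le_Hom hv, 0, e, by simp⟩
    · obtain ⟨b, e, hbe⟩ := exists_of_closed_two hn hm ha h
      exact ⟨0, zero_mem _, zero_mem _, b, e, by simpa using hbe⟩
  obtain ⟨b, hb, e, he, hb', he', hbe⟩ := exists_invariant_solution hn (by norm_num)
    (sub_mem ha hvm) (sub_mem haI (CV_le_Inv hv)) hbe
  exact ⟨v, hv, b, hb, e, he, hb', he', by rw [← hbe]; abel⟩

instance : Nontrivial (MAlg n N) := by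
  refine ⟨1, 0, fun h => ?_⟩
  have := congr_arg (GradedPoly.lift (par := MGen.par (n := n) (N := N))
    (FreeAlgebra.lift ℝ fun _ => (0 : ℝ)) (by rintro _ _ ⟨x, y⟩; simp)) h
  simp at this

/-- The forms `C* dx^0 ⋯ dx^{n-1}` are linearly independent in the cohomology. -/
theorem eq_zero_of_exact {lam : Fin N → Fin n → ℝ} {b c : MAlg n N}
    (h : ∑ a, ∑ i, lam a i • (U .cs a i 1 * vol n N) = dl n N b + dH n N c) : lam = 0 := by
  have h1 : (∑ a, ∑ i, U .cs a i 1 * (lam a i • (1 : MAlg n N))) * vol n N =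
      dl n N b + dH n N c := by
    rw [← h, Finset.sum_mul]
    refine Finset.sum_congr rfl fun a _ => ?_
    rw [Finset.sum_mul]
    exact Finset.sum_congr rfl fun i _ => by rw [mul_smul_comm, mul_one, smul_mul_assoc]
  have hm : (∑ a, ∑ i, U .cs a i 1 * (lam a i • (1 : MAlg n N))) * vol n N ∈
      Hom n N ((n : ℤ), 2, 1, 0, 0, 0) := by
    rw [h1, ← h]
    exact Submodule.sum_mem _ fun a _ => Submodule.sum_mem _ fun i _ =>
      Submodule.smul_mem _ _ (cs_mul_vol_mem a i)
  obtain ⟨b', -, c', -, hb', -, h2⟩ := exists_homogeneous PrStable.top hm (b := b) (c := c)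
    trivial trivial h1
  -- A form linear in the fields has antighost number at most 2, so b' of antighost number 3
  -- vanishes and the relation is exact under `d` alone.
  have hb0 : b' = 0 :=
    eq_zero_of_nonneg ((2 : ℤ) • Deg.ml - Deg.ag) (by decide) (by decide) (by simp) hb'
  rw [hb0, map_zero, zero_add] at h2
  ext a i
  have h3 := Ibp.unique (k := .cs) (κ := Deg.ml) (s := 0) (by decide) (by decide)
    (by decide) (by decide) rfl rfl
    (fun a i => Submodule.smul_mem _ (lam a i) (one_mem_hom (deg := MGen.deg) (par := MGen.par)))
    h2 a i
  simpa using h3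

/-- The forms `C* dx^0 ⋯ dx^{n-1}` are closed in the space of invariant polynomials. -/
theorem exists_dl_CV {v : MAlg n N} (hv : v ∈ CV n N) : ∃ c ∈ Inv n N,
    c ∈ Hom n N ((n : ℤ) + -1, 1, 1, 0, 0, 0) ∧ dl n N v + dH n N c = 0 := by
  induction hv using Submodule.span_induction with
  | mem x hx =>
    obtain ⟨⟨a, i⟩, rfl⟩ := hx
    -- Since δC* is -2 times a divergence of `h*`, its product with the volume form is exact, with
    -- the contracted volume form as primitive.
    refine ⟨(2 : ℝ) • ∑ β, io N β (U .hs a s(β, i) 1 * vol n N), ?_, ?_, ?_⟩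
    · exact Submodule.smul_mem _ _ (Submodule.sum_mem _ fun β _ => io_mem_Inv β
        (mul_mem_Inv (U_mem_Inv (by decide) (by decide) _ _ _) vol_mem_Inv))
    · refine Submodule.smul_mem _ _ (Submodule.sum_mem _ fun β _ => ?_)
      simpa [Kind.deg] using io_shifts β (mul_mem_hom (U_mem .hs a s(β, i) 1)
        (vol_mem (n := n) (N := N)))
    · simp only [dl_mul_vol, dl_cs, map_smul, map_sum, ← del_vol]
      rw [smul_mul_assoc, Finset.sum_mul, neg_smul, neg_add_cancel]
  | zero => exact ⟨0, zero_mem _, zero_mem _, by simp⟩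
  | add x y _ _ hx hy =>
    obtain ⟨c, hc, hc', h⟩ := hx
    obtain ⟨d, hd, hd', h'⟩ := hy
    exact ⟨c + d, add_mem hc hd, add_mem hc' hd', by
      rw [map_add, map_add, add_add_add_comm, h, h', add_zero]⟩
  | smul r x _ hx =>
    obtain ⟨c, hc, hc', h⟩ := hx
    exact ⟨r • c, Submodule.smul_mem _ _ hc, Submodule.smul_mem _ _ hc', by
      rw [map_smul, map_smul, ← smul_add, h, smul_zero]⟩

end PauliFierz
end

noncomputable section

namespace GradedPoly

variable {G H : Type} {par : G → ℕ} {par' : H → ℕ}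

theorem intertwines {f : GradedPoly par →ₐ[ℝ] GradedPoly par'}
    {D : Module.End ℝ (GradedPoly par)} {D' : Module.End ℝ (GradedPoly par')}
    (hD : IsOdd D) (hD' : IsOdd D')
    (hf : ∀ x, f (parityInv par (gen par x)) = parityInv par' (f (gen par x)))
    (h : ∀ x, f (D (gen par x)) = D' (f (gen par x))) (a : GradedPoly par) :
    f (D a) = D' (f a) := by
  induction a using mon_induction with
  | hm l =>
    induction l with
    | nil => rw [mon_nil, hD.map_one, map_zero, map_one, hD'.map_one]
    | cons y l ih => rw [mon_cons, hD.leib, map_add, map_mul, map_mul, map_mul, hD'.leib, h, ih, hf]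
  | hadd a b ha hb => rw [map_add, map_add, map_add, map_add, ha, hb]
  | hsmul r a ha => rw [map_smul, map_smul, map_smul, map_smul, ha]

theorem oddDeriv_isOdd (D₀ : G → GradedPoly par) (h : ∀ x, SuperCommutes (par x + 1) (D₀ x))
    (hp : ∀ x, parityInv par (D₀ x) = (-1 : ℝ) ^ (par x + 1) • D₀ x) : IsOdd (oddDeriv D₀ h) where
  leib := oddDeriv_mul D₀ h
  anti a := by
    induction a using mon_induction with
    | hm l =>
      induction l with
      | nil =>
        have h1 := oddDeriv_mul D₀ h 1 1
        simp at h1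
        simp [h1]
      | cons y l ih =>
        rw [mon_cons, map_mul, oddDeriv_mul, oddDeriv_mul, ih, map_add, map_mul, map_mul,
          parityInv_parityInv, parityInv_gen, map_smul, oddDeriv_gen, hp, pow_succ, mul_neg_one,
          neg_smul, mul_neg, neg_mul, neg_add, neg_neg]
    | hadd a b ha hb => rw [map_add, map_add, map_add, map_add, ha, hb, neg_add]
    | hsmul r a ha => rw [map_smul, map_smul, map_smul, map_smul, ha, smul_neg]

end GradedPoly

namespace PauliFierz

open GradedPoly

variable {n N : ℕ}

/-! ### Local forms in the extended algebra -/

/-- The generators of the local forms among those of the extended algebra. -/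
def Gen.toMGen : Gen n N → MGen n N
  | .dx μ => .dx μ
  | .h a s I => .u .h a s I
  | .hStar a s I => .u .hs a s I
  | .CStar a i I => .u .cs a i I

/-- The generators of the extended algebra that are local forms. -/
def MGen.toGen : MGen n N → Option (Gen n N)
  | .dx μ => some (.dx μ)
  | .u .h a s I => some (.h a s I)
  | .u .hs a s I => some (.hStar a s I)
  | .u .cs a i I => some (.CStar a i I)
  | .u .gh _ _ _ | .u .th _ _ _ | .u .ths _ _ _ | .u .tcs _ _ _ => none

theorem Gen.toGen_toMGen (x : Gen n N) : x.toMGen.toGen = some x := by cases x <;> rfl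

theorem Gen.par_toMGen (x : Gen n N) : x.toMGen.par = x.parity := by cases x <;> rfl

theorem MGen.parity_toGen {x : MGen n N} {y : Gen n N} (h : x.toGen = some y) :
    y.parity = x.par := by
  cases x with
  | dx μ => cases h; rfl
  | u k a i I => cases k <;> cases h <;> rfl

theorem MGen.toMGen_toGen {x : MGen n N} {y : Gen n N} (h : x.toGen = some y) :
    y.toMGen = x := by
  cases x with
  | dx μ => cases h; rfl
  | u k a i I => cases k <;> cases h <;> rfl

/-- Polynomial degree of the generators. -/
def Gen.ml : Gen n N → ℤ
  | .dx _ => 0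
  | _ => 1

theorem Gen.deg_toMGen (x : Gen n N) :
    x.toMGen.deg = ((x.formDeg : ℤ), (x.antigh : ℤ), x.ml, 0, 0, 0) := by
  cases x <;> rfl

theorem MGen.deg_of_toGen {x : MGen n N} (h : x.toGen = none) : 0 < (Deg.gn + Deg.tl) x.deg := by
  cases x with
  | dx μ => cases h
  | u k a i I =>
    cases k
    case gh => exact (by decide : 0 < (Deg.gn + Deg.tl) (Kind.deg .gh))
    case th => exact (by decide : 0 < (Deg.gn + Deg.tl) (Kind.deg .th))
    case ths => exact (by decide : 0 < (Deg.gn + Deg.tl) (Kind.deg .ths))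
    case tcs => exact (by decide : 0 < (Deg.gn + Deg.tl) (Kind.deg .tcs))
    all_goals cases h

/-- The inclusion of the local forms in the extended algebra. -/
def emb (n N : ℕ) : LocalForm n N →ₐ[ℝ] MAlg n N :=
  lift (FreeAlgebra.lift ℝ fun x => gen _ x.toMGen) <| by
    rintro _ _ ⟨x, y⟩
    simp only [map_mul, map_smul, FreeAlgebra.lift_ι_apply]
    rw [gen_comm, Gen.par_toMGen, Gen.par_toMGen]

theorem emb_var (x : Gen n N) : emb n N (var x) = gen _ x.toMGen := by
  simp [emb, gen, lift_mk]

/-- The retraction of the extended algebra on the local forms. -/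
def ret (n N : ℕ) : MAlg n N →ₐ[ℝ] LocalForm n N :=
  lift (FreeAlgebra.lift ℝ fun x => x.toGen.elim 0 var) <| by
    rintro _ _ ⟨x, y⟩
    simp only [map_mul, map_smul, FreeAlgebra.lift_ι_apply]
    cases hx : x.toGen with
    | none => simp
    | some x' =>
      cases hy : y.toGen with
      | none => simp
      | some y' =>
        simp only [Option.elim_some]
        rw [gen_comm, MGen.parity_toGen hx, MGen.parity_toGen hy]

theorem ret_gen (x : MGen n N) : ret n N (gen _ x) = x.toGen.elim 0 var := by
  simp [ret, gen, lift_mk]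

theorem ret_emb (a : LocalForm n N) : ret n N (emb n N a) = a := by
  induction a using mon_induction with
  | hm l =>
    induction l with
    | nil => simp
    | cons y l ih => rw [mon_cons, map_mul, map_mul, ih, emb_var, ret_gen, Gen.toGen_toMGen]; rfl
  | hadd a b ha hb => rw [map_add, map_add, ha, hb]
  | hsmul r a ha => rw [map_smul, map_smul, ha]

theorem emb_parityInv (a : LocalForm n N) : emb n N (parityInv _ a) = parityInv _ (emb n N a) := by
  induction a using mon_induction with
  | hm l =>
    induction l with
    | nil => simp
    | cons y l ih =>
      rw [mon_cons, map_mul, map_mul, ih, parityInv_gen, map_smul, map_mul, map_mul, emb_var,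
        parityInv_gen, Gen.par_toMGen]
  | hadd a b ha hb => simp only [map_add, ha, hb]
  | hsmul r a ha => simp only [map_smul, ha]

theorem ret_parityInv (x : MGen n N) :
    ret n N (parityInv _ (gen _ x)) = parityInv _ (ret n N (gen _ x)) := by
  rw [parityInv_gen, map_smul, ret_gen]
  cases hx : x.toGen with
  | none => simp
  | some y => rw [Option.elim_some, var, parityInv_gen, MGen.parity_toGen hx]

theorem emb_injective : Function.Injective (emb n N) := fun a b h => by
  rw [← ret_emb a, h, ret_emb]

/-! ### The differentials -/

/-- The element that corresponds to a differential expression in the field. -/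
def Lh (a : Fin N) : STen n (Poly n) →ₗ[ℝ] MAlg n N :=
  L a ∘ₗ LinearMap.single ℝ (fun k => Idx n k → Poly n) Kind.h

theorem Lh_single (a : Fin N) (s : Sym2 (Fin n)) (p : Poly n) :
    Lh a (Pi.single s p) = U .h a s p := L_js a .h s p

theorem emb_ddh (a : Fin N) (ρ σ α β : Fin n) (I : Fin n →₀ ℕ) : emb n N (ddh a ρ σ α β I) =
    Lh a (MvPolynomial.monomial I (1 : ℝ) • ((symb n).x ρ * (symb n).x σ) • eS (Poly n) α β) := by
  rw [ddh, emb_var, Gen.toMGen, ← U_monomial, ← Lh_single, eS]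
  congr 1
  rw [← Pi.single_smul, ← Pi.single_smul, smul_eq_mul, smul_eq_mul, mul_one]
  change _ = Pi.single _ (MvPolynomial.monomial I (1 : ℝ) * (MvPolynomial.X ρ * MvPolynomial.X σ))
  rw [← mul_assoc, MvPolynomial.monomial_add_single, MvPolynomial.monomial_add_single, pow_one,
    pow_one]

theorem smul_C (p : Poly n) (r : ℝ) (x : STen n (Poly n)) :
    p • (MvPolynomial.C r : Poly n) • x = r • (p • x) := by
  rw [smul_comm, MvPolynomial.C_eq_smul_one, smul_assoc, one_smul]

theorem emb_curvature (a : Fin N) (α β μ ν : Fin n) (I : Fin n →₀ ℕ) :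
    emb n N (curvature a α β μ ν I) =
      Lh a (MvPolynomial.monomial I (1 : ℝ) • curvV (symb n) α β μ ν) := by
  rw [curvature, curvV, map_smul, map_sub, map_sub, map_add, emb_ddh, emb_ddh, emb_ddh, emb_ddh,
    show -(symb n).hf = MvPolynomial.C (-1 / 2 : ℝ) by rw [neg_div, map_neg]; rfl, smul_C,
    (Lh a).map_smul (-1 / 2 : ℝ)]
  congr 1
  rw [← map_add, ← map_sub, ← map_sub, ← smul_add, ← smul_sub, ← smul_sub]

theorem emb_ricci (a : Fin N) (β ν : Fin n) (I : Fin n →₀ ℕ) : emb n N (ricci a β ν I) =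
    Lh a (MvPolynomial.monomial I (1 : ℝ) • ricV (symb n) β ν) := by
  rw [ricci, ricV, map_sum, Finset.smul_sum, map_sum]
  refine Finset.sum_congr rfl fun α _ => ?_
  rw [show (symb n).e α = MvPolynomial.C (eta α) from rfl, smul_C, map_smul, emb_curvature,
    (Lh a).map_smul (eta α)]

theorem emb_scalarCurvature (a : Fin N) (I : Fin n →₀ ℕ) : emb n N (scalarCurvature a I) =
    Lh a (MvPolynomial.monomial I (1 : ℝ) • scalV (symb n)) := by
  rw [scalarCurvature, scalV, map_sum, Finset.smul_sum, map_sum]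
  refine Finset.sum_congr rfl fun α _ => ?_
  rw [show (symb n).e α = MvPolynomial.C (eta α) from rfl, smul_C, map_smul, emb_ricci,
    (Lh a).map_smul (eta α)]

theorem emb_fieldEq (a : Fin N) (α β : Fin n) (I : Fin n →₀ ℕ) : emb n N (fieldEq a α β I) =
    Lh a (MvPolynomial.monomial I (1 : ℝ) • feV (symb n) α β) := by
  have h1 : (-2 : Poly n) * (symb n).e α * (symb n).e β =
      MvPolynomial.C (-2 * eta α * eta β) := by
    rw [map_mul, map_mul, map_neg]; rfl
  have h2 : (symb n).hf * (if α = β then (symb n).e α else 0) =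
      MvPolynomial.C ((1 / 2 : ℝ) * if α = β then eta α else 0) := by
    rw [map_mul]; split_ifs
    · rfl
    · rw [map_zero]; rfl
  rw [fieldEq, einstein, feV, h1, h2, smul_C, map_smul, map_sub, map_smul, emb_ricci,
    emb_scalarCurvature, (Lh a).map_smul (-2 * eta α * eta β)]
  congr 1
  rw [smul_sub, smul_C, map_sub, (Lh a).map_smul ((1 / 2 : ℝ) * if α = β then eta α else 0)]

theorem delta_var (x : Gen n N) : delta (var x) = deltaGen x := oddDeriv_gen _ _ _

theorem extD_var (x : Gen n N) : extD (var x) = dGen x := oddDeriv_gen _ _ _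

theorem dl_gen_h (a : Fin N) (s : Sym2 (Fin n)) (I : Fin n →₀ ℕ) :
    dl n N (gen _ (.u .h a s I)) = 0 := by
  rw [← U_monomial, ← L_js, dl_acts.L, tdl, LinearMap.add_apply, el_js_ne (by decide),
    el_js_ne (by decide), add_zero, map_zero]

theorem gen_u_add (k : Kind) (a : Fin N) (i : Idx n k) (I : Fin n →₀ ℕ) (μ : Fin n) :
    (gen _ (.u k a i (I + Finsupp.single μ 1)) : MAlg n N) = del N μ (gen _ (.u k a i I)) := by
  rw [← U_monomial, ← U_monomial, ← U_X_mul, MvPolynomial.monomial_add_single, pow_one]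

theorem dl_U_cs (a : Fin N) (i : Fin n) (p : Poly n) : dl n N (U .cs a i p) =
    (-2 : ℝ) • ∑ β, del N β (U .hs a s(β, i) p) := by
  induction p using MvPolynomial.induction_on with
  | C r =>
    have h : (MvPolynomial.C r : Poly n) = r • 1 := MvPolynomial.C_eq_smul_one
    simp only [h, map_smul, dl_cs, ← Finset.smul_sum]
    rw [smul_comm]
  | add p q hp hq => simp only [map_add, hp, hq, Finset.sum_add_distrib, smul_add]
  | mul_X p μ hp =>
    simp only [U_X_mul, del_dl, hp, map_smul, map_sum]
    exact congr_arg _ (Finset.sum_congr rfl fun β _ => del_comm _ _ _)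

theorem emb_deltaGen (x : Gen n N) : emb n N (deltaGen x) = dl n N (gen _ x.toMGen) := by
  cases x with
  | dx μ => rw [deltaGen, map_zero]; exact (dl_acts.dx μ).symm
  | h a s I => rw [deltaGen, map_zero]; exact (dl_gen_h a s I).symm
  | hStar a s I =>
    induction s using Sym2.ind with
    | _ α β =>
      rw [deltaGen, Sym2.lift_mk, emb_fieldEq, Gen.toMGen, ← U_monomial, ← L_js, dl_acts.L, tdl,
        LinearMap.add_apply, el_js, el_js_ne (by decide), add_zero]
      rw [Lh, LinearMap.comp_apply]
      congr 2
      rw [← D1_eS, ← map_smul, eS, ← Pi.single_smul, smul_eq_mul, mul_one]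
      rfl
  | CStar a i I =>
    rw [deltaGen, Gen.toMGen, ← U_monomial, dl_U_cs, map_smul, map_sum]
    refine congr_arg _ (Finset.sum_congr rfl fun β _ => ?_)
    rw [emb_var, Gen.toMGen, gen_u_add, U_monomial]

theorem emb_dGen (x : Gen n N) : emb n N (dGen x) = dH n N (gen _ x.toMGen) := by
  rw [dGen, dH_apply, map_sum]
  refine Finset.sum_congr rfl fun μ _ => ?_
  rw [map_mul, emb_var]
  congr 1
  cases x with
  | dx ν => rw [partialGen, map_zero]; exact (del_dx μ ν).symm
  | h a s I => rw [partialGen, emb_var]; exact gen_u_add _ _ _ _ _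
  | hStar a s I => rw [partialGen, emb_var]; exact gen_u_add _ _ _ _ _
  | CStar a s I => rw [partialGen, emb_var]; exact gen_u_add _ _ _ _ _

theorem delta_isOdd : IsOdd (delta (n := n) (N := N)) :=
  oddDeriv_isOdd _ _ fun x => emb_injective <| by
    rw [emb_parityInv, map_smul, emb_deltaGen, ← neg_neg (parityInv _ _), ← dl_acts.isOdd.anti,
      parityInv_gen, map_smul, ← neg_smul, Gen.par_toMGen, pow_succ, mul_neg_one]

theorem extD_isOdd : IsOdd (extD (n := n) (N := N)) :=
  oddDeriv_isOdd _ _ fun x => emb_injective <| by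
    rw [emb_parityInv, map_smul, emb_dGen, ← neg_neg (parityInv _ _), ← dH_isOdd.anti,
      parityInv_gen, map_smul, ← neg_smul, Gen.par_toMGen, pow_succ, mul_neg_one]

theorem emb_delta (a : LocalForm n N) : emb n N (delta a) = dl n N (emb n N a) :=
  intertwines delta_isOdd dl_acts.isOdd (fun _ => emb_parityInv _)
    (fun x => by rw [delta_var, emb_deltaGen, emb_var]) a

theorem emb_extD (a : LocalForm n N) : emb n N (extD a) = dH n N (emb n N a) :=
  intertwines extD_isOdd dH_isOdd (fun _ => emb_parityInv _)
    (fun x => by rw [extD_var, emb_dGen, emb_var]) a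

/-! ### The gradings -/

theorem emb_monomial (l : List (Gen n N)) :
    emb n N (monomial l) = mon _ (l.map Gen.toMGen) := by
  induction l with
  | nil => simp [monomial]
  | cons x l ih =>
    rw [List.map_cons, mon_cons, ← ih, ← emb_var, ← map_mul]
    simp [monomial]

theorem sum_deg_toMGen (l : List (Gen n N)) : ((l.map Gen.toMGen).map MGen.deg).sum =
    ((((l.map Gen.formDeg).sum : ℕ) : ℤ), (((l.map Gen.antigh).sum : ℕ) : ℤ), (l.map Gen.ml).sum, 0, 0, 0) := by
  induction l with
  | nil => rfl
  | cons x l ih =>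
    simp only [List.map_cons, List.sum_cons, ih, Gen.deg_toMGen, Nat.cast_add]
    rfl

theorem emb_monomial_mem (l : List (Gen n N)) : emb n N (monomial l) ∈
    Hom n N ((((l.map Gen.formDeg).sum : ℕ) : ℤ), (((l.map Gen.antigh).sum : ℕ) : ℤ),
      (l.map Gen.ml).sum, 0, 0,
      0) := by
  rw [emb_monomial, ← sum_deg_toMGen]
  exact mon_mem_hom _

theorem ret_mon (l : List (MGen n N)) : (0 < (Deg.gn + Deg.tl) (l.map MGen.deg).sum ∧
    ret n N (mon _ l) = 0) ∨ ∃ l' : List (Gen n N), l = l'.map Gen.toMGen := by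
  have h0 : ∀ x : MGen n N, 0 ≤ (Deg.gn + Deg.tl) x.deg := fun x => by
    cases hx : x.toGen with
    | none => exact (MGen.deg_of_toGen hx).le
    | some y => rw [← MGen.toMGen_toGen hx, Gen.deg_toMGen]; simp
  induction l with
  | nil => exact Or.inr ⟨[], rfl⟩
  | cons x l ih =>
    rw [List.map_cons, List.sum_cons, map_add, mon_cons, map_mul]
    rcases ih with ⟨h, h'⟩ | ⟨l', rfl⟩
    · exact Or.inl ⟨add_pos_of_nonneg_of_pos (h0 x) h, by rw [h', mul_zero]⟩
    · cases hx : x.toGen with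
      | none =>
        refine Or.inl ⟨?_, by rw [ret_gen, hx]; simp⟩
        refine add_pos_of_pos_of_nonneg (MGen.deg_of_toGen hx) ?_
        rw [sum_deg_toMGen]; simp
      | some y => exact Or.inr ⟨y :: l', by rw [List.map_cons, MGen.toMGen_toGen hx]⟩

theorem ret_eq_zero {r : Deg} (hr : (Deg.gn + Deg.tl) r ≠ 0) {x : MAlg n N} (hx : x ∈ Hom n N r) :
    ret n N x = 0 := by
  rw [Hom, hom_eq_span] at hx
  induction hx using Submodule.span_induction with
  | mem x hx =>
    obtain ⟨l, rfl, rfl⟩ := hx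
    rcases ret_mon l with h | ⟨l', rfl⟩
    · exact h.2
    · rw [sum_deg_toMGen] at hr; simp at hr
  | zero => simp
  | add x y _ _ hx hy => rw [map_add, hx, hy, add_zero]
  | smul c x _ hx => rw [map_smul, hx, smul_zero]

theorem ret_mem_bidegree {p k : ℕ} {m : ℤ} {x : MAlg n N}
    (hx : x ∈ Hom n N ((p : ℤ), (k : ℤ), m, 0, 0, 0)) : ret n N x ∈ bidegree n N p k := by
  rw [Hom, hom_eq_span] at hx
  induction hx using Submodule.span_induction with
  | mem x hx =>
    obtain ⟨l, hl, rfl⟩ := hx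
    rcases ret_mon l with h | ⟨l', rfl⟩
    · rw [h.2]; exact zero_mem _
    · rw [sum_deg_toMGen, Prod.mk.injEq, Prod.mk.injEq] at hl
      rw [← emb_monomial, ret_emb]
      exact Submodule.subset_span ⟨l', by exact_mod_cast hl.1, by exact_mod_cast hl.2.1, rfl⟩
  | zero => rw [map_zero]; exact zero_mem _
  | add x y _ _ hx hy => rw [map_add]; exact add_mem hx hy
  | smul c x _ hx => rw [map_smul]; exact Submodule.smul_mem _ _ hx

/-- On the discarded generators both sides vanish: `dl` preserves the number of ghosts and
second-copy fields, and `ret` kills whatever contains one. -/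
theorem ret_dl (x : MAlg n N) : ret n N (dl n N x) = delta (ret n N x) :=
  intertwines dl_acts.isOdd delta_isOdd ret_parityInv (fun x => by
    cases hx : x.toGen with
    | none =>
      rw [ret_gen, hx, Option.elim_none, map_zero]
      refine ret_eq_zero ?_ (dl_shifts (gen_mem_hom (deg := MGen.deg) x))
      rw [map_add]
      simpa using (MGen.deg_of_toGen hx).ne'
    | some y => rw [← MGen.toMGen_toGen hx, ← emb_var, ← emb_delta, ret_emb, ret_emb]) x

theorem ret_dH (x : MAlg n N) : ret n N (dH n N x) = extD (ret n N x) :=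
  intertwines dH_isOdd extD_isOdd ret_parityInv (fun x => by
    cases hx : x.toGen with
    | none =>
      rw [ret_gen, hx, Option.elim_none, map_zero]
      refine ret_eq_zero ?_ (dH_shifts (gen_mem_hom (deg := MGen.deg) x))
      rw [map_add]
      simpa using (MGen.deg_of_toGen hx).ne'
    | some y => rw [← MGen.toMGen_toGen hx, ← emb_var, ← emb_extD, ret_emb, ret_emb]) x

end PauliFierz
end

noncomputable section

namespace PauliFierz

open GradedPoly

variable {n N : ℕ}

/-! ### Invariant polynomials -/

theorem Lh_mem_Inv (a : Fin N) {w : STen n (Poly n)} (hw : w ∈ W0 n) : Lh a w ∈ Inv n N := by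
  rw [Lh, LinearMap.comp_apply]
  exact L_mem_Inv a (by simpa using hw) (by simp)

theorem emb_mem_Inv {a : LocalForm n N} (ha : a ∈ invariantPolys n N) : emb n N a ∈ Inv n N := by
  suffices h : invariantPolys n N ≤ (Algebra.adjoin ℝ (invGen n N)).comap (emb n N) from h ha
  refine Algebra.adjoin_le ?_
  rintro _ (((⟨μ, rfl⟩ | ⟨a, α, β, μ, ν, I, rfl⟩) | ⟨a, s, I, rfl⟩) | ⟨a, i, I, rfl⟩)
  · change emb n N (var _) ∈ Inv n N
    rw [emb_var]
    exact dx_mem_Inv μ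
  · change emb n N (curvature a α β μ ν I) ∈ Inv n N
    rw [emb_curvature]
    exact Lh_mem_Inv a (Submodule.smul_mem _ _ (Submodule.subset_span ⟨α, β, μ, ν, rfl⟩))
  · change emb n N (var _) ∈ Inv n N
    rw [emb_var, Gen.toMGen, ← U_monomial]
    exact U_mem_Inv (by decide) (by decide) _ _ _
  · change emb n N (var _) ∈ Inv n N
    rw [emb_var, Gen.toMGen, ← U_monomial]
    exact U_mem_Inv (by decide) (by decide) _ _ _

theorem ret_U_mem {k : Kind} (hk : k ≠ .h) (a : Fin N) (i : Idx n k) (p : Poly n) :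
    ret n N (U k a i p) ∈ invariantPolys n N := by
  induction p using MvPolynomial.induction_on' with
  | monomial I r =>
    have : MvPolynomial.monomial I r = r • MvPolynomial.monomial I (1 : ℝ) := by
      rw [MvPolynomial.smul_monomial, smul_eq_mul, mul_one]
    rw [this, map_smul, map_smul, U_monomial, ret_gen]
    refine Subalgebra.smul_mem _ ?_ _
    cases k
    case h => exact absurd rfl hk
    case hs => exact Algebra.subset_adjoin (Or.inl (Or.inr ⟨a, i, I, rfl⟩))
    case cs => exact Algebra.subset_adjoin (Or.inr ⟨a, i, I, rfl⟩)
    all_goals exact zero_mem _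
  | add p q hp hq => rw [map_add, map_add]; exact add_mem hp hq

theorem ret_Lh_mem (a : Fin N) {w : STen n (Poly n)} (hw : w ∈ W0 n) :
    ret n N (Lh a w) ∈ invariantPolys n N := by
  -- Generalized to all polynomial multiples, since `W0` is a span over the polynomials while `ret`
  -- and `Lh` are only real-linear.
  suffices h : ∀ p : Poly n, ret n N (Lh a (p • w)) ∈ invariantPolys n N by simpa using h 1
  rw [W0] at hw
  induction hw using Submodule.span_induction with
  | mem w hw =>
    obtain ⟨α, β, μ, ν, rfl⟩ := hw
    intro p
    induction p using MvPolynomial.induction_on' with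
    | monomial I r =>
      have : MvPolynomial.monomial I r = r • MvPolynomial.monomial I (1 : ℝ) := by
        rw [MvPolynomial.smul_monomial, smul_eq_mul, mul_one]
      rw [this, smul_assoc, (Lh a).map_smul r, map_smul, ← emb_curvature, ret_emb]
      refine Subalgebra.smul_mem _ ?_ _
      exact Algebra.subset_adjoin (Or.inl (Or.inl (Or.inr ⟨a, α, β, μ, ν, I, rfl⟩)))
    | add p q hp hq => rw [add_smul, map_add, map_add]; exact add_mem hp hq
  | zero => intro p; rw [smul_zero, map_zero, map_zero]; exact zero_mem _
  | add x y _ _ hx hy => intro p; rw [smul_add, map_add, map_add]; exact add_mem (hx p) (hy p)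
  | smul q x _ hx => intro p; rw [smul_smul]; exact hx _

theorem L_eq (a : Fin N) (v : Jet n) :
    L a v = Lh a (v .h) + ∑ k ∈ Finset.univ.erase Kind.h, ∑ i, U k a i (v k i) := by
  have h : Lh a (v .h) = ∑ i, U .h a i (v .h i) := by
    simp only [Lh, LinearMap.comp_apply, L, LinearMap.sum_apply, LinearMap.proj_apply]
    rw [Finset.sum_eq_single Kind.h]
    · simp
    · intro k _ hk; simp [Pi.single_eq_of_ne hk]
    · simp
  rw [h, Finset.add_sum_erase _ (fun k => ∑ i, U k a i (v k i)) (Finset.mem_univ Kind.h)]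
  simp [L]

theorem ret_mem_invariantPolys {x : MAlg n N} (hx : x ∈ Inv n N) :
    ret n N x ∈ invariantPolys n N := by
  suffices h : Algebra.adjoin ℝ (invGen n N) ≤ (invariantPolys n N).comap (ret n N) from h hx
  refine Algebra.adjoin_le ?_
  rintro _ (⟨μ, rfl⟩ | ⟨a, v, hv, -, rfl⟩)
  · change ret n N (gen _ _) ∈ invariantPolys n N
    rw [ret_gen]
    exact Algebra.subset_adjoin (Or.inl (Or.inl (Or.inl ⟨μ, rfl⟩)))
  · change ret n N (L a v) ∈ invariantPolys n N
    rw [L_eq, map_add, map_sum]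
    refine add_mem (ret_Lh_mem a hv) (sum_mem fun k hk => ?_)
    rw [map_sum]
    exact sum_mem fun i _ => ret_U_mem (Finset.ne_of_mem_erase hk) _ _ _

theorem ret_mem_invariantForms {p k : ℕ} {m : ℤ} {x : MAlg n N} (hxI : x ∈ Inv n N)
    (hx : x ∈ Hom n N ((p : ℤ), (k : ℤ), m, 0, 0, 0)) : ret n N x ∈ invariantForms n N p k :=
  ⟨ret_mem_invariantPolys hxI, ret_mem_bidegree hx⟩

/-! ### Homogeneous components -/

theorem pr_emb_eq_zero {Q : List (Gen n N) → Prop} {a : LocalForm n N}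
    (ha : a ∈ Submodule.span ℝ {m | ∃ l, Q l ∧ m = monomial l}) {r : Deg}
    (hr : ∀ p k : ℕ, ∀ m : ℤ, r = ((p : ℤ), (k : ℤ), m, 0, 0, 0) → ∀ l, Q l →
      (l.map Gen.formDeg).sum = p → (l.map Gen.antigh).sum ≠ k) : pr r (emb n N a) = 0 := by
  induction ha using Submodule.span_induction with
  | mem x hx =>
    obtain ⟨l, hl, rfl⟩ := hx
    exact proj_of_mem_ne (fun h => hr _ _ _ h.symm l hl rfl rfl) (emb_monomial_mem l)
  | zero => simp
  | add x y _ _ hx hy => rw [map_add, map_add, hx, hy, add_zero]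
  | smul c x _ hx => rw [map_smul, map_smul, hx, smul_zero]

theorem pr_emb_bidegree {p k : ℕ} {a : LocalForm n N} (ha : a ∈ bidegree n N p k) {r : Deg}
    (hr : pr r (emb n N a) ≠ 0) : ∃ m : ℤ, r = ((p : ℤ), (k : ℤ), m, 0, 0, 0) := by
  by_contra h
  refine hr (pr_emb_eq_zero (Q := fun l => (l.map Gen.formDeg).sum = p ∧
    (l.map Gen.antigh).sum = k) (by simp only [and_assoc]; exact ha) ?_)
  rintro p' k' m rfl l ⟨rfl, rfl⟩ rfl rfl
  exact h ⟨m, rfl⟩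

theorem pr_emb_positiveAntigh {a : LocalForm n N} (ha : a ∈ positiveAntigh n N) {r : Deg}
    (hr : pr r (emb n N a) ≠ 0) : ∃ p k m : ℤ, 1 ≤ k ∧ r = (p, k, m, 0, 0, 0) := by
  by_contra h
  refine hr (pr_emb_eq_zero ha ?_)
  rintro p k m rfl l hl rfl rfl
  exact h ⟨_, _, m, by omega, rfl⟩

/-- Reduces a statement about a local form to its homogeneous components in the extended algebra,
including the polynomial degree, which is not fixed in `bidegree`. -/
theorem mem_of_pr {T : Submodule ℝ (LocalForm n N)} {a : LocalForm n N}
    (h : ∀ r, pr r (emb n N a) ≠ 0 → ret n N (pr r (emb n N a)) ∈ T) : a ∈ T := by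
  obtain ⟨s, hs⟩ := sum_proj (deg := MGen.deg) (emb n N a)
  rw [← ret_emb a, hs, map_sum]
  refine Submodule.sum_mem _ fun r _ => ?_
  by_cases h0 : pr r (emb n N a) = 0
  · change ret n N (pr r (emb n N a)) ∈ T
    rw [h0, map_zero]; exact zero_mem _
  · exact h r h0

theorem delta_mem {p k : ℕ} {a : LocalForm n N} (ha : a ∈ invariantForms n N p (k + 1)) :
    delta a ∈ invariantForms n N p k := by
  suffices h : a ∈ (invariantForms n N p k).comap delta from h
  refine mem_of_pr fun r hr => ?_
  obtain ⟨m, rfl⟩ := pr_emb_bidegree ha.2 hr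
  rw [Submodule.mem_comap, ← ret_dl]
  exact ret_mem_invariantForms (dl_mem_Inv (pr_mem_Inv _ _ (emb_mem_Inv ha.1)))
    (by simpa using dl_shifts (proj_mem (deg := MGen.deg) ((p : ℤ), ((k + 1 : ℕ) : ℤ), m, 0, 0, 0)
      (emb n N a)))

theorem delta_delta (a : LocalForm n N) : delta (delta a) = 0 :=
  emb_injective (by rw [emb_delta, emb_delta, dl_dl, map_zero])

theorem delta_extD (a : LocalForm n N) : delta (extD a) = -extD (delta a) :=
  emb_injective (by rw [emb_delta, emb_extD, dl_dH, map_neg, emb_extD, emb_delta])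

/-- The forms `δ b + d c` with invariant polynomials `b` and `c`. -/
def exactForms (n N k : ℕ) : Submodule ℝ (LocalForm n N) :=
  (invariantForms n N n (k + 1)).map delta ⊔ (invariantForms n N (n - 1) k).map extD

theorem mem_exactForms {k : ℕ} {a : LocalForm n N} : a ∈ exactForms n N k ↔
    ∃ b ∈ invariantForms n N n (k + 1), ∃ c ∈ invariantForms n N (n - 1) k,
      a = delta b + extD c := by
  simp only [exactForms, Submodule.mem_sup, Submodule.mem_map]
  constructor
  · rintro ⟨_, ⟨b, hb, rfl⟩, _, ⟨c, hc, rfl⟩, rfl⟩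
    exact ⟨b, hb, c, hc, rfl⟩
  · rintro ⟨b, hb, c, hc, rfl⟩
    exact ⟨_, ⟨b, hb, rfl⟩, _, ⟨c, hc, rfl⟩, rfl⟩

theorem ret_mem_exactForms (hn : 1 ≤ n) {k : ℕ} {m : ℤ} {b e : MAlg n N} (hb : b ∈ Inv n N)
    (he : e ∈ Inv n N) (hb' : b ∈ Hom n N ((n : ℤ), (k : ℤ) + 1, m, 0, 0, 0))
    (he' : e ∈ Hom n N ((n : ℤ) + -1, (k : ℤ), m, 0, 0, 0)) :
    ret n N (dl n N b + dH n N e) ∈ exactForms n N k := by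
  refine mem_exactForms.2 ⟨ret n N b, ret_mem_invariantForms (m := m) hb (by simpa using hb'),
    ret n N e, ret_mem_invariantForms (m := m) he ?_, by rw [map_add, ret_dl, ret_dH]⟩
  rwa [Nat.cast_sub hn, Nat.cast_one, sub_eq_add_neg]

theorem pr_closed {a c : LocalForm n N} (h : delta a + extD c = 0) (r : Deg) :
    ∃ c', dl n N (pr r (emb n N a)) = dH n N c' := by
  have h1 := congr_arg (emb n N) h
  rw [map_add, emb_delta, emb_extD, map_zero, add_eq_zero_iff_eq_neg, ← map_neg] at h1
  have h2 := congr_arg (pr (r + (0, -1, 0, 0, 0, 0))) h1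
  rw [pr_dl, pr_dH, add_assoc, show ((0, -1, 0, 0, 0, 0) + (0, 1, 0, 0, 0, 0) : Deg) = 0 from rfl,
    add_zero] at h2
  exact ⟨_, h2⟩

/-- The forms `C* dx^0 ⋯ dx^{n-1}`. -/
def csVol (i : Fin N) (μ : Fin n) : LocalForm n N := var (.CStar i μ 0) * volumeForm n N

theorem emb_csVol (i : Fin N) (μ : Fin n) : emb n N (csVol i μ) = U .cs i μ 1 * vol n N := by
  rw [csVol, map_mul, emb_var]
  congr 1
  · exact (U_monomial .cs i μ 0).symm
  · rw [volumeForm, List.ofFn_eq_map, map_list_prod, List.map_map, vol, dxs]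
    congr 2
    funext ν
    exact emb_var _

theorem emb_sum_csVol (coeff : Fin N → Fin n → ℝ) :
    emb n N (∑ i, ∑ μ, coeff i μ • csVol i μ) =
      ∑ i, ∑ μ, coeff i μ • (U .cs i μ 1 * vol n N) := by
  simp only [map_sum, map_smul, emb_csVol]

theorem ret_CV {v : MAlg n N} (hv : v ∈ CV n N) : ret n N v ∈
    Submodule.span ℝ (Set.range fun p : Fin N × Fin n => csVol (n := n) p.1 p.2) := by
  induction hv using Submodule.span_induction with
  | mem x hx =>
    obtain ⟨p, rfl⟩ := hx
    refine Submodule.subset_span ⟨p, ?_⟩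
    change _ = ret n N (U .cs p.1 p.2 1 * vol n N)
    rw [← emb_csVol, ret_emb]
  | zero => rw [map_zero]; exact zero_mem _
  | add x y _ _ hx hy => rw [map_add]; exact add_mem hx hy
  | smul c x _ hx => rw [map_smul]; exact Submodule.smul_mem _ _ hx

theorem exists_coeff (hn : 3 ≤ n) {a c : LocalForm n N} (ha : a ∈ invariantForms n N n 2)
    (h : delta a + extD c = 0) : ∃ coeff : Fin N → Fin n → ℝ,
      ∃ x ∈ exactForms n N 2, a = (∑ i, ∑ μ, coeff i μ • csVol i μ) + x := by
  have h1 : a ∈ Submodule.span ℝ (Set.range fun p : Fin N × Fin n => csVol (n := n) p.1 p.2) ⊔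
      exactForms n N 2 := by
    refine mem_of_pr fun r hr => ?_
    obtain ⟨m, rfl⟩ := pr_emb_bidegree ha.2 hr
    obtain ⟨c', hc'⟩ := pr_closed h ((n : ℤ), ((2 : ℕ) : ℤ), m, 0, 0, 0)
    obtain ⟨v, hv, b, hb, e, he, hb', he', hbe⟩ := exists_invariant_of_closed_two hn
      (proj_mem (deg := MGen.deg) _ _) (pr_mem_Inv _ _ (emb_mem_Inv ha.1)) hc'
    refine (congr_arg (ret n N) hbe).symm ▸ ?_
    rw [map_add]
    exact Submodule.add_mem_sup (ret_CV hv)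
      (ret_mem_exactForms (by omega) hb he (by simpa using hb') (by simpa using he'))
  obtain ⟨v, hv, x, hx, rfl⟩ := Submodule.mem_sup.1 h1
  obtain ⟨f, rfl⟩ := (Submodule.mem_span_range_iff_exists_fun ℝ).1 hv
  exact ⟨fun i μ => f (i, μ), x, hx, by rw [Fintype.sum_prod_type]⟩

theorem coeff_eq_zero {coeff : Fin N → Fin n → ℝ} {b c : LocalForm n N}
    (h : ∑ i, ∑ μ, coeff i μ • csVol i μ = delta b + extD c) : coeff = 0 := by
  have h1 := congr_arg (emb n N) h
  rw [emb_sum_csVol, map_add, emb_delta, emb_extD] at h1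
  exact eq_zero_of_exact h1

theorem exists_closed (hn : 1 ≤ n) (coeff : Fin N → Fin n → ℝ) {x : LocalForm n N}
    (hx : x ∈ exactForms n N 2) : ∃ c ∈ invariantForms n N (n - 1) 1,
      delta ((∑ i, ∑ μ, coeff i μ • csVol i μ) + x) + extD c = 0 := by
  obtain ⟨b, hb, e, he, rfl⟩ := mem_exactForms.1 hx
  obtain ⟨c, hc, hc', h⟩ := exists_dl_CV (v := emb n N (∑ i, ∑ μ, coeff i μ • csVol i μ)) (by
    rw [emb_sum_csVol]
    exact Submodule.sum_mem _ fun i _ => Submodule.sum_mem _ fun μ _ =>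
      Submodule.smul_mem _ _ (Submodule.subset_span ⟨(i, μ), rfl⟩))
  refine ⟨ret n N c + delta e, add_mem (ret_mem_invariantForms (m := 1) hc ?_) (delta_mem he),
    ?_⟩
  · rwa [Nat.cast_sub hn, Nat.cast_one, sub_eq_add_neg]
  have h1 := congr_arg (ret n N) h
  rw [map_add, ← emb_delta, ret_emb, ret_dH, map_zero] at h1
  rw [map_add, map_add, map_add, delta_delta, delta_extD, zero_add, add_add_add_comm, h1,
    neg_add_cancel, add_zero]

end PauliFierz

/-! ### The theorem, assembled from homogeneous components -/

open PauliFierz in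
theorem mainTheorem6 (n N : ℕ) (hn : 3 ≤ n) :
    -- triviality of `δ` modulo `d` can be realized within the invariant polynomials
    (∀ a ∈ invariantPolys n N, a ∈ positiveAntigh n N →
      (∃ b c : LocalForm n N, a = delta b + extD c) →
      ∃ b ∈ invariantPolys n N, ∃ c ∈ invariantPolys n N, a = delta b + extD c) ∧
    -- the invariant cohomology of `δ` modulo `d` vanishes in form degree `n`, antighost number `> 2`
    (∀ k : ℕ, 2 < k → ∀ a ∈ invariantForms n N n k,
      (∃ c ∈ invariantForms n N (n - 1) (k - 1), delta a + extD c = 0) →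
      ∃ b ∈ invariantForms n N n (k + 1), ∃ c ∈ invariantForms n N (n - 1) k,
        a = delta b + extD c) ∧
    -- in form degree `n` and antighost number `2` the `C*` are a complete set of representatives
    (∀ a ∈ invariantForms n N n 2,
      (∃ c ∈ invariantForms n N (n - 1) 1, delta a + extD c = 0) ↔
      ∃! coeff : Fin N → Fin n → ℝ,
        ∃ b ∈ invariantForms n N n 3, ∃ c ∈ invariantForms n N (n - 1) 2,
          a = (∑ i, ∑ μ, coeff i μ • (var (.CStar i μ 0) * volumeForm n N))
            + delta b + extD c) := by
  refine ⟨?_, ?_, ?_⟩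
  · rintro a haI ha ⟨b, c, h⟩
    have h1 : a ∈ (invariantPolys n N).toSubmodule.map delta ⊔
        (invariantPolys n N).toSubmodule.map extD := by
      refine mem_of_pr fun r hr => ?_
      obtain ⟨p, k, m, hk, rfl⟩ := pr_emb_positiveAntigh ha hr
      have h2 := congr_arg (fun x => pr (p, k, m, 0, 0, 0) (emb n N x)) h
      simp only [map_add, emb_delta, emb_extD] at h2
      rw [pr_dl, pr_dH] at h2
      obtain ⟨b', hb', c', hc', -, -, h3⟩ := exists_invariant_solution hn hk
        (GradedPoly.proj_mem (deg := MGen.deg) _ _) (pr_mem_Inv _ _ (emb_mem_Inv haI)) h2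
      rw [h3, map_add, ret_dl, ret_dH]
      exact Submodule.add_mem_sup ⟨_, ret_mem_invariantPolys hb', rfl⟩
        ⟨_, ret_mem_invariantPolys hc', rfl⟩
    obtain ⟨_, ⟨b', hb', rfl⟩, _, ⟨c', hc', rfl⟩, h2⟩ := Submodule.mem_sup.1 h1
    exact ⟨b', hb', c', hc', h2.symm⟩
  · rintro k hk a ha ⟨c, -, h⟩
    refine mem_exactForms.1 (mem_of_pr fun r hr => ?_)
    obtain ⟨m, rfl⟩ := pr_emb_bidegree ha.2 hr
    obtain ⟨c', hc'⟩ := pr_closed h ((n : ℤ), (k : ℤ), m, 0, 0, 0)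
    obtain ⟨b, hb, e, he, hb', he', hbe⟩ := exists_invariant_of_closed hn (by omega)
      (GradedPoly.proj_mem (deg := MGen.deg) _ _) (pr_mem_Inv _ _ (emb_mem_Inv ha.1)) hc'
    rw [hbe]
    exact ret_mem_exactForms (by omega) hb he hb' he'
  · intro a ha
    have key : ∀ coeff : Fin N → Fin n → ℝ, (∃ b ∈ invariantForms n N n 3,
        ∃ c ∈ invariantForms n N (n - 1) 2,
          a = (∑ i, ∑ μ, coeff i μ • (var (.CStar i μ 0) * volumeForm n N))
            + delta b + extD c) ↔
        ∃ x ∈ exactForms n N 2, a = (∑ i, ∑ μ, coeff i μ • csVol i μ) + x := by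
      intro coeff
      constructor
      · rintro ⟨b, hb, c, hc, h⟩
        exact ⟨_, mem_exactForms.2 ⟨b, hb, c, hc, rfl⟩, by rw [h, add_assoc]; rfl⟩
      · rintro ⟨x, hx, h⟩
        obtain ⟨b, hb, c, hc, rfl⟩ := mem_exactForms.1 hx
        exact ⟨b, hb, c, hc, by rw [h, ← add_assoc]; rfl⟩
    simp only [key]
    constructor
    · rintro ⟨c, -, h⟩
      obtain ⟨coeff, x, hx, h1⟩ := exists_coeff hn ha h
      refine ⟨coeff, ⟨x, hx, h1⟩, ?_⟩
      rintro coeff' ⟨x', hx', h2⟩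
      -- Two representations differ by an exact form, so the difference of their coefficients
      -- vanishes by independence.
      obtain ⟨b, -, c, -, hbc⟩ := mem_exactForms.1 (sub_mem hx hx')
      refine sub_eq_zero.1 (coeff_eq_zero (b := b) (c := c) ?_)
      simp only [Pi.sub_apply, sub_smul, Finset.sum_sub_distrib]
      rw [← hbc, sub_eq_sub_iff_add_eq_add, ← h2, h1, add_comm]
    · rintro ⟨coeff, ⟨x, hx, rfl⟩, -⟩
      exact exists_closed (by omega) coeff hx

end
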